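/- Let $\Omega\subset\mathbb R^3$ be a contractible Lipschitz domain with a face-to-face partition $\mathcal T_h$ into finitely many tetrahedra. Let $k\ge 2$ and $r\in\{k-1,k,k+1\}$, and let $0<\delta<1/2$. $P_m$ denotes the polynomials of degree at most $m$ ($P_m=\{0\}$ if $m<0$), and bold letters denote vector-valued spaces. **Spaces of functions.** $\Sigma=H^{3/2+\delta}(\Omega)$, $V=\{u\in \mathbf H^{1/2+\delta}(\Omega):\nabla\times u\in \mathbf H^{1/2+\delta}(\Omega)\}$, $W=\{u\in \mathbf H^{1/2+\delta}(\Omega):\nabla\cdot u\in H^{3/2+\delta}(\Omega)\}$. **Shape functions on a tetrahedron $K$.** $\Sigma_h^r(K)=P_r$; $V_h^r(K)=\mathbf P_{r-1}\oplus\{p \text{ homogeneous of degree } r:\ x\cdot p=0\}$; $\Sigma_h^{+,k-1}(K)=P_{k-1}$ if $k\ge5$ and $P_{k-1}\oplus\operatorname{span}\{\lambda_1\lambda_2\lambda_3\lambda_4\}$ (barycentric coordinates of $K$) if $k<5$; $W_h^{r-1,k}(K)=\nabla\times V_h^r(K)\oplus\mathfrak p\,\Sigma_h^{+,k-1}(K)$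 with $(\mathfrak p w)(x)=\int_0^1t^2\,x\,w(tx)\,dt$. **Degrees of freedom**, for all vertices $v$, edges $e$ (unit tangent $\tau$), faces $f$ (unit normal $n$) and tetrahedra $K$ of the mesh: - $\Sigma_h^r$: $u(v)$; the means over $e$, $f$, $K$ of $uq$ with $q\in P_{r-2}$, $P_{r-3}$, $P_{r-4}$ respectively. - $V_h^r$: $\int_e u\cdot\tau\,q\,ds$ with $q\in P_{r-1}$; the mean over $f$ of $u\cdot q$ with $q\in\mathbf P_{r-2}$ tangential to $f$; $\int_K u\cdot q\,dx$ with $q\in\mathbf P_{r-3}$. - $W_h^{r-1,k}$: $(\nabla\cdot u)(v)$; the means over $e$, $f$ of $(\nabla\cdot u)q$ with $q\in P_{k-3}$, $P_{k-4}$; $\int_f u\cdot n\,q\,dA$ with $q\in P_{r-1}$; $\int_K u\cdot q\,dx$ with $q\in\nabla P_{k-5}\oplus C_K$, where $C_K$ is any fixed complement of $\nabla P_{r-1}$ in $\mathbf P_{r-2}$ (representing $\mathbf P_{r-2}/\nabla P_{r-1}$). - $\Sigma_h^{+,k-1}$: those of $\Sigma_h^{k-1}$, and for $k<5$ in addition the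 mean over each $K$. For scalar functions in $H^{3/2+\delta}(\Omega)$, point values and edge and face integrals are those of the representative continuous on $\overline\Omega$. The edge and face moments of a field in $V$, and the moments of $u\cdot n$ for a field in $W$, are the continuous extensions of these functionals from smooth fields, with respect to the norm of $V$ (that is, $\|u\|_{\mathbf H^{1/2+\delta}}+\|\nabla\times u\|_{\mathbf H^{1/2+\delta}}$) and of $\mathbf H^{1/2+\delta}(\Omega)$ respectively. The global spaces $\Sigma_h^r$, $V_h^r$, $W_h^{r-1,k}$, $\Sigma_h^{+,k-1}$ consist of the piecewise polynomials with the given shape functions for which every vertex, edge and face degree of freedom takes the same value from all tetrahedra sharing that vertex, edge or face. The interpolants $\pi_hu\in\Sigma_h^r$, $r_hu\in V_h^r$, $i_hu\in W_h^{r-1,k}$, $\tilde\pi_hu\in\Sigma_h^{+,k-1}$ are the elements of these spaces that have the same degrees of freedom as $u$. Then all interpolants below exist and are unique, and, with the differential operators applied to piecewise polynomials tetrahedron by tetrahedron, $$\nabla\pi_hu=r_h\nabla u\quad\text{for all }u\in\Sigma,$$ $$\nabla\times r_hu=i_h\nabla\times u\quad\text{for all }u\in V,$$ $$\nabla\cdot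 i_hu=\tilde\pi_h\nabla\cdot u\quad\text{for all }u\in W.$$ -/

import Mathlib

open MeasureTheory Filter Topology
open scoped ContDiff ENNReal NNReal

noncomputable section

namespace GradDivFE

/-! ### Space, domain and mesh -/

/-- Three-dimensional Euclidean space. -/
abbrev E3 : Type := EuclideanSpace ℝ (Fin 3)

/-- An open set whose boundary is locally, in suitable orthonormal coordinates, the graph of a
Lipschitz function, the set lying on one side of it. -/
def IsLipschitzDomain (Ω : Set E3) : Prop :=
  IsOpen Ω ∧ ∀ x ∈ frontier Ω, ∃ (A : E3 ≃ₗᵢ[ℝ] E3) (L : ℝ≥0) (g : EuclideanSpace ℝ (Fin 2) → ℝ),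
    LipschitzWith L g ∧ ∀ᶠ y in 𝓝 x, (y ∈ Ω ↔ g !₂[A y 0, A y 1] < A y 2)

/-- A (face-to-face) partition of `Ω` into finitely many tetrahedra, given as the simplicial complex
of all its vertices, edges, faces and elements (a simplex is recorded by its set of vertices). -/
structure IsTetMesh (T : Geometry.SimplicialComplex ℝ E3) (Ω : Set E3) : Prop where
  finite : T.faces.Finite
  pure : ∀ s ∈ T.faces, ∃ K ∈ T.faces, s ⊆ K ∧ K.card = 4
  cover : T.space = closure Ω

/-- The elements (tetrahedra) of the mesh. -/
abbrev Elem (T : Geometry.SimplicialComplex ℝ E3) : Type :=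
  {K : Finset E3 // K ∈ T.faces ∧ K.card = 4}

/-! ### Polynomials -/

/-- Polynomials in `x₁, x₂, x₃`. -/
abbrev Poly : Type := MvPolynomial (Fin 3) ℝ

/-- Polynomial vector fields. -/
abbrev VPoly : Type := Fin 3 → Poly

/-- The function defined by a polynomial. -/
def evalP (p : Poly) : E3 → ℝ := fun x => MvPolynomial.eval (fun i => x i) p

/-- The vector field defined by a polynomial vector field. -/
def evalV (v : VPoly) : E3 → E3 := fun x => WithLp.toLp 2 fun i => evalP (v i) x

/-- `P_m`, the polynomials of degree at most `m`; it is `{0}` for `m < 0`. -/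
def polyLE (m : ℤ) : Submodule ℝ Poly :=
  if 0 ≤ m then MvPolynomial.restrictTotalDegree (Fin 3) ℝ m.toNat else ⊥

/-- `P_m³`. -/
def vpolyLE (m : ℤ) : Submodule ℝ VPoly := Submodule.pi Set.univ fun _ => polyLE m

/-- The gradient of a polynomial. -/
def gradP : Poly →ₗ[ℝ] VPoly :=
  LinearMap.pi fun i => (MvPolynomial.pderiv (R := ℝ) i).toLinearMap

/-- The curl of a polynomial vector field. -/
def curlP (v : VPoly) : VPoly :=
  ![MvPolynomial.pderiv 1 (v 2) - MvPolynomial.pderiv 2 (v 1),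
    MvPolynomial.pderiv 2 (v 0) - MvPolynomial.pderiv 0 (v 2),
    MvPolynomial.pderiv 0 (v 1) - MvPolynomial.pderiv 1 (v 0)]

/-- The divergence of a polynomial vector field. -/
def divP (v : VPoly) : Poly := ∑ i, MvPolynomial.pderiv i (v i)

/-! ### Local spaces of shape functions -/

/-- `R_r = P_{r-1}³ ⊕ {p homogeneous of degree r : x · p = 0}`. -/
def nedelecSpace (r : ℕ) : Set VPoly :=
  {v | ∃ a b : VPoly, v = a + b ∧ a ∈ vpolyLE ((r : ℤ) - 1) ∧
    (∀ i, (b i).IsHomogeneous r) ∧ ∑ i, MvPolynomial.X i * b i = 0}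

/-- `B` is the bubble `λ₁λ₂λ₃λ₄` of the tetrahedron with vertex set `K`, the `λ`s being its
barycentric coordinates. -/
def IsBubble (K : Finset E3) (B : Poly) : Prop :=
  ∃ l : E3 → Poly, (∀ v ∈ K, l v ∈ polyLE 1) ∧ (∀ v ∈ K, evalP (l v) v = 1) ∧
    (∀ v ∈ K, ∀ w ∈ K, w ≠ v → evalP (l v) w = 0) ∧ B = ∏ v ∈ K, l v

/-- The enriched Lagrange space: `P_{k-1}` for `k ≥ 5`, and `P_{k-1} ⊕ span {B_K}` for `k < 5`. -/
def sigmaPlus (k : ℕ) (K : Finset E3) : Set Poly :=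
  {p | if 5 ≤ k then p ∈ polyLE ((k : ℤ) - 1)
    else ∃ q ∈ polyLE ((k : ℤ) - 1), ∃ (c : ℝ) (B : Poly), IsBubble K B ∧ p = q + c • B}

/-- `b = 𝔭 w`, where `(𝔭 w)(x) = ∫₀¹ t² x w(t x) dt`. -/
def IsPoincare (w : Poly) (b : VPoly) : Prop :=
  ∀ x : E3, evalV b x = ∫ t in (0 : ℝ)..1, (t ^ 2 * evalP w (t • x)) • x

/-- `W^{r-1,k}(K) = curl R_r ⊕ 𝔭 Σ^{+,k-1}(K)`. -/
def gradDivSpace (r k : ℕ) (K : Finset E3) : Set VPoly :=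
  {v | ∃ a ∈ nedelecSpace r, ∃ w ∈ sigmaPlus k K, ∃ b, IsPoincare w b ∧ v = curlP a + b}

/-! ### Degrees of freedom

Functionals located on the simplices with vertices in a given set `σ`. -/

/-- The mean value over the edge with end points `a`, `b`. -/
def edgeMean (a b : E3) (f : E3 → ℝ) : ℝ := ∫ t in (0 : ℝ)..1, f (a + t • (b - a))

/-- The mean value over the triangle with vertices `a`, `b`, `c`. -/
def faceMean (a b c : E3) (f : E3 → ℝ) : ℝ :=
  2 * ∫ s in (0 : ℝ)..1, ∫ t in (0 : ℝ)..(1 - s), f (a + s • (b - a) + t • (c - a))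

/-- `(b - a) × (c - a)`: normal to the triangle `a b c`, of length twice its area. -/
def triNormal (a b c : E3) : E3 :=
  WithLp.toLp 2 (crossProduct (WithLp.ofLp (b - a)) (WithLp.ofLp (c - a)))

/-- Vertex, edge and face degrees of freedom of the Lagrange element of degree `m`. -/
def lagrangeDofs (m : ℤ) (σ : Set E3) : Set ((E3 → ℝ) → ℝ) :=
  {L | ∃ v ∈ σ, L = fun u => u v} ∪
  {L | ∃ a ∈ σ, ∃ b ∈ σ, a ≠ b ∧ ∃ q ∈ polyLE (m - 2),
    L = fun u => edgeMean a b fun x => u x * evalP q x} ∪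
  {L | ∃ a ∈ σ, ∃ b ∈ σ, ∃ c ∈ σ, a ≠ b ∧ a ≠ c ∧ b ≠ c ∧ ∃ q ∈ polyLE (m - 3),
    L = fun u => faceMean a b c fun x => u x * evalP q x}

/-- Interior degrees of freedom of a scalar element, with test functions in `Q`. -/
def interiorDofs (Q : Submodule ℝ Poly) (K : Finset E3) : Set ((E3 → ℝ) → ℝ) :=
  {L | ∃ q ∈ Q, L = fun u => ⨍ x in convexHull ℝ (K : Set E3), u x * evalP q x}

/-- The interior test functions for the enriched Lagrange element: `P_{k-5}` for `k ≥ 5`; just the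
constants (one degree of freedom, for the bubble) for `k < 5`. -/
def plusInteriorTests (k : ℕ) : Submodule ℝ Poly :=
  if 5 ≤ k then polyLE ((k : ℤ) - 5) else polyLE 0

/-- Edge and face degrees of freedom of the Nédélec element: `∫_e u · τ q ds` with `q ∈ P_{r-1}(e)`
(the factor `b - a` is the unit tangent times the length of the edge) and the mean over `f` of
`u · v`, with `v ∈ P_{r-2}(f)³` tangential to `f`. -/
def nedelecDofs (r : ℕ) (σ : Set E3) : Set ((E3 → E3) → ℝ) :=
  {L | ∃ a ∈ σ, ∃ b ∈ σ, a ≠ b ∧ ∃ q ∈ polyLE ((r : ℤ) - 1),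
    L = fun u => edgeMean a b fun x => inner ℝ (u x) (b - a) * evalP q x} ∪
  {L | ∃ a ∈ σ, ∃ b ∈ σ, ∃ c ∈ σ, a ≠ b ∧ a ≠ c ∧ b ≠ c ∧ ∃ v ∈ vpolyLE ((r : ℤ) - 2),
    (∀ x ∈ convexHull ℝ {a, b, c}, inner ℝ (evalV v x) (triNormal a b c) = 0) ∧
    L = fun u => faceMean a b c fun x => inner ℝ (u x) (evalV v x)}

/-- Interior degrees of freedom `∫_K u · q dx` of a vector element, with test fields in `Q`. -/
def interiorVDofs (Q : Submodule ℝ VPoly) (K : Finset E3) : Set ((E3 → E3) → ℝ) :=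
  {L | ∃ q ∈ Q, L = fun u => ∫ x in convexHull ℝ (K : Set E3), inner ℝ (u x) (evalV q x)}

/-- The normal-flux degrees of freedom `∫_f u · n q dA`, `q ∈ P_{r-1}(f)`. -/
def fluxDofs (r : ℕ) (σ : Set E3) : Set ((E3 → E3) → ℝ) :=
  {L | ∃ a ∈ σ, ∃ b ∈ σ, ∃ c ∈ σ, a ≠ b ∧ a ≠ c ∧ b ≠ c ∧ ∃ q ∈ polyLE ((r : ℤ) - 1),
    L = fun u => (1 / 2) *
      faceMean a b c fun x => inner ℝ (u x) (triNormal a b c) * evalP q x}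

/-- `C` represents the quotient `P_{r-2}³ / ∇P_{r-1}`: it is a complement of `∇P_{r-1}` in
`P_{r-2}³`. -/
def IsGradComplement (r : ℕ) (C : Submodule ℝ VPoly) : Prop :=
  (polyLE ((r : ℤ) - 1)).map gradP ⊓ C = ⊥ ∧
  (polyLE ((r : ℤ) - 1)).map gradP ⊔ C = vpolyLE ((r : ℤ) - 2)

/-- The interior test fields `∇P_{k-5} ⊕ C` of the grad-div element. -/
def gradDivTests (k : ℕ) (C : Submodule ℝ VPoly) : Submodule ℝ VPoly :=
  (polyLE ((k : ℤ) - 5)).map gradP ⊔ C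

/-! ### Global finite element spaces

A finite element function is the family of its polynomial restrictions to the elements. The local
spaces are glued by the degrees of freedom: those located on a simplex shared by two elements take
the same value from both sides. -/

section Spaces

variable (T : Geometry.SimplicialComplex ℝ E3)

/-- The Lagrange space `Σ_h^r`. -/
def lagrangeFE (r : ℕ) : Set (Elem T → Poly) :=
  {w | (∀ K, w K ∈ polyLE r) ∧
    ∀ K K' : Elem T, ∀ L ∈ lagrangeDofs r ((K.1 : Set E3) ∩ K'.1),
      L (evalP (w K)) = L (evalP (w K'))}

/-- The enriched Lagrange space `Σ_h^{+,k-1}`. -/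
def lagrangePlusFE (k : ℕ) : Set (Elem T → Poly) :=
  {w | (∀ K, w K ∈ sigmaPlus k K.1) ∧
    ∀ K K' : Elem T, ∀ L ∈ lagrangeDofs ((k : ℤ) - 1) ((K.1 : Set E3) ∩ K'.1),
      L (evalP (w K)) = L (evalP (w K'))}

/-- The Nédélec space `V_h^r`. -/
def nedelecFE (r : ℕ) : Set (Elem T → VPoly) :=
  {z | (∀ K, z K ∈ nedelecSpace r) ∧
    ∀ K K' : Elem T, ∀ L ∈ nedelecDofs r ((K.1 : Set E3) ∩ K'.1),
      L (evalV (z K)) = L (evalV (z K'))}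

/-- The grad-div space `W_h^{r-1,k}`. -/
def gradDivFE (r k : ℕ) : Set (Elem T → VPoly) :=
  {y | (∀ K, y K ∈ gradDivSpace r k K.1) ∧
    ∀ K K' : Elem T,
      (∀ L ∈ lagrangeDofs ((k : ℤ) - 1) ((K.1 : Set E3) ∩ K'.1),
        L (evalP (divP (y K))) = L (evalP (divP (y K')))) ∧
      (∀ L ∈ fluxDofs r ((K.1 : Set E3) ∩ K'.1), L (evalV (y K)) = L (evalV (y K')))}

end Spaces

/-! ### Weak derivatives and Sobolev spaces -/

/-- Partial derivative of a function on `ℝ³`. -/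
def partialD (i : Fin 3) (f : E3 → ℝ) (x : E3) : ℝ := fderiv ℝ f x (EuclideanSpace.single i 1)

/-- Classical curl of a vector field. -/
def curlF (u : E3 → E3) (x : E3) : E3 :=
  !₂[partialD 1 (fun y => u y 2) x - partialD 2 (fun y => u y 1) x,
     partialD 2 (fun y => u y 0) x - partialD 0 (fun y => u y 2) x,
     partialD 0 (fun y => u y 1) x - partialD 1 (fun y => u y 0) x]

/-- Test functions on `Ω` with values in `F`: the elements of `C_c^∞(Ω; F)`. -/
def IsTest {F : Type*} [NormedAddCommGroup F] [NormedSpace ℝ F] (Ω : Set E3) (φ : E3 → F) : Prop :=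
  ContDiff ℝ ∞ φ ∧ HasCompactSupport φ ∧ tsupport φ ⊆ Ω

/-- `g = ∇u` in the sense of distributions on `Ω`. -/
def HasWeakGrad (Ω : Set E3) (u : E3 → ℝ) (g : E3 → E3) : Prop :=
  LocallyIntegrableOn u Ω ∧ LocallyIntegrableOn g Ω ∧
  ∀ φ : E3 → ℝ, IsTest Ω φ → ∀ i, ∫ x in Ω, u x * partialD i φ x = -∫ x in Ω, g x i * φ x

/-- `c = curl u` in the sense of distributions on `Ω`. -/
def HasWeakCurl (Ω : Set E3) (u c : E3 → E3) : Prop :=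
  LocallyIntegrableOn u Ω ∧ LocallyIntegrableOn c Ω ∧
  ∀ φ : E3 → E3, IsTest Ω φ →
    ∫ x in Ω, inner ℝ (u x) (curlF φ x) = ∫ x in Ω, inner ℝ (c x) (φ x)

/-- `d = div u` in the sense of distributions on `Ω`. -/
def HasWeakDiv (Ω : Set E3) (u : E3 → E3) (d : E3 → ℝ) : Prop :=
  LocallyIntegrableOn u Ω ∧ LocallyIntegrableOn d Ω ∧
  ∀ φ : E3 → ℝ, IsTest Ω φ →
    ∫ x in Ω, ∑ i, u x i * partialD i φ x = -∫ x in Ω, d x * φ x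

section Sobolev

variable {F : Type*} [NormedAddCommGroup F]

/-- The square of the Sobolev-Slobodeckij semi-norm of order `s ∈ (0,1)`. -/
def gagliardoSq (Ω : Set E3) (s : ℝ) (u : E3 → F) : ℝ≥0∞ :=
  ∫⁻ x in Ω, ∫⁻ y in Ω, ENNReal.ofReal (‖u x - u y‖ ^ 2 / ‖x - y‖ ^ (3 + 2 * s))

/-- `u ∈ H^s(Ω)`, `0 < s < 1`. -/
def MemHs (Ω : Set E3) (s : ℝ) (u : E3 → F) : Prop :=
  MemLp u 2 (volume.restrict Ω) ∧ gagliardoSq Ω s u < ⊤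

/-- `φ_n → u` in `H^s(Ω)`, `0 < s < 1`. -/
def TendstoHs (Ω : Set E3) (s : ℝ) (φ : ℕ → E3 → F) (u : E3 → F) : Prop :=
  Tendsto (fun n => eLpNorm (φ n - u) 2 (volume.restrict Ω)) atTop (𝓝 0) ∧
  Tendsto (fun n => gagliardoSq Ω s (φ n - u)) atTop (𝓝 0)

end Sobolev

/-- `u ∈ H^{1+s}(Ω)`, `0 < s < 1`. -/
def MemH1s (Ω : Set E3) (s : ℝ) (u : E3 → ℝ) : Prop :=
  MemLp u 2 (volume.restrict Ω) ∧ ∃ g, HasWeakGrad Ω u g ∧ MemHs Ω s g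

/-- `Σ = H^{3/2+δ}(Ω)`. -/
def MemSigma (Ω : Set E3) (δ : ℝ) (u : E3 → ℝ) : Prop := MemH1s Ω (1 / 2 + δ) u

/-- `V = {u ∈ H^{1/2+δ}(Ω)³ : curl u ∈ H^{1/2+δ}(Ω)³}`. -/
def MemV (Ω : Set E3) (δ : ℝ) (u : E3 → E3) : Prop :=
  MemHs Ω (1 / 2 + δ) u ∧ ∃ c, HasWeakCurl Ω u c ∧ MemHs Ω (1 / 2 + δ) c

/-- `W = {u ∈ H^{1/2+δ}(Ω)³ : div u ∈ H^{3/2+δ}(Ω)}`. -/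
def MemW (Ω : Set E3) (δ : ℝ) (u : E3 → E3) : Prop :=
  MemHs Ω (1 / 2 + δ) u ∧ ∃ d, HasWeakDiv Ω u d ∧ MemH1s Ω (1 / 2 + δ) d

/-! ### Degrees of freedom of Sobolev functions

Point values and integrals over edges and faces of a function in `H^{3/2+δ}(Ω)` are those of its
continuous representative. The edge and face moments of a vector field are, as usual for traces,
the continuous extensions of these functionals from smooth fields. -/

/-- `v` is the representative of `u` that is continuous on the closure of `Ω`. -/
def IsContRep (Ω : Set E3) (u v : E3 → ℝ) : Prop :=
  ContinuousOn v (closure Ω) ∧ v =ᵐ[volume.restrict Ω] u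

/-- `φ` is a sequence of smooth fields that converges to `u` in `H^{1/2+δ}(Ω)³`. -/
def ApproxHs (Ω : Set E3) (δ : ℝ) (u : E3 → E3) (φ : ℕ → E3 → E3) : Prop :=
  (∀ n, ContDiff ℝ ∞ (φ n)) ∧ TendstoHs Ω (1 / 2 + δ) φ u

/-- `φ` is a sequence of smooth fields that converges to `u` in `V`, that is, in `H^{1/2+δ}(Ω)³`
together with the curls. -/
def ApproxV (Ω : Set E3) (δ : ℝ) (u : E3 → E3) (φ : ℕ → E3 → E3) : Prop :=
  ApproxHs Ω δ u φ ∧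
    ∃ c, HasWeakCurl Ω u c ∧ TendstoHs Ω (1 / 2 + δ) (fun n => curlF (φ n)) c

/-- `c` is the value at `u` of the continuous extension of the functional `L` from smooth fields,
where `A` singles out the sequences of smooth fields that converge to `u`. -/
def IsExtendedValue (A : (ℕ → E3 → E3) → Prop) (L : (E3 → E3) → ℝ) (c : ℝ) : Prop :=
  (∃ φ, A φ) ∧ ∀ φ, A φ → Tendsto (fun n => L (φ n)) atTop (𝓝 c)

/-! ### The canonical interpolations -/

section Interpolation

variable (T : Geometry.SimplicialComplex ℝ E3) (Ω : Set E3)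

/-- `w = π_h u`: `w ∈ Σ_h^r` and all degrees of freedom of `u - w` vanish. -/
def IsLagrangeInterp (r : ℕ) (u : E3 → ℝ) (w : Elem T → Poly) : Prop :=
  w ∈ lagrangeFE T r ∧ ∃ v, IsContRep Ω u v ∧ ∀ K : Elem T,
    ∀ L ∈ lagrangeDofs r (K.1 : Set E3) ∪ interiorDofs (polyLE ((r : ℤ) - 4)) K.1,
      L v = L (evalP (w K))

/-- `w = π̃_h u`: `w ∈ Σ_h^{+,k-1}` and all degrees of freedom of `u - w` vanish. -/
def IsLagrangePlusInterp (k : ℕ) (u : E3 → ℝ) (w : Elem T → Poly) : Prop :=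
  w ∈ lagrangePlusFE T k ∧ ∃ v, IsContRep Ω u v ∧ ∀ K : Elem T,
    ∀ L ∈ lagrangeDofs ((k : ℤ) - 1) (K.1 : Set E3) ∪ interiorDofs (plusInteriorTests k) K.1,
      L v = L (evalP (w K))

/-- `z = r_h u`: `z ∈ V_h^r` and all degrees of freedom of `u - z` vanish. -/
def IsNedelecInterp (δ : ℝ) (r : ℕ) (u : E3 → E3) (z : Elem T → VPoly) : Prop :=
  z ∈ nedelecFE T r ∧ ∀ K : Elem T,
    (∀ L ∈ nedelecDofs r (K.1 : Set E3),
      IsExtendedValue (ApproxV Ω δ u) L (L (evalV (z K)))) ∧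
    (∀ L ∈ interiorVDofs (vpolyLE ((r : ℤ) - 3)) K.1, L u = L (evalV (z K)))

/-- `y = i_h u`: `y ∈ W_h^{r-1,k}` and all degrees of freedom of `u - y` vanish. Here `C K` is the
complement of gradients used in the interior degrees of freedom of `K`. -/
def IsGradDivInterp (δ : ℝ) (r k : ℕ) (C : Elem T → Submodule ℝ VPoly) (u : E3 → E3)
    (y : Elem T → VPoly) : Prop :=
  y ∈ gradDivFE T r k ∧ ∃ d v, HasWeakDiv Ω u d ∧ IsContRep Ω d v ∧ ∀ K : Elem T,
    (∀ L ∈ lagrangeDofs ((k : ℤ) - 1) (K.1 : Set E3), L v = L (evalP (divP (y K)))) ∧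
    (∀ L ∈ fluxDofs r (K.1 : Set E3), IsExtendedValue (ApproxHs Ω δ u) L (L (evalV (y K)))) ∧
    (∀ L ∈ interiorVDofs (gradDivTests k (C K)) K.1, L u = L (evalV (y K)))

end Interpolation

end GradDivFE

end

noncomputable section
namespace GradDivFE
open MvPolynomial (X C pderiv aeval monomial pderiv_X pderiv_monomial smul_monomial
  coeff_homogeneousComponent induction_on')
open ENNReal (ofReal ofReal_ne_top ofReal_mul mul_ne_top coe_ne_top coe_toNNReal)
open EuclideanSpace (single proj)
open Set (Ioc indicator_of_mem indicator_of_notMem)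
open Eventually (of_forall)
open Module (finrank)
open Metric (closedBall isClosed_closedBall)
open ContinuousLinearMap (lsmul smulRightL integral_comp_comm)
open Submodule (mem_sup_left mem_sup_right finrank_map_le subset_span
  finrank_mono)
open Function (uncurry)
open MeasureTheory.Measure (volume_eq_prod restrict_mono prod_restrict)
open Matrix (cons_val cons_val_one cons_val_zero)
open Finset (sum_add_distrib)
open WithLp (toLp)
local notation "hull" K:max => convexHull ℝ (K : Set E3)
local notation "leb" S:max => Measure.restrict volume S
local notation "I₀₁" => Ioc (0 : ℝ) 1
local notation:50 f:51 "⇝" a:51 => Tendsto f atTop (𝓝 a)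
variable {F G H : Type*} [NormedAddCommGroup F] [NormedSpace ℝ F] [NormedAddCommGroup G]
  [NormedSpace ℝ G] [NormedAddCommGroup H] [NormedSpace ℝ H] {K : Finset E3} {a b c d : E3}
  {B S Ω : Set E3} {s D : ℝ} {m : ℤ} {r : ℕ} {p : Poly} {v : VPoly}

/-! ### Polynomials: degrees -/

open MvPolynomial in
theorem mem_polyLE : p ∈ polyLE m ↔ ∀ n, coeff n p ≠ 0 → (n.degree : ℤ) ≤ m := by
  unfold polyLE
  split_ifs with h
  · rw [mem_restrictTotalDegree, totalDegree, Finset.sup_le_iff]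
    refine forall_congr' fun n => ?_
    change (_ → n.degree ≤ _) ↔ _
    rw [mem_support_iff]
    exact imp_congr_right fun _ => by omega
  · constructor
    · intro hp n hn
      rw [Submodule.mem_bot] at hp
      simp [hp] at hn
    · intro hp
      rw [Submodule.mem_bot]
      ext n
      by_contra hn
      have := hp n hn
      omega

theorem polyLE_le {S : Submodule ℝ Poly}
    (h : ∀ n : Fin 3 →₀ ℕ, (n.degree : ℤ) ≤ m → monomial n (1 : ℝ) ∈ S) : polyLE m ≤ S := by
  intro p hp
  rw [p.as_sum]
  refine Submodule.sum_mem _ fun n hn => ?_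
  have := S.smul_mem (p.coeff n) (h n (mem_polyLE.1 hp n (by simpa using hn)))
  simpa [smul_monomial] using this

theorem monomial_mem_polyLE {n : Fin 3 →₀ ℕ} (c : ℝ) (h : (n.degree : ℤ) ≤ m) :
    monomial n c ∈ polyLE m := by
  rw [mem_polyLE]
  intro k hk
  rw [MvPolynomial.coeff_monomial] at hk
  split_ifs at hk with h'
  · exact h' ▸ h
  · exact absurd rfl hk

theorem polyLE_mono {m' : ℤ} (h : m ≤ m') : polyLE m ≤ polyLE m' := fun _ hp =>
  mem_polyLE.2 fun n hn => (mem_polyLE.1 hp n hn).trans h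

theorem C_mem_polyLE (h : 0 ≤ m) (c : ℝ) : (C c : Poly) ∈ polyLE m :=
  monomial_mem_polyLE c (by simpa using h)

theorem X_mem_polyLE (h : 1 ≤ m) (i : Fin 3) : (X i : Poly) ∈ polyLE m :=
  monomial_mem_polyLE 1 (by simpa using h)

theorem mul_mem_polyLE {n : ℤ} {q : Poly} (hp : p ∈ polyLE m) (hq : q ∈ polyLE n) :
    p * q ∈ polyLE (m + n) := by
  rw [mem_polyLE] at *
  intro k hk
  rw [MvPolynomial.coeff_mul] at hk
  obtain ⟨⟨a, b⟩, hab, h⟩ := Finset.exists_ne_zero_of_sum_ne_zero hk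
  have h1 := hp a (left_ne_zero_of_mul h)
  have h2 := hq b (right_ne_zero_of_mul h)
  rw [Finset.HasAntidiagonal.mem_antidiagonal] at hab
  subst hab
  simp only [map_add, Nat.cast_add]
  omega

theorem pderiv_mem_polyLE (hp : p ∈ polyLE m) (i : Fin 3) : pderiv i p ∈ polyLE (m - 1) := by
  have : polyLE m ≤ (polyLE (m - 1)).comap (pderiv (R := ℝ) i).toLinearMap := by
    refine polyLE_le fun n hn => ?_
    rw [Submodule.mem_comap]
    change pderiv i _ ∈ _
    rw [pderiv_monomial]
    by_cases h0 : n i = 0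
    · simp [h0]
    · refine monomial_mem_polyLE _ ?_
      have : n = (n - Finsupp.single i 1) + Finsupp.single i 1 := by
        ext j
        by_cases hj : i = j
        · subst hj; simp; omega
        · simp [hj]
      have h2 := congrArg Finsupp.degree this
      simp only [map_add, Finsupp.degree_single] at h2
      omega
  exact this hp

theorem mem_polyLE_iff_totalDegree (h0 : p ≠ 0) : p ∈ polyLE m ↔ (p.totalDegree : ℤ) ≤ m := by
  unfold polyLE
  split_ifs with h
  · rw [MvPolynomial.mem_restrictTotalDegree]; omega
  · simp [h0]; omega

theorem pow_mem_polyLE {q : Poly} (hq : q ∈ polyLE 1) (n : ℕ) : q ^ n ∈ polyLE n := by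
  induction n with
  | zero => simpa using C_mem_polyLE le_rfl 1
  | succ n ih =>
    rw [pow_succ]
    simpa using mul_mem_polyLE ih hq

theorem aeval_mem_polyLE (hp : p ∈ polyLE m) {g : Fin 3 → Poly} (hg : ∀ i, g i ∈ polyLE 1) :
    aeval g p ∈ polyLE m := by
  have : polyLE m ≤ (polyLE m).comap (aeval (R := ℝ) g).toLinearMap := by
    refine polyLE_le fun n hn => ?_
    rw [Submodule.mem_comap]
    change aeval g _ ∈ _
    rw [MvPolynomial.aeval_monomial, map_one, one_mul, Finsupp.prod_fintype _ _ (by simp),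
      Fin.prod_univ_three]
    refine polyLE_mono ?_ (mul_mem_polyLE (mul_mem_polyLE (pow_mem_polyLE (hg 0) (n 0))
      (pow_mem_polyLE (hg 1) (n 1))) (pow_mem_polyLE (hg 2) (n 2)))
    simpa [Finsupp.degree_eq_sum, Fin.sum_univ_three] using hn
  exact this hp

theorem mem_vpolyLE : v ∈ vpolyLE m ↔ ∀ i, v i ∈ polyLE m := by simp [vpolyLE, Submodule.mem_pi]

/-! ### Dimensions -/

theorem polyLE_eq_restrictSupport (m : ℤ) :
    polyLE m = MvPolynomial.restrictSupport ℝ {n : Fin 3 →₀ ℕ | (n.degree : ℤ) ≤ m} := by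
  ext p
  rw [mem_polyLE, MvPolynomial.mem_restrictSupport_iff]
  simp [Set.subset_def]

theorem degree_lt_eq_biUnion (N : ℕ) :
    {n : Fin 3 →₀ ℕ | (n.degree : ℤ) ≤ (N : ℤ) - 1} =
      ((Finset.range N).biUnion fun j => (Finset.univ : Finset (Fin 3)).finsuppAntidiag j :
        Finset (Fin 3 →₀ ℕ)) := by
  ext n
  simp only [Set.mem_ofPred_eq, Finset.coe_biUnion, Finset.coe_range, Set.mem_Iio, Finset.mem_coe,
    Finset.mem_finsuppAntidiag, Set.mem_iUnion, Finsupp.degree_eq_sum, Finset.subset_univ, and_true,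
    exists_prop, exists_eq_right']
  change _ ↔ ∑ i, n i < N
  omega

instance finite_polyLE (m : ℤ) : Module.Finite ℝ (polyLE m) := by
  unfold polyLE
  by_cases h : 0 ≤ m
  · rw [if_pos h]; infer_instance
  · rw [if_neg h]; infer_instance

theorem finrank_polyLE (N : ℕ) : finrank ℝ (polyLE ((N : ℤ) - 1)) = (N + 2).choose 3 := by
  rw [polyLE_eq_restrictSupport, degree_lt_eq_biUnion,
    Module.finrank_eq_nat_card_basis (MvPolynomial.basisRestrictSupport ℝ _)]
  simp only [SetLike.coe_sort_coe, Nat.card_eq_fintype_card, Fintype.card_coe]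
  rw [Finset.card_biUnion]
  · simp only [Finset.card_finsuppAntidiag_nat_eq_choose, Finset.card_univ, Fintype.card_fin]
    induction N with
    | zero => simp
    | succ N ih =>
      rw [Finset.sum_range_succ, ih]
      have h1 : (3 + N - 1).choose N = (N + 2).choose 2 := by
        rw [show 3 + N - 1 = N + 2 by omega, ← Nat.choose_symm_add]
      rw [h1, Nat.choose_succ_succ' (N + 2) 2, add_comm]
  · intro i _ j _ hij
    rw [Function.onFun, Finset.disjoint_left]
    intro n hn hn'
    rw [Finset.mem_finsuppAntidiag] at hn hn'
    exact hij (hn.1.symm.trans hn'.1)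

/-! ### Values of polynomials -/

@[simp] theorem evalP_add (p q : Poly) (x : E3) : evalP (p + q) x = evalP p x + evalP q x := by
  simp [evalP]
@[simp] theorem evalP_sub (p q : Poly) (x : E3) : evalP (p - q) x = evalP p x - evalP q x := by
  simp [evalP]
@[simp] theorem evalP_mul (p q : Poly) (x : E3) : evalP (p * q) x = evalP p x * evalP q x := by
  simp [evalP]
@[simp] theorem evalP_smul (c : ℝ) (q : Poly) (x : E3) : evalP (c • q) x = c * evalP q x := by
  simp [evalP]
@[simp] theorem evalP_C (c : ℝ) (x : E3) : evalP (C c) x = c := by simp [evalP]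
@[simp] theorem evalP_X (i : Fin 3) (x : E3) : evalP (X i) x = x i := by simp [evalP]
@[simp] theorem evalP_zero (x : E3) : evalP 0 x = 0 := by simp [evalP]
@[simp] theorem evalP_one (x : E3) : evalP 1 x = 1 := by simp [evalP]
@[simp] theorem evalP_pow (p : Poly) (n : ℕ) (x : E3) : evalP (p ^ n) x = evalP p x ^ n := by
  simp [evalP]
@[simp] theorem evalP_sum {ι : Type*} (s : Finset ι) (f : ι → Poly) (x : E3) :
    evalP (∑ i ∈ s, f i) x = ∑ i ∈ s, evalP (f i) x := by simp [evalP]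
@[simp] theorem evalV_apply (v : VPoly) (x : E3) (i : Fin 3) : evalV v x i = evalP (v i) x := rfl

theorem evalP_aeval (g : Fin 3 → Poly) (p : Poly) (x : E3) :
    evalP (aeval g p) x = evalP p (toLp 2 fun i => evalP (g i) x) := by
  unfold evalP
  simp only [← MvPolynomial.aeval_eq_eval]
  exact DFunLike.congr_fun (MvPolynomial.comp_aeval g (aeval fun i => x i)) p

theorem contDiff_evalP (p : Poly) : ContDiff ℝ ∞ (evalP p) := by
  induction p using MvPolynomial.induction_on with
  | C a =>
    have : evalP (C a) = fun _ => a := funext fun x => by simp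
    rw [this]; fun_prop
  | add p q hp hq =>
    have : evalP (p + q) = fun x => evalP p x + evalP q x := funext fun x => by simp
    rw [this]; fun_prop
  | mul_X p i hp =>
    have : evalP (p * X i) = fun x => evalP p x * x i := funext fun x => by simp
    rw [this]; fun_prop

@[fun_prop] theorem continuous_evalP (p : Poly) : Continuous (evalP p) := (contDiff_evalP p).continuous

theorem contDiff_evalV (v : VPoly) : ContDiff ℝ ∞ (evalV v) := by
  rw [contDiff_euclidean]
  exact fun i => contDiff_evalP (v i)

@[fun_prop] theorem continuous_evalV (v : VPoly) : Continuous (evalV v) := (contDiff_evalV v).continuous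

theorem hasFDerivAt_evalP (p : Poly) (x : E3) : HasFDerivAt (evalP p)
      (∑ i, evalP (pderiv i p) x • (proj i : E3 →L[ℝ] ℝ)) x := by
  induction p using MvPolynomial.induction_on with
  | C a =>
    have : evalP (C a) = fun _ => a := funext fun x => by simp
    rw [this]; simpa using hasFDerivAt_const a x
  | add p q hp hq =>
    have : evalP (p + q) = evalP p + evalP q := funext fun x => by simp
    rw [this]
    refine (hp.add hq).congr_fderiv ?_
    ext v
    simp [add_mul, sum_add_distrib]
  | mul_X p j hp =>
    have : evalP (p * X j) = evalP p * (proj j : E3 →L[ℝ] ℝ) := funext fun x => by simp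
    rw [this]
    refine (hp.mul (proj j : E3 →L[ℝ] ℝ).hasFDerivAt).congr_fderiv ?_
    ext v
    simp only [add_apply, smul_apply, sum_apply, PiLp.proj_apply, smul_eq_mul, Derivation.leibniz,
      evalP_add, evalP_mul, pderiv_X, Pi.single_apply, add_mul, evalP_X,
      sum_add_distrib, Finset.mul_sum]
    congr 1
    · rw [Finset.sum_eq_single j (fun i _ hi => by simp [hi.symm]) (by simp)]
      simp
    · exact Finset.sum_congr rfl fun i _ => by ring

theorem fderiv_evalP (p : Poly) (x h : E3) :
    fderiv ℝ (evalP p) x h = ∑ i, evalP (pderiv i p) x * h i := by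
  rw [(hasFDerivAt_evalP p x).fderiv]
  simp

theorem partialD_evalP (i : Fin 3) (p : Poly) : partialD i (evalP p) = evalP (pderiv i p) := by
  ext x
  simp [partialD, fderiv_evalP]

theorem curlF_evalV (v : VPoly) : curlF (evalV v) = evalV (curlP v) := by
  ext x i
  have h (k j) : partialD k (fun y => evalV v y j) = evalP (pderiv k (v j)) :=
    partialD_evalP k (v j)
  simp only [curlF, h]
  fin_cases i <;> simp [curlP]

theorem eq_zero_of_evalP_eq_zero_box {lo hi : Fin 3 → ℝ} (h : ∀ i, lo i < hi i)
    (hp : ∀ x : E3, (∀ i, x i ∈ Set.Ioo (lo i) (hi i)) → evalP p x = 0) : p = 0 := by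
  refine MvPolynomial.funext_set (fun i => Set.Ioo (lo i) (hi i)) (fun i => Set.Ioo_infinite (h i)) ?_
  intro x hx
  simpa [evalP] using hp (toLp 2 x) fun i => hx i trivial

theorem eq_zero_of_evalP_eq_zero {U : Set E3} (hU : IsOpen U) (hne : U.Nonempty)
    (hp : ∀ x ∈ U, evalP p x = 0) : p = 0 := by
  obtain ⟨x, hx⟩ := hne
  have hU' : IsOpen ((toLp 2 : (Fin 3 → ℝ) → E3) ⁻¹' U) := hU.preimage (PiLp.continuous_toLp 2 _)
  obtain ⟨ε, hε, hb⟩ := Metric.isOpen_iff.1 hU' (WithLp.ofLp x) hx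
  refine eq_zero_of_evalP_eq_zero_box (lo := fun i => x i - ε) (hi := fun i => x i + ε)
    (fun i => by linarith) fun y hy => hp y ?_
  refine hb (a := WithLp.ofLp y) ?_
  rw [Metric.mem_ball, dist_pi_lt_iff hε]
  intro i
  rw [Real.dist_eq, abs_lt]
  have := hy i
  constructor <;> linarith [this.1, this.2]

/-! ### Division by linear polynomials -/

theorem dvd_of_aeval_update_eq_zero {i : Fin 3} {g : Poly}
    (h : aeval (Function.update X i g) p = 0) : X i - g ∣ p := by
  rw [← Ideal.mem_span_singleton, ← Ideal.Quotient.eq_zero_iff_mem]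
  set I := Ideal.span {X i - g}
  have : (Ideal.Quotient.mkₐ ℝ I) = (Ideal.Quotient.mkₐ ℝ I).comp
      (aeval (Function.update X i g)) := by
    ext j
    by_cases hj : j = i
    · subst hj
      simp only [Ideal.Quotient.mkₐ_eq_mk, AlgHom.coe_comp, Function.comp_apply,
        MvPolynomial.aeval_X, Function.update_self]
      rw [Ideal.Quotient.eq]
      exact Ideal.subset_span rfl
    · simp [hj]
  have h2 := congrArg (fun f => f p) this
  simp only [AlgHom.comp_apply, h, map_zero] at h2
  exact h2

/-! ### Polynomial potentials -/

/-- Division of the homogeneous component of degree `j` by `j + c`. -/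
def eulerInv (c : ℕ) : Poly →ₗ[ℝ] Poly := (MvPolynomial.basisMonomials (Fin 3) ℝ).constr ℝ fun n =>
    monomial n ((n.degree + c : ℝ)⁻¹)

theorem eulerInv_monomial (c : ℕ) (n : Fin 3 →₀ ℕ) (a : ℝ) :
    eulerInv c (monomial n a) = monomial n ((n.degree + c : ℝ)⁻¹ * a) := by
  have h : monomial n a = a • MvPolynomial.basisMonomials (Fin 3) ℝ n := by simp [smul_monomial]
  rw [h, map_smul, eulerInv, Module.Basis.constr_basis, smul_monomial, smul_eq_mul, mul_comm]

theorem eulerInv_mem_polyLE (c : ℕ) (hp : p ∈ polyLE m) : eulerInv c p ∈ polyLE m := by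
  have : polyLE m ≤ (polyLE m).comap (eulerInv c) := polyLE_le fun n hn => by
    rw [Submodule.mem_comap, eulerInv_monomial]
    exact monomial_mem_polyLE _ hn
  exact this hp

theorem degree_sub_single {n : Fin 3 →₀ ℕ} {i : Fin 3} (h : n i ≠ 0) :
    (n - Finsupp.single i 1).degree + 1 = n.degree := by
  have : n = (n - Finsupp.single i 1) + Finsupp.single i 1 := by
    ext j
    by_cases hj : i = j
    · subst hj; simp; omega
    · simp [hj]
  have h2 := congrArg Finsupp.degree this
  simp only [map_add, Finsupp.degree_single] at h2
  omega

theorem pderiv_eulerInv (c : ℕ) (i : Fin 3) (p : Poly) :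
    pderiv i (eulerInv c p) = eulerInv (c + 1) (pderiv i p) := by
  induction p using induction_on' with
  | monomial n a =>
    rw [eulerInv_monomial, pderiv_monomial, pderiv_monomial, eulerInv_monomial]
    by_cases h : n i = 0
    · simp [h]
    · rw [← degree_sub_single h]
      push_cast
      rw [add_assoc, add_comm (1 : ℝ), mul_assoc]
  | add p q hp hq => simp only [map_add, hp, hq]

theorem euler_eulerInv {c : ℕ} (hc : 0 < c) (p : Poly) :
    ∑ i, X i * pderiv i (eulerInv c p) + (c : Poly) * eulerInv c p = p := by
  induction p using induction_on' with
  | monomial n a =>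
    rw [eulerInv_monomial, (MvPolynomial.isHomogeneous_monomial _ rfl).sum_X_mul_pderiv,
      nsmul_eq_mul, ← add_mul, ← Nat.cast_add, ← nsmul_eq_mul, ← map_nsmul, nsmul_eq_mul,
      ← mul_assoc]
    have : (n.degree + c : ℝ) ≠ 0 := by positivity
    push_cast
    rw [mul_inv_cancel₀ this, one_mul]
  | add p q hp hq =>
    conv_rhs => rw [← hp, ← hq]
    simp only [map_add, mul_add, sum_add_distrib]
    ring

/-- The map `v ↦ x · v`. -/
def dotX : VPoly →ₗ[ℝ] Poly where
  toFun v := ∑ i, X i * v i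
  map_add' v w := by simp [mul_add, sum_add_distrib]
  map_smul' c v := by simp [Finset.smul_sum]

/-- The curl, as a linear map. -/
def curlL : VPoly →ₗ[ℝ] VPoly where
  toFun := curlP
  map_add' v w := by
    ext1 i
    fin_cases i <;> simp [curlP] <;> ring
  map_smul' c v := by
    ext1 i
    fin_cases i <;> simp [curlP, smul_sub]

/-- The divergence, as a linear map. -/
def divL : VPoly →ₗ[ℝ] Poly where
  toFun := divP
  map_add' v w := by simp [divP, sum_add_distrib]
  map_smul' c v := by simp [divP, Finset.smul_sum]

/-- The Poincaré operator `w ↦ ∫₀¹ t² x w(t x) dt`. -/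
def poincareL : Poly →ₗ[ℝ] VPoly where
  toFun w i := X i * eulerInv 3 w
  map_add' v w := by ext1 i; simp [mul_add]
  map_smul' c v := by ext1 i; simp

theorem curlL_apply (v : VPoly) : curlL v = curlP v := rfl
theorem divL_apply (v : VPoly) : divL v = divP v := rfl
theorem gradP_apply (p : Poly) (i : Fin 3) : gradP p i = pderiv i p := rfl

theorem pderiv_comm (i j : Fin 3) (p : Poly) : pderiv i (pderiv j p) = pderiv j (pderiv i p) := by
  induction p using induction_on' with
  | monomial n a =>
    simp only [pderiv_monomial]
    by_cases hij : i = j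
    · subst hij; rfl
    · simp only [Finsupp.coe_tsub, Pi.sub_apply, Finsupp.single_apply, if_neg hij, if_neg (Ne.symm hij),
        Nat.sub_zero]
      rw [tsub_right_comm]
      congr 1
      ring
  | add p q hp hq => simp only [map_add, hp, hq]

theorem divP_curlP (v : VPoly) : divP (curlP v) = 0 := by
  simp only [divP, curlP, Fin.sum_univ_three, cons_val_zero, cons_val_one, cons_val, map_sub]
  rw [pderiv_comm 1 0, pderiv_comm 2 0, pderiv_comm 2 1]
  ring

theorem divP_poincareL (w : Poly) : divP (poincareL w) = w := by
  conv_rhs => rw [← euler_eulerInv (c := 3) (by norm_num) w]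
  simp only [divP, poincareL, LinearMap.coe_mk, AddHom.coe_mk, Derivation.leibniz, smul_eq_mul,
    sum_add_distrib, MvPolynomial.pderiv_X_self, mul_one]
  simp

theorem dotX_mem_polyLE {m' : ℤ} (hv : v ∈ vpolyLE m) (h : m + 1 = m') : dotX v ∈ polyLE m' := by
  change ∑ i, X i * v i ∈ _
  refine Submodule.sum_mem (polyLE m') fun i _ => ?_
  rw [← h, add_comm]
  exact mul_mem_polyLE (X_mem_polyLE le_rfl i) (mem_vpolyLE.1 hv i)

theorem mem_nedelecSpace : v ∈ nedelecSpace r ↔ v ∈ vpolyLE r ∧ dotX v ∈ polyLE r := by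
  constructor
  · rintro ⟨a, b, rfl, ha, hb, hb'⟩
    rw [mem_vpolyLE] at ha ⊢
    constructor
    · intro i
      refine add_mem (polyLE_mono (by omega) (ha i)) (mem_polyLE.2 fun n hn => ?_)
      have := (hb i) hn
      rw [Finsupp.degree_eq_weight_one]
      exact_mod_cast this.le
    · rw [map_add]
      have : dotX b = 0 := hb'
      rw [this, add_zero]
      exact dotX_mem_polyLE (mem_vpolyLE.2 ha) (by ring)
  · rintro ⟨h1, h2⟩
    rw [mem_vpolyLE] at h1
    refine ⟨fun i => v i - MvPolynomial.homogeneousComponent r (v i),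
      fun i => MvPolynomial.homogeneousComponent r (v i), ?_, ?_, ?_, ?_⟩
    · ext1 i; simp
    · rw [mem_vpolyLE]
      intro i
      rw [mem_polyLE]
      intro n hn
      rw [MvPolynomial.coeff_sub, coeff_homogeneousComponent] at hn
      split_ifs at hn with h
      · simp at hn
      · rw [sub_zero] at hn
        have := mem_polyLE.1 (h1 i) n hn
        omega
    · exact fun i => MvPolynomial.homogeneousComponent_isHomogeneous r _
    · ext n
      rw [MvPolynomial.coeff_zero]
      by_cases hn : n.degree = r + 1
      · have h3 : MvPolynomial.coeff n (dotX v) = 0 := by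
          by_contra h
          have := mem_polyLE.1 h2 n h
          omega
        rw [← h3]
        simp only [dotX, LinearMap.coe_mk, AddHom.coe_mk, MvPolynomial.coeff_sum,
          MvPolynomial.coeff_X_mul']
        refine Finset.sum_congr rfl fun i _ => ?_
        split_ifs with h
        · rw [coeff_homogeneousComponent, if_pos]
          have := degree_sub_single (Finsupp.mem_support_iff.1 h)
          omega
        · rfl
      · rw [MvPolynomial.coeff_sum]
        refine Finset.sum_eq_zero fun i _ => ?_
        rw [MvPolynomial.coeff_X_mul']
        split_ifs with h
        · rw [coeff_homogeneousComponent, if_neg]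
          have := degree_sub_single (Finsupp.mem_support_iff.1 h)
          omega
        · rfl

/-- The space `R_r` as a submodule. -/
def nedelecSub (r : ℕ) : Submodule ℝ VPoly := vpolyLE r ⊓ (polyLE r).comap dotX

theorem mem_nedelecSub : v ∈ nedelecSub r ↔ v ∈ nedelecSpace r := by rw [mem_nedelecSpace]; rfl

theorem exists_gradP_eq (hv : v ∈ nedelecSpace r) (h : curlP v = 0) :
    ∃ ψ ∈ polyLE r, gradP ψ = v := by
  rw [mem_nedelecSpace] at hv
  have key : dotX (fun i => eulerInv 1 (v i)) ∈ polyLE r := by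
    have : ∀ p : Poly, ∀ i, X i * eulerInv 1 p = eulerInv 0 (X i * p) := by
      intro p i
      induction p using induction_on' with
      | monomial n a =>
        rw [eulerInv_monomial, X, MvPolynomial.monomial_mul, MvPolynomial.monomial_mul,
          eulerInv_monomial]
        simp [add_comm]
      | add p q hp hq => simp only [map_add, mul_add, hp, hq]
    have h2 : dotX (fun i => eulerInv 1 (v i)) = eulerInv 0 (dotX v) := by
      simp only [dotX, LinearMap.coe_mk, AddHom.coe_mk, map_sum, this]
    rw [h2]
    exact eulerInv_mem_polyLE 0 hv.2
  refine ⟨_, key, ?_⟩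
  have c0 := congrFun h 0
  have c1 := congrFun h 1
  have c2 := congrFun h 2
  simp only [curlP, cons_val_zero, cons_val_one, cons_val, Pi.zero_apply, sub_eq_zero] at c0 c1 c2
  have e (k : Fin 3) := euler_eulerInv (c := 1) one_pos (v k)
  ext1 k
  rw [gradP_apply, ← e k]
  simp only [dotX, LinearMap.coe_mk, AddHom.coe_mk, Fin.sum_univ_three, map_add,
    Derivation.leibniz, smul_eq_mul, pderiv_eulerInv]
  fin_cases k
  · simp [pderiv_X, c1, c2]
    ring
  · simp [pderiv_X, c0, c2]
    ring
  · simp [pderiv_X, c0, c1]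
    ring

theorem exists_curlP_eq (hv : v ∈ vpolyLE ((r : ℤ) - 1)) (h : divP v = 0) :
    ∃ a ∈ nedelecSpace r, curlP a = v := by
  rw [mem_vpolyLE] at hv
  set w : VPoly := fun i => eulerInv 2 (v i) with hw
  have hw' (i : Fin 3) : w i ∈ polyLE ((r : ℤ) - 1) := eulerInv_mem_polyLE 2 (hv i)
  have hX (i j : Fin 3) : w i * X j ∈ polyLE r := by
    simpa using mul_mem_polyLE (hw' i) (X_mem_polyLE le_rfl j)
  refine ⟨![w 1 * X 2 - w 2 * X 1, w 2 * X 0 - w 0 * X 2, w 0 * X 1 - w 1 * X 0], ?_, ?_⟩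
  · rw [mem_nedelecSpace]
    constructor
    · rw [mem_vpolyLE]
      intro i
      fin_cases i
      exacts [sub_mem (hX _ _) (hX _ _), sub_mem (hX _ _) (hX _ _), sub_mem (hX _ _) (hX _ _)]
    · convert Submodule.zero_mem _
      simp [dotX, Fin.sum_univ_three]
      ring
  · have hd : ∑ i, pderiv i (w i) = 0 := by
      simp only [hw, pderiv_eulerInv, ← map_sum]
      have : ∑ i, pderiv i (v i) = 0 := h
      rw [this, map_zero]
    have e (k : Fin 3) : ∑ i, X i * pderiv i (w k) + 2 * w k = v k :=
      euler_eulerInv (c := 2) two_pos (v k)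
    rw [Fin.sum_univ_three] at hd
    ext1 k
    rw [← e k]
    fin_cases k
    · simp [curlP, pderiv_X, Fin.sum_univ_three]
      linear_combination (-X 0) * hd
    · simp [curlP, pderiv_X, Fin.sum_univ_three]
      linear_combination (-X 1) * hd
    · simp [curlP, pderiv_X, Fin.sum_univ_three]
      linear_combination (-X 2) * hd

theorem curlP_mem_vpolyLE {r : ℤ} (hv : v ∈ vpolyLE r) : curlP v ∈ vpolyLE (r - 1) := by
  rw [mem_vpolyLE] at *
  intro i
  fin_cases i
  exacts [sub_mem (pderiv_mem_polyLE (hv _) _) (pderiv_mem_polyLE (hv _) _),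
    sub_mem (pderiv_mem_polyLE (hv _) _) (pderiv_mem_polyLE (hv _) _),
    sub_mem (pderiv_mem_polyLE (hv _) _) (pderiv_mem_polyLE (hv _) _)]

theorem divP_mem_polyLE (hv : v ∈ vpolyLE m) : divP v ∈ polyLE (m - 1) :=
  Submodule.sum_mem _ fun i _ => pderiv_mem_polyLE (mem_vpolyLE.1 hv i) i

theorem gradP_mem_vpolyLE (hp : p ∈ polyLE m) : gradP p ∈ vpolyLE (m - 1) :=
  mem_vpolyLE.2 fun i => pderiv_mem_polyLE hp i

theorem gradP_mem_nedelecSpace (hp : p ∈ polyLE r) : gradP p ∈ nedelecSpace r := by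
  rw [mem_nedelecSpace]
  have h := mem_vpolyLE.1 (gradP_mem_vpolyLE hp)
  refine ⟨mem_vpolyLE.2 fun i => polyLE_mono (by omega) (h i), dotX_mem_polyLE (mem_vpolyLE.2 h) (by ring)⟩

theorem eq_C_of_gradP_eq_zero (h : gradP p = 0) : p = C (evalP p 0) := by
  have h1 : ∀ x, evalP p x = evalP p 0 := fun x => is_const_of_fderiv_eq_zero
    (contDiff_evalP p |>.differentiable (by simp)) (fun x => by
      ext v
      rw [fderiv_evalP]
      have (i : Fin 3) : pderiv i p = 0 := congrFun h i
      simp [this]) x 0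
  rw [← sub_eq_zero]
  exact eq_zero_of_evalP_eq_zero isOpen_univ ⟨0, trivial⟩ fun x _ => by simp [h1 x]

theorem isPoincare_iff {w : Poly} {b : VPoly} : IsPoincare w b ↔ b = poincareL w := by
  have key (x : E3) : ∫ t in (0 : ℝ)..1, t ^ 2 * evalP w (t • x) = evalP (eulerInv 3 w) x := by
    induction w using induction_on' with
    | monomial n a =>
      have (t : ℝ) : t ^ 2 * evalP (monomial n a) (t • x) =
          t ^ (n.degree + 2) * evalP (monomial n a) x := by
        simp only [evalP, MvPolynomial.eval_monomial, PiLp.smul_apply, smul_eq_mul]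
        rw [Finsupp.prod_fintype _ _ (by simp), Finsupp.prod_fintype _ _ (by simp)]
        simp only [mul_pow, Finset.prod_mul_distrib, Finset.prod_pow_eq_pow_sum]
        rw [← Finsupp.degree_eq_sum]
        ring
      simp only [this, intervalIntegral.integral_mul_const, integral_pow, eulerInv_monomial]
      simp only [evalP, MvPolynomial.eval_monomial]
      simp
      ring_nf
    | add p q hp hq =>
      simp only [evalP_add, mul_add, map_add]
      rw [intervalIntegral.integral_add, hp, hq] <;>
      exact Continuous.intervalIntegrable (by fun_prop) _ _
  have hi (x : E3) : ∫ t in (0 : ℝ)..1, (t ^ 2 * evalP w (t • x)) • x = evalV (poincareL w) x := by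
    rw [intervalIntegral.integral_smul_const, key]
    ext i
    simp [poincareL, mul_comm]
  constructor
  · intro h
    ext1 i
    rw [← sub_eq_zero]
    refine eq_zero_of_evalP_eq_zero isOpen_univ ⟨0, trivial⟩ fun x _ => ?_
    have := congrArg (fun z : E3 => z i) ((h x).trans (hi x))
    simp only [evalV_apply] at this
    simp [this]
  · rintro rfl x
    exact (hi x).symm

/-! ### Dimensions of the shape function spaces -/

/-- Polynomial vector fields as triples of polynomials. -/
def vpolyLEEquiv (m : ℤ) : vpolyLE m ≃ₗ[ℝ] (Fin 3 → polyLE m) where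
  toFun v i := ⟨v.1 i, mem_vpolyLE.1 v.2 i⟩
  invFun v := ⟨fun i => (v i).1, mem_vpolyLE.2 fun i => (v i).2⟩
  map_add' _ _ := rfl
  map_smul' _ _ := rfl
  left_inv _ := rfl
  right_inv _ := rfl

theorem finrank_vpolyLE (m : ℤ) : finrank ℝ (vpolyLE m) = 3 * finrank ℝ (polyLE m) := by
  rw [(vpolyLEEquiv m).finrank_eq, Module.finrank_pi_fintype]
  simp

instance finite_vpolyLE (m : ℤ) : Module.Finite ℝ (vpolyLE m) :=
  Module.Finite.equiv (vpolyLEEquiv m).symm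

instance finite_nedelecSub (r : ℕ) : Module.Finite ℝ (nedelecSub r) :=
  Submodule.finiteDimensional_of_le (inf_le_left : nedelecSub r ≤ vpolyLE r)

theorem finrank_le_of_map_le {V W : Type*} [AddCommGroup V] [Module ℝ V] [AddCommGroup W]
    [Module ℝ W] (f : V →ₗ[ℝ] W) (A : Submodule ℝ V) [Module.Finite ℝ A] {B : Submodule ℝ W}
    [Module.Finite ℝ B] (h : A.map f ≤ B) :
    finrank ℝ A ≤ finrank ℝ B + finrank ℝ ↥(A ⊓ LinearMap.ker f) := by
  have h1 := LinearMap.finrank_range_add_finrank_ker (f.domRestrict A)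
  rw [LinearMap.range_domRestrict] at h1
  have h2 : finrank ℝ (LinearMap.ker (f.domRestrict A)) = finrank ℝ ↥(A ⊓ LinearMap.ker f) := by
    rw [LinearMap.ker_domRestrict, ← Submodule.finrank_map_subtype_eq, Submodule.map_comap_subtype]
  rw [← h1, h2]
  exact Nat.add_le_add_right (finrank_mono h) _

theorem le_finrank_nedelecSub (r : ℕ) :
    4 * (r + 3).choose 3 ≤ finrank ℝ (nedelecSub r) + (r + 4).choose 3 := by
  have hN (n : ℕ) : finrank ℝ (polyLE n) = (n + 3).choose 3 := by
    have := finrank_polyLE (n + 1)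
    rwa [Nat.cast_add, Nat.cast_one, add_sub_cancel_right] at this
  set q := (polyLE r).mkQ
  have h1 := finrank_le_of_map_le (q.comp dotX) (vpolyLE r) (B := (polyLE (r + 1)).map q) (by
    rw [Submodule.map_comp]
    refine Submodule.map_mono ?_
    rintro _ ⟨v, hv, rfl⟩
    exact dotX_mem_polyLE hv rfl)
  have h2 : vpolyLE r ⊓ LinearMap.ker (q.comp dotX) = nedelecSub r := by
    rw [nedelecSub, LinearMap.ker_comp, Submodule.ker_mkQ]
  have h3 := LinearMap.finrank_range_add_finrank_ker (q.domRestrict (polyLE (r + 1)))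
  rw [LinearMap.range_domRestrict, LinearMap.ker_domRestrict, Submodule.ker_mkQ,
    ← Submodule.finrank_map_subtype_eq, Submodule.map_comap_subtype,
    inf_eq_right.2 (polyLE_mono (by omega))] at h3
  have h4 := hN (r + 1)
  push_cast at h4
  rw [h2, finrank_vpolyLE, hN] at h1
  rw [h4, hN] at h3
  rw [show r + 4 = r + 1 + 3 by ring]
  omega

theorem finrank_map_gradP (N : ℕ) :
    finrank ℝ ((polyLE (N : ℤ)).map gradP) + 1 = (N + 3).choose 3 := by
  have h3 := LinearMap.finrank_range_add_finrank_ker (gradP.domRestrict (polyLE (N : ℤ)))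
  have hk : polyLE (N : ℤ) ⊓ LinearMap.ker gradP = ℝ ∙ (1 : Poly) := by
    ext p
    rw [Submodule.mem_inf, LinearMap.mem_ker, Submodule.mem_span_singleton]
    constructor
    · rintro ⟨_, h⟩
      refine ⟨evalP p 0, ?_⟩
      conv_rhs => rw [eq_C_of_gradP_eq_zero h]
      rw [MvPolynomial.smul_eq_C_mul, mul_one]
    · rintro ⟨c, rfl⟩
      refine ⟨Submodule.smul_mem _ _ (by simpa using C_mem_polyLE (m := N) (by omega) 1), ?_⟩
      ext1 i
      simp [gradP_apply]
  rw [LinearMap.range_domRestrict, LinearMap.ker_domRestrict,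
    ← Submodule.finrank_map_subtype_eq, Submodule.map_comap_subtype, hk,
    finrank_span_singleton one_ne_zero] at h3
  rw [h3]
  have := finrank_polyLE (N + 1)
  rwa [Nat.cast_add, Nat.cast_one, add_sub_cancel_right] at this

/-- Divergence-free fields of degree at most `r - 1`. -/
def divFreeSub (r : ℕ) : Submodule ℝ VPoly := vpolyLE ((r : ℤ) - 1) ⊓ LinearMap.ker divL

theorem divFreeSub_eq (r : ℕ) : divFreeSub r = (nedelecSub r).map curlL := by
  ext v
  constructor
  · rintro ⟨h1, h2⟩
    obtain ⟨a, ha, h⟩ := exists_curlP_eq h1 h2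
    exact ⟨a, mem_nedelecSub.2 ha, h⟩
  · rintro ⟨a, ha, rfl⟩
    exact ⟨curlP_mem_vpolyLE ha.1, divP_curlP a⟩

theorem le_finrank_divFreeSub (hr : 1 ≤ r) :
    3 * (r + 2).choose 3 ≤ (r + 1).choose 3 + finrank ℝ (divFreeSub r) := by
  have h1 := finrank_le_of_map_le divL (vpolyLE ((r : ℤ) - 1)) (B := polyLE ((r : ℤ) - 1 - 1)) (by
    rintro _ ⟨v, hv, rfl⟩
    exact divP_mem_polyLE hv)
  obtain ⟨n, rfl⟩ : ∃ n, r = n + 1 := ⟨r - 1, by omega⟩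
  rw [finrank_vpolyLE, finrank_polyLE] at h1
  have h2 := finrank_polyLE n
  rw [show (((n + 1 : ℕ) : ℤ) - 1 - 1) = (n : ℤ) - 1 by push_cast; ring, h2] at h1
  exact h1

/-! ### Tetrahedra -/

/-- Six times the signed volume of the tetrahedron `a b c d`. -/
def tetVol (a b c d : E3) : ℝ := inner ℝ (triNormal a b c) (d - a)

/-- The gradient of the barycentric coordinate of `d` in the tetrahedron `a b c d`. -/
def baryGrad (a b c d : E3) : E3 := (tetVol a b c d)⁻¹ • triNormal a b c

/-- `K` is the vertex set of the nondegenerate tetrahedron `a b c d`. -/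
structure IsTet (K : Finset E3) (a b c d : E3) : Prop where
  eq : (K : Set E3) = {a, b, c, d}
  vol : tetVol a b c d ≠ 0

theorem inner_E3 (u v : E3) : inner ℝ u v = u 0 * v 0 + u 1 * v 1 + u 2 * v 2 := by
  simp [PiLp.inner_apply, Fin.sum_univ_three, mul_comm]

theorem triNormal_apply (a b c : E3) : triNormal a b c =
    !₂[(b 1 - a 1) * (c 2 - a 2) - (b 2 - a 2) * (c 1 - a 1),
      (b 2 - a 2) * (c 0 - a 0) - (b 0 - a 0) * (c 2 - a 2),
      (b 0 - a 0) * (c 1 - a 1) - (b 1 - a 1) * (c 0 - a 0)] := by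
  ext i
  fin_cases i <;> simp [triNormal, cross_apply] <;> ring

theorem tetVol_eq (a b c d : E3) : tetVol a b c d =
    ((b 1 - a 1) * (c 2 - a 2) - (b 2 - a 2) * (c 1 - a 1)) * (d 0 - a 0) +
    ((b 2 - a 2) * (c 0 - a 0) - (b 0 - a 0) * (c 2 - a 2)) * (d 1 - a 1) +
    ((b 0 - a 0) * (c 1 - a 1) - (b 1 - a 1) * (c 0 - a 0)) * (d 2 - a 2) := by
  rw [tetVol, triNormal_apply, inner_E3]
  simp

theorem tetVol_swap12 (a b c d : E3) : tetVol b a c d = -tetVol a b c d := by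
  simp only [tetVol_eq]; ring
theorem tetVol_swap23 (a b c d : E3) : tetVol a c b d = -tetVol a b c d := by
  simp only [tetVol_eq]; ring
theorem tetVol_swap34 (a b c d : E3) : tetVol a b d c = -tetVol a b c d := by
  simp only [tetVol_eq]; ring

theorem IsTet.swap12 (h : IsTet K a b c d) : IsTet K b a c d :=
  ⟨by rw [h.eq, Set.insert_comm], by rw [tetVol_swap12]; exact neg_ne_zero.2 h.vol⟩
theorem IsTet.swap23 (h : IsTet K a b c d) : IsTet K a c b d :=
  ⟨by rw [h.eq, Set.insert_comm b], by rw [tetVol_swap23]; exact neg_ne_zero.2 h.vol⟩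
theorem IsTet.swap34 (h : IsTet K a b c d) : IsTet K a b d c :=
  ⟨by rw [h.eq, Set.pair_comm], by rw [tetVol_swap34]; exact neg_ne_zero.2 h.vol⟩
/-- The face opposite to `b`. -/
theorem IsTet.oppB (h : IsTet K a b c d) : IsTet K a c d b := h.swap23.swap34
/-- The face opposite to `c`. -/
theorem IsTet.oppC (h : IsTet K a b c d) : IsTet K a d b c := h.swap34.swap23
/-- The face opposite to `a`. -/
theorem IsTet.oppA (h : IsTet K a b c d) : IsTet K b c d a := h.swap12.swap23.swap34

theorem IsTet.ma (h : IsTet K a b c d) : a ∈ (K : Set E3) := by simp [h.eq]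
theorem IsTet.mb (h : IsTet K a b c d) : b ∈ (K : Set E3) := by simp [h.eq]
theorem IsTet.mc (h : IsTet K a b c d) : c ∈ (K : Set E3) := by simp [h.eq]
theorem IsTet.md (h : IsTet K a b c d) : d ∈ (K : Set E3) := by simp [h.eq]

theorem IsTet.ab (h : IsTet K a b c d) : a ≠ b := by
  rintro rfl
  exact h.vol (by simp [tetVol_eq])
theorem IsTet.ac (h : IsTet K a b c d) : a ≠ c := h.swap23.ab
theorem IsTet.ad (h : IsTet K a b c d) : a ≠ d := h.swap34.ac
theorem IsTet.bc (h : IsTet K a b c d) : b ≠ c := h.oppA.ab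
theorem IsTet.bd (h : IsTet K a b c d) : b ≠ d := h.swap12.ad
theorem IsTet.cd (h : IsTet K a b c d) : c ≠ d := h.swap23.bd

theorem IsTet.exists_of_mem {v : E3} (h : IsTet K a b c d) (hv : v ∈ (K : Set E3)) :
    ∃ x y z, IsTet K v x y z := by
  rw [h.eq] at hv
  rcases hv with rfl | rfl | rfl | rfl
  exacts [⟨_, _, _, h⟩, ⟨_, _, _, h.swap12⟩, ⟨_, _, _, h.swap23.swap12⟩,
    ⟨_, _, _, h.swap34.swap23.swap12⟩]

theorem IsTet.exists_of_mem₂ {v w : E3} (h : IsTet K a b c d) (hv : v ∈ (K : Set E3))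
    (hw : w ∈ (K : Set E3)) (hvw : v ≠ w) : ∃ x y, IsTet K v w x y := by
  obtain ⟨x, y, z, h'⟩ := h.exists_of_mem hv
  rw [h'.eq] at hw
  rcases hw with rfl | rfl | rfl | rfl
  exacts [absurd rfl hvw, ⟨_, _, h'⟩, ⟨_, _, h'.swap23⟩, ⟨_, _, h'.swap34.swap23⟩]

theorem IsTet.exists_of_mem₃ {u v w : E3} (h : IsTet K a b c d) (hu : u ∈ (K : Set E3))
    (hv : v ∈ (K : Set E3)) (hw : w ∈ (K : Set E3)) (huv : u ≠ v) (huw : u ≠ w) (hvw : v ≠ w) :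
    ∃ x, IsTet K u v w x := by
  obtain ⟨x, y, hq⟩ := h.exists_of_mem₂ hu hv huv
  rw [hq.eq] at hw
  rcases hw with rfl | rfl | rfl | rfl
  exacts [absurd rfl huw, absurd rfl hvw, ⟨_, hq⟩, ⟨_, hq.swap34⟩]

/-- Cramer's rule. -/
theorem IsTet.decomp (h : IsTet K a b c d) (v : E3) :
    v = inner ℝ (baryGrad a c d b) v • (b - a) + inner ℝ (baryGrad a d b c) v • (c - a) +
      inner ℝ (baryGrad a b c d) v • (d - a) := by
  have h1 := h.vol
  have e1 : tetVol a c d b = tetVol a b c d := by rw [tetVol_swap34, tetVol_swap23, neg_neg]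
  have e2 : tetVol a d b c = tetVol a b c d := by rw [tetVol_swap23, tetVol_swap34, neg_neg]
  simp only [baryGrad, e1, e2, inner_smul_left, mul_smul, ← smul_add]
  rw [← smul_right_injective E3 h1 |>.eq_iff]
  simp only [conj_trivial, smul_inv_smul₀ h1]
  ext i
  fin_cases i <;> simp [tetVol_eq, triNormal_apply, inner_E3] <;> ring

theorem IsTet.inner_self (h : IsTet K a b c d) : inner ℝ (baryGrad a b c d) (d - a) = 1 := by
  rw [baryGrad, inner_smul_left]
  exact inv_mul_cancel₀ h.vol

theorem inner_baryGrad_left : inner ℝ (baryGrad a b c d) (b - a) = 0 := by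
  rw [baryGrad, inner_smul_left, triNormal_apply, inner_E3]
  simp; right; ring

theorem inner_baryGrad_right : inner ℝ (baryGrad a b c d) (c - a) = 0 := by
  rw [baryGrad, inner_smul_left, triNormal_apply, inner_E3]
  simp; right; ring

theorem IsTet.baryGrad_add (h : IsTet K a b c d) :
    baryGrad b c d a = -(baryGrad a c d b + baryGrad a d b c + baryGrad a b c d) := by
  have e1 : tetVol a c d b = tetVol a b c d := by rw [tetVol_swap34, tetVol_swap23, neg_neg]
  have e2 : tetVol a d b c = tetVol a b c d := by rw [tetVol_swap23, tetVol_swap34, neg_neg]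
  have e3 : tetVol b c d a = -tetVol a b c d := by
    rw [tetVol_swap34, tetVol_swap23, tetVol_swap12, neg_neg]
  simp only [baryGrad, e1, e2, e3, inv_neg, neg_smul, ← smul_add]
  congr 2
  ext i
  fin_cases i <;> simp [triNormal_apply] <;> ring

theorem IsTet.linearIndependent (h : IsTet K a b c d) :
    LinearIndependent ℝ ![b - a, c - a, d - a] := by
  rw [Fintype.linearIndependent_iff]
  intro g hg
  simp only [Fin.sum_univ_three, cons_val_zero, cons_val_one, cons_val] at hg
  have h1 := congrArg (fun v => inner ℝ (baryGrad a c d b) v) hg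
  have h2 := congrArg (fun v => inner ℝ (baryGrad a d b c) v) hg
  have h3 := congrArg (fun v => inner ℝ (baryGrad a b c d) v) hg
  simp only [inner_add_right, inner_smul_right, inner_zero_right, inner_baryGrad_left,
    inner_baryGrad_right, h.inner_self, h.oppB.inner_self, h.oppC.inner_self] at h1 h2 h3
  intro i
  fin_cases i <;> simp at * <;> assumption

theorem exists_isTet (hc : K.card = 4) (hi : AffineIndependent ℝ ((↑) : K → E3)) :
    ∃ a b c d, IsTet K a b c d := by
  let e : Fin 4 ≃ K := (Fintype.equivFinOfCardEq (by simpa using hc)).symm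
  have h1 : AffineIndependent ℝ fun i => (e i : E3) := hi.comp_embedding e.toEmbedding
  refine ⟨e 0, e 1, e 2, e 3, ?_, ?_⟩
  · ext x
    simp only [Finset.mem_coe, Set.mem_insert_iff, Set.mem_singleton_iff]
    constructor
    · intro hx
      obtain ⟨i, hi⟩ := e.surjective ⟨x, hx⟩
      have : x = e i := by rw [hi]
      fin_cases i <;> simp [this]
    · rintro (rfl | rfl | rfl | rfl) <;> exact Subtype.prop _
  · rw [affineIndependent_iff_linearIndependent_vsub ℝ _ 0] at h1
    have h2 : LinearIndependent ℝ fun i : Fin 3 => WithLp.ofLp ((e i.succ : E3) - (e 0 : E3)) := by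
      have := h1.comp (fun i : Fin 3 => ⟨i.succ, Fin.succ_ne_zero i⟩) (fun i j hij => by
        simpa using hij)
      exact this.map' (WithLp.linearEquiv 2 ℝ (Fin 3 → ℝ)).toLinearMap (LinearEquiv.ker _)
    have h3 := Matrix.linearIndependent_rows_iff_isUnit (A := Matrix.of fun i : Fin 3 =>
      WithLp.ofLp ((e i.succ : E3) - (e 0 : E3))) |>.1 h2
    rw [Matrix.isUnit_iff_isUnit_det, Matrix.det_fin_three, isUnit_iff_ne_zero] at h3
    intro h0
    apply h3
    rw [← h0, tetVol_eq]
    simp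
    ring

/-! ### Edge and face means -/

theorem edgeMean_symm (a b : E3) (f : E3 → ℝ) : edgeMean b a f = edgeMean a b f := by
  have := intervalIntegral.integral_comp_sub_left (a := 0) (b := 1)
    (fun t : ℝ => f (a + t • (b - a))) 1
  simp only [sub_self, sub_zero] at this
  rw [edgeMean, edgeMean, ← this]
  congr 1 with t
  congr 1
  module

theorem faceMean_rev (a b c : E3) (f : E3 → ℝ) : faceMean c b a f = faceMean a b c f := by
  unfold faceMean
  congr 2 with s
  have := intervalIntegral.integral_comp_sub_left (a := 0) (b := 1 - s)
    (fun t : ℝ => f (a + s • (b - a) + t • (c - a))) (1 - s)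
  simp only [sub_self, sub_zero] at this
  rw [← this]
  congr 1 with t
  congr 1
  module

/-- The reference triangle. -/
def refTri : Set (ℝ × ℝ) := {p | 0 ≤ p.1 ∧ 0 ≤ p.2 ∧ p.1 + p.2 ≤ 1}

theorem isClosed_refTri : IsClosed refTri := (isClosed_le continuous_const continuous_fst).inter
    ((isClosed_le continuous_const continuous_snd).inter
      (isClosed_le (continuous_fst.add continuous_snd) continuous_const))

theorem refTri_subset : refTri ⊆ Set.Icc 0 1 := fun p hp =>
  ⟨⟨hp.1, hp.2.1⟩, ⟨by simpa using by linarith [hp.1, hp.2.1, hp.2.2],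
    by simpa using by linarith [hp.1, hp.2.1, hp.2.2]⟩⟩

theorem isCompact_refTri : IsCompact refTri :=
  isCompact_Icc.of_isClosed_subset isClosed_refTri refTri_subset

theorem integral_refTri {F : ℝ × ℝ → ℝ} (hF : Continuous F) :
    ∫ s in (0 : ℝ)..1, ∫ t in (0 : ℝ)..(1 - s), F (s, t) = ∫ p in refTri, F p := by
  have hm := isClosed_refTri.measurableSet
  rw [← integral_indicator hm, volume_eq_prod, integral_prod]
  · rw [intervalIntegral.integral_of_le zero_le_one, ← integral_Icc_eq_integral_Ioc,
      ← integral_indicator measurableSet_Icc]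
    congr 1 with s
    by_cases hs : s ∈ Set.Icc (0 : ℝ) 1
    · rw [indicator_of_mem hs, intervalIntegral.integral_of_le (by linarith [hs.2]),
        ← integral_Icc_eq_integral_Ioc, ← integral_indicator measurableSet_Icc]
      congr 1 with t
      by_cases ht : t ∈ Set.Icc 0 (1 - s)
      · rw [indicator_of_mem ht, indicator_of_mem]
        exact ⟨hs.1, ht.1, by simpa using by linarith [ht.2]⟩
      · rw [indicator_of_notMem ht, indicator_of_notMem]
        exact fun h => ht ⟨h.2.1, by linarith [h.2.2]⟩
    · rw [indicator_of_notMem hs, eq_comm]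
      convert integral_zero ℝ ℝ with t
      rw [indicator_of_notMem]
      exact fun h => hs ⟨h.1, by linarith [h.2.1, h.2.2]⟩
  · rw [← volume_eq_prod, integrable_indicator_iff hm]
    exact hF.continuousOn.integrableOn_compact isCompact_refTri

theorem integrableOn_refTri {f : ℝ × ℝ → ℝ} (hf : Continuous f) : IntegrableOn f refTri :=
  hf.continuousOn.integrableOn_compact isCompact_refTri

/-- Parametrization of the triangle `a b c`. -/
def triMap (a b c : E3) (p : ℝ × ℝ) : E3 := a + p.1 • (b - a) + p.2 • (c - a)

@[fun_prop] theorem continuous_triMap (a b c : E3) : Continuous (triMap a b c) := by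
  unfold triMap; fun_prop

theorem faceMean_eq {f : E3 → ℝ} (hf : Continuous f) (a b c : E3) :
    faceMean a b c f = 2 * ∫ p in refTri, f (triMap a b c p) := by
  rw [← integral_refTri (F := fun p => f (triMap a b c p)) (by fun_prop)]
  rfl

theorem faceMean_swap {f : E3 → ℝ} (hf : Continuous f) (a b c : E3) :
    faceMean a c b f = faceMean a b c f := by
  rw [faceMean_eq hf, faceMean_eq hf]
  have h := (Measure.measurePreserving_swap (μ := (volume : Measure ℝ)) (ν := (volume : Measure ℝ)))
  have h2 := h.setIntegral_preimage_emb MeasurableEquiv.prodComm.measurableEmbedding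
    (fun p => f (triMap a c b p)) refTri
  rw [← volume_eq_prod] at h2
  rw [← h2]
  have h3 : Prod.swap ⁻¹' refTri = refTri := by
    ext p
    simp only [refTri, Set.mem_preimage, Set.mem_ofPred_eq, Prod.fst_swap, Prod.snd_swap]
    rw [add_comm p.2]
    tauto
  rw [h3]
  congr 2 with p
  congr 1
  simp only [triMap, Prod.fst_swap, Prod.snd_swap]
  abel

theorem triMap_mem {p : ℝ × ℝ} (hp : p ∈ refTri) : triMap a b c p ∈ convexHull ℝ {a, b, c} := by
  have h : triMap a b c p = (1 - p.1 - p.2) • a + p.1 • b + p.2 • c := by unfold triMap; module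
  rw [h]
  have hs : Convex ℝ (convexHull ℝ {a, b, c}) := convex_convexHull ℝ _
  have ha : a ∈ convexHull ℝ {a, b, c} := subset_convexHull ℝ _ (by simp)
  have hb : b ∈ convexHull ℝ {a, b, c} := subset_convexHull ℝ _ (by simp)
  have hc : c ∈ convexHull ℝ {a, b, c} := subset_convexHull ℝ _ (by simp)
  have := hs.sum_mem (t := Finset.univ) (w := ![1 - p.1 - p.2, p.1, p.2]) (z := ![a, b, c])
    (by intro i _; fin_cases i <;> simp <;> linarith [hp.1, hp.2.1, hp.2.2])
    (by simp [Fin.sum_univ_three]; ring) (by intro i _; fin_cases i <;> simpa)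
  simpa [Fin.sum_univ_three] using this

theorem faceMean_congr {f g : E3 → ℝ} (h : ∀ x ∈ convexHull ℝ {a, b, c}, f x = g x) :
    faceMean a b c f = faceMean a b c g := by
  unfold faceMean
  congr 1
  refine intervalIntegral.integral_congr fun s hs => ?_
  rw [Set.uIcc_of_le zero_le_one] at hs
  refine intervalIntegral.integral_congr fun t ht => ?_
  rw [Set.uIcc_of_le (by linarith [hs.2])] at ht
  exact h _ (triMap_mem (p := (s, t)) ⟨hs.1, ht.1, by simpa using by linarith [ht.2]⟩)

theorem segMap_mem {t : ℝ} (ht : t ∈ Set.Icc (0 : ℝ) 1) : a + t • (b - a) ∈ segment ℝ a b := by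
  rw [segment_eq_image']
  exact ⟨t, ht, rfl⟩

theorem edgeMean_congr {f g : E3 → ℝ} (h : ∀ x ∈ segment ℝ a b, f x = g x) :
    edgeMean a b f = edgeMean a b g := by
  refine intervalIntegral.integral_congr fun s hs => ?_
  rw [Set.uIcc_of_le zero_le_one] at hs
  exact h _ (segMap_mem hs)

section Linear

variable {f g : E3 → ℝ}

theorem edgeMean_add (hf : Continuous f) (hg : Continuous g) :
    edgeMean a b (fun x => f x + g x) = edgeMean a b f + edgeMean a b g :=
  intervalIntegral.integral_add (Continuous.intervalIntegrable (by fun_prop) _ _)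
    (Continuous.intervalIntegrable (by fun_prop) _ _)

theorem edgeMean_const_mul (r : ℝ) : edgeMean a b (fun x => r * f x) = r * edgeMean a b f :=
  intervalIntegral.integral_const_mul r _

theorem edgeMean_sub (hf : Continuous f) (hg : Continuous g) :
    edgeMean a b (fun x => f x - g x) = edgeMean a b f - edgeMean a b g :=
  intervalIntegral.integral_sub (Continuous.intervalIntegrable (by fun_prop) _ _)
    (Continuous.intervalIntegrable (by fun_prop) _ _)

theorem faceMean_const_mul (r : ℝ) : faceMean a b c (fun x => r * f x) = r * faceMean a b c f := by
  simp only [faceMean, intervalIntegral.integral_const_mul]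
  ring

theorem faceMean_add (hf : Continuous f) (hg : Continuous g) :
    faceMean a b c (fun x => f x + g x) = faceMean a b c f + faceMean a b c g := by
  rw [faceMean_eq hf, faceMean_eq hg, faceMean_eq (by fun_prop), integral_add, mul_add]
  · exact integrableOn_refTri (by fun_prop)
  · exact integrableOn_refTri (by fun_prop)

theorem faceMean_sub (hf : Continuous f) (hg : Continuous g) :
    faceMean a b c (fun x => f x - g x) = faceMean a b c f - faceMean a b c g := by
  rw [eq_sub_iff_add_eq, ← faceMean_add (by fun_prop) hg]
  simp

end Linear

/-! ### Fundamental theorem of calculus on simplices -/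

theorem fderiv_comp_line {F : E3 → ℝ} (hF : ContDiff ℝ 1 F) (x h : E3) (t : ℝ) :
    HasDerivAt (fun t : ℝ => F (x + t • h)) (fderiv ℝ F (x + t • h) h) t := by
  have h1 : HasDerivAt (fun t : ℝ => x + t • h) h t := by
    simpa using ((hasDerivAt_id t).smul_const h).const_add x
  exact ((hF.differentiable one_ne_zero).differentiableAt.hasFDerivAt).comp_hasDerivAt t h1

theorem continuous_fderiv_apply {F : E3 → ℝ} (hF : ContDiff ℝ 1 F) (h : E3) :
    Continuous fun x => fderiv ℝ F x h :=
  (hF.continuous_fderiv one_ne_zero).clm_apply continuous_const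

theorem edgeMean_fderiv {F : E3 → ℝ} (hF : ContDiff ℝ 1 F) (a b : E3) :
    edgeMean a b (fun x => fderiv ℝ F x (b - a)) = F b - F a := by
  have hc := continuous_fderiv_apply hF (b - a)
  rw [edgeMean, intervalIntegral.integral_eq_sub_of_hasDerivAt
    (fun t _ => fderiv_comp_line hF a (b - a) t)
    (Continuous.intervalIntegrable (by fun_prop) _ _)]
  simp

theorem faceMean_fderiv {F : E3 → ℝ} (hF : ContDiff ℝ 1 F) (a b c : E3) :
    faceMean a b c (fun x => fderiv ℝ F x (c - a)) = 2 * (edgeMean b c F - edgeMean a b F) := by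
  have hc := continuous_fderiv_apply hF (c - a)
  have h0 := hF.continuous
  rw [← edgeMean_symm b c]
  unfold faceMean edgeMean
  rw [← intervalIntegral.integral_sub (Continuous.intervalIntegrable (by fun_prop) _ _)
    (Continuous.intervalIntegrable (by fun_prop) _ _)]
  congr 2 with s
  rw [intervalIntegral.integral_eq_sub_of_hasDerivAt
    (fun t _ => fderiv_comp_line hF (a + s • (b - a)) (c - a) t)
    (Continuous.intervalIntegrable (by fun_prop) _ _)]
  congr 2
  · module
  · module

theorem faceMean_fderiv' {F : E3 → ℝ} (hF : ContDiff ℝ 1 F) (a b c : E3) :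
    faceMean a b c (fun x => fderiv ℝ F x (b - a)) = 2 * (edgeMean b c F - edgeMean a c F) := by
  rw [← faceMean_swap (continuous_fderiv_apply hF (b - a)), faceMean_fderiv hF, edgeMean_symm b c]

/-- The linear map that takes the unit vectors to `b - a`, `c - a`, `d - a`. -/
def tetLin (a b c d : E3) : E3 →L[ℝ] E3 := (proj 0 : E3 →L[ℝ] ℝ).smulRight (b - a) +
    (proj 1 : E3 →L[ℝ] ℝ).smulRight (c - a) +
    (proj 2 : E3 →L[ℝ] ℝ).smulRight (d - a)

theorem tetLin_apply (a b c d y : E3) :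
    tetLin a b c d y = y 0 • (b - a) + y 1 • (c - a) + y 2 • (d - a) := by simp [tetLin]

/-- The reference tetrahedron. -/
def refTet : Set E3 := {y | (∀ i, 0 ≤ y i) ∧ y 0 + y 1 + y 2 ≤ 1}

theorem isClosed_refTet : IsClosed refTet := by
  have h : refTet = (⋂ i, {y : E3 | 0 ≤ y i}) ∩ {y | y 0 + y 1 + y 2 ≤ 1} := by ext y; simp [refTet]
  rw [h]
  exact (isClosed_iInter fun i => isClosed_le continuous_const (by fun_prop)).inter
    (isClosed_le (by fun_prop) continuous_const)

theorem convex_refTet : Convex ℝ refTet := by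
  intro x hx y hy s t hs ht hst
  refine ⟨fun i => ?_, ?_⟩
  · have := mul_nonneg hs (hx.1 i)
    have := mul_nonneg ht (hy.1 i)
    simp only [PiLp.add_apply, PiLp.smul_apply, smul_eq_mul]
    linarith
  · have := mul_le_mul_of_nonneg_left hx.2 hs
    have := mul_le_mul_of_nonneg_left hy.2 ht
    simp only [PiLp.add_apply, PiLp.smul_apply, smul_eq_mul]
    linarith

theorem tetMap_image (a b c d : E3) :
    (fun y => a + tetLin a b c d y) '' refTet = convexHull ℝ {a, b, c, d} := by
  apply Set.Subset.antisymm
  · rintro _ ⟨y, hy, rfl⟩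
    have h : a + tetLin a b c d y = (1 - y 0 - y 1 - y 2) • a + y 0 • b + y 1 • c + y 2 • d := by
      rw [tetLin_apply]; module
    change a + tetLin a b c d y ∈ _
    rw [h]
    have hs : Convex ℝ (convexHull ℝ {a, b, c, d}) := convex_convexHull ℝ _
    have ha : a ∈ convexHull ℝ {a, b, c, d} := subset_convexHull ℝ _ (by simp)
    have hb : b ∈ convexHull ℝ {a, b, c, d} := subset_convexHull ℝ _ (by simp)
    have hc : c ∈ convexHull ℝ {a, b, c, d} := subset_convexHull ℝ _ (by simp)
    have hd : d ∈ convexHull ℝ {a, b, c, d} := subset_convexHull ℝ _ (by simp)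
    have := hs.sum_mem (t := Finset.univ) (w := ![1 - y 0 - y 1 - y 2, y 0, y 1, y 2])
      (z := ![a, b, c, d])
      (by intro i _; fin_cases i <;> simp <;> linarith [hy.1 0, hy.1 1, hy.1 2, hy.2])
      (by simp [Fin.sum_univ_four]; ring) (by intro i _; fin_cases i <;> simpa)
    simpa [Fin.sum_univ_four] using this
  · refine convexHull_min ?_ ?_
    · have key : ∀ y : E3, y ∈ refTet → a + tetLin a b c d y ∈
          (fun y => a + tetLin a b c d y) '' refTet := fun y hy => ⟨y, hy, rfl⟩
      rintro x (rfl | rfl | rfl | rfl)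
      · simpa using key 0 (by simp [refTet])
      · simpa [tetLin_apply] using key (single 0 1) ⟨fun i => by fin_cases i <;> simp, by simp⟩
      · simpa [tetLin_apply] using key (single 1 1) ⟨fun i => by fin_cases i <;> simp, by simp⟩
      · simpa [tetLin_apply] using key (single 2 1) ⟨fun i => by fin_cases i <;> simp, by simp⟩
    · rw [← Set.image_image (fun z => a + z)]
      exact (convex_refTet.linear_image (tetLin a b c d).toLinearMap).translate a

/-- Coordinates of `ℝ³`, the last one singled out. -/
def coord3 : (ℝ × ℝ) × ℝ ≃ᵐ E3 := (MeasurableEquiv.prodComm.trans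
    (((MeasurableEquiv.refl ℝ).prodCongr MeasurableEquiv.finTwoArrow.symm).trans
      (MeasurableEquiv.piFinSuccAbove (fun _ : Fin 3 => ℝ) 2).symm)).trans
    (MeasurableEquiv.toLp 2 (Fin 3 → ℝ))

theorem coord3_apply (p : (ℝ × ℝ) × ℝ) : coord3 p = !₂[p.1.1, p.1.2, p.2] := by
  ext i
  fin_cases i <;> rfl

theorem measurePreserving_coord3 : MeasurePreserving coord3 := by
  have h1 : MeasurePreserving (MeasurableEquiv.prodComm (α := ℝ × ℝ) (β := ℝ)) :=
    Measure.measurePreserving_swap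
  have h2 : MeasurePreserving ((MeasurableEquiv.refl ℝ).prodCongr
      (MeasurableEquiv.finTwoArrow (α := ℝ)).symm) :=
    (MeasurePreserving.id volume).prod (volume_preserving_finTwoArrow ℝ).symm
  exact ((h1.trans h2).trans (volume_preserving_piFinSuccAbove (fun _ : Fin 3 => ℝ) 2).symm).trans
    (PiLp.volume_preserving_toLp (Fin 3))

theorem integral_refTet {H : E3 → ℝ} (hH : Continuous H) : ∫ y in refTet, H y =
      ∫ p in refTri, ∫ u in (0 : ℝ)..(1 - p.1 - p.2), H !₂[p.1, p.2, u] := by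
  rw [← measurePreserving_coord3.setIntegral_preimage_emb coord3.measurableEmbedding]
  have hcont : Continuous fun p : (ℝ × ℝ) × ℝ => H !₂[p.1.1, p.1.2, p.2] := by
    refine hH.comp ((PiLp.continuous_toLp 2 _).comp ?_)
    refine continuous_pi fun i => ?_
    fin_cases i <;> simp <;> fun_prop
  have hm : MeasurableSet (coord3 ⁻¹' refTet) := coord3.measurable isClosed_refTet.measurableSet
  have hmem (p : ℝ × ℝ) (u : ℝ) : (p, u) ∈ coord3 ⁻¹' refTet ↔
      p ∈ refTri ∧ u ∈ Set.Icc 0 (1 - p.1 - p.2) := by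
    simp only [Set.mem_preimage, coord3_apply, refTet, Set.mem_ofPred_eq, Fin.forall_fin_succ,
      refTri, Set.mem_Icc]
    simp
    constructor
    · rintro ⟨⟨h1, h2, h3⟩, h4⟩
      exact ⟨⟨h1, h2, by linarith⟩, h3, by linarith⟩
    · rintro ⟨⟨h1, h2, h3⟩, h4, h5⟩
      exact ⟨⟨h1, h2, h4⟩, by linarith⟩
  have hsub : coord3 ⁻¹' refTet ⊆ Set.Icc ((0, 0), 0) ((1, 1), 1) := by
    rintro ⟨p, u⟩ hp
    obtain ⟨⟨h1, h2, h3⟩, h4, h5⟩ := (hmem p u).1 hp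
    exact ⟨⟨⟨h1, h2⟩, h4⟩, ⟨⟨by simpa using by linarith, by simpa using by linarith⟩,
      by simpa using by linarith⟩⟩
  simp only [coord3_apply]
  rw [← integral_indicator hm, volume_eq_prod, integral_prod,
    ← integral_indicator isClosed_refTri.measurableSet]
  · congr 1 with p
    by_cases hp : p ∈ refTri
    · rw [indicator_of_mem hp, intervalIntegral.integral_of_le (by linarith [hp.2.2]),
        ← integral_Icc_eq_integral_Ioc, ← integral_indicator measurableSet_Icc]
      congr 1 with t
      by_cases ht : t ∈ Set.Icc 0 (1 - p.1 - p.2)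
      · rw [indicator_of_mem ht, indicator_of_mem ((hmem p t).2 ⟨hp, ht⟩)]
      · rw [indicator_of_notMem ht, indicator_of_notMem]
        exact fun h => ht ((hmem p t).1 h).2
    · rw [indicator_of_notMem hp]
      convert integral_zero ℝ ℝ with t
      rw [indicator_of_notMem]
      exact fun h => hp ((hmem p t).1 h).1
  · rw [← volume_eq_prod, integrable_indicator_iff hm]
    exact (hcont.continuousOn.integrableOn_compact isCompact_Icc).mono_set hsub

theorem IsTet.tetLin_injective (h : IsTet K a b c d) : Function.Injective (tetLin a b c d) := by
  rw [injective_iff_map_eq_zero]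
  intro y hy
  have := Fintype.linearIndependent_iff.1 h.linearIndependent (fun i => y i) (by
    simpa [Fin.sum_univ_three, tetLin_apply] using hy)
  ext i
  exact this i

theorem integral_tet (h : IsTet K a b c d) : ∃ J : ℝ, 0 < J ∧ ∀ g : E3 → ℝ, Continuous g →
    ∫ x in hull K, g x = J * ∫ p in refTri, ∫ u in (0 : ℝ)..(1 - p.1 - p.2),
      g (triMap a b c p + u • (d - a)) := by
  refine ⟨|(tetLin a b c d).det|, abs_pos.2 ?_, fun g hg => ?_⟩
  · exact ((LinearEquiv.ofInjectiveEndo (tetLin a b c d).toLinearMap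
      h.tetLin_injective).isUnit_det').ne_zero
  · rw [h.eq, ← tetMap_image, integral_image_eq_integral_abs_det_fderiv_smul volume
      isClosed_refTet.measurableSet
      (fun y _ => ((tetLin a b c d).hasFDerivAt.const_add a).hasFDerivWithinAt)
      (fun y _ z _ hyz => h.tetLin_injective (by simpa using hyz))]
    simp only [smul_eq_mul, integral_const_mul]
    rw [integral_refTet (H := fun y => g (a + tetLin a b c d y)) (by fun_prop)]
    congr 3 with p
    congr 1 with u
    congr 1
    simp [tetLin_apply, triMap]
    module

theorem integral_refTri_one_sub : ∫ p in refTri, (1 - p.1 - p.2) = 1 / 6 := by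
  rw [← integral_refTri (F := fun p => 1 - p.1 - p.2) (by fun_prop)]
  have (s : ℝ) : ∫ t in (0 : ℝ)..(1 - s), (1 - s - t) = (1 - s) ^ 2 / 2 := by
    rw [intervalIntegral.integral_comp_sub_left (fun x => x)]
    simp
  simp only [this]
  rw [intervalIntegral.integral_comp_sub_left (fun x => x ^ 2 / 2)]
  simp
  norm_num

theorem integral_tet_fderiv (h : IsTet K a b c d) {F : E3 → ℝ} (hF : ContDiff ℝ 1 F) :
    ∫ x in hull K, fderiv ℝ F x (d - a) =
      3 * volume.real (hull K) * (faceMean b c d F - faceMean a b c F) := by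
  obtain ⟨J, hJ, H⟩ := integral_tet h
  have h1 := H (fun _ => 1) continuous_const
  simp only [integral_const, intervalIntegral.integral_const, sub_zero, smul_eq_mul, mul_one,
    integral_refTri_one_sub, measureReal_restrict_apply_univ] at h1
  have hc := continuous_fderiv_apply hF (d - a)
  have h0 := hF.continuous
  rw [H _ hc, ← faceMean_rev b c d, faceMean_swap h0 d b c, faceMean_eq h0, faceMean_eq h0,
    ← mul_sub, ← integral_sub, ← mul_assoc, h1, show 3 * (J * (1 / 6)) * 2 = J by ring]
  · congr 2 with p
    rw [intervalIntegral.integral_eq_sub_of_hasDerivAt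
      (fun t _ => fderiv_comp_line hF (triMap a b c p) (d - a) t)
      (Continuous.intervalIntegrable (by fun_prop) _ _)]
    congr 2
    · unfold triMap; module
    · module
  · exact integrableOn_refTri (by fun_prop)
  · exact integrableOn_refTri (by fun_prop)

theorem IsTet.volume_pos (h : IsTet K a b c d) : 0 < volume.real (hull K) := by
  obtain ⟨J, hJ, H⟩ := integral_tet h
  have h1 := H (fun _ => 1) continuous_const
  simp only [integral_const, intervalIntegral.integral_const, sub_zero, smul_eq_mul, mul_one,
    integral_refTri_one_sub, measureReal_restrict_apply_univ] at h1
  rw [h1]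
  positivity

/-! ### Differential operators and the divergence theorem -/

/-- Classical gradient. -/
def gradF (ψ : E3 → ℝ) (x : E3) : E3 := toLp 2 fun i => partialD i ψ x

/-- Classical divergence. -/
def divF (u : E3 → E3) (x : E3) : ℝ := ∑ i, partialD i (fun y => u y i) x

theorem single_sum (h : E3) : ∑ i, h i • single i (1 : ℝ) = h := by
  ext j
  simp [Pi.single_apply]

theorem fderiv_eq_sum (ψ : E3 → ℝ) (x h : E3) : fderiv ℝ ψ x h = ∑ i, h i * partialD i ψ x := by
  conv_lhs => rw [← single_sum h]
  simp [partialD]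

theorem inner_gradF (ψ : E3 → ℝ) (x h : E3) : inner ℝ (gradF ψ x) h = fderiv ℝ ψ x h := by
  rw [fderiv_eq_sum, PiLp.inner_apply]
  simp [gradF, mul_comm]

theorem contDiff_coord {n : WithTop ℕ∞} {u : E3 → E3} (hu : ContDiff ℝ n u) (i : Fin 3) :
    ContDiff ℝ n fun y => u y i := (contDiff_euclidean.1 hu) i

theorem partialD_inner {u : E3 → E3} (hu : ContDiff ℝ 1 u) (g x : E3) (i : Fin 3) :
    partialD i (fun y => inner ℝ (u y) g) x = ∑ j, g j * partialD i (fun y => u y j) x := by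
  have h : (fun y => inner ℝ (u y) g) = fun y => ∑ j, g j * u y j := by
    ext y; rw [PiLp.inner_apply]; simp
  have hd (j : Fin 3) : DifferentiableAt ℝ (fun y => u y j) x :=
    ((contDiff_coord hu j).differentiable one_ne_zero).differentiableAt
  rw [h]
  unfold partialD
  rw [fderiv_fun_sum fun j _ => (hd j).const_mul _]
  simp [fderiv_const_mul (hd _)]

theorem IsTet.divF_eq (h : IsTet K a b c d) {u : E3 → E3} (hu : ContDiff ℝ 1 u) (x : E3) :
    divF u x = fderiv ℝ (fun y => inner ℝ (u y) (baryGrad a c d b)) x (b - a) +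
      fderiv ℝ (fun y => inner ℝ (u y) (baryGrad a d b c)) x (c - a) +
      fderiv ℝ (fun y => inner ℝ (u y) (baryGrad a b c d)) x (d - a) := by
  have key (i j : Fin 3) : (if j = i then (1 : ℝ) else 0) = baryGrad a c d b j * (b i - a i) +
      baryGrad a d b c j * (c i - a i) + baryGrad a b c d j * (d i - a i) := by
    have := congrArg (fun v : E3 => v i) (h.decomp (single j 1))
    simp only [PiLp.add_apply, PiLp.smul_apply, PiLp.sub_apply, smul_eq_mul,
      EuclideanSpace.inner_single_right, one_mul, conj_trivial] at this
    rw [← this]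
    simp [eq_comm]
  simp only [fderiv_eq_sum, partialD_inner hu, ← sum_add_distrib, Finset.mul_sum, divF]
  refine Finset.sum_congr rfl fun i _ => ?_
  have : partialD i (fun y => u y i) x =
      ∑ j, (if j = i then (1 : ℝ) else 0) * partialD i (fun y => u y j) x := by simp
  rw [this]
  refine Finset.sum_congr rfl fun j _ => ?_
  rw [key]
  simp only [PiLp.sub_apply]
  ring

theorem contDiff_inner_const {n : WithTop ℕ∞} {u : E3 → E3} (hu : ContDiff ℝ n u) (g : E3) :
    ContDiff ℝ n fun y => inner ℝ (u y) g := hu.inner ℝ contDiff_const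

theorem IsTet.isCompact (_h : IsTet K a b c d) : IsCompact (hull K) :=
  K.finite_toSet.isCompact_convexHull ℝ

theorem IsTet.integral_divF (h : IsTet K a b c d) {u : E3 → E3} (hu : ContDiff ℝ 1 u) :
    ∫ x in hull K, divF u x =
      -(3 * volume.real (hull K) *
        (faceMean a b c (fun x => inner ℝ (u x) (baryGrad a b c d)) +
          faceMean a c d (fun x => inner ℝ (u x) (baryGrad a c d b)) +
          faceMean a d b (fun x => inner ℝ (u x) (baryGrad a d b c)) +
          faceMean b c d (fun x => inner ℝ (u x) (baryGrad b c d a)))) := by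
  have hi (g e : E3) : IntegrableOn (fun x => fderiv ℝ (fun y => inner ℝ (u y) g) x e) (hull K) :=
    (continuous_fderiv_apply (contDiff_inner_const hu g) e).continuousOn.integrableOn_compact
      h.isCompact
  have hc (g : E3) : Continuous fun y => inner ℝ (u y) g := (contDiff_inner_const hu g).continuous
  simp only [h.divF_eq hu]
  have hi2 (g e g' e' : E3) : IntegrableOn (fun x => fderiv ℝ (fun y => inner ℝ (u y) g) x e +
      fderiv ℝ (fun y => inner ℝ (u y) g') x e') (hull K) :=
    (hi g e).add (hi g' e')
  rw [integral_add (hi2 _ _ _ _) (hi _ _), integral_add (hi _ _) (hi _ _),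
    integral_tet_fderiv h (contDiff_inner_const hu _),
    integral_tet_fderiv h.oppB (contDiff_inner_const hu _),
    integral_tet_fderiv h.oppC (contDiff_inner_const hu _)]
  have e1 : ∀ f : E3 → ℝ, Continuous f → faceMean c d b f = faceMean b c d f := fun f hf => by
    rw [← faceMean_rev, faceMean_swap hf]
  have e2 : ∀ f : E3 → ℝ, Continuous f → faceMean d b c f = faceMean b c d f := fun f hf => by
    rw [faceMean_swap hf, faceMean_rev]
  have e3 : faceMean b c d (fun x => inner ℝ (u x) (baryGrad b c d a)) =
      -(faceMean b c d (fun x => inner ℝ (u x) (baryGrad a c d b)) +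
      faceMean b c d (fun x => inner ℝ (u x) (baryGrad a d b c)) +
      faceMean b c d (fun x => inner ℝ (u x) (baryGrad a b c d))) := by
    have h0 := hu.continuous
    rw [← faceMean_add (hc _) (hc _), ← faceMean_add (by fun_prop) (hc _),
      h.baryGrad_add, neg_eq_neg_one_mul, ← faceMean_const_mul]
    congr 1 with x
    rw [inner_neg_right, inner_add_right, inner_add_right]
    ring
  rw [e1 _ (hc _), e2 _ (hc _), e3]
  ring

/-! ### Integration by parts on simplices -/

/-- The polynomial `γ · v`. -/
def dotC (γ : E3) (v : VPoly) : Poly := ∑ i, γ i • v i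

/-- The derivative of a polynomial in the direction `h`. -/
def dirP (h : E3) (q : Poly) : Poly := ∑ i, h i • pderiv i q

/-- The barycentric coordinate of `d` in the tetrahedron `a b c d`. -/
def baryP (a b c d : E3) : Poly := ∑ i, baryGrad a b c d i • (X i - C (a i))

theorem evalP_dotC (γ : E3) (v : VPoly) (x : E3) : evalP (dotC γ v) x = inner ℝ (evalV v x) γ := by
  simp [dotC, PiLp.inner_apply]

theorem evalP_dirP (h : E3) (q : Poly) (x : E3) : evalP (dirP h q) x = fderiv ℝ (evalP q) x h := by
  simp [dirP, fderiv_evalP, mul_comm]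

theorem evalP_baryP (x : E3) : evalP (baryP a b c d) x = inner ℝ (baryGrad a b c d) (x - a) := by
  simp [baryP, PiLp.inner_apply, mul_comm]

theorem dotC_mem (γ : E3) (hv : v ∈ vpolyLE m) : dotC γ v ∈ polyLE m :=
  Submodule.sum_mem _ fun i _ => Submodule.smul_mem _ _ (mem_vpolyLE.1 hv i)

theorem dirP_mem (h : E3) {q : Poly} (hq : q ∈ polyLE m) : dirP h q ∈ polyLE (m - 1) :=
  Submodule.sum_mem _ fun i _ => Submodule.smul_mem _ _ (pderiv_mem_polyLE hq i)

theorem baryP_mem : baryP a b c d ∈ polyLE 1 :=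
  Submodule.sum_mem _ fun i _ => Submodule.smul_mem _ _
    (sub_mem (X_mem_polyLE le_rfl i) (C_mem_polyLE zero_le_one _))

theorem fderiv_mul_evalP {ψ : E3 → ℝ} (hψ : ContDiff ℝ 1 ψ) (q : Poly) (x h : E3) :
    fderiv ℝ (fun y => ψ y * evalP q y) x h =
      fderiv ℝ ψ x h * evalP q x + ψ x * evalP (dirP h q) x := by
  rw [fderiv_fun_mul (hψ.differentiable one_ne_zero).differentiableAt
    ((contDiff_evalP q).differentiable (by simp)).differentiableAt]
  simp [evalP_dirP]
  ring

theorem contDiff_mul_evalP {ψ : E3 → ℝ} (hψ : ContDiff ℝ 1 ψ) (q : Poly) :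
    ContDiff ℝ 1 fun y => ψ y * evalP q y := hψ.mul ((contDiff_evalP q).of_le (by simp))

theorem continuous_partialD {ψ : E3 → ℝ} (hψ : ContDiff ℝ 1 ψ) (i : Fin 3) :
    Continuous (partialD i ψ) := continuous_fderiv_apply hψ _

theorem continuous_gradF {ψ : E3 → ℝ} (hψ : ContDiff ℝ 1 ψ) : Continuous (gradF ψ) :=
  (PiLp.continuous_toLp 2 _).comp (continuous_pi fun i => continuous_partialD hψ i)

theorem continuous_curlF {φ : E3 → E3} (hφ : ContDiff ℝ 1 φ) : Continuous (curlF φ) := by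
  refine (PiLp.continuous_toLp 2 _).comp (continuous_pi fun i => ?_)
  have h (i j) : Continuous (partialD i fun y => φ y j) := continuous_partialD (contDiff_coord hφ j) i
  fin_cases i <;> exact (h _ _).sub (h _ _)

theorem continuous_divF {φ : E3 → E3} (hφ : ContDiff ℝ 1 φ) : Continuous (divF φ) :=
  continuous_finsetSum _ fun i _ => continuous_partialD (contDiff_coord hφ i) i

theorem edgeMean_gradF {ψ : E3 → ℝ} (hψ : ContDiff ℝ 1 ψ) (a b : E3) (q : Poly) :
    edgeMean a b (fun x => inner ℝ (gradF ψ x) (b - a) * evalP q x) =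
      ψ b * evalP q b - ψ a * evalP q a -
        edgeMean a b (fun x => ψ x * evalP (dirP (b - a) q) x) := by
  have h := edgeMean_fderiv (contDiff_mul_evalP hψ q) a b
  have h1 := hψ.continuous
  have h2 := continuous_fderiv_apply hψ (b - a)
  simp only [fderiv_mul_evalP hψ] at h
  rw [edgeMean_add (by fun_prop) (by fun_prop)] at h
  simp only [inner_gradF]
  linarith

theorem faceMean_gradF (h : IsTet K a b c d) {ψ : E3 → ℝ} (hψ : ContDiff ℝ 1 ψ)
    (hv : ∀ x ∈ convexHull ℝ {a, b, c}, inner ℝ (evalV v x) (triNormal a b c) = 0) :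
    faceMean a b c (fun x => inner ℝ (gradF ψ x) (evalV v x)) =
    2 * (edgeMean b c (fun x => ψ x * evalP (dotC (baryGrad a c d b) v) x) -
    edgeMean a c (fun x => ψ x * evalP (dotC (baryGrad a c d b) v) x)) + 2 *
    (edgeMean b c (fun x => ψ x * evalP (dotC (baryGrad a d b c) v) x) - edgeMean a b
    (fun x => ψ x * evalP (dotC (baryGrad a d b c) v) x)) - faceMean a b c (fun x => ψ x * evalP
    (dirP (b - a) (dotC (baryGrad a c d b) v) + dirP (c - a) (dotC (baryGrad a d b c) v)) x) := by
  have h1 := hψ.continuous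
  have h2 := continuous_fderiv_apply hψ (b - a)
  have h3 := continuous_fderiv_apply hψ (c - a)
  have e : faceMean a b c (fun x => inner ℝ (gradF ψ x) (evalV v x)) =
      faceMean a b c (fun x => fderiv ℝ ψ x (b - a) * evalP (dotC (baryGrad a c d b) v) x +
        fderiv ℝ ψ x (c - a) * evalP (dotC (baryGrad a d b c) v) x) := by
    refine faceMean_congr fun x hx => ?_
    have h4 : inner ℝ (baryGrad a b c d) (evalV v x) = 0 := by
      rw [baryGrad, inner_smul_left, real_inner_comm, hv x hx, mul_zero]
    have h5 := h.decomp (evalV v x)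
    rw [h4, zero_smul, add_zero] at h5
    conv_lhs => rw [h5]
    rw [inner_add_right, inner_smul_right, inner_smul_right, inner_gradF, inner_gradF,
      evalP_dotC, evalP_dotC, real_inner_comm (evalV v x), real_inner_comm (evalV v x)]
    ring
  have g1 := faceMean_fderiv' (contDiff_mul_evalP hψ (dotC (baryGrad a c d b) v)) a b c
  have g2 := faceMean_fderiv (contDiff_mul_evalP hψ (dotC (baryGrad a d b c) v)) a b c
  simp only [fderiv_mul_evalP hψ] at g1 g2
  rw [faceMean_add (by fun_prop) (by fun_prop)] at g1 g2
  simp only [evalP_add, mul_add]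
  rw [e, faceMean_add (by fun_prop) (by fun_prop), faceMean_add (by fun_prop) (by fun_prop)]
  linarith

theorem IsTet.integrableOn (h : IsTet K a b c d) {f : E3 → ℝ} (hf : Continuous f) :
    IntegrableOn f (hull K) :=
  hf.continuousOn.integrableOn_compact h.isCompact

/-- The sum of the fluxes of a field through the faces, with a common scaling. -/
def IsTet.flux (_h : IsTet K a b c d) (u : E3 → E3) : ℝ :=
  faceMean a b c (fun x => inner ℝ (u x) (baryGrad a b c d)) +
    faceMean a c d (fun x => inner ℝ (u x) (baryGrad a c d b)) +
    faceMean a d b (fun x => inner ℝ (u x) (baryGrad a d b c)) +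
    faceMean b c d (fun x => inner ℝ (u x) (baryGrad b c d a))

theorem partialD_mul {f g : E3 → ℝ} (hf : ContDiff ℝ 1 f) (hg : ContDiff ℝ 1 g) (i : Fin 3) (x : E3) :
    partialD i (fun y => f y * g y) x = partialD i f x * g x + f x * partialD i g x := by
  unfold partialD
  rw [fderiv_fun_mul (hf.differentiable one_ne_zero).differentiableAt
    (hg.differentiable one_ne_zero).differentiableAt]
  simp
  ring

theorem partialD_sub {f g : E3 → ℝ} (hf : ContDiff ℝ 1 f) (hg : ContDiff ℝ 1 g) (i : Fin 3) (x : E3) :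
    partialD i (fun y => f y - g y) x = partialD i f x - partialD i g x := by
  unfold partialD
  rw [fderiv_fun_sub (hf.differentiable one_ne_zero).differentiableAt
    (hg.differentiable one_ne_zero).differentiableAt]
  simp

theorem contDiff_one_evalP (p : Poly) : ContDiff ℝ 1 (evalP p) := (contDiff_evalP p).of_le (by simp)

theorem integral_gradF (h : IsTet K a b c d) {ψ : E3 → ℝ} (hψ : ContDiff ℝ 1 ψ) (v : VPoly) :
    ∫ x in hull K, inner ℝ (gradF ψ x) (evalV v x) =
      -(3 * volume.real (hull K) * h.flux fun x => ψ x • evalV v x) -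
        ∫ x in hull K, ψ x * evalP (divP v) x := by
  have hu : ContDiff ℝ 1 fun x => ψ x • evalV v x := hψ.smul ((contDiff_evalV v).of_le (by simp))
  have h1 := h.integral_divF hu
  have h2 (x : E3) : divF (fun x => ψ x • evalV v x) x =
      inner ℝ (gradF ψ x) (evalV v x) + ψ x * evalP (divP v) x := by
    simp only [divF, PiLp.smul_apply, smul_eq_mul, evalV_apply,
      partialD_mul hψ (contDiff_one_evalP _), partialD_evalP, sum_add_distrib, divP,
      evalP_sum, Finset.mul_sum]
    simp [PiLp.inner_apply, gradF, mul_comm]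
  have hc := continuous_gradF hψ
  have hc' := hψ.continuous
  simp only [h2] at h1
  rw [integral_add (h.integrableOn (by fun_prop)) (h.integrableOn (by fun_prop))] at h1
  rw [IsTet.flux]
  linarith

theorem integral_divF_mul (h : IsTet K a b c d) {u : E3 → E3} (hu : ContDiff ℝ 1 u) (q : Poly) :
    ∫ x in hull K, divF u x * evalP q x =
      -(3 * volume.real (hull K) * h.flux fun x => evalP q x • u x) -
        ∫ x in hull K, inner ℝ (u x) (evalV (gradP q) x) := by
  have hu' : ContDiff ℝ 1 fun x => evalP q x • u x := (contDiff_one_evalP q).smul hu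
  have h1 := h.integral_divF hu'
  have h2 (x : E3) : divF (fun x => evalP q x • u x) x =
      divF u x * evalP q x + inner ℝ (u x) (evalV (gradP q) x) := by
    simp only [divF, PiLp.smul_apply, smul_eq_mul,
      partialD_mul (contDiff_one_evalP _) (contDiff_coord hu _), partialD_evalP,
      sum_add_distrib, Finset.sum_mul, PiLp.inner_apply, evalV_apply, gradP_apply]
    rw [add_comm]
    congr 1
    exact Finset.sum_congr rfl fun i _ => mul_comm _ _
  have hc := continuous_divF hu
  have hc' := hu.continuous
  simp only [h2] at h1
  rw [integral_add (h.integrableOn (by fun_prop)) (h.integrableOn (by fun_prop))] at h1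
  rw [IsTet.flux]
  linarith

/-- The cross product on `E3`. -/
def crossE (u v : E3) : E3 :=
  !₂[u 1 * v 2 - u 2 * v 1, u 2 * v 0 - u 0 * v 2, u 0 * v 1 - u 1 * v 0]

/-- The cross product of a polynomial field with a constant one. -/
def crossP (v : VPoly) (γ : E3) : VPoly :=
  ![γ 2 • v 1 - γ 1 • v 2, γ 0 • v 2 - γ 2 • v 0, γ 1 • v 0 - γ 0 • v 1]

theorem evalV_crossP (v : VPoly) (γ x : E3) : evalV (crossP v γ) x = crossE (evalV v x) γ := by
  ext i
  fin_cases i <;> simp [crossP, crossE] <;> ring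

theorem crossP_mem (hv : v ∈ vpolyLE m) (γ : E3) : crossP v γ ∈ vpolyLE m := by
  rw [mem_vpolyLE] at *
  have h (i : Fin 3) (r : ℝ) := Submodule.smul_mem _ r (hv i)
  intro i
  fin_cases i
  exacts [sub_mem (h _ _) (h _ _), sub_mem (h _ _) (h _ _), sub_mem (h _ _) (h _ _)]

theorem integral_curlF (h : IsTet K a b c d) {φ : E3 → E3} (hφ : ContDiff ℝ 1 φ) (v : VPoly) :
    ∫ x in hull K, inner ℝ (curlF φ x) (evalV v x) =
      -(3 * volume.real (hull K) * h.flux fun x => crossE (φ x) (evalV v x)) +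
        ∫ x in hull K, inner ℝ (φ x) (evalV (curlP v) x) := by
  have hm (i j) : ContDiff ℝ 1 fun x => φ x i * evalP (v j) x :=
    (contDiff_coord hφ i).mul (contDiff_one_evalP _)
  have hu : ContDiff ℝ 1 fun x => crossE (φ x) (evalV v x) := by
    rw [contDiff_euclidean]
    intro i
    fin_cases i <;> exact (hm _ _).sub (hm _ _)
  have h1 := h.integral_divF hu
  have hp (i j k) (x : E3) : partialD k (fun x => φ x i * evalP (v j) x) x = _ :=
    partialD_mul (contDiff_coord hφ i) (contDiff_one_evalP (v j)) k x
  have h2 (x : E3) : divF (fun x => crossE (φ x) (evalV v x)) x =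
      inner ℝ (curlF φ x) (evalV v x) - inner ℝ (φ x) (evalV (curlP v) x) := by
    simp only [divF, crossE, Fin.sum_univ_three, inner_E3, evalV_apply, cons_val_zero,
      cons_val_one, cons_val, partialD_sub (hm _ _) (hm _ _), hp, partialD_evalP,
      curlF, curlP, evalP_sub]
    ring
  have hc := continuous_curlF hφ
  have hc' := hφ.continuous
  simp only [h2] at h1
  rw [integral_sub (h.integrableOn (by fun_prop)) (h.integrableOn (by fun_prop))] at h1
  rw [IsTet.flux]
  linarith

theorem inner_curlF_triNormal {φ : E3 → E3} (hφ : ContDiff ℝ 1 φ) (x : E3) :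
    inner ℝ (curlF φ x) (triNormal a b c) = fderiv ℝ (fun y => inner ℝ (φ y) (c - a)) x (b - a) -
        fderiv ℝ (fun y => inner ℝ (φ y) (b - a)) x (c - a) := by
  rw [fderiv_eq_sum, fderiv_eq_sum]
  simp only [partialD_inner hφ]
  simp only [Fin.sum_univ_three, inner_E3, triNormal_apply, curlF, cons_val_zero, cons_val_one, cons_val, PiLp.sub_apply]
  ring

/-- The tangential test field that appears in Stokes' theorem on the triangle `a b c`. -/
def stokesField (a b c : E3) (q : Poly) : VPoly := fun i =>
  (c i - a i) • dirP (b - a) q - (b i - a i) • dirP (c - a) q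

theorem evalV_stokesField (q : Poly) (x : E3) : evalV (stokesField a b c q) x =
    evalP (dirP (b - a) q) x • (c - a) - evalP (dirP (c - a) q) x • (b - a) := by
  ext i
  simp [stokesField, mul_comm]

theorem stokesField_mem {q : Poly} (hq : q ∈ polyLE m) : stokesField a b c q ∈ vpolyLE (m - 1) :=
  mem_vpolyLE.2 fun _ => sub_mem (Submodule.smul_mem _ _ (dirP_mem _ hq))
    (Submodule.smul_mem _ _ (dirP_mem _ hq))

theorem inner_stokesField (q : Poly) (x : E3) :
    inner ℝ (evalV (stokesField a b c q) x) (triNormal a b c) = 0 := by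
  rw [evalV_stokesField, inner_E3, triNormal_apply]
  simp
  ring

theorem faceMean_curlF {φ : E3 → E3} (hφ : ContDiff ℝ 1 φ) (a b c : E3) (q : Poly) :
    faceMean a b c (fun x => inner ℝ (curlF φ x) (triNormal a b c) * evalP q x) =
      2 * (edgeMean b c (fun x => inner ℝ (φ x) (c - b) * evalP q x) -
        edgeMean a c (fun x => inner ℝ (φ x) (c - a) * evalP q x) +
        edgeMean a b (fun x => inner ℝ (φ x) (b - a) * evalP q x)) -
      faceMean a b c (fun x => inner ℝ (φ x) (evalV (stokesField a b c q) x)) := by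
  have hb := contDiff_inner_const hφ (b - a)
  have hc := contDiff_inner_const hφ (c - a)
  have g1 := faceMean_fderiv' (contDiff_mul_evalP hc q) a b c
  have g2 := faceMean_fderiv (contDiff_mul_evalP hb q) a b c
  simp only [fderiv_mul_evalP hc, fderiv_mul_evalP hb] at g1 g2
  have c1 := continuous_fderiv_apply hc (b - a)
  have c2 := continuous_fderiv_apply hb (c - a)
  have c3 := hφ.continuous
  rw [faceMean_add (by fun_prop) (by fun_prop)] at g1 g2
  have e2 (x : E3) : inner ℝ (φ x) (evalV (stokesField a b c q) x) =
      inner ℝ (φ x) (c - a) * evalP (dirP (b - a) q) x -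
        inner ℝ (φ x) (b - a) * evalP (dirP (c - a) q) x := by
    rw [evalV_stokesField, inner_sub_right, inner_smul_right, inner_smul_right]
    ring
  simp only [inner_curlF_triNormal hφ, e2, sub_mul]
  rw [faceMean_sub (by fun_prop) (by fun_prop), faceMean_sub (by fun_prop) (by fun_prop)]
  have e1 : edgeMean b c (fun x => inner ℝ (φ x) (c - b) * evalP q x) =
      edgeMean b c (fun x => inner ℝ (φ x) (c - a) * evalP q x) -
      edgeMean b c (fun x => inner ℝ (φ x) (b - a) * evalP q x) := by
    rw [← edgeMean_sub (by fun_prop) (by fun_prop)]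
    congr 1 with x
    rw [← sub_mul, ← inner_sub_right, sub_sub_sub_cancel_right]
  linarith

/-! ### Convergence of degrees of freedom is inherited by derivatives -/

section Commuting

variable {ι : Type*} {l : Filter ι}

theorem IsTet.tendsto_flux (h : IsTet K a b c d) {u : ι → E3 → E3} {w : E3 → E3}
    (H : ∀ p q r s, IsTet K p q r s → Tendsto
      (fun n => faceMean p q r (fun x => inner ℝ (u n x) (baryGrad p q r s))) l
      (𝓝 (faceMean p q r (fun x => inner ℝ (w x) (baryGrad p q r s))))) :
    Tendsto (fun n => h.flux (u n)) l (𝓝 (h.flux w)) :=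
  (((H _ _ _ _ h).add (H _ _ _ _ h.oppB)).add (H _ _ _ _ h.oppC)).add (H _ _ _ _ h.oppA)

theorem IsTet.tendsto_average_iff (h : IsTet K a b c d) {f : ι → E3 → ℝ} {g : E3 → ℝ} :
    Tendsto (fun n => ⨍ x in hull K, f n x) l (𝓝 (⨍ x in hull K, g x)) ↔
    Tendsto (fun n => ∫ x in hull K, f n x) l (𝓝 (∫ x in hull K, g x)) := by
  have hv := h.volume_pos.ne'
  simp only [setAverage_eq, smul_eq_mul]
  constructor
  · intro H
    have := H.const_mul (volume.real (hull K))
    simpa only [mul_inv_cancel_left₀ hv] using this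
  · exact fun H => H.const_mul _

theorem tendsto_nedelecDofs_gradF (h : IsTet K a b c d) {m : ℕ} {ψ : ι → E3 → ℝ} {w : E3 → ℝ}
    (hψ : ∀ n, ContDiff ℝ 1 (ψ n)) (hw : ContDiff ℝ 1 w)
    (H : ∀ L ∈ lagrangeDofs m (K : Set E3), Tendsto (fun n => L (ψ n)) l (𝓝 (L w))) :
    ∀ L ∈ nedelecDofs m (K : Set E3), Tendsto (fun n => L (gradF (ψ n))) l (𝓝 (L (gradF w))) := by
  have HV (v) (hv : v ∈ (K : Set E3)) : Tendsto (fun n => ψ n v) l (𝓝 (w v)) :=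
    H _ (Or.inl (Or.inl ⟨v, hv, rfl⟩))
  have HE (p q) (hp : p ∈ (K : Set E3)) (hq : q ∈ (K : Set E3)) (hpq : p ≠ q) (g : Poly)
      (hg : g ∈ polyLE ((m : ℤ) - 2)) : Tendsto (fun n => edgeMean p q fun x => ψ n x * evalP g x) l
      (𝓝 (edgeMean p q fun x => w x * evalP g x)) :=
    H _ (Or.inl (Or.inr ⟨p, hp, q, hq, hpq, g, hg, rfl⟩))
  rintro L (⟨p, hp, q, hq, hpq, g, hg, rfl⟩ | ⟨p, hp, q, hq, s, hs, hpq, hps, hqs, v, hv, hv', rfl⟩)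
  · simp only [edgeMean_gradF (hψ _), edgeMean_gradF hw]
    refine (((HV _ hq).mul_const _).sub ((HV _ hp).mul_const _)).sub (HE _ _ hp hq hpq _ ?_)
    have := dirP_mem (q - p) hg
    rwa [sub_sub] at this
  · obtain ⟨t, h'⟩ := h.exists_of_mem₃ hp hq hs hpq hps hqs
    simp only [faceMean_gradF h' (hψ _) hv', faceMean_gradF h' hw hv']
    refine (((HE _ _ hq hs hqs _ (dotC_mem _ hv)).sub (HE _ _ hp hs hps _ (dotC_mem _ hv))).const_mul
      2).add (((HE _ _ hq hs hqs _ (dotC_mem _ hv)).sub (HE _ _ hp hq hpq _ (dotC_mem _ hv))).const_mul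
      2) |>.sub (H _ (Or.inr ⟨p, hp, q, hq, s, hs, hpq, hps, hqs, _, ?_, rfl⟩))
    have h1 := dirP_mem (q - p) (dotC_mem (baryGrad p s t q) hv)
    have h2 := dirP_mem (s - p) (dotC_mem (baryGrad p t q s) hv)
    rw [sub_sub] at h1 h2
    exact add_mem h1 h2

theorem tendsto_interior_gradF (h : IsTet K a b c d) {m : ℕ} {ψ : ι → E3 → ℝ} {w : E3 → ℝ}
    (hψ : ∀ n, ContDiff ℝ 1 (ψ n)) (hw : ContDiff ℝ 1 w)
    (H : ∀ L ∈ lagrangeDofs m (K : Set E3) ∪ interiorDofs (polyLE ((m : ℤ) - 4)) K,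
      Tendsto (fun n => L (ψ n)) l (𝓝 (L w))) :
    ∀ L ∈ interiorVDofs (vpolyLE ((m : ℤ) - 3)) K,
      Tendsto (fun n => L (gradF (ψ n))) l (𝓝 (L (gradF w))) := by
  rintro L ⟨v, hv, rfl⟩
  simp only [integral_gradF h (hψ _), integral_gradF h hw]
  refine (Tendsto.neg (Tendsto.const_mul _ (h.tendsto_flux fun p q r s h' => ?_))).sub ?_
  · have e (f : E3 → ℝ) : (fun x => inner ℝ (f x • evalV v x) (baryGrad p q r s)) =
        fun x => f x * evalP (dotC (baryGrad p q r s) v) x := by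
      ext x
      rw [inner_smul_left, evalP_dotC]; rfl
    simp only [e]
    exact H _ (Or.inl (Or.inr ⟨p, h'.ma, q, h'.mb, r, h'.mc, h'.ab, h'.ac, h'.bc, _,
      dotC_mem _ hv, rfl⟩))
  · rw [← h.tendsto_average_iff]
    refine H _ (Or.inr ⟨_, ?_, rfl⟩)
    have := divP_mem_polyLE hv
    rwa [sub_sub] at this

theorem tendsto_fluxDofs_curlF {m : ℕ} {φ : ι → E3 → E3} {w : E3 → E3}
    (hφ : ∀ n, ContDiff ℝ 1 (φ n)) (hw : ContDiff ℝ 1 w)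
    (H : ∀ L ∈ nedelecDofs m (K : Set E3), Tendsto (fun n => L (φ n)) l (𝓝 (L w))) :
    ∀ L ∈ fluxDofs m (K : Set E3), Tendsto (fun n => L (curlF (φ n))) l (𝓝 (L (curlF w))) := by
  rintro L ⟨p, hp, q, hq, s, hs, hpq, hps, hqs, g, hg, rfl⟩
  have HE (p q) (hp : p ∈ (K : Set E3)) (hq : q ∈ (K : Set E3)) (hpq : p ≠ q) :
      Tendsto (fun n => edgeMean p q fun x => inner ℝ (φ n x) (q - p) * evalP g x) l
      (𝓝 (edgeMean p q fun x => inner ℝ (w x) (q - p) * evalP g x)) :=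
    H _ (Or.inl ⟨p, hp, q, hq, hpq, g, hg, rfl⟩)
  simp only [faceMean_curlF (hφ _), faceMean_curlF hw]
  refine Tendsto.const_mul _ ((Tendsto.const_mul _ (((HE _ _ hq hs hqs).sub
    (HE _ _ hp hs hps)).add (HE _ _ hp hq hpq))).sub
      (H _ (Or.inr ⟨p, hp, q, hq, s, hs, hpq, hps, hqs, _, ?_,
        fun x _ => inner_stokesField _ _, rfl⟩)))
  have := stokesField_mem (a := p) (b := q) (c := s) hg
  rwa [sub_sub] at this

theorem tendsto_interior_curlF (h : IsTet K a b c d) {m : ℕ} {φ : ι → E3 → E3} {w : E3 → E3}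
    (hφ : ∀ n, ContDiff ℝ 1 (φ n)) (hw : ContDiff ℝ 1 w)
    (H : ∀ L ∈ nedelecDofs m (K : Set E3) ∪ interiorVDofs (vpolyLE ((m : ℤ) - 3)) K,
      Tendsto (fun n => L (φ n)) l (𝓝 (L w))) :
    ∀ L ∈ interiorVDofs (vpolyLE ((m : ℤ) - 2)) K,
      Tendsto (fun n => L (curlF (φ n))) l (𝓝 (L (curlF w))) := by
  rintro L ⟨v, hv, rfl⟩
  simp only [integral_curlF h (hφ _), integral_curlF h hw]
  refine (Tendsto.neg (Tendsto.const_mul _ (h.tendsto_flux fun p q r s h' => ?_))).add ?_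
  · have e (f : E3 → E3) : (fun x => inner ℝ (crossE (f x) (evalV v x)) (baryGrad p q r s)) =
        fun x => inner ℝ (f x) (evalV (crossP v (baryGrad p q r s)) x) := by
      ext x
      rw [evalV_crossP]
      simp only [inner_E3, crossE, cons_val_zero, cons_val_one, cons_val]
      ring
    simp only [e]
    refine H _ (Or.inl (Or.inr ⟨p, h'.ma, q, h'.mb, r, h'.mc, h'.ab, h'.ac, h'.bc, _,
      crossP_mem hv _, fun x _ => ?_, rfl⟩))
    rw [evalV_crossP, inner_E3, baryGrad]
    simp only [crossE, cons_val_zero, cons_val_one, cons_val, PiLp.smul_apply, smul_eq_mul]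
    ring
  · refine H _ (Or.inr ⟨_, ?_, rfl⟩)
    have := curlP_mem_vpolyLE hv
    rwa [sub_sub] at this

theorem tendsto_interior_divF (h : IsTet K a b c d) {k : ℕ} (hr : 1 ≤ r) (hk : k ≤ r + 1)
    {C : Submodule ℝ VPoly} {u : ι → E3 → E3} {w : E3 → E3} (hu : ∀ n, ContDiff ℝ 1 (u n))
    (hw : ContDiff ℝ 1 w) (H : ∀ L ∈ fluxDofs r (K : Set E3) ∪ interiorVDofs (gradDivTests k C) K,
    Tendsto (fun n => L (u n)) l (𝓝 (L w))) : ∀ L ∈ interiorDofs (plusInteriorTests k) K,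
    Tendsto (fun n => L (divF (u n))) l (𝓝 (L (divF w))) := by
  rintro L ⟨q, hq, rfl⟩
  have hq1 : q ∈ polyLE ((r : ℤ) - 1) := by
    unfold plusInteriorTests at hq
    split_ifs at hq <;> exact polyLE_mono (by omega) hq
  have hq2 : gradP q ∈ gradDivTests k C := by
    unfold plusInteriorTests at hq
    split_ifs at hq
    · exact mem_sup_left ⟨q, hq, rfl⟩
    · convert Submodule.zero_mem _
      ext1 i
      have := pderiv_mem_polyLE hq i
      rw [polyLE, if_neg (by norm_num), Submodule.mem_bot] at this
      exact this
  rw [h.tendsto_average_iff]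
  simp only [integral_divF_mul h (hu _), integral_divF_mul h hw]
  refine (Tendsto.neg (Tendsto.const_mul _ (h.tendsto_flux fun p q' r s h' => ?_))).sub
    (H _ (Or.inr ⟨_, hq2, rfl⟩))
  have e (f : E3 → E3) : (fun x => inner ℝ (evalP q x • f x) (baryGrad p q' r s)) =
      fun x => (tetVol p q' r s)⁻¹ * (inner ℝ (f x) (triNormal p q' r) * evalP q x) := by
    ext x
    rw [inner_smul_left, baryGrad, inner_smul_right]
    simp only [conj_trivial]
    ring
  simp only [e, faceMean_const_mul]
  refine Tendsto.const_mul _ ?_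
  have := (H _ (Or.inl ⟨p, h'.ma, q', h'.mb, r, h'.mc, h'.ab, h'.ac, h'.bc, q, hq1, rfl⟩)).const_mul 2
  simpa only [← mul_assoc, mul_one_div_cancel (two_ne_zero' ℝ), one_mul] using this

end Commuting

theorem gradDivTests_le {k : ℕ} (hk : k ≤ r + 4) {C : Submodule ℝ VPoly}
    (hC : IsGradComplement r C) : gradDivTests k C ≤ vpolyLE ((r : ℤ) - 2) := by
  refine sup_le ?_ (hC.2 ▸ le_sup_right)
  rintro _ ⟨q, hq, rfl⟩
  rw [mem_vpolyLE]
  exact fun i => polyLE_mono (by omega) (mem_vpolyLE.1 (gradP_mem_vpolyLE hq) i)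

/-! ### Recovering a potential's degrees of freedom from those of its gradient -/

/-- Solution of `n E + (x - a) · ∇E = q`. -/
theorem exists_euler_eq (a : E3) {n : ℕ} (hn : 0 < n) {q : Poly} (hq : q ∈ polyLE m) :
    ∃ E ∈ polyLE m, ∀ x, n * evalP E x + fderiv ℝ (evalP E) x (x - a) = evalP q x := by
  set q' : Poly := aeval (fun i => X i + C (a i)) q with hq'
  set E : Poly := aeval (fun i => X i - C (a i)) (eulerInv n q') with hE
  have m1 (i : Fin 3) (r : ℝ) := C_mem_polyLE (m := 1) zero_le_one r
  have h1 : evalP E = fun x => evalP (eulerInv n q') (x - a) := by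
    ext x
    rw [hE, evalP_aeval]
    congr 1
    ext i; simp
  refine ⟨E, aeval_mem_polyLE (eulerInv_mem_polyLE n (aeval_mem_polyLE hq fun i =>
    add_mem (X_mem_polyLE le_rfl i) (m1 i _))) fun i => sub_mem (X_mem_polyLE le_rfl i) (m1 i _),
    fun x => ?_⟩
  have h2 : evalP q x = evalP q' (x - a) := by
    rw [hq', evalP_aeval]
    congr 1
    ext i; simp
  rw [h2, h1, fderiv_comp_sub, fderiv_evalP]
  conv_rhs => rw [← euler_eulerInv hn q']
  simp only [evalP_add, evalP_sum, evalP_mul, evalP_X, mul_comm]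
  rw [add_comm]
  congr 2
  simp [evalP]

theorem gradF_evalP (p : Poly) : gradF (evalP p) = evalV (gradP p) := by
  ext x i
  simp [gradF, partialD_evalP, gradP_apply]

theorem IsTet.baryP_edge (h : IsTet K a b c d) {x : E3} (hx : x ∈ segment ℝ a b) :
    x - a = evalP (baryP a c d b) x • (b - a) := by
  rw [segment_eq_image'] at hx
  obtain ⟨t, _, rfl⟩ := hx
  rw [evalP_baryP, add_sub_cancel_left, inner_smul_right, h.oppB.inner_self, mul_one]

theorem IsTet.baryP_face (h : IsTet K a b c d) {x : E3} (hx : x ∈ convexHull ℝ {a, b, c}) :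
    evalP (baryP a b c d) x = 0 := by
  have : convexHull ℝ {a, b, c} ⊆ {x | evalP (baryP a b c d) x = 0} := by
    refine convexHull_min ?_ ?_
    · rintro y (rfl | rfl | rfl)
      · simp [evalP_baryP]
      · simp [evalP_baryP, inner_baryGrad_left]
      · simp [evalP_baryP, inner_baryGrad_right]
    · intro x hx y hy s t hs ht hst
      simp only [Set.mem_ofPred_eq, evalP_baryP] at *
      have : s • x + t • y - a = s • (x - a) + t • (y - a) := by
        rw [smul_sub, smul_sub, sub_add_sub_comm, ← add_smul, hst, one_smul]
      rw [this, inner_add_right, inner_smul_right, inner_smul_right, hx, hy]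
      simp
  exact this hx

theorem evalP_dirP_baryP_mul (E : Poly) (x g : E3) : evalP (dirP g (baryP a b c d * E)) x =
      inner ℝ (baryGrad a b c d) g * evalP E x + evalP (baryP a b c d) x * fderiv ℝ (evalP E) x g := by
  have e1 : evalP (baryP a b c d * E) = fun z => evalP (baryP a b c d) z * evalP E z := by
    ext z; simp
  have e2 : fderiv ℝ (evalP (baryP a b c d)) x g = inner ℝ (baryGrad a b c d) g := by
    have e3 : evalP (baryP a b c d) = fun z => inner ℝ (z - a) (baryGrad a b c d) := by
      ext z; rw [evalP_baryP, real_inner_comm]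
    have hf := fderiv_inner_apply ℝ (f := fun z : E3 => z - a) (g := fun _ => baryGrad a b c d)
      (x := x) (by fun_prop) (by fun_prop) g
    rw [e3, hf]
    simp [fderiv_sub_const, real_inner_comm]
  rw [evalP_dirP, e1, fderiv_mul_evalP (contDiff_one_evalP _), e2, evalP_dirP]

theorem lagrangeDofs_eq_zero_of_gradP (h : IsTet K a b c d) {m : ℕ} (hm : 1 ≤ m)
    (ha : evalP p a = 0) (H : ∀ L ∈ nedelecDofs m (K : Set E3)
    ∪ interiorVDofs (vpolyLE ((m : ℤ) - 3)) K, L (evalV (gradP p)) = 0) :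
    ∀ L ∈ lagrangeDofs m (K : Set E3) ∪ interiorDofs (polyLE ((m : ℤ) - 4)) K, L (evalP p) = 0 := by
  have hp := contDiff_one_evalP p
  simp only [← gradF_evalP] at H
  have HE (x y) (hx : x ∈ (K : Set E3)) (hy : y ∈ (K : Set E3)) (hxy : x ≠ y) (Q : Poly)
      (hQ : Q ∈ polyLE ((m : ℤ) - 1)) : evalP p y * evalP Q y - evalP p x * evalP Q x =
        edgeMean x y (fun z => evalP p z * evalP (dirP (y - x) Q) z) := by
    have := H _ (Or.inl (Or.inl ⟨x, hx, y, hy, hxy, Q, hQ, rfl⟩))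
    rw [edgeMean_gradF hp] at this
    linarith
  have hV : ∀ v ∈ (K : Set E3), evalP p v = 0 := by
    intro v hv
    by_cases hav : a = v
    · rw [← hav, ha]
    · have := HE a v h.ma hv hav 1 (by simpa using C_mem_polyLE (by omega) 1)
      simpa [ha, dirP, edgeMean] using this
  have hE : ∀ x ∈ (K : Set E3), ∀ y ∈ (K : Set E3), x ≠ y → ∀ q ∈ polyLE ((m : ℤ) - 2),
      edgeMean x y (fun z => evalP p z * evalP q z) = 0 := by
    intro x hx y hy hxy q hq
    obtain ⟨s, t, h'⟩ := h.exists_of_mem₂ hx hy hxy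
    obtain ⟨E, hE, hEq⟩ := exists_euler_eq x one_pos hq
    have h2 := HE x y hx hy hxy (baryP x s t y * E) (by
      have := mul_mem_polyLE (baryP_mem (a := x) (b := s) (c := t) (d := y)) hE
      rwa [show (1 : ℤ) + (m - 2) = m - 1 by ring] at this)
    rw [hV x hx, hV y hy, zero_mul, zero_mul, sub_zero] at h2
    rw [h2]
    refine edgeMean_congr fun z hz => ?_
    rw [evalP_dirP_baryP_mul, h'.oppB.inner_self, ← hEq z]
    conv_lhs => rw [h'.baryP_edge hz]
    simp
  have hF : ∀ x ∈ (K : Set E3), ∀ y ∈ (K : Set E3), ∀ s ∈ (K : Set E3), x ≠ y → x ≠ s → y ≠ s →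
      ∀ q ∈ polyLE ((m : ℤ) - 3), faceMean x y s (fun z => evalP p z * evalP q z) = 0 := by
    intro x hx y hy s hs hxy hxs hys q hq
    obtain ⟨t, h'⟩ := h.exists_of_mem₃ hx hy hs hxy hxs hys
    obtain ⟨E, hEm, hEq⟩ := exists_euler_eq x two_pos hq
    set w : VPoly := fun i => (X i - C (x i)) * E with hw
    have hwe (z : E3) : evalV w z = evalP E z • (z - x) := by ext i; simp [hw, mul_comm]
    have hwm : w ∈ vpolyLE ((m : ℤ) - 2) := mem_vpolyLE.2 fun i => by
      have := mul_mem_polyLE (sub_mem (X_mem_polyLE le_rfl i) (C_mem_polyLE zero_le_one (x i))) hEm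
      rwa [show (1 : ℤ) + (m - 3) = m - 2 by ring] at this
    have hin {z : E3} (hz : z ∈ convexHull ℝ {x, y, s}) : inner ℝ (baryGrad x y s t) (z - x) = 0 := by
      rw [← evalP_baryP, h'.baryP_face hz]
    have hwt : ∀ z ∈ convexHull ℝ {x, y, s}, inner ℝ (evalV w z) (triNormal x y s) = 0 := by
      intro z hz
      have := hin hz
      rw [baryGrad, inner_smul_left] at this
      rw [hwe, inner_smul_left, real_inner_comm,
        (mul_eq_zero.1 this).resolve_left (by simpa using h'.vol), mul_zero]
    have hd (γ : E3) : dotC γ w = (∑ i, γ i • (X i - C (x i))) * E := by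
      simp [dotC, hw, Finset.sum_mul]
    have h2 := faceMean_gradF h' hp hwt
    have hwd (γ : E3) := dotC_mem γ hwm
    rw [H _ (Or.inl (Or.inr ⟨x, hx, y, hy, s, hs, hxy, hxs, hys, w, hwm, hwt, rfl⟩)),
      hE y hy s hs hys _ (hwd _), hE x hx s hs hxs _ (hwd _), hE y hy s hs hys _ (hwd _),
      hE x hx y hy hxy _ (hwd _)] at h2
    have h3 : faceMean x y s (fun z => evalP p z * evalP q z) = faceMean x y s (fun z =>
        evalP p z * evalP (dirP (y - x) (dotC (baryGrad x s t y) w) +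
          dirP (s - x) (dotC (baryGrad x t y s) w)) z) := by
      refine faceMean_congr fun z hz => ?_
      rw [hd, hd]
      change _ = _ * evalP (dirP (y - x) (baryP x s t y * E) + dirP (s - x) (baryP x t y s * E)) z
      rw [evalP_add, evalP_dirP_baryP_mul, evalP_dirP_baryP_mul, h'.oppB.inner_self,
        h'.oppC.inner_self, ← hEq z, evalP_baryP, evalP_baryP]
      conv_lhs => rw [h'.decomp (z - x), hin hz]
      simp only [zero_smul, add_zero, map_add, map_smul, smul_eq_mul]
      push_cast
      ring
    rw [h3]
    linarith
  rintro L (((⟨v, hv, rfl⟩ | ⟨x, hx, y, hy, hxy, q, hq, rfl⟩) |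
    ⟨x, hx, y, hy, s, hs, hxy, hxs, hys, q, hq, rfl⟩) | ⟨q, hq, rfl⟩)
  · exact hV v hv
  · exact hE x hx y hy hxy q hq
  · exact hF x hx y hy s hs hxy hxs hys q hq
  · have hm4 : poincareL q ∈ vpolyLE ((m : ℤ) - 3) := mem_vpolyLE.2 fun i => by
      have := mul_mem_polyLE (X_mem_polyLE le_rfl i) (eulerInv_mem_polyLE 3 hq)
      rwa [show (1 : ℤ) + (m - 4) = m - 3 by ring] at this
    have h2 := integral_gradF h hp (poincareL q)
    rw [H _ (Or.inr ⟨_, hm4, rfl⟩), divP_poincareL] at h2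
    have h3 : (h.flux fun x => evalP p x • evalV (poincareL q) x) = 0 := by
      have key : ∀ x y s t, IsTet K x y s t → faceMean x y s
          (fun z => inner ℝ (evalP p z • evalV (poincareL q) z) (baryGrad x y s t)) = 0 := by
        intro x y s t h'
        rw [← hF x h'.ma y h'.mb s h'.mc h'.ab h'.ac h'.bc _ (dotC_mem (baryGrad x y s t) hm4)]
        congr 1 with z
        rw [inner_smul_left, evalP_dotC]; rfl
      rw [IsTet.flux, key _ _ _ _ h, key _ _ _ _ h.oppB, key _ _ _ _ h.oppC, key _ _ _ _ h.oppA]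
      simp
    rw [h3] at h2
    change (⨍ x in hull K, evalP p x * evalP q x) = 0
    rw [setAverage_eq, smul_eq_mul]
    rw [show ∫ x in hull K, evalP p x * evalP q x = 0 by linarith, mul_zero]

/-! ### Unisolvence of the Lagrange element: injectivity -/

theorem mem_polyLE_of_mul' {l q : Poly} (x y : E3) (hxy : evalP l x ≠ evalP l y)
    (h : l * q ∈ polyLE m) : q ∈ polyLE (m - 1) := by
  by_cases hq : q = 0
  · simp [hq]
  have hl0 : l ≠ 0 := by rintro rfl; simp at hxy
  have hl1 : l.totalDegree ≠ 0 := by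
    intro h0
    rw [MvPolynomial.totalDegree_eq_zero_iff_eq_C] at h0
    rw [h0] at hxy
    simp at hxy
  rw [mem_polyLE_iff_totalDegree (mul_ne_zero hl0 hq),
    MvPolynomial.totalDegree_mul_of_isDomain hl0 hq] at h
  rw [mem_polyLE_iff_totalDegree hq]
  push_cast at h
  omega

/-- The polynomial `y ↦ p (a + y₀ e₀ + y₁ e₁ + y₂ e₂)`. -/
def pullP (a e₀ e₁ e₂ : E3) (p : Poly) : Poly := aeval (fun i => C (a i) + e₀ i • X 0 +
    e₁ i • X 1 + e₂ i • X 2) p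

theorem evalP_pullP (a e₀ e₁ e₂ : E3) (p : Poly) (y : E3) :
    evalP (pullP a e₀ e₁ e₂ p) y = evalP p (a + y 0 • e₀ + y 1 • e₁ + y 2 • e₂) := by
  rw [pullP, evalP_aeval]
  congr 1
  ext i
  simp [mul_comm]

theorem pullP_mem (hp : p ∈ polyLE m) (a e₀ e₁ e₂ : E3) : pullP a e₀ e₁ e₂ p ∈ polyLE m :=
  aeval_mem_polyLE hp fun _ => add_mem (add_mem (add_mem (C_mem_polyLE zero_le_one _)
    (Submodule.smul_mem _ _ (X_mem_polyLE le_rfl _)))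
    (Submodule.smul_mem _ _ (X_mem_polyLE le_rfl _)))
    (Submodule.smul_mem _ _ (X_mem_polyLE le_rfl _))

theorem exists_factor (i : Fin 3) (g M F : Poly) (z : E3)
    (hM : evalP M (toLp 2 (Function.update z.ofLp i (evalP g z))) ≠ 0)
    (h : ∀ y : E3, (∀ j, y j ∈ Set.Ioo (0 : ℝ) (1 / 3)) →
      evalP (M * F) (toLp 2 (Function.update y.ofLp i (evalP g y))) = 0) :
    ∃ F', F = (X i - g) * F' := by
  have e (P : Poly) (y : E3) : evalP (aeval (Function.update X i g) P) y =
      evalP P (toLp 2 (Function.update y.ofLp i (evalP g y))) := by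
    rw [evalP_aeval]
    congr 1
    ext j
    by_cases hj : j = i
    · subst hj; simp
    · simp [hj]
  have h1 : aeval (Function.update X i g) (M * F) = 0 :=
    eq_zero_of_evalP_eq_zero_box (lo := fun _ => 0) (hi := fun _ => 1 / 3) (by norm_num)
      fun y hy => by rw [e, h y hy]
  rw [map_mul, mul_eq_zero] at h1
  refine dvd_of_aeval_update_eq_zero (h1.resolve_left fun h0 => hM ?_)
  rw [← e, h0, evalP_zero]

theorem eqOn_zero_of_setIntegral_eq_zero {X : Type*} [TopologicalSpace X] [MeasurableSpace X]
    [BorelSpace X] {μ : Measure X} [μ.IsOpenPosMeasure] {s : Set X} {f : X → ℝ}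
    (hf : Continuous f) (hs : MeasurableSet s) (hi : IntegrableOn f s μ)
    (hsub : s ⊆ closure (interior s)) (h0 : ∀ x ∈ s, 0 ≤ f x) (h : ∫ x in s, f x ∂μ = 0) :
    ∀ x ∈ s, f x = 0 := by
  rw [setIntegral_eq_zero_iff_of_nonneg_ae ((ae_restrict_iff' hs).2 (ae_of_all _ h0)) hi] at h
  exact Measure.eqOn_of_ae_eq h hf.continuousOn continuousOn_const hsub

theorem refTri_subset_closure : refTri ⊆ closure (interior refTri) := by
  have hc : Convex ℝ refTri := by
    intro x hx y hy s t hs ht hst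
    refine ⟨?_, ?_, ?_⟩ <;> simp only [Prod.fst_add, Prod.snd_add, Prod.smul_fst, Prod.smul_snd,
      smul_eq_mul] <;> nlinarith [hx.1, hx.2.1, hx.2.2, hy.1, hy.2.1, hy.2.2]
  have hne : (interior refTri).Nonempty := by
    refine ⟨(1 / 3, 1 / 3), mem_interior.2 ⟨Set.Ioo 0 (1 / 2) ×ˢ Set.Ioo 0 (1 / 2), ?_,
      isOpen_Ioo.prod isOpen_Ioo, by constructor <;> constructor <;> norm_num⟩⟩
    rintro ⟨x, y⟩ ⟨⟨h1, h2⟩, h3, h4⟩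
    exact ⟨h1.le, h3.le, by simpa using by linarith⟩
  rw [hc.closure_interior_eq_closure_of_nonempty_interior hne]
  exact subset_closure

theorem IsTet.interior_nonempty (h : IsTet K a b c d) : (interior (hull K)).Nonempty := by
  by_contra hne
  have h1 := (convex_convexHull ℝ (K : Set E3)).addHaar_frontier volume
  have h2 : hull K ⊆ frontier (hull K) := by
    rw [frontier, Set.not_nonempty_iff_eq_empty.1 hne, Set.sdiff_empty]
    exact subset_closure
  have h3 := h.volume_pos
  rw [measureReal_def, measure_mono_null h2 h1] at h3
  simp at h3

theorem IsTet.subset_closure (h : IsTet K a b c d) : hull K ⊆ closure (interior (hull K)) := by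
  rw [(convex_convexHull ℝ _).closure_interior_eq_closure_of_nonempty_interior h.interior_nonempty]
  exact _root_.subset_closure

theorem IsTet.eq_zero_of_forall_mem (h : IsTet K a b c d) (hp : ∀ x ∈ hull K, evalP p x = 0) :
    p = 0 :=
  eq_zero_of_evalP_eq_zero isOpen_interior h.interior_nonempty fun x hx => hp x (interior_subset hx)

theorem IsTet.eqOn_zero (h : IsTet K a b c d) {f : E3 → ℝ} (hf : Continuous f)
    (h0 : ∀ x ∈ hull K, 0 ≤ f x)
    (hi : ∫ x in hull K, f x = 0) :
    ∀ x ∈ hull K, f x = 0 :=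
  eqOn_zero_of_setIntegral_eq_zero hf h.isCompact.measurableSet (h.integrableOn hf)
    h.subset_closure h0 hi

theorem eq_zero_on_edge (h : IsTet K a b c d) (hp : p ∈ polyLE m) (ha : evalP p a = 0)
    (hb : evalP p b = 0)
    (H : ∀ q ∈ polyLE (m - 2), edgeMean a b (fun x => evalP p x * evalP q x) = 0) : ∀ t :
    ℝ, evalP p (a + t • (b - a)) = 0 := by
  set F := pullP a (b - a) 0 0 p with hF
  have hFe (y : E3) : evalP F y = evalP p (a + y 0 • (b - a)) := by rw [hF, evalP_pullP]; simp
  obtain ⟨F₁, h1⟩ := exists_factor 0 0 1 F 0 (by simp) (fun y _ => by simp [hFe, ha])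
  obtain ⟨F₂, h2⟩ := exists_factor 0 1 (X 0 - 0) F₁ 0 (by simp) (fun y _ => by
    rw [← h1]; simp [hFe, hb])
  have hm : F₂ ∈ polyLE (m - 2) := by
    have h0 := pullP_mem hp a (b - a) 0 0
    rw [← hF, h1, h2] at h0
    have := mem_polyLE_of_mul' 0 (single 0 1) (by simp)
      (mem_polyLE_of_mul' 0 (single 0 1) (by simp) h0)
    rwa [sub_sub] at this
  set q : Poly := aeval ![baryP a c d b, 0, 0] F₂ with hq
  have hqm : q ∈ polyLE (m - 2) := aeval_mem_polyLE hm fun i => by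
    fin_cases i
    exacts [baryP_mem, Submodule.zero_mem _, Submodule.zero_mem _]
  have hqe (t : ℝ) : evalP q (a + t • (b - a)) = evalP F₂ (single 0 t) := by
    rw [hq, evalP_aeval]
    congr 1
    ext i
    fin_cases i <;> simp [evalP_baryP, inner_smul_right, h.oppB.inner_self]
  have hpe (t : ℝ) : evalP p (a + t • (b - a)) = t * (t - 1) * evalP F₂ (single 0 t) := by
    have := hFe (single 0 t)
    rw [h1, h2] at this
    simp at this
    rw [← this, mul_assoc]
  have hz := H q hqm
  simp only [edgeMean, hqe, hpe] at hz
  have hcont : Continuous fun t : ℝ => evalP F₂ (single 0 t) := by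
    have : Continuous fun t : ℝ => (single 0 t : E3) := by
      have e : (fun t : ℝ => (single 0 t : E3)) = fun t => t • single 0 1 := by ext t i; simp
      rw [e]
      fun_prop
    fun_prop
  rw [intervalIntegral.integral_of_le zero_le_one, ← integral_Icc_eq_integral_Ioc] at hz
  have key := eqOn_zero_of_setIntegral_eq_zero (s := Set.Icc (0 : ℝ) 1) (μ := volume)
    (f := fun t => -(t * (t - 1) * evalP F₂ (single 0 t) *
      evalP F₂ (single 0 t))) (by fun_prop) measurableSet_Icc
    (Continuous.integrableOn_Icc (by fun_prop))
    (by rw [interior_Icc, closure_Ioo zero_ne_one]) (fun t ht => by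
      have := mul_nonneg (mul_nonneg ht.1 (sub_nonneg.2 ht.2))
        (mul_self_nonneg (evalP F₂ (single 0 t)))
      linarith) (by rw [integral_neg, hz, neg_zero])
  have hF2 : F = 0 := by
    refine eq_zero_of_evalP_eq_zero_box (lo := fun _ => 0) (hi := fun _ => 1) (by simp)
      fun y hy => ?_
    have h3 := key (y 0) ⟨(hy 0).1.le, (hy 0).2.le⟩
    rw [neg_eq_zero] at h3
    rw [hFe, hpe]
    rcases mul_eq_zero.1 h3 with h4 | h4
    · exact h4
    · rw [h4, mul_zero]
  intro t
  have := hFe (single 0 t)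
  rw [hF2] at this
  simpa using this.symm

theorem eq_zero_on_face (h : IsTet K a b c d) (hp : p ∈ polyLE m)
    (hab : ∀ t : ℝ, evalP p (a + t • (b - a)) = 0) (hac : ∀ t : ℝ, evalP p (a + t • (c - a)) = 0)
    (hbc : ∀ t : ℝ, evalP p (b + t • (c - b)) = 0)
    (H : ∀ q ∈ polyLE (m - 3), faceMean a b c (fun x => evalP p x * evalP q x) = 0) : ∀ s t :
    ℝ, evalP p (a + s • (b - a) + t • (c - a)) = 0 := by
  set F := pullP a (b - a) (c - a) 0 p with hF
  have hFe (y : E3) : evalP F y = evalP p (a + y 0 • (b - a) + y 1 • (c - a)) := by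
    rw [hF, evalP_pullP]; simp
  obtain ⟨F₁, h1⟩ := exists_factor 0 0 1 F 0 (by simp) (fun y _ => by simp [hFe, hac])
  obtain ⟨F₂, h2⟩ := exists_factor 1 0 (X 0 - 0) F₁ !₂[1, 1, 1] (by simp) (fun y _ => by
    rw [← h1]; simp [hFe, hab])
  obtain ⟨F₃, h3⟩ := exists_factor 0 (1 - X 1)
    ((X 0 - 0) * (X 1 - 0)) F₂ !₂[0, 1 / 2, 0] (by simp; norm_num)
    (fun y _ => by
      rw [mul_assoc, ← h2, ← h1, hFe]
      simp
      convert hbc (y 1) using 2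
      module)
  have hm : F₃ ∈ polyLE (m - 3) := by
    have h0 := pullP_mem hp a (b - a) (c - a) 0
    rw [← hF, h1, h2, h3] at h0
    have := mem_polyLE_of_mul' 0 (single 0 1) (by simp)
      (mem_polyLE_of_mul' 0 (single 1 1) (by simp)
      (mem_polyLE_of_mul' 0 (single 0 1) (by simp) h0))
    rwa [sub_sub, sub_sub, show (1 : ℤ) + (1 + 1) = 3 by norm_num] at this
  set q : Poly := aeval ![baryP a c d b, baryP a d b c, 0] F₃ with hq
  have hqm : q ∈ polyLE (m - 3) := aeval_mem_polyLE hm fun i => by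
    fin_cases i
    exacts [baryP_mem, baryP_mem, Submodule.zero_mem _]
  have hqe (s t : ℝ) : evalP q (a + s • (b - a) + t • (c - a)) = evalP F₃ !₂[s, t, 0] := by
    rw [hq, evalP_aeval]
    congr 1
    ext i
    fin_cases i <;> simp [evalP_baryP, add_assoc, inner_add_right, inner_smul_right,
      h.oppB.inner_self, h.oppC.inner_self, inner_baryGrad_left, inner_baryGrad_right]
  have hpe (s t : ℝ) : evalP p (a + s • (b - a) + t • (c - a)) =
      s * t * (s + t - 1) * evalP F₃ !₂[s, t, 0] := by
    have := hFe !₂[s, t, 0]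
    rw [h1, h2, h3] at this
    simp at this
    rw [← this]
    ring
  have hz := H q hqm
  simp only [faceMean, hqe, hpe] at hz
  have hcont : Continuous fun p : ℝ × ℝ => evalP F₃ !₂[p.1, p.2, 0] := by
    refine (continuous_evalP F₃).comp ((PiLp.continuous_toLp 2 _).comp (continuous_pi fun i => ?_))
    fin_cases i <;> simp <;> fun_prop
  rw [integral_refTri (F := fun p => p.1 * p.2 * (p.1 + p.2 - 1) * evalP F₃ !₂[p.1, p.2, 0] *
    evalP F₃ !₂[p.1, p.2, 0]) (by fun_prop), mul_eq_zero] at hz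
  have key := eqOn_zero_of_setIntegral_eq_zero (s := refTri) (μ := volume)
    (f := fun p => -(p.1 * p.2 * (p.1 + p.2 - 1) * evalP F₃ !₂[p.1, p.2, 0] *
      evalP F₃ !₂[p.1, p.2, 0])) (by fun_prop) isClosed_refTri.measurableSet
    (integrableOn_refTri (by fun_prop))
    refTri_subset_closure (fun t ht => by
      have := mul_nonneg (mul_nonneg (mul_nonneg ht.1 ht.2.1) (sub_nonneg.2 ht.2.2))
        (mul_self_nonneg (evalP F₃ !₂[t.1, t.2, 0]))
      linarith) (by rw [integral_neg, hz.resolve_left two_ne_zero, neg_zero])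
  have hF2 : F = 0 := by
    refine eq_zero_of_evalP_eq_zero_box (lo := fun _ => 0) (hi := fun _ => 1 / 3) (by norm_num)
      fun y hy => ?_
    have h3 := key (y 0, y 1) ⟨(hy 0).1.le, (hy 1).1.le, by
      simpa using by linarith [(hy 0).2, (hy 1).2]⟩
    rw [neg_eq_zero] at h3
    rw [hFe, hpe]
    rcases mul_eq_zero.1 h3 with h4 | h4
    · exact h4
    · simp only at h4
      rw [h4, mul_zero]
  intro s t
  have := hFe !₂[s, t, 0]
  rw [hF2] at this
  simpa using this.symm

theorem IsTet.baryP_nonneg (h : IsTet K a b c d) : ∀ x ∈ hull K, 0 ≤ evalP (baryP a b c d) x := by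
  intro x hx
  have hc : Convex ℝ {x | 0 ≤ evalP (baryP a b c d) x} := by
    intro x hx y hy s t hs ht hst
    simp only [Set.mem_ofPred_eq, evalP_baryP] at *
    have : s • x + t • y - a = s • (x - a) + t • (y - a) := by
      have : a = (s + t) • a := by rw [hst, one_smul]
      nth_rw 1 [this]
      module
    rw [this, inner_add_right, inner_smul_right, inner_smul_right]
    positivity
  refine convexHull_min ?_ hc hx
  rw [h.eq]
  rintro y (rfl | rfl | rfl | rfl) <;>
    simp [evalP_baryP, inner_baryGrad_left, inner_baryGrad_right, h.inner_self]

theorem IsTet.evalP_baryP_oppA (h : IsTet K a b c d) (x : E3) :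
    evalP (baryP b c d a) x = 1 - (evalP (baryP a c d b) x + evalP (baryP a d b c) x +
      evalP (baryP a b c d) x) := by
  have e : x - b = (x - a) - (b - a) := by abel
  rw [evalP_baryP, h.baryGrad_add, e, inner_sub_right]
  simp only [evalP_baryP, inner_neg_left, inner_add_left, inner_baryGrad_left,
    inner_baryGrad_right, h.oppB.inner_self]
  ring

theorem eq_zero_on_tet (h : IsTet K a b c d) (hp : p ∈ polyLE m)
    (hface : ∀ x y z w, IsTet K x y z w → ∀ s t : ℝ, evalP p (x + s • (y - x) + t • (z - x)) = 0)
    (H : ∀ q ∈ polyLE (m - 4), ∫ x in hull K, evalP p x * evalP q x = 0) : p = 0 := by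
  set F := pullP a (b - a) (c - a) (d - a) p with hF
  have hFe (y : E3) : evalP F y = evalP p (a + y 0 • (b - a) + y 1 • (c - a) + y 2 • (d - a)) := by
    rw [hF, evalP_pullP]
  obtain ⟨F₁, h1⟩ := exists_factor 0 0 1 F 0 (by simp) (fun y _ => by
    simp [hFe, hface _ _ _ _ h.oppB])
  obtain ⟨F₂, h2⟩ := exists_factor 1 0 (X 0 - 0) F₁ !₂[1, 1, 1] (by simp) (fun y _ => by
    rw [← h1]; simp [hFe, hface _ _ _ _ h.oppC.swap23])
  obtain ⟨F₃, h3⟩ := exists_factor 2 0 ((X 0 - 0) * (X 1 - 0)) F₂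
    !₂[1, 1, 1] (by simp) (fun y _ => by rw [mul_assoc, ← h2, ← h1]; simp [hFe, hface _ _ _ _ h])
  obtain ⟨F₄, h4⟩ := exists_factor 0 (1 - X 1 - X 2)
    ((X 0 - 0) * (X 1 - 0) * (X 2 - 0)) F₃
    !₂[0, 1 / 4, 1 / 4] (by simp; norm_num)
    (fun y _ => by
      rw [mul_assoc, ← h3, mul_assoc, ← h2, ← h1, hFe]
      simp
      convert hface _ _ _ _ h.oppA (y 1) (y 2) using 2
      module)
  have hm : F₄ ∈ polyLE (m - 4) := by
    have h0 := pullP_mem hp a (b - a) (c - a) (d - a)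
    rw [← hF, h1, h2, h3, h4] at h0
    have := mem_polyLE_of_mul' 0 (single 0 1) (by simp)
      (mem_polyLE_of_mul' 0 (single 2 1) (by simp)
      (mem_polyLE_of_mul' 0 (single 1 1) (by simp)
      (mem_polyLE_of_mul' 0 (single 0 1) (by simp) h0)))
    rwa [sub_sub, sub_sub, sub_sub, show (1 : ℤ) + (1 + (1 + 1)) = 4 by norm_num] at this
  set q : Poly := aeval ![baryP a c d b, baryP a d b c, baryP a b c d] F₄ with hq
  have hqm : q ∈ polyLE (m - 4) := aeval_mem_polyLE hm fun i => by
    fin_cases i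
    exacts [baryP_mem, baryP_mem, baryP_mem]
  have hpe (x : E3) : evalP p x = evalP (baryP a c d b) x * evalP (baryP a d b c) x *
      evalP (baryP a b c d) x * (evalP (baryP a c d b) x + evalP (baryP a d b c) x +
        evalP (baryP a b c d) x - 1) * evalP q x := by
    have e := hFe !₂[evalP (baryP a c d b) x, evalP (baryP a d b c) x, evalP (baryP a b c d) x]
    have e2 := h.decomp (x - a)
    simp only [← evalP_baryP] at e2
    rw [h1, h2, h3, h4] at e
    simp only [cons_val_zero, cons_val_one, cons_val, add_assoc] at e
    rw [add_assoc] at e2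
    rw [← e2, add_sub_cancel] at e
    rw [← e, hq, evalP_aeval]
    simp
    have e3 : (toLp 2 fun i => evalP ((![baryP a c d b, baryP a d b c, baryP a b c d] :
      Fin 3 → Poly) i) x : E3) =
      !₂[evalP (baryP a c d b) x, evalP (baryP a d b c) x, evalP (baryP a b c d) x] := by
      ext i
      fin_cases i <;> rfl
    rw [e3]
    ring
  have hz := H q hqm
  have key := h.eqOn_zero (f := fun x => -(evalP p x * evalP q x)) (by fun_prop) (fun x hx => by
      have := mul_nonneg (mul_nonneg (mul_nonneg (mul_nonneg (h.oppB.baryP_nonneg x hx)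
        (h.oppC.baryP_nonneg x hx)) (h.baryP_nonneg x hx)) (h.oppA.baryP_nonneg x hx))
        (mul_self_nonneg (evalP q x))
      rw [h.evalP_baryP_oppA] at this
      rw [hpe]
      linarith) (by rw [integral_neg, hz, neg_zero])
  refine h.eq_zero_of_forall_mem fun x hx => ?_
  have h3 := key x hx
  rw [neg_eq_zero] at h3
  rcases mul_eq_zero.1 h3 with h4 | h4
  · exact h4
  · rw [hpe, h4, mul_zero]

/-! ### Unisolvence: injectivity for the scalar elements -/

theorem IsTet.integral_eq_zero_of_average (h : IsTet K a b c d) {f : E3 → ℝ}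
    (hf : ⨍ x in hull K, f x = 0) :
    ∫ x in hull K, f x = 0 := by
  rw [setAverage_eq, smul_eq_mul, mul_eq_zero] at hf
  exact hf.resolve_left (inv_ne_zero h.volume_pos.ne')

theorem lagrange_inj (h : IsTet K a b c d) (hp : p ∈ polyLE m)
    (H : ∀ L ∈ lagrangeDofs m (K : Set E3) ∪ interiorDofs (polyLE (m - 4)) K, L (evalP p) = 0) :
    p = 0 := by
  have hV (v) (hv : v ∈ (K : Set E3)) : evalP p v = 0 := H _ (Or.inl (Or.inl (Or.inl ⟨v, hv, rfl⟩)))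
  have hE {x y z w : E3} (h' : IsTet K x y z w) : ∀ t : ℝ, evalP p (x + t • (y - x)) = 0 :=
    eq_zero_on_edge h' hp (hV _ h'.ma) (hV _ h'.mb) fun q hq =>
      H _ (Or.inl (Or.inl (Or.inr ⟨x, h'.ma, y, h'.mb, h'.ab, q, hq, rfl⟩)))
  refine eq_zero_on_tet h hp (fun x y z w h' => eq_zero_on_face h' hp (hE h') (hE h'.swap23)
    (hE h'.oppA) fun q hq => H _ (Or.inl (Or.inr
      ⟨x, h'.ma, y, h'.mb, z, h'.mc, h'.ab, h'.ac, h'.bc, q, hq, rfl⟩))) fun q hq => ?_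
  exact h.integral_eq_zero_of_average (H _ (Or.inr ⟨q, hq, rfl⟩))

theorem polyLE_neg (hm : m < 0) : polyLE m = ⊥ := if_neg (not_le.2 hm)

theorem affine_unique (h : IsTet K a b c d) {q : Poly} (hp : p ∈ polyLE 1) (hq : q ∈ polyLE 1)
    (H : ∀ v ∈ (K : Set E3), evalP p v = evalP q v) : p = q := by
  rw [← sub_eq_zero]
  refine lagrange_inj h (sub_mem hp hq) ?_
  rintro L (((⟨v, hv, rfl⟩ | ⟨x, hx, y, hy, hxy, q, hq, rfl⟩) |
    ⟨x, hx, y, hy, z, hz, _, _, _, q, hq, rfl⟩) | ⟨q, hq, rfl⟩)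
  · simp [H v hv]
  all_goals
    rw [polyLE_neg (by norm_num), Submodule.mem_bot] at hq
    subst hq
    simp [edgeMean, faceMean]

/-- The product of the barycentric coordinates. -/
def bubbleP (a b c d : E3) : Poly :=
  baryP b c d a * (baryP a c d b * (baryP a d b c * baryP a b c d))

theorem isBubble_iff (h : IsTet K a b c d) {B : Poly} : IsBubble K B ↔ B = bubbleP a b c d := by
  classical
  have hK : K = {a, b, c, d} := by
    apply Finset.coe_injective
    rw [h.eq]; simp
  have hprod (l : E3 → Poly) : ∏ v ∈ K, l v = l a * (l b * (l c * l d)) := by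
    rw [hK, Finset.prod_insert, Finset.prod_insert, Finset.prod_insert, Finset.prod_singleton]
    · simp [h.cd]
    · simp [h.bc, h.bd]
    · simp [h.ab, h.ac, h.ad]
  have base {x y z w : E3} (h' : IsTet K x y z w) {v : E3} (hv : v ∈ (K : Set E3)) :
      evalP (baryP x y z w) v = if v = w then 1 else 0 := by
    rw [h'.eq] at hv
    rcases hv with rfl | rfl | rfl | rfl
    · simp [evalP_baryP, h'.ad]
    · simp [evalP_baryP, h'.bd, inner_baryGrad_left]
    · simp [evalP_baryP, h'.cd, inner_baryGrad_right]
    · simp [evalP_baryP, h'.inner_self]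
  have key (l : E3 → Poly) (h1 : ∀ v ∈ K, l v ∈ polyLE 1) (h2 : ∀ v ∈ K, evalP (l v) v = 1)
      (h3 : ∀ v ∈ K, ∀ w ∈ K, w ≠ v → evalP (l v) w = 0) {x y z w : E3} (h' : IsTet K x y z w) :
      l w = baryP x y z w := by
    refine affine_unique h (h1 w h'.md) baryP_mem fun v hv => ?_
    rw [base h' hv]
    split_ifs with e
    · rw [e, h2 w h'.md]
    · exact h3 w h'.md v hv e
  constructor
  · rintro ⟨l, h1, h2, h3, rfl⟩
    rw [hprod, bubbleP, key l h1 h2 h3 h, key l h1 h2 h3 h.oppA, key l h1 h2 h3 h.oppB,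
      key l h1 h2 h3 h.oppC]
  · rintro rfl
    have sw {x y z w : E3} (h' : IsTet K x y z w) : ∃ l ∈ polyLE 1,
        ∀ v ∈ K, evalP l v = if v = w then 1 else 0 := ⟨_, baryP_mem, fun v hv => base h' hv⟩
    have all (w : E3) (hw : w ∈ K) : ∃ l ∈ polyLE 1, ∀ v ∈ K, evalP l v = if v = w then 1 else 0 := by
      obtain ⟨x, y, z, h'⟩ := h.exists_of_mem hw
      exact sw h'.oppA
    choose! l hl1 hl2 using all
    have h1 := fun v hv => hl1 v hv
    have h2 : ∀ v ∈ K, evalP (l v) v = 1 := fun v hv => by rw [hl2 v hv v hv, if_pos rfl]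
    have h3 : ∀ v ∈ K, ∀ w ∈ K, w ≠ v → evalP (l v) w = 0 := fun v hv w hw hne => by
      rw [hl2 v hv w hw, if_neg hne]
    refine ⟨l, h1, h2, h3, ?_⟩
    rw [hprod, bubbleP, key l h1 h2 h3 h, key l h1 h2 h3 h.oppA, key l h1 h2 h3 h.oppB,
      key l h1 h2 h3 h.oppC]

theorem bubbleP_eq (h : IsTet K a b c d) {x y z w : E3} (h' : IsTet K x y z w) :
    bubbleP a b c d = bubbleP x y z w :=
  (isBubble_iff h').1 ((isBubble_iff h).2 rfl)

theorem bubbleP_eq_zero_of_mem_face (h : IsTet K a b c d) {x y z w : E3} (h' : IsTet K x y z w)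
    {v : E3} (hv : v ∈ convexHull ℝ {x, y, z}) : evalP (bubbleP a b c d) v = 0 := by
  rw [bubbleP_eq h h', bubbleP]
  simp [h'.baryP_face hv]

theorem bubbleP_ne_zero (h : IsTet K a b c d) : bubbleP a b c d ≠ 0 := by
  have ne {x y z w : E3} (h' : IsTet K x y z w) : baryP x y z w ≠ 0 := by
    intro h0
    have := h'.inner_self
    rw [← evalP_baryP, h0] at this
    simp at this
  exact mul_ne_zero (ne h.oppA) (mul_ne_zero (ne h.oppB) (mul_ne_zero (ne h.oppC) (ne h)))

theorem bubbleP_nonneg (h : IsTet K a b c d) : ∀ x ∈ hull K,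
    0 ≤ evalP (bubbleP a b c d) x := fun x hx => by
  simp only [bubbleP, evalP_mul]
  exact mul_nonneg (h.oppA.baryP_nonneg x hx) (mul_nonneg (h.oppB.baryP_nonneg x hx)
    (mul_nonneg (h.oppC.baryP_nonneg x hx) (h.baryP_nonneg x hx)))

theorem lagrangeDofs_congr (h : IsTet K a b c d) {f g : E3 → ℝ} (hfg : ∀ x y z w, IsTet K x y z w →
    ∀ v ∈ convexHull ℝ {x, y, z}, f v = g v) : ∀ L ∈ lagrangeDofs m (K : Set E3), L f = L g := by
  rintro L ((⟨v, hv, rfl⟩ | ⟨x, hx, y, hy, hxy, q, hq, rfl⟩) |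
    ⟨x, hx, y, hy, z, hz, h1, h2, h3, q, hq, rfl⟩)
  · obtain ⟨x, y, z, hz⟩ := h.exists_of_mem hv
    exact hfg _ _ _ _ hz _ (subset_convexHull ℝ _ (by simp))
  · obtain ⟨z, w, hz⟩ := h.exists_of_mem₂ hx hy hxy
    refine edgeMean_congr fun v hv => ?_
    rw [← convexHull_pair] at hv
    rw [hfg _ _ _ _ hz v (convexHull_mono (by intro t; simp; tauto) hv)]
  · obtain ⟨w, hz⟩ := h.exists_of_mem₃ hx hy hz h1 h2 h3
    refine faceMean_congr fun v hv => ?_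
    rw [hfg _ _ _ _ hz v hv]

/-- The enriched Lagrange space on the tetrahedron `a b c d`. -/
def sigmaPlusSub (k : ℕ) (a b c d : E3) : Submodule ℝ Poly :=
  polyLE ((k : ℤ) - 1) ⊔ if 5 ≤ k then ⊥ else ℝ ∙ bubbleP a b c d

theorem sigmaPlusSub_of_le {k : ℕ} (hk : 5 ≤ k) : sigmaPlusSub k a b c d = polyLE ((k : ℤ) - 1) := by
  rw [sigmaPlusSub, if_pos hk, sup_bot_eq]

theorem sigmaPlusSub_of_lt {k : ℕ} (hk : k < 5) :
    sigmaPlusSub k a b c d = polyLE ((k : ℤ) - 1) ⊔ ℝ ∙ bubbleP a b c d := by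
  rw [sigmaPlusSub, if_neg (not_le.2 hk)]

theorem mem_sigmaPlusSub (h : IsTet K a b c d) {k : ℕ} :
    p ∈ sigmaPlusSub k a b c d ↔ p ∈ sigmaPlus k K := by
  unfold sigmaPlusSub sigmaPlus
  rw [Set.mem_ofPred_eq]
  split_ifs with hk
  · rw [sup_bot_eq]
  · simp only [Submodule.mem_sup, Submodule.mem_span_singleton, isBubble_iff h]
    constructor
    · rintro ⟨q, hq, _, ⟨t, rfl⟩, rfl⟩
      exact ⟨q, hq, t, _, rfl, rfl⟩
    · rintro ⟨q, hq, t, _, rfl, rfl⟩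
      exact ⟨q, hq, _, ⟨t, rfl⟩, rfl⟩

theorem lagrangeDofs_add_bubble (h : IsTet K a b c d) (q : Poly) (t : ℝ) :
    ∀ L ∈ lagrangeDofs m (K : Set E3), L (evalP (q + t • bubbleP a b c d)) = L (evalP q) :=
  lagrangeDofs_congr h fun x y z w h' v hv => by simp [bubbleP_eq_zero_of_mem_face h h' hv]

theorem lagrange_inj_of_lt (h : IsTet K a b c d) (hm : m < 4) (hp : p ∈ polyLE m)
    (H : ∀ L ∈ lagrangeDofs m (K : Set E3), L (evalP p) = 0) : p = 0 := by
  refine lagrange_inj h hp ?_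
  rintro L (hL | ⟨q, hq, rfl⟩)
  · exact H L hL
  · rw [polyLE_neg (by omega), Submodule.mem_bot] at hq
    simp [hq]

theorem lagrangePlus_inj (h : IsTet K a b c d) {k : ℕ} (hp : p ∈ sigmaPlusSub k a b c d)
    (H : ∀ L ∈ lagrangeDofs ((k : ℤ) - 1) (K : Set E3) ∪ interiorDofs (plusInteriorTests k) K,
    L (evalP p) = 0) : p = 0 := by
  unfold sigmaPlusSub plusInteriorTests at *
  split_ifs at hp H with hk
  · rw [sup_bot_eq] at hp
    exact lagrange_inj h hp (by rwa [sub_sub])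
  · simp only [Submodule.mem_sup, Submodule.mem_span_singleton] at hp
    obtain ⟨q, hq, _, ⟨t, rfl⟩, rfl⟩ := hp
    have hq0 : q = 0 := lagrange_inj_of_lt h (by omega) hq fun L hL => by
      rw [← lagrangeDofs_add_bubble h q t L hL]
      exact H L (Or.inl hL)
    subst hq0
    rw [zero_add] at H ⊢
    have h1 := h.integral_eq_zero_of_average
      (H (fun u => ⨍ x in hull K, u x * evalP 1 x) (Or.inr ⟨1, (map_one (C (σ := Fin 3) (R := ℝ))) ▸ C_mem_polyLE le_rfl (1 : ℝ), rfl⟩))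
    simp only [evalP_one, mul_one, evalP_smul, integral_const_mul, mul_eq_zero] at h1
    rcases h1 with h1 | h1
    · rw [h1, zero_smul]
    · exact absurd (h.eq_zero_of_forall_mem
        (h.eqOn_zero (continuous_evalP _) (bubbleP_nonneg h) h1)) (bubbleP_ne_zero h)

instance finite_sigmaPlusSub (k : ℕ) (a b c d : E3) : Module.Finite ℝ (sigmaPlusSub k a b c d) := by
  rcases le_or_gt 5 k with hk | hk
  · rw [sigmaPlusSub_of_le hk]; infer_instance
  · rw [sigmaPlusSub_of_lt hk]; infer_instance

theorem le_finrank_sigmaPlusSub (h : IsTet K a b c d) (k : ℕ) :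
    (k + 2).choose 3 + (if 5 ≤ k then 0 else 1) ≤ finrank ℝ (sigmaPlusSub k a b c d) := by
  rcases le_or_gt 5 k with hk | hk
  · rw [sigmaPlusSub_of_le hk, finrank_polyLE, if_pos hk, add_zero]
  · have hinf : polyLE ((k : ℤ) - 1) ⊓ (ℝ ∙ bubbleP a b c d) = ⊥ := by
      rw [eq_bot_iff]
      rintro p ⟨hp, hp'⟩
      obtain ⟨t, rfl⟩ := Submodule.mem_span_singleton.1 hp'
      refine lagrange_inj_of_lt h (by omega) hp fun L hL => ?_
      have := lagrangeDofs_add_bubble h 0 t L hL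
      rw [zero_add] at this
      rw [this]
      rcases hL with (⟨v, hv, rfl⟩ | ⟨x, hx, y, hy, hxy, q, hq, rfl⟩) |
        ⟨x, hx, y, hy, z, hz, h1, h2, h3, q, hq, rfl⟩ <;> simp [edgeMean, faceMean]
    have := Submodule.finrank_sup_add_finrank_inf_eq (polyLE ((k : ℤ) - 1)) (ℝ ∙ bubbleP a b c d)
    rw [hinf, finrank_bot, finrank_span_singleton (bubbleP_ne_zero h), finrank_polyLE] at this
    rw [sigmaPlusSub_of_lt hk, if_neg (not_le.2 hk)]
    omega

/-! ### Unisolvence: injectivity for the vector elements -/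

theorem exists_baryP_mul (h : IsTet K a b c d) (hp : p ∈ polyLE m)
    (h0 : ∀ s t : ℝ, evalP p (a + s • (b - a) + t • (c - a)) = 0) :
    ∃ w ∈ polyLE (m - 1), ∀ x, evalP p x = evalP (baryP a b c d) x * evalP w x := by
  set F := pullP a (b - a) (c - a) (d - a) p with hF
  have hFe (y : E3) : evalP F y = evalP p (a + y 0 • (b - a) + y 1 • (c - a) + y 2 • (d - a)) := by
    rw [hF, evalP_pullP]
  obtain ⟨F₁, h1⟩ := exists_factor 2 0 1 F 0 (by simp) (fun y _ => by simp [hFe, h0])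
  have hm : F₁ ∈ polyLE (m - 1) := by
    have h0 := pullP_mem hp a (b - a) (c - a) (d - a)
    rw [← hF, h1] at h0
    exact mem_polyLE_of_mul' 0 (single 2 1) (by simp) h0
  refine ⟨aeval ![baryP a c d b, baryP a d b c, baryP a b c d] F₁,
    aeval_mem_polyLE hm fun i => ?_, fun x => ?_⟩
  · fin_cases i
    exacts [baryP_mem, baryP_mem, baryP_mem]
  have e := hFe !₂[evalP (baryP a c d b) x, evalP (baryP a d b c) x, evalP (baryP a b c d) x]
  have e2 := h.decomp (x - a)
  simp only [← evalP_baryP] at e2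
  rw [h1] at e
  simp only [cons_val_zero, cons_val_one, cons_val, add_assoc] at e
  rw [add_assoc] at e2
  rw [← e2, add_sub_cancel] at e
  rw [← e, evalP_aeval]
  have e3 : (toLp 2 fun i => evalP ((![baryP a c d b, baryP a d b c, baryP a b c d] :
    Fin 3 → Poly) i) x : E3) =
    !₂[evalP (baryP a c d b) x, evalP (baryP a d b c) x, evalP (baryP a b c d) x] := by
    ext i
    fin_cases i <;> rfl
  rw [e3]
  simp

theorem eq_zero_of_faceMean_sq (p : Poly)
    (H : faceMean a b c (fun x => evalP p x * evalP p x) = 0) :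
    ∀ s t : ℝ, evalP p (a + s • (b - a) + t • (c - a)) = 0 := by
  set F := pullP a (b - a) (c - a) 0 p with hF
  have hFe (y : E3) : evalP F y = evalP p (a + y 0 • (b - a) + y 1 • (c - a)) := by
    rw [hF, evalP_pullP]; simp
  rw [faceMean_eq (by fun_prop), mul_eq_zero] at H
  have key := eqOn_zero_of_setIntegral_eq_zero (s := refTri) (μ := volume)
    (f := fun z => evalP p (triMap a b c z) * evalP p (triMap a b c z)) (by fun_prop)
    isClosed_refTri.measurableSet
    (integrableOn_refTri (by fun_prop))
    refTri_subset_closure (fun t ht => mul_self_nonneg _) (H.resolve_left two_ne_zero)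
  have hF2 : F = 0 := by
    refine eq_zero_of_evalP_eq_zero_box (lo := fun _ => 0) (hi := fun _ => 1 / 3) (by norm_num)
      fun y hy => ?_
    rw [hFe]
    exact mul_self_eq_zero.1 (key (y 0, y 1) ⟨(hy 0).1.le, (hy 1).1.le, by
      simpa using by linarith [(hy 0).2, (hy 1).2]⟩)
  intro s t
  have := hFe !₂[s, t, 0]
  rw [hF2] at this
  simpa using this.symm

theorem divFree_inj (h : IsTet K a b c d) (hv : v ∈ vpolyLE ((r : ℤ) - 1)) (hdiv : divP v = 0)
    {C : Submodule ℝ VPoly} (hC : IsGradComplement r C)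
    (H : ∀ L ∈ fluxDofs r (K : Set E3) ∪ interiorVDofs C K, L (evalV v) = 0) : v = 0 := by
  have hface {x y z w : E3} (h' : IsTet K x y z w) :
      ∀ s t : ℝ, evalP (dotC (baryGrad x y z w) v) (x + s • (y - x) + t • (z - x)) = 0 := by
    refine eq_zero_of_faceMean_sq _ ?_
    have := H _ (Or.inl ⟨x, h'.ma, y, h'.mb, z, h'.mc, h'.ab, h'.ac, h'.bc,
      _, dotC_mem (baryGrad x y z w) hv, rfl⟩)
    rw [mul_eq_zero] at this
    have e : (fun x' => evalP (dotC (baryGrad x y z w) v) x' * evalP (dotC (baryGrad x y z w) v) x') =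
        fun x' => (tetVol x y z w)⁻¹ * (inner ℝ (evalV v x') (triNormal x y z) *
          evalP (dotC (baryGrad x y z w) v) x') := by
      ext x'
      nth_rw 1 [evalP_dotC]
      nth_rw 1 [baryGrad]
      rw [inner_smul_right]
      ring
    rw [e, faceMean_const_mul, this.resolve_left (by norm_num), mul_zero]
  have hgrad (q : Poly) : ∫ x in hull K, inner ℝ (evalV v x) (evalV (gradP q) x) = 0 := by
    have h1 := integral_divF_mul h ((contDiff_evalV v).of_le (by simp)) q
    have h2 : divF (evalV v) = fun _ => 0 := by
      ext x
      have : divF (evalV v) x = evalP (divP v) x := by simp [divF, divP, partialD_evalP]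
      rw [this, hdiv, evalP_zero]
    have h3 {x y z w : E3} (h' : IsTet K x y z w) :
        faceMean x y z (fun t => inner ℝ (evalP q t • evalV v t) (baryGrad x y z w)) = 0 := by
      have := hface h'
      simp only [evalP_dotC] at this
      simp [faceMean, inner_smul_left, this]
    rw [h2] at h1
    simp only [IsTet.flux, h3 h, h3 h.oppA, h3 h.oppB, h3 h.oppC, zero_mul, integral_zero] at h1
    linarith
  obtain ⟨wb, hwb, eb⟩ := exists_baryP_mul h.oppB (dotC_mem _ hv) (hface h.oppB)
  obtain ⟨wc, hwc, ec⟩ := exists_baryP_mul h.oppC (dotC_mem _ hv) (hface h.oppC)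
  obtain ⟨wd, hwd, ed⟩ := exists_baryP_mul h (dotC_mem _ hv) (hface h)
  set z : VPoly := fun i => baryGrad a c d b i • wb + baryGrad a d b c i • wc +
    baryGrad a b c d i • wd with hz
  have hzm : z ∈ vpolyLE ((r : ℤ) - 2) := by
    rw [mem_vpolyLE]
    rw [show (r : ℤ) - 1 - 1 = r - 2 by ring] at hwb hwc hwd
    exact fun i => add_mem (add_mem (Submodule.smul_mem _ _ hwb) (Submodule.smul_mem _ _ hwc))
      (Submodule.smul_mem _ _ hwd)
  have hze (x : E3) : inner ℝ (evalV v x) (evalV z x) =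
      evalP (baryP a c d b) x * (evalP wb x * evalP wb x) +
      evalP (baryP a d b c) x * (evalP wc x * evalP wc x) +
      evalP (baryP a b c d) x * (evalP wd x * evalP wd x) := by
    have e : evalV z x = evalP wb x • baryGrad a c d b + evalP wc x • baryGrad a d b c +
        evalP wd x • baryGrad a b c d := by
      ext i
      simp [hz, mul_comm]
    rw [e, inner_add_right, inner_add_right, inner_smul_right, inner_smul_right, inner_smul_right,
      ← evalP_dotC, ← evalP_dotC, ← evalP_dotC, eb, ec, ed]
    ring
  have hz0 : ∫ x in hull K, inner ℝ (evalV v x) (evalV z x) = 0 := by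
    rw [← hC.2, Submodule.mem_sup] at hzm
    obtain ⟨_, ⟨q, hq, rfl⟩, g, hg, e⟩ := hzm
    have e' (x : E3) : evalV z x = evalV (gradP q) x + evalV g x := by rw [← e]; ext i; simp
    simp only [e', inner_add_right]
    rw [integral_add (h.integrableOn (by fun_prop)) (h.integrableOn (by fun_prop)), hgrad, zero_add]
    exact H _ (Or.inr ⟨g, hg, rfl⟩)
  have nn (x : E3) (hx : x ∈ hull K) :=
    And.intro (mul_nonneg (h.oppB.baryP_nonneg x hx) (mul_self_nonneg (evalP wb x)))
    (And.intro (mul_nonneg (h.oppC.baryP_nonneg x hx) (mul_self_nonneg (evalP wc x)))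
    (mul_nonneg (h.baryP_nonneg x hx) (mul_self_nonneg (evalP wd x))))
  have key := h.eqOn_zero (f := fun x => inner ℝ (evalV v x) (evalV z x)) (by fun_prop)
    (fun x hx => by
      obtain ⟨n1, n2, n3⟩ := nn x hx
      rw [hze]
      positivity) hz0
  have hv0 (x : E3) (hx : x ∈ hull K) : evalV v x = 0 := by
    obtain ⟨n1, n2, n3⟩ := nn x hx
    have h0 := key x hx
    rw [hze] at h0
    have z1 {s t : ℝ} (hst : s * (t * t) = 0) : s * t = 0 := by
      rcases mul_eq_zero.1 hst with h | h
      · rw [h, zero_mul]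
      · rw [mul_self_eq_zero.1 h, mul_zero]
    have c1 := z1 (show evalP (baryP a c d b) x * (evalP wb x * evalP wb x) = 0 by linarith)
    have c2 := z1 (show evalP (baryP a d b c) x * (evalP wc x * evalP wc x) = 0 by linarith)
    have c3 := z1 (show evalP (baryP a b c d) x * (evalP wd x * evalP wd x) = 0 by linarith)
    rw [← eb, evalP_dotC, real_inner_comm] at c1
    rw [← ec, evalP_dotC, real_inner_comm] at c2
    rw [← ed, evalP_dotC, real_inner_comm] at c3
    rw [h.decomp (evalV v x), c1, c2, c3]
    simp
  ext1 i
  refine h.eq_zero_of_forall_mem fun x hx => ?_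
  rw [← evalV_apply, hv0 x hx]
  rfl

theorem dof_zero {m : ℕ} {C : Submodule ℝ VPoly} :
    (∀ L ∈ nedelecDofs m (K : Set E3) ∪ interiorVDofs C K, L (fun _ => 0) = 0) ∧
    (∀ L ∈ fluxDofs r (K : Set E3) ∪ interiorVDofs C K, L (fun _ => 0) = 0) := by
  constructor
  · rintro L ((⟨x, hx, y, hy, hxy, q, hq, rfl⟩ |
      ⟨x, hx, y, hy, z, hz, h1, h2, h3, v, hv, hv', rfl⟩) | ⟨q, hq, rfl⟩) <;>
    simp [edgeMean, faceMean]
  · rintro L (⟨x, hx, y, hy, z, hz, h1, h2, h3, v, hv, rfl⟩ | ⟨q, hq, rfl⟩) <;>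
    simp [faceMean]

theorem curlF_zero : curlF (fun _ => (0 : E3)) = fun _ => 0 := by
  ext x i
  fin_cases i <;> simp [curlF, partialD]

theorem divF_zero : divF (fun _ => (0 : E3)) = fun _ => 0 := by
  ext x
  simp [divF, partialD]

theorem divF_evalV (v : VPoly) : divF (evalV v) = evalP (divP v) := by
  ext x
  simp [divF, divP, partialD_evalP]

theorem evalV_curlP (v : VPoly) : evalV (curlP v) = curlF (evalV v) := by
  ext x
  rw [curlF_evalV]

theorem exists_isGradComplement (r : ℕ) : ∃ C, IsGradComplement r C := by
  obtain ⟨D, hD⟩ := Submodule.exists_isCompl ((polyLE ((r : ℤ) - 1)).map gradP)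
  have hle : (polyLE ((r : ℤ) - 1)).map gradP ≤ vpolyLE ((r : ℤ) - 2) := by
    rintro _ ⟨q, hq, rfl⟩
    have := gradP_mem_vpolyLE hq
    rwa [sub_sub] at this
  refine ⟨D ⊓ vpolyLE ((r : ℤ) - 2), ?_, ?_⟩
  · rw [← inf_assoc, hD.inf_eq_bot, bot_inf_eq]
  · rw [← sup_inf_assoc_of_le _ hle, hD.sup_eq_top, top_inf_eq]

theorem interiorVDofs_mono {Q Q' : Submodule ℝ VPoly} (hQ : Q ≤ Q') :
    interiorVDofs Q K ⊆ interiorVDofs Q' K := by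
  rintro L ⟨q, hq, rfl⟩
  exact ⟨q, hQ hq, rfl⟩

theorem nedelec_inj (h : IsTet K a b c d) (hr : 1 ≤ r) (hv : v ∈ nedelecSpace r) (H : ∀ L ∈
    nedelecDofs r (K : Set E3) ∪ interiorVDofs (vpolyLE ((r : ℤ) - 3)) K, L (evalV v) = 0) :
    v = 0 := by
  have hs : ContDiff ℝ 1 (evalV v) := (contDiff_evalV v).of_le (by simp)
  obtain ⟨C, hC⟩ := exists_isGradComplement r
  have H' : ∀ L ∈ nedelecDofs r (K : Set E3) ∪ interiorVDofs (vpolyLE ((r : ℤ) - 3)) K,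
      (fun _ : ℕ => L (evalV v)) ⇝ (L fun _ => 0) := fun L hL => by
    rw [H L hL, (dof_zero (m := r) (r := r)).1 L hL]
    exact tendsto_const_nhds
  have hcurl : curlP v = 0 := by
    refine divFree_inj h (curlP_mem_vpolyLE (mem_nedelecSpace.1 hv).1) (divP_curlP v) hC ?_
    rintro L (hL | hL)
    · have := tendsto_fluxDofs_curlF (fun _ => hs) contDiff_const (fun L hL => H' L (Or.inl hL)) L hL
      rw [curlF_zero, (dof_zero (m := r) (r := r) (C := C)).2 L (Or.inl hL)] at this
      rw [evalV_curlP]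
      exact tendsto_nhds_unique tendsto_const_nhds this
    · have := tendsto_interior_curlF h (fun _ => hs) contDiff_const H' L
        (interiorVDofs_mono (hC.2 ▸ le_sup_right) hL)
      rw [curlF_zero, (dof_zero (m := r) (r := r) (C := C)).2 L (Or.inr hL)] at this
      rw [evalV_curlP]
      exact tendsto_nhds_unique tendsto_const_nhds this
  obtain ⟨ψ, hψ, rfl⟩ := exists_gradP_eq hv hcurl
  set p := ψ - MvPolynomial.C (evalP ψ a) with hp
  have e : gradP p = gradP ψ := by
    rw [hp, map_sub]
    ext1 i
    simp [gradP_apply]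
  have h0 : p = 0 := lagrange_inj h (sub_mem hψ (C_mem_polyLE (by omega) _))
    (lagrangeDofs_eq_zero_of_gradP h hr (by simp [hp]) (by rwa [e]))
  rw [← e, h0, map_zero]

/-- The grad-div space on the tetrahedron `a b c d`. -/
def gradDivSub (r k : ℕ) (a b c d : E3) : Submodule ℝ VPoly :=
  divFreeSub r ⊔ (sigmaPlusSub k a b c d).map poincareL

theorem mem_gradDivSub (h : IsTet K a b c d) {k : ℕ} {y : VPoly} :
    y ∈ gradDivSub r k a b c d ↔ y ∈ gradDivSpace r k K := by
  simp only [gradDivSub, divFreeSub_eq, Submodule.mem_sup, Submodule.mem_map, gradDivSpace,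
    isPoincare_iff, mem_sigmaPlusSub h, mem_nedelecSub, curlL_apply, Set.mem_ofPred_eq]
  constructor
  · rintro ⟨_, ⟨v, hv, rfl⟩, _, ⟨w, hw, rfl⟩, rfl⟩
    exact ⟨v, hv, w, hw, _, rfl, rfl⟩
  · rintro ⟨v, hv, w, hw, _, rfl, rfl⟩
    exact ⟨_, ⟨v, hv, rfl⟩, _, ⟨w, hw, rfl⟩, rfl⟩

theorem divP_mem_sigmaPlusSub {k : ℕ} {y : VPoly} (hy : y ∈ gradDivSub r k a b c d) :
    divP y ∈ sigmaPlusSub k a b c d := by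
  obtain ⟨v, hv, _, ⟨w, hw, rfl⟩, rfl⟩ := Submodule.mem_sup.1 hy
  rw [← divL_apply, map_add, LinearMap.mem_ker.1 hv.2, zero_add, divL_apply, divP_poincareL]
  exact hw

theorem gradDiv_inj (h : IsTet K a b c d) {k : ℕ} (hr : 1 ≤ r) (hk : k ≤ r + 1)
    {C : Submodule ℝ VPoly} (hC : IsGradComplement r C) {y : VPoly}
    (hy : y ∈ gradDivSub r k a b c d)
    (H1 : ∀ L ∈ lagrangeDofs ((k : ℤ) - 1) (K : Set E3), L (evalP (divP y)) = 0)
    (H2 : ∀ L ∈ fluxDofs r (K : Set E3) ∪ interiorVDofs (gradDivTests k C) K, L (evalV y) = 0) :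
    y = 0 := by
  have hd := divP_mem_sigmaPlusSub hy
  have hd0 : divP y = 0 := by
    refine lagrangePlus_inj h hd ?_
    rintro L (hL | hL)
    · exact H1 L hL
    · have := tendsto_interior_divF h hr hk (C := C) (u := fun _ : ℕ => evalV y)
        (w := fun _ => 0) (l := atTop) (fun _ => (contDiff_evalV y).of_le (by simp)) contDiff_const
        (fun L hL => by
          rw [H2 L hL, (dof_zero (m := r) (r := r)).2 L hL]
          exact tendsto_const_nhds) L hL
      rw [divF_zero, divF_evalV] at this
      refine (tendsto_nhds_unique tendsto_const_nhds this).trans ?_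
      obtain ⟨q, hq, rfl⟩ := hL
      simp
  obtain ⟨v, hv, _, ⟨w, hw, rfl⟩, rfl⟩ := Submodule.mem_sup.1 hy
  rw [← divL_apply, map_add, LinearMap.mem_ker.1 hv.2, zero_add, divL_apply, divP_poincareL] at hd0
  subst hd0
  rw [map_zero, add_zero] at H2 ⊢
  refine divFree_inj h hv.1 hv.2 hC fun L hL => H2 L (hL.imp_right fun hL => ?_)
  exact interiorVDofs_mono le_sup_right hL

instance finite_divFreeSub (r : ℕ) : Module.Finite ℝ (divFreeSub r) := by
  unfold divFreeSub; infer_instance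

instance finite_gradDivSub (r k : ℕ) (a b c d : E3) : Module.Finite ℝ (gradDivSub r k a b c d) := by
  unfold gradDivSub; infer_instance

theorem le_finrank_gradDivSub (h : IsTet K a b c d) (hr : 1 ≤ r) (k : ℕ) :
    3 * (r + 2).choose 3 + ((k + 2).choose 3 + if 5 ≤ k then 0 else 1) ≤
    (r + 1).choose 3 + finrank ℝ (gradDivSub r k a b c d) := by
  have hinf : divFreeSub r ⊓ (sigmaPlusSub k a b c d).map poincareL = ⊥ := by
    rw [eq_bot_iff]
    rintro _ ⟨hv, w, hw, rfl⟩
    have := LinearMap.mem_ker.1 hv.2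
    rw [divL_apply, divP_poincareL] at this
    simp [this]
  have hinj : Function.Injective poincareL := fun v w hvw => by
    rw [← divP_poincareL v, hvw, divP_poincareL]
  have h1 := Submodule.finrank_sup_add_finrank_inf_eq (divFreeSub r)
    ((sigmaPlusSub k a b c d).map poincareL)
  rw [hinf, finrank_bot, ← (Submodule.equivMapOfInjective poincareL hinj _).finrank_eq] at h1
  have h2 := le_finrank_divFreeSub hr
  have h3 := le_finrank_sigmaPlusSub h k
  rw [gradDivSub]
  omega

/-! ### Unisolvence: existence -/

theorem surjective_of_injective_dual {S U : Type*} [AddCommGroup S] [Module ℝ S]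
    [AddCommGroup U] [Module ℝ U] [Module.Finite ℝ S] [Module.Finite ℝ U]
    (E : S →ₗ[ℝ] Module.Dual ℝ U) (hE : Function.Injective E)
    (hc : finrank ℝ U ≤ finrank ℝ S) : Function.Surjective E := by
  refine (LinearMap.injective_iff_surjective_of_finrank_eq_finrank
    (le_antisymm (LinearMap.finrank_le_finrank_of_injective hE) ?_)).1 hE
  rwa [Subspace.dual_finrank_eq]

/-- If the degrees of freedom span a space of functionals of dimension at most that of the space of
shape functions and determine a shape function, then prescribed limits of degrees of freedom are
attained by a shape function. -/
theorem exists_limit_of_dofs {X Y S : Type*} [AddCommGroup X] [Module ℝ X] [AddCommGroup S]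
    [Module ℝ S] [Module.Finite ℝ S] (D : Set (Y → ℝ)) (i : X → Y) (j : S →ₗ[ℝ] X)
    (W : Submodule ℝ (Module.Dual ℝ X)) [Module.Finite ℝ W]
    (hW : ∀ L ∈ D, ∃ ℓ ∈ W, ∀ x, ℓ x = L (i x)) (hc : finrank ℝ W ≤ finrank ℝ S)
    (hinj : ∀ p, (∀ L ∈ D, L (i (j p)) = 0) → p = 0) (φ : ℕ → X)
    (hφ : ∀ L ∈ D, ∃ t, (fun n => L (i (φ n))) ⇝ t) :
    ∃ p, ∀ L ∈ D, (fun n => L (i (φ n))) ⇝ (L (i (j p))) := by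
  set U : Submodule ℝ (Module.Dual ℝ X) := Submodule.span ℝ {ℓ | ∃ L ∈ D, ∀ x, ℓ x = L (i x)} with hU
  have hUW : U ≤ W := Submodule.span_le.2 fun ℓ ⟨L, hL, h⟩ => by
    obtain ⟨ℓ', hℓ', h'⟩ := hW L hL
    rwa [show ℓ = ℓ' from LinearMap.ext fun x => by rw [h, h']]
  have : Module.Finite ℝ U := Submodule.finiteDimensional_of_le hUW
  have hlim (ℓ : U) : ∃ t, (fun n => ℓ.1 (φ n)) ⇝ t := by
    obtain ⟨ℓ, hℓ⟩ := ℓ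
    induction hℓ using Submodule.span_induction with
    | mem ℓ h =>
      obtain ⟨L, hL, h⟩ := h
      simpa only [h] using hφ L hL
    | zero => exact ⟨0, by simp⟩
    | add x y _ _ hx hy =>
      obtain ⟨s, hs⟩ := hx
      obtain ⟨t, ht⟩ := hy
      exact ⟨s + t, hs.add ht⟩
    | smul r x _ hx =>
      obtain ⟨s, hs⟩ := hx
      exact ⟨r * s, hs.const_mul r⟩
  choose t ht using hlim
  set T : Module.Dual ℝ U :=
    { toFun := t
      map_add' := fun x y => tendsto_nhds_unique (ht _) ((ht x).add (ht y))
      map_smul' := fun r x => tendsto_nhds_unique (ht _) ((ht x).const_mul r) } with hT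
  set E : S →ₗ[ℝ] Module.Dual ℝ U := U.subtype.dualMap ∘ₗ Module.Dual.eval ℝ X ∘ₗ j with hE
  have hEi : Function.Injective E := by
    rw [← LinearMap.ker_eq_bot, eq_bot_iff]
    intro p hp
    refine hinj p fun L hL => ?_
    obtain ⟨ℓ, _, h⟩ := hW L hL
    have := LinearMap.congr_fun (LinearMap.mem_ker.1 hp) ⟨ℓ, subset_span ⟨L, hL, h⟩⟩
    rw [← h]
    exact this
  obtain ⟨p, hp⟩ := surjective_of_injective_dual (U := U) E hEi ((finrank_mono hUW).trans hc) T
  refine ⟨p, fun L hL => ?_⟩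
  obtain ⟨ℓ, _, h⟩ := hW L hL
  have h1 := ht ⟨ℓ, subset_span ⟨L, hL, h⟩⟩
  have h2 := LinearMap.congr_fun hp ⟨ℓ, subset_span ⟨L, hL, h⟩⟩
  simp only [h] at h1
  rw [← h]
  rwa [show ℓ (j p) = t ⟨ℓ, subset_span ⟨L, hL, h⟩⟩ from h2]

theorem finrank_sup_le {V : Type*} [AddCommGroup V] [Module ℝ V] (A B : Submodule ℝ V)
    [Module.Finite ℝ A] [Module.Finite ℝ B] {m n : ℕ} (hA : finrank ℝ A ≤ m)
    (hB : finrank ℝ B ≤ n) : finrank ℝ ↥(A ⊔ B) ≤ m + n :=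
  (Submodule.finrank_add_le_finrank_add_finrank A B).trans (add_le_add hA hB)

section Skeleton

variable {V : Type*} [AddCommGroup V] [Module ℝ V]

/-- The sum of the subspaces attached to the edges of `a b c d`. -/
def edgeSup (f : E3 → E3 → Submodule ℝ V) (a b c d : E3) : Submodule ℝ V :=
  f a b ⊔ f a c ⊔ f a d ⊔ f b c ⊔ f b d ⊔ f c d

/-- The sum of the subspaces attached to the faces of `a b c d`. -/
def faceSup (f : E3 → E3 → E3 → Submodule ℝ V) (a b c d : E3) : Submodule ℝ V :=
  f a b c ⊔ f a b d ⊔ f a c d ⊔ f b c d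

instance finite_edgeSup (f : E3 → E3 → Submodule ℝ V) [∀ x y, Module.Finite ℝ (f x y)] :
    Module.Finite ℝ (edgeSup f a b c d) := by unfold edgeSup; infer_instance

instance finite_faceSup (f : E3 → E3 → E3 → Submodule ℝ V) [∀ x y z, Module.Finite ℝ (f x y z)] :
    Module.Finite ℝ (faceSup f a b c d) := by unfold faceSup; infer_instance

theorem IsTet.forall_edges (h : IsTet K a b c d) {P : E3 → E3 → Prop}
    (h1 : ∀ x y, P x y → P y x) (k1 : P a b) (k2 : P a c) (k3 : P a d) (k4 : P b c) (k5 : P b d)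
    (k6 : P c d) {x y : E3} (hx : x ∈ (K : Set E3)) (hy : y ∈ (K : Set E3)) (hxy : x ≠ y) :
    P x y := by
  have l1 := h1 _ _ k1
  have l2 := h1 _ _ k2
  have l3 := h1 _ _ k3
  have l4 := h1 _ _ k4
  have l5 := h1 _ _ k5
  have l6 := h1 _ _ k6
  rw [h.eq] at hx hy
  simp only [Set.mem_insert_iff, Set.mem_singleton_iff] at hx hy
  clear h1 h
  rcases hx with rfl | rfl | rfl | rfl <;> rcases hy with rfl | rfl | rfl | rfl <;>
  first
  | exact absurd rfl hxy
  | assumption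

theorem le_edgeSup (h : IsTet K a b c d) {f : E3 → E3 → Submodule ℝ V}
    (hf : ∀ x y, f x y = f y x) {x y : E3} (hx : x ∈ (K : Set E3)) (hy : y ∈ (K : Set E3))
    (hxy : x ≠ y) : f x y ≤ edgeSup f a b c d := by
  refine h.forall_edges (P := fun x y => f x y ≤ edgeSup f a b c d)
    (fun x y hp => (hf y x).le.trans hp) ?_ ?_ ?_ ?_ ?_ le_sup_right hx hy hxy
  all_goals unfold edgeSup
  · exact le_sup_of_le_left (le_sup_of_le_left (le_sup_of_le_left (le_sup_of_le_left le_sup_left)))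
  · exact le_sup_of_le_left (le_sup_of_le_left (le_sup_of_le_left (le_sup_of_le_left le_sup_right)))
  · exact le_sup_of_le_left (le_sup_of_le_left (le_sup_of_le_left le_sup_right))
  · exact le_sup_of_le_left (le_sup_of_le_left le_sup_right)
  · exact le_sup_of_le_left le_sup_right

theorem IsTet.forall_faces (h : IsTet K a b c d) {P : E3 → E3 → E3 → Prop}
    (h1 : ∀ x y z, P x y z → P z y x) (h2 : ∀ x y z, P x y z → P x z y)
    (k1 : P a b c) (k2 : P a b d) (k3 : P a c d) (k4 : P b c d) {x y z : E3}
    (hx : x ∈ (K : Set E3)) (hy : y ∈ (K : Set E3)) (hz : z ∈ (K : Set E3))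
    (hxy : x ≠ y) (hxz : x ≠ z) (hyz : y ≠ z) : P x y z := by
  have key (x y z : E3) (hp : P x y z) : P x z y ∧ P y x z ∧ P y z x ∧ P z x y ∧ P z y x :=
    ⟨h2 _ _ _ hp, h2 _ _ _ (h1 _ _ _ (h2 _ _ _ hp)), h1 _ _ _ (h2 _ _ _ hp),
      h2 _ _ _ (h1 _ _ _ hp), h1 _ _ _ hp⟩
  obtain ⟨k5, k6, k7, k8, k9⟩ := key _ _ _ k1
  obtain ⟨l5, l6, l7, l8, l9⟩ := key _ _ _ k2
  obtain ⟨m5, m6, m7, m8, m9⟩ := key _ _ _ k3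
  obtain ⟨n5, n6, n7, n8, n9⟩ := key _ _ _ k4
  rw [h.eq] at hx hy hz
  simp only [Set.mem_insert_iff, Set.mem_singleton_iff] at hx hy hz
  clear key h1 h2 h
  rcases hx with rfl | rfl | rfl | rfl <;> rcases hy with rfl | rfl | rfl | rfl <;>
  first
  | exact absurd rfl hxy
  | rcases hz with rfl | rfl | rfl | rfl <;>
    first
    | exact absurd rfl hxz
    | exact absurd rfl hyz
    | assumption

theorem le_faceSup (h : IsTet K a b c d) {f : E3 → E3 → E3 → Submodule ℝ V}
    (h1 : ∀ x y z, f x y z = f z y x) (h2 : ∀ x y z, f x y z = f x z y) {x y z : E3}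
    (hx : x ∈ (K : Set E3)) (hy : y ∈ (K : Set E3)) (hz : z ∈ (K : Set E3))
    (hxy : x ≠ y) (hxz : x ≠ z) (hyz : y ≠ z) : f x y z ≤ faceSup f a b c d :=
  h.forall_faces (P := fun x y z => f x y z ≤ faceSup f a b c d)
    (fun x y z hp => (h1 z y x).le.trans hp) (fun x y z hp => (h2 x z y).le.trans hp)
    (le_sup_of_le_left (le_sup_of_le_left le_sup_left))
    (le_sup_of_le_left (le_sup_of_le_left le_sup_right)) (le_sup_of_le_left le_sup_right)
    le_sup_right hx hy hz hxy hxz hyz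

theorem finrank_edgeSup_le (h : IsTet K a b c d) (f : E3 → E3 → Submodule ℝ V)
    [∀ x y, Module.Finite ℝ (f x y)] {n : ℕ}
    (hf : ∀ x y z w, IsTet K x y z w → finrank ℝ (f x y) ≤ n) :
    finrank ℝ (edgeSup f a b c d) ≤ 6 * n := by
  unfold edgeSup
  refine (finrank_sup_le _ _ (finrank_sup_le _ _ (finrank_sup_le _ _ (finrank_sup_le _ _
    (finrank_sup_le _ _ (hf _ _ _ _ h) (hf _ _ _ _ h.swap23)) (hf _ _ _ _ h.oppC))
    (hf _ _ _ _ h.oppA)) (hf _ _ _ _ h.swap12.oppC))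
    (hf _ _ _ _ h.oppA.oppA)).trans (by omega)

theorem finrank_faceSup_le (h : IsTet K a b c d) (f : E3 → E3 → E3 → Submodule ℝ V)
    [∀ x y z, Module.Finite ℝ (f x y z)] {n : ℕ}
    (hf : ∀ x y z w, IsTet K x y z w → finrank ℝ (f x y z) ≤ n) :
    finrank ℝ (faceSup f a b c d) ≤ 4 * n := by
  unfold faceSup
  refine (finrank_sup_le _ _ (finrank_sup_le _ _ (finrank_sup_le _ _ (hf _ _ _ _ h)
    (hf _ _ _ _ h.swap34)) (hf _ _ _ _ h.oppB)) (hf _ _ _ _ h.oppA)).trans (by omega)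

end Skeleton

theorem polyLE_le_span (h : IsTet K a b c d) (N : ℤ) : polyLE N ≤
    Submodule.span ℝ {p | ∃ i j k : ℕ, ((i + j + k : ℕ) : ℤ) ≤ N ∧
      p = baryP a c d b ^ i * baryP a d b c ^ j * baryP a b c d ^ k} := by
  intro p hp
  set F := pullP a (b - a) (c - a) (d - a) p with hF
  set A : Poly →ₐ[ℝ] Poly := aeval ![baryP a c d b, baryP a d b c, baryP a b c d] with hA
  have hpe : A F = p := by
    rw [← sub_eq_zero]
    refine h.eq_zero_of_forall_mem fun x _ => ?_
    have e := evalP_pullP a (b - a) (c - a) (d - a) p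
      !₂[evalP (baryP a c d b) x, evalP (baryP a d b c) x, evalP (baryP a b c d) x]
    have e2 := h.decomp (x - a)
    simp only [← evalP_baryP] at e2
    simp only [cons_val_zero, cons_val_one, cons_val, add_assoc] at e
    rw [add_assoc] at e2
    rw [← e2, add_sub_cancel] at e
    rw [evalP_sub, ← e, hA, evalP_aeval]
    have e3 : (toLp 2 fun i => evalP ((![baryP a c d b, baryP a d b c, baryP a b c d] :
      Fin 3 → Poly) i) x : E3) =
      !₂[evalP (baryP a c d b) x, evalP (baryP a d b c) x, evalP (baryP a b c d) x] := by
      ext i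
      fin_cases i <;> rfl
    rw [e3, hF, sub_self]
  have hFm : F ∈ polyLE N := pullP_mem hp _ _ _ _
  rw [← hpe]
  set S := Submodule.span ℝ {p | ∃ i j k : ℕ, ((i + j + k : ℕ) : ℤ) ≤ N ∧
      p = baryP a c d b ^ i * baryP a d b c ^ j * baryP a b c d ^ k} with hS
  have : polyLE N ≤ S.comap A.toLinearMap := polyLE_le fun n hn => by
    rw [Submodule.mem_comap, AlgHom.toLinearMap_apply]
    refine subset_span ⟨n 0, n 1, n 2, ?_, ?_⟩
    · rwa [Finsupp.degree_eq_sum, Fin.sum_univ_three] at hn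
    · rw [hA, MvPolynomial.aeval_monomial,
        Finsupp.prod_fintype _ _ (by simp), Fin.prod_univ_three, map_one, one_mul]
      simp only [cons_val_zero, cons_val_one, cons_val]
  have h2 := this hFm
  rwa [Submodule.mem_comap, AlgHom.toLinearMap_apply] at h2

theorem finrank_map_polyLE_edge (h : IsTet K a b c d) {V : Type*} [AddCommGroup V] [Module ℝ V]
    (M : Poly →ₗ[ℝ] V) (N : ℤ)
    (hM : ∀ q : Poly, (∀ x ∈ segment ℝ a b, evalP q x = 0) → M q = 0) :
    finrank ℝ ((polyLE N).map M) ≤ (N + 1).toNat := by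
  have hz (x : E3) (hx : x ∈ segment ℝ a b) : evalP (baryP a d b c) x = 0 ∧
      evalP (baryP a b c d) x = 0 := by
    rw [← convexHull_pair] at hx
    exact ⟨h.oppC.baryP_face (convexHull_mono (by intro t; simp; tauto) hx), h.baryP_face (convexHull_mono (by intro t; simp; tauto) hx)⟩
  classical
  have hle : (polyLE N).map M ≤ Submodule.span ℝ
      (((Finset.range (N + 1).toNat).image fun i => M (baryP a c d b ^ i) : Finset V) : Set V) := by
    refine (Submodule.map_mono (polyLE_le_span h N)).trans ?_
    rw [Submodule.map_span, Submodule.span_le]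
    rintro _ ⟨_, ⟨i, j, k, hijk, rfl⟩, rfl⟩
    by_cases hjk : j = 0 ∧ k = 0
    · obtain ⟨rfl, rfl⟩ := hjk
      refine subset_span ?_
      simp only [Finset.coe_image, Set.mem_image, Finset.coe_range, Set.mem_Iio]
      exact ⟨i, by omega, by simp⟩
    · rw [hM]
      · exact Submodule.zero_mem _
      · intro x hx
        obtain ⟨h1, h2⟩ := hz x hx
        simp only [evalP_mul, evalP_pow, h1, h2]
        rw [not_and_or] at hjk
        rcases hjk with hj | hk
        · simp [hj]
        · simp [hk]
  refine (finrank_mono hle).trans ((finrank_span_finset_le_card _).trans ?_)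
  exact Finset.card_image_le.trans (by simp)

theorem finrank_map_polyLE_face (h : IsTet K a b c d) {V : Type*} [AddCommGroup V] [Module ℝ V]
    (M : Poly →ₗ[ℝ] V) (N : ℤ)
    (hM : ∀ q : Poly, (∀ x ∈ convexHull ℝ {a, b, c}, evalP q x = 0) → M q = 0) :
    finrank ℝ ((polyLE N).map M) ≤ (N + 2).toNat.choose 2 := by
  set P : Finset (Σ _ : ℕ, ℕ) := (Finset.range (N + 1).toNat).sigma
    fun i => Finset.range ((N + 1).toNat - i) with hP
  have hcard : P.card = (N + 2).toNat.choose 2 := by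
    have key (n : ℕ) : ∑ i ∈ Finset.range n, (n - i) = (n + 1).choose 2 := by
      induction n with
      | zero => simp
      | succ n ih =>
        rw [Finset.sum_range_succ']
        simp only [Nat.add_sub_add_right, ih, Nat.sub_zero]
        rw [Nat.choose_succ_succ' (n + 1) 1]
        simp; ring
    rw [hP, Finset.card_sigma]
    simp only [Finset.card_range, key]
    rcases le_or_gt (-1) N with hN | hN
    · congr 1; omega
    · rw [show (N + 1).toNat = 0 by omega, show (N + 2).toNat = 0 by omega]
      rfl
  classical
  have hle : (polyLE N).map M ≤ Submodule.span ℝ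
      ((P.image fun i => M (baryP a c d b ^ i.1 * baryP a d b c ^ i.2) : Finset V) : Set V) := by
    refine (Submodule.map_mono (polyLE_le_span h N)).trans ?_
    rw [Submodule.map_span, Submodule.span_le]
    rintro _ ⟨_, ⟨i, j, k, hijk, rfl⟩, rfl⟩
    by_cases hk : k = 0
    · subst hk
      refine subset_span ?_
      simp only [Finset.coe_image, Set.mem_image]
      refine ⟨⟨i, j⟩, ?_, by simp⟩
      simp only [hP, Finset.coe_sigma, Set.mem_sigma_iff, Finset.coe_range, Set.mem_Iio]
      omega
    · rw [hM]
      · exact Submodule.zero_mem _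
      · intro x hx
        simp only [evalP_mul, evalP_pow, h.baryP_face hx, zero_pow hk, mul_zero]
  refine (finrank_mono hle).trans ((finrank_span_finset_le_card _).trans ?_)
  exact Finset.card_image_le.trans hcard.le

/-! ### The degrees of freedom as linear functionals -/

/-- The functionals `u ↦ edgeMean x y (u q)`. -/
def edgeL (x y : E3) : Poly →ₗ[ℝ] C(E3, ℝ) →ₗ[ℝ] ℝ :=
  LinearMap.mk₂ ℝ (fun q u => edgeMean x y fun z => u z * evalP q z) (fun p q u => by
      simp only [evalP_add, mul_add]
      exact edgeMean_add (by fun_prop) (by fun_prop))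
    (fun r q u => by
      simp only [evalP_smul, mul_left_comm _ r]
      exact edgeMean_const_mul r)
    (fun q u v => by
      simp only [ContinuousMap.add_apply, add_mul]
      exact edgeMean_add (by fun_prop) (by fun_prop))
    (fun r q u => by
      simp only [ContinuousMap.smul_apply, smul_eq_mul, mul_assoc]
      exact edgeMean_const_mul r)

/-- The functionals `u ↦ faceMean x y z (u q)`. -/
def faceL (x y z : E3) : Poly →ₗ[ℝ] C(E3, ℝ) →ₗ[ℝ] ℝ :=
  LinearMap.mk₂ ℝ (fun q u => faceMean x y z fun z => u z * evalP q z) (fun p q u => by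
      simp only [evalP_add, mul_add]
      exact faceMean_add (by fun_prop) (by fun_prop))
    (fun r q u => by
      simp only [evalP_smul, mul_left_comm _ r]
      exact faceMean_const_mul r)
    (fun q u v => by
      simp only [ContinuousMap.add_apply, add_mul]
      exact faceMean_add (by fun_prop) (by fun_prop))
    (fun r q u => by
      simp only [ContinuousMap.smul_apply, smul_eq_mul, mul_assoc]
      exact faceMean_const_mul r)

/-- The functionals `u ↦ faceMean x y z (u · v)`. -/
def faceV (x y z : E3) : VPoly →ₗ[ℝ] C(E3, E3) →ₗ[ℝ] ℝ :=
  LinearMap.mk₂ ℝ (fun v u => faceMean x y z fun z => inner ℝ (u z) (evalV v z)) (fun p q u => by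
      rw [← faceMean_add (by fun_prop) (by fun_prop)]
      congr 1 with z
      rw [← inner_add_right]; congr 1; ext i; simp)
    (fun r q u => by
      rw [smul_eq_mul, ← faceMean_const_mul]
      congr 1 with z
      rw [← real_inner_smul_right]; congr 1; ext i; simp)
    (fun q u v => by
      simp only [ContinuousMap.add_apply, inner_add_left]
      exact faceMean_add (by fun_prop) (by fun_prop))
    (fun r q u => by
      simp only [ContinuousMap.smul_apply, real_inner_smul_left]
      exact faceMean_const_mul r)

theorem integrableOn_convexHull (K : Finset E3) {f : E3 → ℝ} (hf : Continuous f) :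
    IntegrableOn f (hull K) :=
  hf.continuousOn.integrableOn_compact (K.finite_toSet.isCompact_convexHull ℝ)

/-- The functionals `u ↦ ∫_K u · v`. -/
def cellV (K : Finset E3) : VPoly →ₗ[ℝ] C(E3, E3) →ₗ[ℝ] ℝ :=
  LinearMap.mk₂ ℝ (fun v u => ∫ z in hull K, inner ℝ (u z) (evalV v z)) (fun p q u => by
      rw [← integral_add (integrableOn_convexHull K (by fun_prop))
        (integrableOn_convexHull K (by fun_prop))]
      congr 1 with z
      rw [← inner_add_right]; congr 1; ext i; simp)
    (fun r q u => by
      rw [smul_eq_mul, ← integral_const_mul]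
      congr 1 with z
      rw [← real_inner_smul_right]; congr 1; ext i; simp)
    (fun q u v => by
      simp only [ContinuousMap.add_apply, inner_add_left]
      exact integral_add (integrableOn_convexHull K (by fun_prop))
        (integrableOn_convexHull K (by fun_prop)))
    (fun r q u => by
      simp only [ContinuousMap.smul_apply, real_inner_smul_left]
      exact integral_const_mul r _)

/-- The functionals `u ↦ ⨍_K u q`. -/
def cellL (K : Finset E3) : Poly →ₗ[ℝ] C(E3, ℝ) →ₗ[ℝ] ℝ :=
  LinearMap.mk₂ ℝ (fun q u => ⨍ z in hull K, u z * evalP q z) (fun p q u => by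
      simp only [setAverage_eq, smul_eq_mul, ← mul_add]
      rw [← integral_add (integrableOn_convexHull K (by fun_prop))
        (integrableOn_convexHull K (by fun_prop))]
      simp only [evalP_add, mul_add])
    (fun r q u => by
      simp only [setAverage_eq, smul_eq_mul, evalP_smul, mul_left_comm _ r, integral_const_mul])
    (fun q u v => by
      simp only [setAverage_eq, smul_eq_mul, ← mul_add]
      rw [← integral_add (integrableOn_convexHull K (by fun_prop))
        (integrableOn_convexHull K (by fun_prop))]
      simp only [ContinuousMap.add_apply, add_mul])
    (fun r q u => by
      simp only [ContinuousMap.smul_apply, setAverage_eq, smul_eq_mul, mul_assoc,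
        integral_const_mul]
      ring)

/-- Evaluation at `v`. -/
def pointL (v : E3) : C(E3, ℝ) →ₗ[ℝ] ℝ where
  toFun u := u v
  map_add' _ _ := rfl
  map_smul' _ _ := rfl

/-- The component of a field in the direction `w`. -/
def innerC (w : E3) : C(E3, E3) →ₗ[ℝ] C(E3, ℝ) where
  toFun u := ⟨fun x => inner ℝ (u x) w, by fun_prop⟩
  map_add' u v := by ext x; simp [inner_add_left]
  map_smul' r u := by ext x; simp [real_inner_smul_left]

theorem innerC_neg (w : E3) : innerC (-w) = -innerC w := by
  ext u x
  simp [innerC]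

theorem map_dualMap_innerC_neg (w : E3) (A : Submodule ℝ (C(E3, ℝ) →ₗ[ℝ] ℝ)) :
    A.map (innerC (-w)).dualMap = A.map (innerC w).dualMap := by
  have : (innerC (-w)).dualMap = -(innerC w).dualMap := by
    ext f u
    simp [innerC_neg]
  rw [this, Submodule.map_neg]

theorem edgeL_symm (x y : E3) : edgeL y x = edgeL x y := by
  refine LinearMap.ext fun q => LinearMap.ext fun u => ?_
  exact edgeMean_symm x y fun t => u t * evalP q t

theorem faceL_rev (x y z : E3) : faceL z y x = faceL x y z := by
  refine LinearMap.ext fun q => LinearMap.ext fun u => ?_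
  exact faceMean_rev x y z fun t => u t * evalP q t

theorem faceL_swap (x y z : E3) : faceL x z y = faceL x y z := by
  refine LinearMap.ext fun q => LinearMap.ext fun u => ?_
  exact faceMean_swap (f := fun t => u t * evalP q t) (by fun_prop) x y z

theorem faceV_rev (x y z : E3) : faceV z y x = faceV x y z := by
  refine LinearMap.ext fun q => LinearMap.ext fun u => ?_
  exact faceMean_rev x y z fun t => inner ℝ (u t) (evalV q t)

theorem faceV_swap (x y z : E3) : faceV x z y = faceV x y z := by
  refine LinearMap.ext fun q => LinearMap.ext fun u => ?_
  exact faceMean_swap (f := fun t => inner ℝ (u t) (evalV q t)) (by fun_prop) x y z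

theorem finrank_polyLE_toNat (j : ℤ) : finrank ℝ (polyLE j) = (j + 3).toNat.choose 3 := by
  rcases le_or_gt (-1) j with hj | hj
  · have := finrank_polyLE (j + 1).toNat
    rw [show (((j + 1).toNat : ℕ) : ℤ) - 1 = j by omega] at this
    rw [this]
    congr 1
    omega
  · rw [polyLE_neg (by omega), finrank_bot, Nat.choose_eq_zero_of_lt (by omega)]

/-- The span of the vertex values. -/
def pointSpan (a b c d : E3) : Submodule ℝ (C(E3, ℝ) →ₗ[ℝ] ℝ) :=
  Submodule.span ℝ (Set.range ![pointL a, pointL b, pointL c, pointL d])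

instance finite_pointSpan (a b c d : E3) : Module.Finite ℝ (pointSpan a b c d) :=
  FiniteDimensional.span_of_finite ℝ (Set.finite_range _)

/-- The span of the vertex, edge and face functionals of degree `m`. -/
def lagrangeW (m : ℤ) (a b c d : E3) : Submodule ℝ (C(E3, ℝ) →ₗ[ℝ] ℝ) := pointSpan a b c d ⊔
    edgeSup (fun x y => (polyLE (m - 2)).map (edgeL x y)) a b c d ⊔
    faceSup (fun x y z => (polyLE (m - 3)).map (faceL x y z)) a b c d

instance finite_lagrangeW (m : ℤ) (a b c d : E3) : Module.Finite ℝ (lagrangeW m a b c d) := by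
  unfold lagrangeW
  infer_instance

theorem exists_mem_lagrangeW (h : IsTet K a b c d) :
    ∀ L ∈ lagrangeDofs m (K : Set E3), ∃ ℓ ∈ lagrangeW m a b c d, ∀ u : C(E3, ℝ), ℓ u = L u := by
  unfold lagrangeW
  rintro L ((⟨v, hv, rfl⟩ | ⟨x, hx, y, hy, hxy, q, hq, rfl⟩) |
    ⟨x, hx, y, hy, z, hz, h1, h2, h3, q, hq, rfl⟩)
  · refine ⟨pointL v, mem_sup_left (mem_sup_left (subset_span ?_)), fun u => rfl⟩
    rw [h.eq] at hv
    rcases hv with rfl | rfl | rfl | rfl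
    exacts [⟨0, rfl⟩, ⟨1, rfl⟩, ⟨2, rfl⟩, ⟨3, rfl⟩]
  · exact ⟨edgeL x y q, mem_sup_left (mem_sup_right
      (le_edgeSup (f := fun x y => (polyLE (m - 2)).map (edgeL x y)) h
        (fun x y => by rw [edgeL_symm]) hx hy hxy ⟨q, hq, rfl⟩)), fun u => rfl⟩
  · exact ⟨faceL x y z q, mem_sup_right
      (le_faceSup (f := fun x y z => (polyLE (m - 3)).map (faceL x y z)) h
        (fun x y z => by rw [faceL_rev]) (fun x y z => by rw [faceL_swap]) hx hy hz h1 h2 h3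
        ⟨q, hq, rfl⟩), fun u => rfl⟩

theorem finrank_map_edgeL_le (h : IsTet K a b c d) (N : ℤ) :
    finrank ℝ ((polyLE N).map (edgeL a b)) ≤ (N + 1).toNat :=
  finrank_map_polyLE_edge h (edgeL a b) N fun q hq => by
    refine LinearMap.ext fun u => ?_
    exact (edgeMean_congr (f := fun z => u z * evalP q z) (g := fun _ => 0)
      fun x hx => by simp [hq x hx]).trans (by simp [edgeMean])

theorem finrank_map_faceL_le (h : IsTet K a b c d) (N : ℤ) :
    finrank ℝ ((polyLE N).map (faceL a b c)) ≤ (N + 2).toNat.choose 2 :=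
  finrank_map_polyLE_face h (faceL a b c) N fun q hq => by
    refine LinearMap.ext fun u => ?_
    exact (faceMean_congr (f := fun z => u z * evalP q z) (g := fun _ => 0)
      fun x hx => by simp [hq x hx]).trans (by simp [faceMean])

theorem finrank_lagrangeW_le (h : IsTet K a b c d) (m : ℤ) : finrank ℝ (lagrangeW m a b c d) ≤
      4 + 6 * (m - 1).toNat + 4 * (m - 1).toNat.choose 2 := by
  unfold lagrangeW
  refine finrank_sup_le _ _ (finrank_sup_le _ _ ?_ ?_) ?_
  · exact (finrank_range_le_card _).trans (by simp)
  · refine finrank_edgeSup_le h _ fun x y z w h' => ?_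
    exact (finrank_map_edgeL_le h' _).trans (by omega)
  · refine finrank_faceSup_le h _ fun x y z w h' => (finrank_map_faceL_le h' _).trans (le_of_eq ?_)
    congr 2; omega

/-- The continuous function defined by a polynomial. -/
def toC : Poly →ₗ[ℝ] C(E3, ℝ) where
  toFun p := ⟨evalP p, continuous_evalP p⟩
  map_add' p q := by ext x; simp
  map_smul' r p := by ext x; simp

/-- The continuous field defined by a polynomial field. -/
def toCV : VPoly →ₗ[ℝ] C(E3, E3) where
  toFun p := ⟨evalV p, continuous_evalV p⟩
  map_add' p q := by ext x i; simp
  map_smul' r p := by ext x i; simp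

theorem choose_four (n : ℕ) : (n + 4).choose 3 = n.choose 3 + 4 * n.choose 2 + 6 * n + 4 := by
  simp [Nat.choose_succ_succ' _ 2, Nat.choose_succ_succ' _ 1, Nat.choose_succ_succ' _ 0]
  ring

theorem choose_three (n : ℕ) : (n + 3).choose 3 = n.choose 3 + 3 * n.choose 2 + 3 * n + 1 := by
  simp [Nat.choose_succ_succ' _ 2, Nat.choose_succ_succ' _ 1, Nat.choose_succ_succ' _ 0]
  ring

theorem exists_lagrange_limit (h : IsTet K a b c d) {m : ℕ} (hm : 1 ≤ m) (ψ : ℕ → E3 → ℝ)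
    (hψ : ∀ n, Continuous (ψ n))
    (H : ∀ L ∈ lagrangeDofs m (K : Set E3) ∪ interiorDofs (polyLE ((m : ℤ) - 4)) K,
      ∃ t, (fun n => L (ψ n)) ⇝ t) :
    ∃ p ∈ polyLE m, ∀ L ∈ lagrangeDofs m (K : Set E3) ∪ interiorDofs (polyLE ((m : ℤ) - 4)) K,
      (fun n => L (ψ n)) ⇝ (L (evalP p)) := by
  obtain ⟨p, hp⟩ := exists_limit_of_dofs
    (lagrangeDofs m (K : Set E3) ∪ interiorDofs (polyLE ((m : ℤ) - 4)) K)
    (fun u : C(E3, ℝ) => (u : E3 → ℝ)) (toC.domRestrict (polyLE m))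
    (lagrangeW m a b c d ⊔ (polyLE ((m : ℤ) - 4)).map (cellL K)) (by
      rintro L (hL | ⟨q, hq, rfl⟩)
      · obtain ⟨ℓ, h1, h2⟩ := exists_mem_lagrangeW h L hL
        exact ⟨ℓ, mem_sup_left h1, h2⟩
      · exact ⟨cellL K q, mem_sup_right ⟨q, hq, rfl⟩, fun u => rfl⟩) (by
      obtain ⟨n, rfl⟩ : ∃ n, m = n + 1 := ⟨m - 1, by omega⟩
      refine (finrank_sup_le _ _ (finrank_lagrangeW_le h _)
        ((finrank_map_le _ _).trans (finrank_polyLE_toNat _).le)).trans ?_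
      rw [finrank_polyLE_toNat, show (((n + 1 : ℕ) : ℤ) + 3).toNat = n + 4 by omega, choose_four,
        show (((n + 1 : ℕ) : ℤ) - 4 + 3).toNat = n by omega,
        show (((n + 1 : ℕ) : ℤ) - 1).toNat = n by omega]
      omega) (fun p hp => Subtype.ext (lagrange_inj h p.2 hp)) (fun n => ⟨ψ n, hψ n⟩) H
  exact ⟨p.1, p.2, hp⟩

theorem triNormal_rev (x y z : E3) : triNormal z y x = -triNormal x y z := by
  rw [triNormal_apply, triNormal_apply]
  ext i
  fin_cases i <;> simp <;> ring

theorem triNormal_swap (x y z : E3) : triNormal x z y = -triNormal x y z := by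
  rw [triNormal_apply, triNormal_apply]
  ext i
  fin_cases i <;> simp <;> ring

/-- Polynomial fields tangential to the triangle `x y z`. -/
def tangSub (N : ℤ) (x y z : E3) : Submodule ℝ VPoly where
  carrier := {v | v ∈ vpolyLE N ∧
    ∀ p ∈ convexHull ℝ {x, y, z}, inner ℝ (evalV v p) (triNormal x y z) = 0}
  add_mem' := fun {u v} hu hv => ⟨add_mem hu.1 hv.1, fun p hp => by
    have : evalV (u + v) p = evalV u p + evalV v p := by ext i; simp
    rw [this, inner_add_left, hu.2 p hp, hv.2 p hp, add_zero]⟩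
  zero_mem' := ⟨zero_mem _, fun p hp => by
    have : evalV 0 p = 0 := by ext i; simp
    rw [this, inner_zero_left]⟩
  smul_mem' := fun r v hv => ⟨Submodule.smul_mem _ r hv.1, fun p hp => by
    have : evalV (r • v) p = r • evalV v p := by ext i; simp
    rw [this, real_inner_smul_left, hv.2 p hp, mul_zero]⟩

instance finite_tangSub (N : ℤ) (x y z : E3) : Module.Finite ℝ (tangSub N x y z) :=
  Submodule.finiteDimensional_of_le (fun _ hv => hv.1 : tangSub N x y z ≤ vpolyLE N)

theorem tangSub_rev (N : ℤ) (x y z : E3) : tangSub N z y x = tangSub N x y z := by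
  ext v
  change (_ ∧ _) ↔ (_ ∧ _)
  simp only [triNormal_rev x y z, inner_neg_right, neg_eq_zero,
    show ({z, y, x} : Set E3) = {x, y, z} by ext; simp; tauto]

theorem tangSub_swap (N : ℤ) (x y z : E3) : tangSub N x z y = tangSub N x y z := by
  ext v
  change (_ ∧ _) ↔ (_ ∧ _)
  simp only [triNormal_swap x y z, inner_neg_right, neg_eq_zero,
    show ({x, z, y} : Set E3) = {x, y, z} by ext; simp; tauto]

theorem finrank_map_faceV_le (h : IsTet K a b c d) (N : ℤ) :
    finrank ℝ ((tangSub N a b c).map (faceV a b c)) ≤ 2 * (N + 2).toNat.choose 2 := by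
  have hle : (tangSub N a b c).map (faceV a b c) ≤
      ((polyLE N).map (faceL a b c)).map (innerC (b - a)).dualMap ⊔
        ((polyLE N).map (faceL a b c)).map (innerC (c - a)).dualMap := by
    rintro _ ⟨v, ⟨hv, ht⟩, rfl⟩
    have e : faceV a b c v = (innerC (b - a)).dualMap (faceL a b c (dotC (baryGrad a c d b) v)) +
        (innerC (c - a)).dualMap (faceL a b c (dotC (baryGrad a d b c) v)) := by
      refine LinearMap.ext fun u => ?_
      change faceMean a b c (fun z => inner ℝ (u z) (evalV v z)) =
        faceMean a b c (fun z => inner ℝ (u z) (b - a) * evalP (dotC (baryGrad a c d b) v) z) +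
        faceMean a b c (fun z => inner ℝ (u z) (c - a) * evalP (dotC (baryGrad a d b c) v) z)
      rw [← faceMean_add (by fun_prop) (by fun_prop)]
      refine faceMean_congr fun x hx => ?_
      have h0 : inner ℝ (baryGrad a b c d) (evalV v x) = 0 := by
        rw [baryGrad, real_inner_smul_left, real_inner_comm, ht x hx, mul_zero]
      conv_lhs => rw [h.decomp (evalV v x), h0, zero_smul, add_zero]
      rw [inner_add_right, real_inner_smul_right, real_inner_smul_right, evalP_dotC, evalP_dotC,
        real_inner_comm _ (evalV v x), real_inner_comm _ (evalV v x), mul_comm, mul_comm (inner ℝ _ (evalV v x))]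
    rw [e]
    exact Submodule.add_mem_sup ⟨_, ⟨_, dotC_mem _ hv, rfl⟩, rfl⟩ ⟨_, ⟨_, dotC_mem _ hv, rfl⟩, rfl⟩
  refine (finrank_mono hle).trans ((finrank_sup_le _ _
    ((finrank_map_le _ _).trans (finrank_map_faceL_le h N))
    ((finrank_map_le _ _).trans (finrank_map_faceL_le h N))).trans (by omega))

/-- The edge and face functionals of the Nédélec element. -/
def nedelecW (r : ℕ) (a b c d : E3) : Submodule ℝ (C(E3, E3) →ₗ[ℝ] ℝ) :=
  edgeSup (fun x y => ((polyLE ((r : ℤ) - 1)).map (edgeL x y)).map (innerC (y - x)).dualMap) a b c d ⊔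
    faceSup (fun x y z => (tangSub ((r : ℤ) - 2) x y z).map (faceV x y z)) a b c d

instance finite_nedelecW (r : ℕ) (a b c d : E3) : Module.Finite ℝ (nedelecW r a b c d) := by
  unfold nedelecW
  infer_instance

theorem exists_mem_nedelecW (h : IsTet K a b c d) :
    ∀ L ∈ nedelecDofs r (K : Set E3), ∃ ℓ ∈ nedelecW r a b c d, ∀ u : C(E3, E3), ℓ u = L u := by
  unfold nedelecW
  rintro L (⟨x, hx, y, hy, hxy, q, hq, rfl⟩ | ⟨x, hx, y, hy, z, hz, h1, h2, h3, v, hv, ht, rfl⟩)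
  · refine ⟨(innerC (y - x)).dualMap (edgeL x y q), mem_sup_left ?_, fun u => rfl⟩
    exact le_edgeSup (f := fun x y => ((polyLE ((r : ℤ) - 1)).map (edgeL x y)).map
      (innerC (y - x)).dualMap) h (fun x y => by
        rw [edgeL_symm, ← neg_sub x y, map_dualMap_innerC_neg]) hx hy hxy ⟨_, ⟨q, hq, rfl⟩, rfl⟩
  · refine ⟨faceV x y z v, mem_sup_right ?_, fun u => rfl⟩
    exact le_faceSup (f := fun x y z => (tangSub ((r : ℤ) - 2) x y z).map (faceV x y z)) h
      (fun x y z => by rw [faceV_rev, tangSub_rev]) (fun x y z => by rw [faceV_swap, tangSub_swap])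
      hx hy hz h1 h2 h3 ⟨v, ⟨hv, ht⟩, rfl⟩

theorem finrank_nedelecW_le (h : IsTet K a b c d) (r : ℕ) :
    finrank ℝ (nedelecW r a b c d) ≤ 6 * r + 8 * r.choose 2 := by
  unfold nedelecW
  refine (finrank_sup_le _ _ (m := 6 * r) (n := 4 * (2 * r.choose 2)) ?_ ?_).trans (by omega)
  · refine finrank_edgeSup_le h _ fun x y z w h' => (finrank_map_le _ _).trans ?_
    exact (finrank_map_edgeL_le h' _).trans (by omega)
  · refine finrank_faceSup_le h _ fun x y z w h' => (finrank_map_faceV_le h' _).trans (le_of_eq ?_)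
    congr 2; omega

theorem exists_nedelec_limit (h : IsTet K a b c d) (hr : 1 ≤ r) (φ : ℕ → E3 → E3) (hφ : ∀ n,
    Continuous (φ n)) (H : ∀ L ∈ nedelecDofs r (K : Set E3) ∪ interiorVDofs (vpolyLE ((r : ℤ) - 3))
    K, ∃ t, (fun n => L (φ n)) ⇝ t) : ∃ z ∈ nedelecSpace r, ∀ L ∈ nedelecDofs r (K : Set E3)
    ∪ interiorVDofs (vpolyLE ((r : ℤ) - 3)) K, (fun n => L (φ n)) ⇝ (L (evalV z)) := by
  obtain ⟨p, hp⟩ := exists_limit_of_dofs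
    (nedelecDofs r (K : Set E3) ∪ interiorVDofs (vpolyLE ((r : ℤ) - 3)) K)
    (fun u : C(E3, E3) => (u : E3 → E3)) (toCV.domRestrict (nedelecSub r))
    (nedelecW r a b c d ⊔ (vpolyLE ((r : ℤ) - 3)).map (cellV K)) (by
      rintro L (hL | ⟨q, hq, rfl⟩)
      · obtain ⟨ℓ, h1, h2⟩ := exists_mem_nedelecW h L hL
        exact ⟨ℓ, mem_sup_left h1, h2⟩
      · exact ⟨cellV K q, mem_sup_right ⟨q, hq, rfl⟩, fun u => rfl⟩) (by
      have h1 := le_finrank_nedelecSub r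
      refine (finrank_sup_le _ _ (finrank_nedelecW_le h _)
        ((finrank_map_le _ _).trans (finrank_vpolyLE _).le)).trans ?_
      rw [finrank_polyLE_toNat, show ((r : ℤ) - 3 + 3).toNat = r by omega]
      rw [choose_three, choose_four] at h1
      omega) (fun p hp => Subtype.ext (nedelec_inj h hr (mem_nedelecSub.1 p.2) hp))
      (fun n => ⟨φ n, hφ n⟩) H
  exact ⟨p.1, mem_nedelecSub.1 p.2, hp⟩

/-- The flux functionals. -/
def fluxW (r : ℕ) (a b c d : E3) : Submodule ℝ (C(E3, E3) →ₗ[ℝ] ℝ) :=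
  faceSup (fun x y z => ((polyLE ((r : ℤ) - 1)).map (faceL x y z)).map
    (innerC (triNormal x y z)).dualMap) a b c d

instance finite_fluxW (r : ℕ) (a b c d : E3) : Module.Finite ℝ (fluxW r a b c d) := by
  unfold fluxW
  infer_instance

theorem exists_mem_fluxW (h : IsTet K a b c d) :
    ∀ L ∈ fluxDofs r (K : Set E3), ∃ ℓ ∈ fluxW r a b c d, ∀ u : C(E3, E3), ℓ u = L u := by
  unfold fluxW
  rintro L ⟨x, hx, y, hy, z, hz, h1, h2, h3, q, hq, rfl⟩
  refine ⟨(1 / 2 : ℝ) • (innerC (triNormal x y z)).dualMap (faceL x y z q),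
    Submodule.smul_mem _ _ ?_, fun u => rfl⟩
  exact le_faceSup (f := fun x y z => ((polyLE ((r : ℤ) - 1)).map (faceL x y z)).map
    (innerC (triNormal x y z)).dualMap) h
    (fun x y z => by rw [faceL_rev, triNormal_rev, map_dualMap_innerC_neg])
    (fun x y z => by rw [faceL_swap, triNormal_swap, map_dualMap_innerC_neg])
    hx hy hz h1 h2 h3 ⟨_, ⟨q, hq, rfl⟩, rfl⟩

theorem finrank_fluxW_le (h : IsTet K a b c d) (r : ℕ) :
    finrank ℝ (fluxW r a b c d) ≤ 4 * (r + 1).choose 2 := by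
  unfold fluxW
  refine finrank_faceSup_le h _ fun x y z w h' => (finrank_map_le _ _).trans
    ((finrank_map_faceL_le h' _).trans (le_of_eq ?_))
  congr 1; omega

theorem finite_of_isGradComplement {C : Submodule ℝ VPoly} (hC : IsGradComplement r C) :
    Module.Finite ℝ C :=
  Submodule.finiteDimensional_of_le (hC.2 ▸ le_sup_right : C ≤ vpolyLE ((r : ℤ) - 2))

theorem finrank_gradDivTests_le {k : ℕ} (hr : 1 ≤ r) (hk : 2 ≤ k) {C : Submodule ℝ VPoly}
    (hC : IsGradComplement r C) : finrank ℝ (gradDivTests k C) + (if 5 ≤ k then 1 else 0) +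
    (r + 2).choose 3 ≤ (k - 2).choose 3 + 3 * (r + 1).choose 3 + 1 := by
  have := finite_of_isGradComplement hC
  have h1 := Submodule.finrank_sup_add_finrank_inf_eq ((polyLE ((r : ℤ) - 1)).map gradP) C
  rw [hC.1, hC.2, finrank_bot, finrank_vpolyLE, finrank_polyLE_toNat,
    show ((r : ℤ) - 2 + 3).toNat = r + 1 by omega] at h1
  have h2 := finrank_map_gradP (r - 1)
  rw [show ((r - 1 : ℕ) : ℤ) = r - 1 by omega, show r - 1 + 3 = r + 2 by omega] at h2
  have h3 := Submodule.finrank_add_le_finrank_add_finrank ((polyLE ((k : ℤ) - 5)).map gradP) C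
  unfold gradDivTests
  split_ifs with h5
  · have h4 := finrank_map_gradP (k - 5)
    rw [show ((k - 5 : ℕ) : ℤ) = k - 5 by omega, show k - 5 + 3 = k - 2 by omega] at h4
    omega
  · rw [polyLE_neg (by omega), Submodule.map_bot, finrank_bot] at h3
    rw [polyLE_neg (by omega), Submodule.map_bot]
    omega

theorem exists_gradDiv_limit (h : IsTet K a b c d) {k : ℕ} (hr : 1 ≤ r) (hk : 2 ≤ k)
    (hkr : k ≤ r + 1) {C : Submodule ℝ VPoly} (hC : IsGradComplement r C) (ψ : ℕ → E3 → ℝ)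
    (hψ : ∀ n, Continuous (ψ n)) (φ : ℕ → E3 → E3) (hφ : ∀ n, Continuous (φ n))
    (H1 : ∀ L ∈ lagrangeDofs ((k : ℤ) - 1) (K : Set E3), ∃ t, (fun n => L (ψ n)) ⇝ t) (H2 : ∀ L ∈
    fluxDofs r (K : Set E3) ∪ interiorVDofs (gradDivTests k C) K, ∃ t, (fun n => L (φ n)) ⇝ t) :
    ∃ y ∈ gradDivSpace r k K,
    (∀ L ∈ lagrangeDofs ((k : ℤ) - 1) (K : Set E3), (fun n => L (ψ n)) ⇝ (L (evalP (divP y)))) ∧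
    ∀ L ∈ fluxDofs r (K : Set E3) ∪ interiorVDofs (gradDivTests k C) K, (fun n => L (φ n)) ⇝
    (L (evalV y)) := by
  have := finite_of_isGradComplement hC
  have : Module.Finite ℝ (gradDivTests k C) := by unfold gradDivTests; infer_instance
  obtain ⟨p, hp⟩ := exists_limit_of_dofs (X := C(E3, ℝ) × C(E3, E3))
    ((fun L (u : (E3 → ℝ) × (E3 → E3)) => L u.1) '' lagrangeDofs ((k : ℤ) - 1) (K : Set E3) ∪
      (fun L (u : (E3 → ℝ) × (E3 → E3)) => L u.2) ''
        (fluxDofs r (K : Set E3) ∪ interiorVDofs (gradDivTests k C) K))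
    (fun u => ((u.1 : E3 → ℝ), (u.2 : E3 → E3)))
    (((toC ∘ₗ divL).prod toCV).domRestrict (gradDivSub r k a b c d))
    ((lagrangeW ((k : ℤ) - 1) a b c d).map (LinearMap.fst ℝ C(E3, ℝ) C(E3, E3)).dualMap ⊔
      (fluxW r a b c d ⊔ (gradDivTests k C).map (cellV K)).map
        (LinearMap.snd ℝ C(E3, ℝ) C(E3, E3)).dualMap) (by
      rintro _ (⟨L, hL, rfl⟩ | ⟨L, hL | ⟨q, hq, rfl⟩, rfl⟩)
      · obtain ⟨ℓ, h1, h2⟩ := exists_mem_lagrangeW h L hL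
        exact ⟨_, mem_sup_left ⟨ℓ, h1, rfl⟩, fun u => h2 u.1⟩
      · obtain ⟨ℓ, h1, h2⟩ := exists_mem_fluxW h L hL
        exact ⟨_, mem_sup_right ⟨ℓ, mem_sup_left h1, rfl⟩, fun u => h2 u.2⟩
      · exact ⟨_, mem_sup_right ⟨cellV K q, mem_sup_right ⟨q, hq, rfl⟩, rfl⟩, fun u => rfl⟩) (by
      have h1 := le_finrank_gradDivSub h hr k
      have h2 := finrank_gradDivTests_le hr hk hC
      refine (finrank_sup_le _ _
        ((finrank_map_le _ _).trans (finrank_lagrangeW_le h _))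
        ((finrank_map_le _ _).trans (finrank_sup_le _ _ (finrank_fluxW_le h r)
          (finrank_map_le _ _)))).trans ?_
      obtain ⟨n, rfl⟩ : ∃ n, k = n + 2 := ⟨k - 2, by omega⟩
      rw [show (((n + 2 : ℕ) : ℤ) - 1 - 1).toNat = n by omega]
      rw [show n + 2 + 2 = n + 4 by ring, choose_four] at h1
      rw [Nat.add_sub_cancel] at h2
      have h3 : (r + 2).choose 3 = (r + 1).choose 2 + (r + 1).choose 3 :=
        Nat.choose_succ_succ' (r + 1) 2
      split_ifs at h1 h2 <;> omega) (fun p hp => Subtype.ext (gradDiv_inj h hr hkr hC p.2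
        (fun L hL => hp _ (Or.inl ⟨L, hL, rfl⟩)) (fun L hL => hp _ (Or.inr ⟨L, hL, rfl⟩))))
      (fun n => (⟨ψ n, hψ n⟩, ⟨φ n, hφ n⟩)) (by
        rintro _ (⟨L, hL, rfl⟩ | ⟨L, hL, rfl⟩)
        · exact H1 L hL
        · exact H2 L hL)
  exact ⟨p.1, (mem_gradDivSub h).1 p.2, fun L hL => hp _ (Or.inl ⟨L, hL, rfl⟩),
    fun L hL => hp _ (Or.inr ⟨L, hL, rfl⟩)⟩

/-! ### The norm of `H^s` -/

theorem tendsto_zero_of_le {f g : ℕ → ℝ≥0∞} (hg : g ⇝ 0) (h : ∀ n, f n ≤ g n) : f ⇝ 0 :=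
  tendsto_of_tendsto_of_tendsto_of_le_of_le tendsto_const_nhds hg (fun _ => zero_le) h

/-- The difference quotient in the Sobolev-Slobodeckij semi-norm. -/
def dq (s : ℝ) (u : E3 → F) (p : E3 × E3) : F := (‖p.1 - p.2‖ ^ (3 / 2 + s))⁻¹ • (u p.1 - u p.2)

/-- The semi-norm of `H^s(Ω)`. -/
def hsSemi (Ω : Set E3) (s : ℝ) (u : E3 → F) : ℝ≥0∞ := eLpNorm (dq s u) 2 (leb (Ω ×ˢ Ω))

/-- The norm of `H^s(Ω)`. -/
def hsNorm (Ω : Set E3) (s : ℝ) (u : E3 → F) : ℝ≥0∞ := eLpNorm u 2 (leb Ω) + hsSemi Ω s u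

theorem eLpNorm_two_sq {α : Type*} [MeasurableSpace α] (f : α → G) (μ : Measure α) :
    eLpNorm f 2 μ ^ 2 = ∫⁻ x, ‖f x‖ₑ ^ 2 ∂μ := by
  have := eLpNorm_nnreal_pow_eq_lintegral (f := f) (μ := μ) (p := 2) two_ne_zero
  simpa using this

theorem enorm_dq_sq (s : ℝ) (u : E3 → F) (x y : E3) :
    ‖dq s u (x, y)‖ₑ ^ 2 = ofReal (‖u x - u y‖ ^ 2 / ‖x - y‖ ^ (3 + 2 * s)) := by
  rw [← ofReal_norm, ← ENNReal.ofReal_pow (norm_nonneg _)]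
  congr 1
  rw [dq, norm_smul, mul_pow, norm_inv, Real.norm_of_nonneg (by positivity), inv_pow,
    ← Real.rpow_natCast, ← Real.rpow_mul (norm_nonneg _), mul_comm, div_eq_mul_inv]
  congr 3
  push_cast; ring

theorem dq_sub (s : ℝ) (u v : E3 → F) : dq s (u - v) = dq s u - dq s v := by
  ext p
  simp only [dq, Pi.sub_apply, ← smul_sub]
  congr 1; abel

theorem dq_add (s : ℝ) (u v : E3 → F) : dq s (u + v) = dq s u + dq s v := by
  ext p
  simp only [dq, Pi.add_apply, ← smul_add]
  congr 1; abel

theorem measurable_dq_coeff (s : ℝ) :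
    Measurable fun p : E3 × E3 => (‖p.1 - p.2‖ ^ (3 / 2 + s))⁻¹ := by fun_prop

theorem aestronglyMeasurable_dq (s : ℝ) {u : E3 → F} (hu : AEStronglyMeasurable u (leb Ω)) :
    AEStronglyMeasurable (dq s u) (leb (Ω ×ˢ Ω)) := by
  rw [volume_eq_prod, ← prod_restrict]
  exact (measurable_dq_coeff s).aestronglyMeasurable.smul (hu.comp_fst.sub hu.comp_snd)

theorem gagliardoSq_eq (s : ℝ) {u : E3 → F} (hu : AEStronglyMeasurable u (leb Ω)) :
    gagliardoSq Ω s u = hsSemi Ω s u ^ 2 := by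
  have h := aestronglyMeasurable_dq s hu
  rw [hsSemi, eLpNorm_two_sq]
  rw [volume_eq_prod, ← prod_restrict] at h ⊢
  rw [lintegral_prod _ (by fun_prop)]
  simp only [enorm_dq_sq]
  rfl

theorem memHs_iff {u : E3 → F} : MemHs Ω s u ↔ AEStronglyMeasurable u (leb Ω) ∧
    hsNorm Ω s u < ⊤ := by
  constructor
  · rintro ⟨h1, h2⟩
    rw [gagliardoSq_eq s h1.1] at h2
    exact ⟨h1.1, ENNReal.add_lt_top.2 ⟨h1.2, by simpa using h2⟩⟩
  · rintro ⟨h1, h2⟩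
    rw [hsNorm, ENNReal.add_lt_top] at h2
    refine ⟨⟨h1, h2.1⟩, ?_⟩
    rw [gagliardoSq_eq s h1]
    simpa using h2.2

theorem tendstoHs_iff {φ : ℕ → E3 → F} {u : E3 → F} (hφ : ∀ n, AEStronglyMeasurable (φ n) (leb Ω))
    (hu : AEStronglyMeasurable u (leb Ω)) :
    TendstoHs Ω s φ u ↔ (fun n => hsNorm Ω s (φ n - u)) ⇝ 0 := by
  have e (n) := gagliardoSq_eq s ((hφ n).sub hu)
  simp only [TendstoHs, e, hsNorm]
  constructor
  · rintro ⟨h1, h2⟩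
    have h3 := h2.ennrpow_const (1 / 2)
    rw [ENNReal.zero_rpow_of_pos (by norm_num)] at h3
    have h4 (x : ℝ≥0∞) : (x ^ 2) ^ (1 / 2 : ℝ) = x := by
      rw [← ENNReal.rpow_natCast, ← ENNReal.rpow_mul]; norm_num
    simp only [h4] at h3
    simpa using h1.add h3
  · intro h
    refine ⟨tendsto_zero_of_le h (fun _ => le_self_add), ?_⟩
    have h1 := tendsto_zero_of_le h (fun n => le_add_self (a := hsSemi Ω s (φ n - u)))
    have := ENNReal.Tendsto.pow (n := 2) h1
    simpa using this

theorem hsSemi_mono {Ω' : Set E3} (h : Ω ⊆ Ω') (s : ℝ) (u : E3 → F) :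
    hsSemi Ω s u ≤ hsSemi Ω' s u :=
  eLpNorm_mono_measure _ (restrict_mono (Set.prod_mono h h) le_rfl)

theorem hsNorm_mono {Ω' : Set E3} (h : Ω ⊆ Ω') (s : ℝ) (u : E3 → F) :
    hsNorm Ω s u ≤ hsNorm Ω' s u :=
  add_le_add (eLpNorm_mono_measure _ (restrict_mono h le_rfl)) (hsSemi_mono h s u)

theorem hsNorm_add_le {u v : E3 → F} (hu : AEStronglyMeasurable u (leb Ω))
    (hv : AEStronglyMeasurable v (leb Ω)) : hsNorm Ω s (u + v) ≤ hsNorm Ω s u + hsNorm Ω s v := by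
  simp only [hsNorm, hsSemi, dq_add]
  calc _ ≤ (eLpNorm u 2 _ + eLpNorm v 2 _) + (eLpNorm (dq s u) 2 _ + eLpNorm (dq s v) 2 _) :=
        add_le_add (eLpNorm_add_le hu hv one_le_two) (eLpNorm_add_le (aestronglyMeasurable_dq s hu)
          (aestronglyMeasurable_dq s hv) one_le_two)
    _ = _ := by ring

theorem hsNorm_sub_comm (Ω : Set E3) (s : ℝ) (u v : E3 → F) :
    hsNorm Ω s (u - v) = hsNorm Ω s (v - u) := by
  simp only [hsNorm, hsSemi, dq_sub]
  rw [eLpNorm_sub_comm, eLpNorm_sub_comm (dq s u)]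

theorem hsNorm_congr {u v : E3 → F} (h : u =ᵐ[leb Ω] v) : hsNorm Ω s u = hsNorm Ω s v := by
  unfold hsNorm hsSemi
  congr 1
  · exact eLpNorm_congr_ae h
  · refine eLpNorm_congr_ae ?_
    rw [volume_eq_prod, ← prod_restrict]
    filter_upwards [Measure.quasiMeasurePreserving_fst.ae h,
      Measure.quasiMeasurePreserving_snd.ae h] with p h1 h2
    rw [dq, dq, h1, h2]

/-! ### Averages over shrinking copies of a convex set -/

/-- A bounded convex open set, with a bound for its diameter. -/
structure IsBody (B : Set E3) (D : ℝ) : Prop where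
  isOpen : IsOpen B
  convex : Convex ℝ B
  pos : 0 < D
  dist_le : ∀ x ∈ closure B, ∀ y ∈ closure B, ‖x - y‖ ≤ D

theorem IsBody.mem (hB : IsBody B D) {x y : E3} (hx : x ∈ closure B) (hy : y ∈ B) {t : ℝ}
    (ht : t ∈ I₀₁) : x + t • (y - x) ∈ B := by
  have := hB.convex.add_smul_sub_mem_interior' hx (hB.isOpen.interior_eq.symm ▸ hy) ht
  rwa [hB.isOpen.interior_eq] at this

theorem IsBody.lintegral_shrink_le (hB : IsBody B D) {x : E3} (hx : x ∈ closure B) {t : ℝ}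
    (ht : t ∈ I₀₁) (g : E3 → ℝ≥0∞) : ∫⁻ y in B, g (x + t • (y - x)) ≤ ofReal (t ^ 3)⁻¹ * ∫⁻ z in B,
    (closedBall x (t * D)).indicator g z := by
  have hd (y : E3) : HasFDerivAt (fun y : E3 => x + t • (y - x))
      (t • ContinuousLinearMap.id ℝ E3) y :=
    (((hasFDerivAt_id y).sub_const x).const_smul t).const_add x
  have hinj : Function.Injective fun y : E3 => x + t • (y - x) := fun y z h => by
    have := smul_right_injective E3 ht.1.ne' (add_left_cancel h)
    exact sub_left_injective this
  have h1 := lintegral_image_eq_lintegral_abs_det_fderiv_mul volume hB.isOpen.measurableSet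
    (fun y _ => (hd y).hasFDerivWithinAt) hinj.injOn g
  have hdet : (t • ContinuousLinearMap.id ℝ E3).det = t ^ 3 := by
    have : (t • ContinuousLinearMap.id ℝ E3).det = LinearMap.det (t • LinearMap.id : E3 →ₗ[ℝ] E3) := rfl
    rw [this, LinearMap.det_smul]
    simp
  have h3 : (0 : ℝ) < t ^ 3 := pow_pos ht.1 3
  simp only [hdet, abs_of_pos h3] at h1
  rw [lintegral_const_mul' _ _ ofReal_ne_top] at h1
  have h4 : ∫⁻ y in B, g (x + t • (y - x)) = ofReal (t ^ 3)⁻¹ *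
      ∫⁻ z in (fun y : E3 => x + t • (y - x)) '' B, g z := by
    rw [h1, ← mul_assoc, ← ofReal_mul (inv_nonneg.2 h3.le), inv_mul_cancel₀ h3.ne',
      ENNReal.ofReal_one, one_mul]
  rw [h4]
  refine mul_le_mul' le_rfl ?_
  rw [setLIntegral_indicator Metric.isClosed_closedBall.measurableSet]
  refine lintegral_mono_set ?_
  rintro _ ⟨y, hy, rfl⟩
  refine ⟨?_, hB.mem hx hy ht⟩
  rw [Metric.mem_closedBall, dist_eq_norm, add_sub_cancel_left, norm_smul, Real.norm_of_nonneg ht.1.le]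
  exact mul_le_mul_of_nonneg_left (hB.dist_le y (subset_closure hy) x hx) ht.1.le

theorem IsBody.measure_lt_top (hB : IsBody B D) : volume B < ⊤ := by
  refine (Metric.isBounded_iff.2 ⟨D, fun x hx y hy => ?_⟩ : Bornology.IsBounded B).measure_lt_top
  rw [dist_eq_norm]
  exact hB.dist_le x (subset_closure hx) y (subset_closure hy)

theorem IsBody.measure_pos (hB : IsBody B D) (hne : B.Nonempty) :
    volume B ≠ 0 := (hB.isOpen.measure_pos volume hne).ne'

theorem stronglyMeasurable_dq (s : ℝ) {φ : E3 → F} (hφ : Continuous φ) :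
    StronglyMeasurable (dq s φ) :=
  (measurable_dq_coeff s).stronglyMeasurable.smul
    ((hφ.comp continuous_fst).sub (hφ.comp continuous_snd)).stronglyMeasurable

theorem enorm_sub_sq_le (s : ℝ) (hs : 0 < s) (φ : E3 → F) {x y : E3} {R : ℝ} (h : ‖x - y‖ ≤ R) :
    ‖φ x - φ y‖ₑ ^ 2 ≤ ofReal (R ^ (3 + 2 * s)) * ‖dq s φ (x, y)‖ₑ ^ 2 := by
  rw [enorm_dq_sq, ← ofReal_mul (by have := (norm_nonneg _).trans h; positivity),
    ← ofReal_norm, ← ENNReal.ofReal_pow (norm_nonneg _)]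
  refine ENNReal.ofReal_le_ofReal ?_
  rcases eq_or_ne x y with rfl | hxy
  · simp
  have h0 : 0 < ‖x - y‖ := norm_pos_iff.2 (sub_ne_zero.2 hxy)
  rw [← mul_div_assoc, le_div_iff₀ (by positivity), mul_comm]
  gcongr

theorem IsBody.lintegral_pair_le (hB : IsBody B D) {κ M : ℝ} (hs : 0 < s)
    {μ : Measure E3} [IsFiniteMeasure μ] (hμ : ∀ᵐ P ∂μ, P ∈ closure B) (hM : ∀ q R, 0 < R → μ
    (closedBall q R) ≤ ofReal (M * R ^ κ)) {φ : E3 → F} (hφ : Continuous φ) {t : ℝ} (ht : t ∈ I₀₁) :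
    ∫⁻ P, (∫⁻ y in B, ∫⁻ y' in B, ‖φ (P + (t / 2) • (y - P)) - φ (P + t • (y' - P))‖ₑ ^ 2) ∂μ ≤
    ofReal ((2 * D * t) ^ (3 + 2 * s) * ((t ^ 3)⁻¹ * (((t / 2) ^ 3)⁻¹ * (M * (t / 2 * D) ^ κ)))) *
    hsSemi B s φ ^ 2 := by
  have hD := hB.pos
  have ht0 := ht.1
  have ht' : t / 2 ∈ I₀₁ := ⟨by linarith, by linarith [ht.2]⟩
  set H : E3 → E3 → ℝ≥0∞ := fun z z' => ‖dq s φ (z, z')‖ₑ ^ 2 with hH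
  have hHm : Measurable (uncurry H) := (stronglyMeasurable_dq s hφ).enorm.pow_const 2
  set Hh : E3 → ℝ≥0∞ := fun z => ∫⁻ z' in B, H z z' with hHh
  have hHhm : Measurable Hh := hHm.lintegral_prod_right'
  have hG : hsSemi B s φ ^ 2 = ∫⁻ z in B, Hh z := by
    rw [hsSemi, eLpNorm_two_sq, volume_eq_prod, ← prod_restrict,
      lintegral_prod (fun p => ‖dq s φ p‖ₑ ^ 2) hHm.aemeasurable]
  have h1 (P : E3) (hP : P ∈ closure B) : ∫⁻ y in B, ∫⁻ y' in B,
      ‖φ (P + (t / 2) • (y - P)) - φ (P + t • (y' - P))‖ₑ ^ 2 ≤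
      ofReal ((2 * D * t) ^ (3 + 2 * s)) * (ofReal (t ^ 3)⁻¹ * (ofReal ((t / 2) ^ 3)⁻¹ *
        ∫⁻ z in B, (closedBall P (t / 2 * D)).indicator Hh z)) := by
    calc _ ≤ ∫⁻ y in B, ofReal ((2 * D * t) ^ (3 + 2 * s)) * (ofReal (t ^ 3)⁻¹ *
          Hh (P + (t / 2) • (y - P))) := by
          refine setLIntegral_mono' hB.isOpen.measurableSet fun y hy => ?_
          calc _ ≤ ∫⁻ y' in B, ofReal ((2 * D * t) ^ (3 + 2 * s)) *
                H (P + (t / 2) • (y - P)) (P + t • (y' - P)) := by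
                refine setLIntegral_mono' hB.isOpen.measurableSet fun y' hy' =>
                  enorm_sub_sq_le s hs φ ?_
                have e : P + (t / 2) • (y - P) - (P + t • (y' - P)) =
                    (t / 2) • (y - P) - t • (y' - P) := by abel
                rw [e]
                refine (norm_sub_le _ _).trans ?_
                rw [norm_smul, norm_smul, Real.norm_of_nonneg ht'.1.le, Real.norm_of_nonneg ht0.le]
                have a1 := hB.dist_le y (subset_closure hy) P hP
                have a2 := hB.dist_le y' (subset_closure hy') P hP
                have a3 := mul_le_mul_of_nonneg_left a1 ht'.1.le
                have a4 := mul_le_mul_of_nonneg_left a2 ht0.le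
                nlinarith
            _ = ofReal ((2 * D * t) ^ (3 + 2 * s)) *
                ∫⁻ y' in B, H (P + (t / 2) • (y - P)) (P + t • (y' - P)) :=
                lintegral_const_mul' _ _ ofReal_ne_top
            _ ≤ _ := by
                refine mul_le_mul' le_rfl ((hB.lintegral_shrink_le hP ht _).trans
                  (mul_le_mul' le_rfl (lintegral_mono fun z => ?_)))
                exact Set.indicator_le_self' (fun _ _ => zero_le) z
      _ = ofReal ((2 * D * t) ^ (3 + 2 * s)) * (ofReal (t ^ 3)⁻¹ *
          ∫⁻ y in B, Hh (P + (t / 2) • (y - P))) := by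
          rw [lintegral_const_mul' _ _ ofReal_ne_top, lintegral_const_mul' _ _ ofReal_ne_top]
      _ ≤ _ := by refine mul_le_mul' le_rfl (mul_le_mul' le_rfl (hB.lintegral_shrink_le hP ht' _))
  have h2 : ∫⁻ P, (∫⁻ z in B, (closedBall P (t / 2 * D)).indicator Hh z) ∂μ ≤
      ofReal (M * (t / 2 * D) ^ κ) * ∫⁻ z in B, Hh z := by
    have hm : Measurable (uncurry fun (P z : E3) => (closedBall P (t / 2 * D)).indicator Hh z) := by
      have : (uncurry fun (P z : E3) =>
          (closedBall P (t / 2 * D)).indicator Hh z) =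
          Set.indicator {p : E3 × E3 | dist p.2 p.1 ≤ t / 2 * D} fun p => Hh p.2 := by
        ext ⟨P, z⟩
        simp [Set.indicator]
      rw [this]
      exact (hHhm.comp measurable_snd).indicator
        (isClosed_le (by fun_prop) continuous_const).measurableSet
    rw [lintegral_lintegral_swap hm.aemeasurable, ← lintegral_const_mul' _ _ ofReal_ne_top]
    refine lintegral_mono fun z => ?_
    have : (fun P => (closedBall P (t / 2 * D)).indicator Hh z) =
        (closedBall z (t / 2 * D)).indicator fun _ => Hh z := by
      ext P
      simp [Set.indicator, dist_comm]
    rw [this, lintegral_indicator_const Metric.isClosed_closedBall.measurableSet, mul_comm]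
    exact mul_le_mul' (hM z _ (by positivity)) le_rfl
  calc _ ≤ ∫⁻ P, ofReal ((2 * D * t) ^ (3 + 2 * s)) * (ofReal (t ^ 3)⁻¹ * (ofReal ((t / 2) ^ 3)⁻¹ *
        ∫⁻ z in B, (closedBall P (t / 2 * D)).indicator Hh z)) ∂μ := by
        refine lintegral_mono_ae ?_
        filter_upwards [hμ] with P hP using h1 P hP
    _ = ofReal ((2 * D * t) ^ (3 + 2 * s)) * (ofReal (t ^ 3)⁻¹ * (ofReal ((t / 2) ^ 3)⁻¹ *
        ∫⁻ P, (∫⁻ z in B, (closedBall P (t / 2 * D)).indicator Hh z) ∂μ)) := by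
        rw [lintegral_const_mul' _ _ ofReal_ne_top, lintegral_const_mul' _ _ ofReal_ne_top,
          lintegral_const_mul' _ _ ofReal_ne_top]
    _ ≤ ofReal ((2 * D * t) ^ (3 + 2 * s)) * (ofReal (t ^ 3)⁻¹ *
        (ofReal ((t / 2) ^ 3)⁻¹ * (ofReal (M * (t / 2 * D) ^ κ) *
        hsSemi B s φ ^ 2))) := by
        rw [hG]
        exact mul_le_mul' le_rfl (mul_le_mul' le_rfl (mul_le_mul' le_rfl h2))
    _ = _ := by
        rw [ofReal_mul (p := (2 * D * t) ^ (3 + 2 * s)) (by positivity),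
          ofReal_mul (p := (t ^ 3)⁻¹) (by positivity),
          ofReal_mul (p := ((t / 2) ^ 3)⁻¹) (by positivity)]
        simp only [mul_assoc]

/-- The mean, over a measure `μ`, of the integrals of `‖φ‖` over the copies of `B` scaled by `t`
towards a point. -/
def shrinkAvg (B : Set E3) (μ : Measure E3) (φ : E3 → F) (t : ℝ) : ℝ≥0∞ :=
  ∫⁻ P, (∫⁻ y in B, ‖φ (P + t • (y - P))‖ₑ) ∂μ

theorem IsBody.shrinkAvg_half_le (hB : IsBody B D) (hne : B.Nonempty) (hs : 0 < s) (κ : ℝ) {M m : ℝ}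
    (hM0 : 0 ≤ M) : ∃ C : ℝ, 0 ≤ C ∧ ∀ (μ : Measure E3) [IsFiniteMeasure μ], μ Set.univ ≤ ofReal m →
    (∀ᵐ P ∂μ, P ∈ closure B) → (∀ q R, 0 < R → μ (closedBall q R) ≤ ofReal (M * R ^ κ)) → ∀ φ :
    E3 → F, Continuous φ → ∀ t ∈ I₀₁, shrinkAvg B μ φ (t / 2) ≤
    shrinkAvg B μ φ t + ofReal (C * t ^ (s - 3 / 2 + κ / 2)) * hsSemi B s φ := by
  have hD := hB.pos
  have hV0 := hB.measure_pos hne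
  have hVt := hB.measure_lt_top
  set K1 : ℝ := (2 * D) ^ (3 + 2 * s) * (8 * (M * (D / 2) ^ κ)) with hK1
  have hK1n : 0 ≤ K1 := by positivity
  refine ⟨Real.sqrt K1 * ((volume B)⁻¹ * (ofReal m * (volume B * volume B)) ^ (1 / 2 : ℝ)).toReal,
    by positivity, fun μ _ hm hμ hM φ hφ t ht => ?_⟩
  have ht0 := ht.1
  set f : E3 × E3 × E3 → F := fun p =>
    φ (p.1 + (t / 2) • (p.2.1 - p.1)) - φ (p.1 + t • (p.2.2 - p.1)) with hf
  have hfc : Continuous f := by fun_prop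
  have hfm : StronglyMeasurable f := hfc.stronglyMeasurable
  set π : Measure (E3 × E3 × E3) := μ.prod ((leb B).prod (leb B)) with hπ
  have : IsFiniteMeasure (leb B) := ⟨by simpa using hVt⟩
  have hL2 : eLpNorm f 2 π ≤ ofReal (Real.sqrt K1 * t ^ (s - 3 / 2 + κ / 2)) * hsSemi B s φ := by
    have key : eLpNorm f 2 π ^ 2 ≤ (ofReal (Real.sqrt K1 * t ^ (s - 3 / 2 + κ / 2)) *
        hsSemi B s φ) ^ 2 := by
      rw [eLpNorm_two_sq, hπ, lintegral_prod _ (hfm.enorm.pow_const 2).aemeasurable]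
      have h1 := hB.lintegral_pair_le hs hμ hM hφ ht
      have e (P : E3) : ∫⁻ y, ‖f (P, y)‖ₑ ^ 2 ∂((leb B).prod (leb B)) =
          ∫⁻ y in B, ∫⁻ y' in B, ‖φ (P + (t / 2) • (y - P)) - φ (P + t • (y' - P))‖ₑ ^ 2 :=
        lintegral_prod _ ((hfm.comp_measurable (by fun_prop :
          Measurable fun y : E3 × E3 => (P, y))).enorm.pow_const 2).aemeasurable
      simp only [e]
      refine h1.trans (le_of_eq ?_)
      rw [mul_pow, ← ENNReal.ofReal_pow (by positivity), mul_pow, Real.sq_sqrt hK1n]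
      congr 2
      rw [← Real.rpow_natCast (t ^ _), ← Real.rpow_mul ht0.le, hK1,
        Real.mul_rpow (by positivity) ht0.le,
        show t / 2 * D = D / 2 * t by ring, Real.mul_rpow (by positivity) ht0.le,
        show (t ^ 3)⁻¹ = t ^ (-3 : ℝ) by rw [Real.rpow_neg ht0.le]; norm_cast,
        show ((t / 2) ^ 3)⁻¹ = 8 * t ^ (-3 : ℝ) by
          rw [Real.rpow_neg ht0.le, div_pow, inv_div, div_eq_mul_inv]; norm_cast,
        show (s - 3 / 2 + κ / 2) * ((2 : ℕ) : ℝ) = (3 + 2 * s) + (-3) + (-3) + κ by push_cast; ring,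
        Real.rpow_add ht0 _ κ, Real.rpow_add ht0 (3 + 2 * s + -3) (-3),
        Real.rpow_add ht0 (3 + 2 * s) (-3)]
      generalize t ^ (3 + 2 * s) = A₁
      generalize t ^ (-3 : ℝ) = A₂
      ring
    exact (ENNReal.pow_le_pow_left_iff two_ne_zero).1 key
  have hL1 : ∫⁻ P, (∫⁻ y in B, ∫⁻ y' in B, ‖f (P, y, y')‖ₑ) ∂μ ≤
      eLpNorm f 2 π * (ofReal m * (volume B * volume B)) ^ (1 / 2 : ℝ) := by
    have h1 := eLpNorm_le_eLpNorm_mul_rpow_measure_univ (μ := π) (p := 1) (q := 2) one_le_two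
      hfm.aestronglyMeasurable
    rw [eLpNorm_one_eq_lintegral_enorm, hπ, lintegral_prod _ hfm.enorm.aemeasurable] at h1
    have e (P : E3) : ∫⁻ y, ‖f (P, y)‖ₑ ∂((leb B).prod (leb B)) =
        ∫⁻ y in B, ∫⁻ y' in B, ‖f (P, y, y')‖ₑ :=
      lintegral_prod _ ((hfm.comp_measurable (by fun_prop :
          Measurable fun y : E3 × E3 => (P, y))).enorm).aemeasurable
    simp only [e] at h1
    refine h1.trans (mul_le_mul' le_rfl ?_)
    have : μ.prod ((leb B).prod (leb B)) Set.univ = μ Set.univ * (volume B * volume B) := by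
      rw [← Set.univ_prod_univ, Measure.prod_prod, ← Set.univ_prod_univ, Measure.prod_prod]
      simp
    rw [this]
    norm_num
    gcongr
  have hmain : volume B * shrinkAvg B μ φ (t / 2) ≤ volume B * shrinkAvg B μ φ t +
      ∫⁻ P, (∫⁻ y in B, ∫⁻ y' in B, ‖f (P, y, y')‖ₑ) ∂μ := by
    rw [shrinkAvg, shrinkAvg, ← lintegral_const_mul' _ _ hVt.ne, ← lintegral_const_mul' _ _ hVt.ne]
    have hA : Measurable fun P => ∫⁻ y in B, ‖φ (P + t • (y - P))‖ₑ :=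
      (hφ.comp (by fun_prop : Continuous fun p : E3 × E3 =>
        p.1 + t • (p.2 - p.1))).stronglyMeasurable.enorm.lintegral_prod_right'
    rw [← lintegral_add_left (hA.const_mul _)]
    refine lintegral_mono fun P => ?_
    have h1 (y : E3) : volume B * ‖φ (P + (t / 2) • (y - P))‖ₑ ≤
        (∫⁻ y' in B, ‖φ (P + t • (y' - P))‖ₑ) + ∫⁻ y' in B, ‖f (P, y, y')‖ₑ := by
      have hm' : Measurable fun y' => ‖φ (P + t • (y' - P))‖ₑ := (hφ.comp (by fun_prop :
        Continuous fun y : E3 => P + t • (y - P))).stronglyMeasurable.enorm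
      rw [← lintegral_add_left hm', mul_comm, ← setLIntegral_const]
      refine lintegral_mono fun y' => ?_
      have e : φ (P + (t / 2) • (y - P)) = φ (P + t • (y' - P)) + f (P, y, y') := by
        simp only [hf]; abel
      rw [e]
      exact enorm_add_le _ _
    calc _ = ∫⁻ y in B, volume B * ‖φ (P + (t / 2) • (y - P))‖ₑ :=
          (lintegral_const_mul' _ _ hVt.ne).symm
      _ ≤ ∫⁻ y in B, ((∫⁻ y' in B, ‖φ (P + t • (y' - P))‖ₑ) + ∫⁻ y' in B, ‖f (P, y, y')‖ₑ) :=
          lintegral_mono h1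
      _ = _ := by rw [lintegral_add_left measurable_const, setLIntegral_const, mul_comm]
  have h3 : shrinkAvg B μ φ (t / 2) = (volume B)⁻¹ * (volume B * shrinkAvg B μ φ (t / 2)) := by
    rw [← mul_assoc, ENNReal.inv_mul_cancel hV0 hVt.ne, one_mul]
  have hc : (volume B)⁻¹ * (ofReal m * (volume B * volume B)) ^ (1 / 2 : ℝ) ≠ ⊤ := by
    refine mul_ne_top (ENNReal.inv_ne_top.2 hV0) (ENNReal.rpow_ne_top_of_nonneg (by norm_num)
      (mul_ne_top ofReal_ne_top (mul_ne_top hVt.ne hVt.ne)))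
  rw [h3]
  calc _ ≤ (volume B)⁻¹ * (volume B * shrinkAvg B μ φ t +
      (ofReal (Real.sqrt K1 * t ^ (s - 3 / 2 + κ / 2)) * hsSemi B s φ) *
        (ofReal m * (volume B * volume B)) ^ (1 / 2 : ℝ)) :=
        mul_le_mul' le_rfl (hmain.trans (add_le_add le_rfl (hL1.trans (mul_le_mul' hL2 le_rfl))))
    _ = _ := by
        rw [mul_add, ← mul_assoc, ENNReal.inv_mul_cancel hV0 hVt.ne, one_mul,
          mul_right_comm (Real.sqrt K1), ofReal_mul (by positivity), ofReal_mul (by positivity),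
          ofReal_mul (p := Real.sqrt K1) (by positivity), ENNReal.ofReal_toReal hc]
        ring

theorem lintegral_enorm_le_eLpNorm_two {φ : E3 → F} (hφ : AEStronglyMeasurable φ (leb B)) :
    ∫⁻ y in B, ‖φ y‖ₑ ≤ volume B ^ (1 / 2 : ℝ) * eLpNorm φ 2 (leb B) := by
  have h1 := eLpNorm_le_eLpNorm_mul_rpow_measure_univ (p := 1) (q := 2) one_le_two hφ
  rw [eLpNorm_one_eq_lintegral_enorm, Measure.restrict_apply_univ] at h1
  norm_num at h1
  rw [mul_comm]
  simpa using h1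

theorem IsBody.isCompact_closure (hB : IsBody B D) : IsCompact (closure B) := by
  refine Metric.isCompact_of_isClosed_isBounded isClosed_closure
    (Metric.isBounded_iff.2 ⟨D, fun x hx y hy => ?_⟩)
  rw [dist_eq_norm]
  exact hB.dist_le x hx y hy

theorem shrinkAvg_dirac (x : E3) {φ : E3 → F} (hφ : Continuous φ) (t : ℝ) :
    shrinkAvg B (Measure.dirac x) φ t = ∫⁻ y in B, ‖φ (x + t • (y - x))‖ₑ := by
  rw [shrinkAvg, lintegral_dirac']
  exact (hφ.comp (by fun_prop : Continuous fun p : E3 × E3 =>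
        p.1 + t • (p.2 - p.1))).stronglyMeasurable.enorm.lintegral_prod_right'

theorem lintegral_Ioc_half (f : ℝ → ℝ≥0∞) :
    ∫⁻ t in I₀₁, f (t / 2) = 2 * ∫⁻ t in Ioc (0 : ℝ) (1 / 2), f t := by
  have h1 := lintegral_image_eq_lintegral_abs_deriv_mul (s := I₀₁)
    (f := fun t => t / 2) (f' := fun _ => 1 / 2) measurableSet_Ioc
    (fun x _ => ((hasDerivAt_id x).div_const 2).hasDerivWithinAt)
    (fun x _ y _ h => by simpa using h) f
  have h2 : (fun t : ℝ => t / 2) '' Ioc 0 1 = Ioc 0 (1 / 2) := by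
    ext t
    simp only [Set.mem_image, Set.mem_Ioc]
    constructor
    · rintro ⟨x, ⟨h1, h2⟩, rfl⟩
      constructor <;> linarith
    · rintro ⟨h1, h2⟩
      exact ⟨2 * t, ⟨by linarith, by linarith⟩, by ring⟩
  rw [h2, lintegral_const_mul' _ _ ofReal_ne_top] at h1
  rw [h1, ← mul_assoc, show (2 : ℝ≥0∞) = ofReal 2 by simp, ← ofReal_mul (by norm_num)]
  norm_num

theorem IsBody.exists_bound (hB : IsBody B D) {φ : E3 → F} (hφ : Continuous φ) : ∃ M :
    ℝ, ∀ x ∈ closure B, ‖φ x‖ ≤ M :=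
  hB.isCompact_closure.exists_bound_of_continuousOn hφ.continuousOn

/-- The integrals of `‖φ‖` over the cone with apex `x` and base `B`. -/
theorem IsBody.exists_cone_bound (hB : IsBody B D) (hne : B.Nonempty) (hs : 1 / 2 < s) : ∃ C :
    ℝ≥0, ∀ x ∈ closure B, ∀ φ :
    E3 → F, Continuous φ → ∫⁻ t in I₀₁, ∫⁻ y in B, ‖φ (x + t • (y - x))‖ₑ ≤ C * hsNorm B s φ := by
  obtain ⟨C, hC, H⟩ := hB.shrinkAvg_half_le (F := F) hne (by linarith : 0 < s) 0 (M := 1) (m := 1)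
    zero_le_one
  have hVt := hB.measure_lt_top
  set β : ℝ := s - 3 / 2 + 0 / 2 with hβ
  set J : ℝ≥0∞ := ∫⁻ t in I₀₁, ofReal (C * t ^ β) with hJ
  have hJt : J ≠ ⊤ := by
    have : IntegrableOn (fun t : ℝ => C * t ^ β) (Ioc 0 1) := by
      have := intervalIntegral.intervalIntegrable_rpow' (a := 0) (b := 1) (r := β)
        (by rw [hβ]; linarith)
      rw [intervalIntegrable_iff_integrableOn_Ioc_of_le zero_le_one] at this
      exact this.const_mul C
    exact this.lintegral_lt_top.ne
  have hV2 : volume B ^ (1 / 2 : ℝ) ≠ ⊤ := ENNReal.rpow_ne_top_of_nonneg (by norm_num) hVt.ne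
  refine ⟨(J + 8 * volume B ^ (1 / 2 : ℝ)).toNNReal, fun x hx φ hφ => ?_⟩
  rw [coe_toNNReal (ENNReal.add_ne_top.2 ⟨hJt, mul_ne_top (by simp) hV2⟩)]
  set ν : ℝ → ℝ≥0∞ := fun t => ∫⁻ y in B, ‖φ (x + t • (y - x))‖ₑ with hν
  have hstep (t : ℝ) (ht : t ∈ I₀₁) : ν (t / 2) ≤ ν t + ofReal (C * t ^ β) * hsSemi B s φ := by
    have := H (Measure.dirac x) (by simp) (by rw [ae_dirac_eq]; exact hx)
      (fun q R hR => prob_le_one.trans (by simp)) φ hφ t ht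
    rwa [shrinkAvg_dirac x hφ, shrinkAvg_dirac x hφ] at this
  have hνm : Measurable ν := (hφ.comp (by fun_prop : Continuous fun p : ℝ × E3 =>
      x + p.1 • (p.2 - x))).stronglyMeasurable.enorm.lintegral_prod_right'
  set I := ∫⁻ t in I₀₁, ν t with hI
  have hIt : I ≠ ⊤ := by
    obtain ⟨M, hM⟩ := hB.exists_bound hφ
    refine ne_top_of_le_ne_top (b := ∫⁻ t in I₀₁, ofReal M * volume B) ?_
      (setLIntegral_mono' measurableSet_Ioc fun t ht => ?_)
    · rw [setLIntegral_const]
      exact mul_ne_top (mul_ne_top ofReal_ne_top hVt.ne) (by simp)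
    · rw [← setLIntegral_const]
      refine setLIntegral_mono' hB.isOpen.measurableSet fun y hy => ?_
      rw [← ofReal_norm]
      exact ENNReal.ofReal_le_ofReal (hM _ (subset_closure (hB.mem hx hy ht)))
  have h1 : 2 * ∫⁻ t in Ioc (0 : ℝ) (1 / 2), ν t ≤ I + J * hsSemi B s φ := by
    rw [← lintegral_Ioc_half]
    refine (setLIntegral_mono' measurableSet_Ioc hstep).trans (le_of_eq ?_)
    rw [lintegral_add_left hνm, lintegral_mul_const'' _ (by fun_prop)]
  have h2 : ∫⁻ t in Ioc (1 / 2 : ℝ) 1, ν t ≤ 4 * ∫⁻ y in B, ‖φ y‖ₑ := by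
    calc _ ≤ ∫⁻ t in Ioc (1 / 2 : ℝ) 1, 8 * ∫⁻ y in B, ‖φ y‖ₑ := by
          refine setLIntegral_mono' measurableSet_Ioc fun t ht => ?_
          have ht' : t ∈ I₀₁ := ⟨by linarith [ht.1], ht.2⟩
          refine (hB.lintegral_shrink_le hx ht' fun y => ‖φ y‖ₑ).trans (mul_le_mul' ?_
            (lintegral_mono fun z => Set.indicator_le_self' (fun _ _ => zero_le) z))
          rw [show (8 : ℝ≥0∞) = ofReal 8 by simp]
          refine ENNReal.ofReal_le_ofReal ?_
          rw [inv_le_comm₀ (pow_pos ht'.1 3) (by norm_num)]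
          calc (8 : ℝ)⁻¹ = (1 / 2) ^ 3 := by norm_num
            _ ≤ t ^ 3 := pow_le_pow_left₀ (by norm_num) ht.1.le 3
      _ = _ := by
          rw [setLIntegral_const, Real.volume_Ioc, mul_right_comm]
          congr 1
          rw [show (8 : ℝ≥0∞) = ofReal 8 by simp, ← ofReal_mul (by norm_num)]
          norm_num
  have h3 : I = (∫⁻ t in Ioc (0 : ℝ) (1 / 2), ν t) + ∫⁻ t in Ioc (1 / 2 : ℝ) 1, ν t := by
    rw [hI, ← Set.Ioc_union_Ioc_eq_Ioc (by norm_num : (0 : ℝ) ≤ 1 / 2) (by norm_num : (1 / 2 : ℝ) ≤ 1),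
      lintegral_union measurableSet_Ioc (Set.Ioc_disjoint_Ioc_of_le le_rfl)]
  have h4 : I + I ≤ I + (J * hsSemi B s φ + 8 * ∫⁻ y in B, ‖φ y‖ₑ) := by
    calc I + I = 2 * (∫⁻ t in Ioc (0 : ℝ) (1 / 2), ν t) +
          2 * ∫⁻ t in Ioc (1 / 2 : ℝ) 1, ν t := by rw [← two_mul, h3, mul_add]
      _ ≤ (I + J * hsSemi B s φ) + 2 * (4 * ∫⁻ y in B, ‖φ y‖ₑ) :=
          add_le_add h1 (mul_le_mul' le_rfl h2)
      _ = _ := by rw [← mul_assoc, add_assoc]; norm_num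
  calc I ≤ J * hsSemi B s φ + 8 * ∫⁻ y in B, ‖φ y‖ₑ := (ENNReal.add_le_add_iff_left hIt).1 h4
    _ ≤ J * hsSemi B s φ + 8 * (volume B ^ (1 / 2 : ℝ) * eLpNorm φ 2 (leb B)) :=
        add_le_add le_rfl (mul_le_mul' le_rfl
          (lintegral_enorm_le_eLpNorm_two hφ.aestronglyMeasurable))
    _ ≤ _ := by
        rw [hsNorm, add_mul, ← mul_assoc]
        exact add_le_add (mul_le_mul' le_rfl le_add_self) (mul_le_mul' le_rfl le_self_add)

/-- The trace inequality for a measure of dimension `κ > 3 - 2 s`. -/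
theorem IsBody.exists_trace_bound (hB : IsBody B D) (hne : B.Nonempty) {κ : ℝ} (hs : 0 < s)
    (hκ : 0 < s - 3 / 2 + κ / 2) {M : ℝ} (hM0 : 0 ≤ M) (μ : Measure E3) [IsFiniteMeasure μ]
    (hμ : ∀ᵐ P ∂μ, P ∈ closure B) (hM : ∀ q R, 0 < R → μ (closedBall q R) ≤ ofReal (M * R ^ κ)) :
    ∃ C : ℝ≥0, ∀ φ : E3 → F, Continuous φ → ∫⁻ P, ‖φ P‖ₑ ∂μ ≤ C * hsNorm B s φ := by
  obtain ⟨C, hC, H⟩ := hB.shrinkAvg_half_le (F := F) hne hs κ (M := M) (m := (μ Set.univ).toReal) hM0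
  have hVt := hB.measure_lt_top
  have hV0 := hB.measure_pos hne
  set β : ℝ := s - 3 / 2 + κ / 2 with hβ
  set ρ : ℝ := (1 / 2 : ℝ) ^ β with hρ
  have hρ1 : ρ < 1 := Real.rpow_lt_one (by norm_num) (by norm_num) hκ
  have hρ0 : 0 ≤ ρ := by positivity
  set A : ℝ := C * (1 - ρ)⁻¹ with hA
  have hV2 : volume B ^ (1 / 2 : ℝ) ≠ ⊤ := ENNReal.rpow_ne_top_of_nonneg (by norm_num) hVt.ne
  set E : ℝ≥0∞ := (volume B)⁻¹ * (μ Set.univ * volume B ^ (1 / 2 : ℝ) + ofReal A) with hE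
  have hEt : E ≠ ⊤ := mul_ne_top (ENNReal.inv_ne_top.2 hV0)
    (ENNReal.add_ne_top.2 ⟨mul_ne_top (measure_ne_top _ _) hV2, ofReal_ne_top⟩)
  refine ⟨E.toNNReal, fun φ hφ => ?_⟩
  rw [coe_toNNReal hEt]
  have hj (j : ℕ) : shrinkAvg B μ φ ((1 / 2) ^ j) ≤ shrinkAvg B μ φ 1 +
      ofReal (∑ i ∈ Finset.range j, C * ρ ^ i) * hsSemi B s φ := by
    induction j with
    | zero => simp
    | succ j ih =>
      have h1 := H μ (ENNReal.ofReal_toReal (measure_ne_top _ _)).ge hμ hM φ hφ ((1 / 2) ^ j)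
        ⟨by positivity, pow_le_one₀ (by norm_num) (by norm_num)⟩
      have h2 : ((1 / 2 : ℝ) ^ j) ^ β = ρ ^ j := by
        rw [hρ, ← Real.rpow_natCast, ← Real.rpow_natCast, ← Real.rpow_mul (by norm_num),
          ← Real.rpow_mul (by norm_num), mul_comm]
      rw [h2, show (1 / 2 : ℝ) ^ j / 2 = (1 / 2) ^ (j + 1) by rw [pow_succ]; ring] at h1
      refine h1.trans ((add_le_add ih le_rfl).trans (le_of_eq ?_))
      rw [Finset.sum_range_succ, ENNReal.ofReal_add (Finset.sum_nonneg fun i _ => by positivity)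
        (by positivity), add_mul, add_assoc]
  have hj' (j : ℕ) : shrinkAvg B μ φ ((1 / 2) ^ j) ≤
      shrinkAvg B μ φ 1 + ofReal A * hsSemi B s φ := by
    refine (hj j).trans (add_le_add le_rfl (mul_le_mul' (ENNReal.ofReal_le_ofReal ?_) le_rfl))
    rw [← Finset.mul_sum]
    exact mul_le_mul_of_nonneg_left (by
      rw [← tsum_geometric_of_lt_one hρ0 hρ1]
      exact Summable.sum_le_tsum _ (fun i _ => by positivity) (summable_geometric_of_lt_one hρ0 hρ1)) hC
  have h1 : shrinkAvg B μ φ 1 = μ Set.univ * ∫⁻ y in B, ‖φ y‖ₑ := by simp [shrinkAvg, mul_comm]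
  have : IsFiniteMeasure (leb B) := ⟨by simpa using hVt⟩
  have hliminf : volume B * ∫⁻ P, ‖φ P‖ₑ ∂μ ≤ shrinkAvg B μ φ 1 + ofReal A * hsSemi B s φ := by
    have hm (t : ℝ) : Measurable fun p : E3 × E3 => ‖φ (p.1 + t • (p.2 - p.1))‖ₑ :=
      (hφ.comp (by fun_prop : Continuous fun p : E3 × E3 =>
        p.1 + t • (p.2 - p.1))).stronglyMeasurable.enorm
    have hb (t : ℝ) : shrinkAvg B μ φ t = ∫⁻ p, ‖φ (p.1 + t • (p.2 - p.1))‖ₑ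
        ∂(μ.prod (leb B)) := (lintegral_prod _ (hm t).aemeasurable).symm
    have h2 := lintegral_liminf_le (u := atTop) (μ := μ.prod (leb B))
      (f := fun (j : ℕ) (p : E3 × E3) => ‖φ (p.1 + (1 / 2 : ℝ) ^ j • (p.2 - p.1))‖ₑ)
      (fun j => hm _)
    have h3 (p : E3 × E3) : liminf (fun j : ℕ => ‖φ (p.1 + (1 / 2 : ℝ) ^ j • (p.2 - p.1))‖ₑ) atTop =
        ‖φ p.1‖ₑ := by
      refine Tendsto.liminf_eq ?_
      have h4 : (fun j : ℕ => (1 / 2 : ℝ) ^ j) ⇝ 0 :=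
        tendsto_pow_atTop_nhds_zero_of_lt_one (by norm_num) (by norm_num)
      have h5 : Continuous fun t : ℝ => ‖φ (p.1 + t • (p.2 - p.1))‖ₑ := by fun_prop
      have := (h5.tendsto 0).comp h4
      rwa [zero_smul, add_zero] at this
    simp only [h3] at h2
    rw [lintegral_prod (fun a : E3 × E3 => ‖φ a.1‖ₑ)
      (hφ.comp continuous_fst).stronglyMeasurable.enorm.aemeasurable] at h2
    simp only [lintegral_const, Measure.restrict_apply_univ] at h2
    rw [lintegral_mul_const' _ _ hVt.ne, mul_comm] at h2
    refine h2.trans (liminf_le_of_frequently_le' (Eventually.frequently (f := atTop)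
      (of_forall fun j => ?_)))
    rw [← hb]
    exact hj' j
  calc ∫⁻ P, ‖φ P‖ₑ ∂μ = (volume B)⁻¹ * (volume B * ∫⁻ P, ‖φ P‖ₑ ∂μ) := by
        rw [← mul_assoc, ENNReal.inv_mul_cancel hV0 hVt.ne, one_mul]
    _ ≤ (volume B)⁻¹ * (μ Set.univ * (volume B ^ (1 / 2 : ℝ) * eLpNorm φ 2 (leb B)) +
        ofReal A * hsSemi B s φ) := by
        refine mul_le_mul' le_rfl (hliminf.trans (add_le_add ?_ le_rfl))
        rw [h1]
        exact mul_le_mul' le_rfl (lintegral_enorm_le_eLpNorm_two hφ.aestronglyMeasurable)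
    _ ≤ _ := by
        rw [hE, mul_assoc, add_mul, hsNorm, ← mul_assoc (μ _)]
        exact mul_le_mul' le_rfl (add_le_add (mul_le_mul' le_rfl le_self_add)
          (mul_le_mul' le_rfl le_add_self))

/-! ### Bounds of the degrees of freedom -/

/-- The open tetrahedron. -/
def tetInt (K : Finset E3) : Set E3 := interior (hull K)

theorem IsTet.closure_tetInt (h : IsTet K a b c d) : closure (tetInt K) = hull K :=
  ((convex_convexHull ℝ _).closure_interior_eq_closure_of_nonempty_interior h.interior_nonempty).trans
    h.isCompact.isClosed.closure_eq

theorem IsTet.isBody (h : IsTet K a b c d) : ∃ D, IsBody (tetInt K) D := by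
  obtain ⟨D, hD⟩ := Metric.isBounded_iff.1 h.isCompact.isBounded
  refine ⟨max D 1, isOpen_interior, (convex_convexHull ℝ _).interior, by positivity,
    fun x hx y hy => ?_⟩
  rw [h.closure_tetInt] at hx hy
  rw [← dist_eq_norm]
  exact (hD hx hy).trans (le_max_left _ _)

theorem restrict_tetInt (K : Finset E3) : leb (tetInt K) = (leb (hull K) : Measure E3) :=
  Measure.restrict_congr_set (interior_ae_eq_of_null_frontier
    ((convex_convexHull ℝ _).addHaar_frontier volume))

theorem IsTet.exists_face_bound (h : IsTet K a b c d) (hs : 1 / 2 < s) : ∃ C : ℝ≥0, ∀ φ :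
    E3 → F, Continuous φ → ∫⁻ p in refTri, ‖φ (triMap a b c p)‖ₑ ≤ C * hsNorm (tetInt K) s φ := by
  obtain ⟨D, hB⟩ := h.isBody
  set γ := baryGrad a c d b
  set γ' := baryGrad a d b c
  set G : ℝ := ‖γ‖ + ‖γ'‖ with hG
  have hfin : IsFiniteMeasure (leb refTri : Measure (ℝ × ℝ)) :=
    ⟨by simpa using isCompact_refTri.measure_lt_top⟩
  have hm : Measurable (triMap a b c) := (continuous_triMap a b c).measurable
  have hγ (p : ℝ × ℝ) : inner ℝ γ (triMap a b c p - a) = p.1 ∧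
      inner ℝ γ' (triMap a b c p - a) = p.2 := by
    have e : triMap a b c p - a = p.1 • (b - a) + p.2 • (c - a) := by unfold triMap; module
    rw [e, inner_add_right, inner_add_right, inner_smul_right, inner_smul_right, inner_smul_right,
      inner_smul_right, h.oppB.inner_self, h.oppC.inner_self, inner_baryGrad_left,
      inner_baryGrad_right]
    constructor <;> ring
  obtain ⟨C, hC⟩ := hB.exists_trace_bound (F := F) h.interior_nonempty (by linarith : 0 < s) (κ := 2)
    (by linarith) (M := 4 * G ^ 2) (by positivity) ((leb refTri).map (triMap a b c)) (by
      rw [ae_map_iff hm.aemeasurable (by rw [h.closure_tetInt]; exact h.isCompact.measurableSet)]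
      refine (ae_restrict_iff' isClosed_refTri.measurableSet).2 (of_forall fun p hp => ?_)
      rw [h.closure_tetInt, h.eq]
      exact convexHull_mono (by intro x; simp; tauto) (triMap_mem hp)) (fun q R hR => by
      rw [Measure.map_apply hm Metric.isClosed_closedBall.measurableSet]
      have h1 : triMap a b c ⁻¹' closedBall q R ⊆ closedBall (inner ℝ γ (q - a)) (G * R) ×ˢ
            closedBall (inner ℝ γ' (q - a)) (G * R) := by
        intro p hp
        rw [Set.mem_preimage, Metric.mem_closedBall, dist_eq_norm] at hp
        have e : triMap a b c p - a - (q - a) = triMap a b c p - q := by abel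
        constructor
        · rw [Metric.mem_closedBall, Real.dist_eq, ← (hγ p).1, ← inner_sub_right, e]
          exact (abs_real_inner_le_norm _ _).trans (mul_le_mul
            (by rw [hG]; linarith [norm_nonneg γ']) hp (norm_nonneg _) (by positivity))
        · rw [Metric.mem_closedBall, Real.dist_eq, ← (hγ p).2, ← inner_sub_right, e]
          exact (abs_real_inner_le_norm _ _).trans (mul_le_mul
            (by rw [hG]; linarith [norm_nonneg γ]) hp (norm_nonneg _) (by positivity))
      refine ((Measure.restrict_apply_le _ _).trans (measure_mono h1)).trans (le_of_eq ?_)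
      rw [volume_eq_prod, Measure.prod_prod, Real.volume_closedBall, Real.volume_closedBall,
        ← ofReal_mul (by positivity)]
      congr 1
      rw [Real.rpow_two]
      ring)
  refine ⟨C, fun φ hφ => ?_⟩
  have := hC φ hφ
  rwa [lintegral_map hφ.enorm.measurable hm] at this

/-- The Sobolev inequality for `H^{1+s}`, `s > 1/2`. -/
theorem IsBody.exists_sup_bound (hB : IsBody B D) (hne : B.Nonempty) (hs : 1 / 2 < s) : ∃ C :
    ℝ≥0, ∀ x ∈ closure B, ∀ ψ :
    E3 → ℝ, ContDiff ℝ 1 ψ → ‖ψ x‖ₑ ≤ C * (eLpNorm ψ 2 (leb B) + hsNorm B s (gradF ψ)) := by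
  obtain ⟨C, hC⟩ := hB.exists_cone_bound (F := E3) hne hs
  have hVt := hB.measure_lt_top
  have hV0 := hB.measure_pos hne
  have hV2 : volume B ^ (1 / 2 : ℝ) ≠ ⊤ := ENNReal.rpow_ne_top_of_nonneg (by norm_num) hVt.ne
  set A : ℝ≥0∞ := (volume B)⁻¹ * (volume B ^ (1 / 2 : ℝ) + ofReal D * C)
  have hA : A ≠ ⊤ := mul_ne_top (ENNReal.inv_ne_top.2 hV0)
    (ENNReal.add_ne_top.2 ⟨hV2, mul_ne_top ofReal_ne_top coe_ne_top⟩)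
  refine ⟨A.toNNReal, fun x hx ψ hψ => ?_⟩
  rw [coe_toNNReal hA]
  have hg := continuous_gradF hψ
  have h1 (y : E3) (hy : y ∈ B) : ‖ψ x‖ₑ ≤ ‖ψ y‖ₑ + ofReal D *
      ∫⁻ t in I₀₁, ‖gradF ψ (x + t • (y - x))‖ₑ := by
    have h2 := edgeMean_fderiv hψ x y
    have h3 : ψ x = ψ y - edgeMean x y (fun z => inner ℝ (gradF ψ z) (y - x)) := by
      simp only [inner_gradF ψ]
      rw [h2]; ring
    rw [h3]
    refine enorm_sub_le.trans (add_le_add le_rfl ?_)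
    rw [edgeMean, intervalIntegral.integral_of_le zero_le_one]
    refine (enorm_integral_le_lintegral_enorm _).trans ?_
    rw [← lintegral_const_mul' _ _ ofReal_ne_top]
    refine lintegral_mono fun t => ?_
    rw [← ofReal_norm, ← ofReal_norm, ← ofReal_mul hB.pos.le]
    refine ENNReal.ofReal_le_ofReal ((norm_inner_le_norm _ _).trans ?_)
    rw [mul_comm]
    exact mul_le_mul_of_nonneg_right (hB.dist_le _ (subset_closure hy) _ hx) (norm_nonneg _)
  have h2 : volume B * ‖ψ x‖ₑ ≤ volume B ^ (1 / 2 : ℝ) * eLpNorm ψ 2 (leb B) +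
      ofReal D * (C * hsNorm B s (gradF ψ)) := by
    calc volume B * ‖ψ x‖ₑ = ∫⁻ _ in B, ‖ψ x‖ₑ := by rw [setLIntegral_const, mul_comm]
      _ ≤ ∫⁻ y in B, (‖ψ y‖ₑ + ofReal D * ∫⁻ t in I₀₁, ‖gradF ψ (x + t • (y - x))‖ₑ) :=
          setLIntegral_mono' hB.isOpen.measurableSet h1
      _ = (∫⁻ y in B, ‖ψ y‖ₑ) + ofReal D *
          ∫⁻ y in B, ∫⁻ t in I₀₁, ‖gradF ψ (x + t • (y - x))‖ₑ := by
          rw [lintegral_add_left hψ.continuous.enorm.measurable,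
            lintegral_const_mul' _ _ ofReal_ne_top]
      _ ≤ _ := by
          refine add_le_add (lintegral_enorm_le_eLpNorm_two hψ.continuous.aestronglyMeasurable)
            (mul_le_mul' le_rfl ?_)
          rw [lintegral_lintegral_swap]
          · exact hC x hx _ hg
          · exact Continuous.aemeasurable (by unfold uncurry; fun_prop)
  calc ‖ψ x‖ₑ = (volume B)⁻¹ * (volume B * ‖ψ x‖ₑ) := by
        rw [← mul_assoc, ENNReal.inv_mul_cancel hV0 hVt.ne, one_mul]
    _ ≤ (volume B)⁻¹ * (volume B ^ (1 / 2 : ℝ) * eLpNorm ψ 2 (leb B) +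
      ofReal D * (C * hsNorm B s (gradF ψ))) := mul_le_mul' le_rfl h2
    _ ≤ _ := by
        rw [mul_assoc, add_mul, ← mul_assoc (ofReal D)]
        exact mul_le_mul' le_rfl (add_le_add (mul_le_mul' le_rfl le_self_add)
          (mul_le_mul' le_rfl le_add_self))

/-! ### Edges -/

theorem lintegral_Icc_scale (r : ℝ) (g : ℝ → ℝ≥0∞) :
    ∫⁻ u in Set.Icc 0 r, g u = ofReal r * ∫⁻ l in I₀₁, g (r * l) := by
  rcases le_or_gt r 0 with hr | hr
  · rw [ENNReal.ofReal_of_nonpos hr, zero_mul]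
    refine setLIntegral_measure_zero _ _ ?_
    rw [Real.volume_Icc, sub_zero, ENNReal.ofReal_of_nonpos hr]
  · have h1 := lintegral_image_eq_lintegral_abs_deriv_mul (s := I₀₁)
      (f := fun t => r * t) (f' := fun _ => r) measurableSet_Ioc
      (fun x _ => by simpa using ((hasDerivAt_id x).const_mul r).hasDerivWithinAt)
      (fun x _ y _ h => by simpa [hr.ne'] using h) g
    have h2 : (fun t : ℝ => r * t) '' Ioc 0 1 = Ioc 0 r := by
      have := Set.image_mul_left_Ioc hr 0 1
      simpa using this
    rw [h2, lintegral_const_mul' _ _ ofReal_ne_top, abs_of_pos hr] at h1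
    rw [← h1, restrict_Ioc_eq_restrict_Icc]

theorem lintegral_refTri_le {g : ℝ × ℝ → ℝ≥0∞} (hg : Measurable g) : ∫⁻ p in refTri, g p ≤
      ∫⁻ t in I₀₁, ∫⁻ l in I₀₁, g ((1 - t) * l, t) := by
  have hm := isClosed_refTri.measurableSet
  rw [← lintegral_indicator hm, volume_eq_prod, lintegral_prod_symm _
    (hg.indicator hm).aemeasurable, restrict_Ioc_eq_restrict_Icc, ← lintegral_indicator measurableSet_Icc]
  refine lintegral_mono fun t => ?_
  by_cases ht : t ∈ Set.Icc (0 : ℝ) 1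
  · rw [indicator_of_mem ht]
    have : (fun x => refTri.indicator g (x, t)) = (Set.Icc 0 (1 - t)).indicator fun x => g (x, t) := by
      ext x
      simp only [Set.indicator, refTri, Set.mem_ofPred_eq, Set.mem_Icc, ht.1, true_and,
        le_sub_iff_add_le]
    rw [this, lintegral_indicator measurableSet_Icc, lintegral_Icc_scale]
    rw [restrict_Ioc_eq_restrict_Icc]
    exact mul_le_of_le_one_left zero_le (by rw [ENNReal.ofReal_le_one]; linarith [ht.1])
  · rw [indicator_of_notMem ht]
    refine le_of_eq ((lintegral_congr fun x => ?_).trans lintegral_zero)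
    refine indicator_of_notMem (fun hx => ht ?_) _
    exact ⟨hx.2.1, by linarith [hx.1, hx.2.2]⟩

/-- The integrals of `‖φ‖` over the triangles with a fixed edge and a variable third vertex. -/
theorem IsBody.exists_fan_bound (hB : IsBody B D) (hne : B.Nonempty) (hs : 1 / 2 < s) : ∃ C :
    ℝ≥0, ∀ a ∈ closure B, ∀ b ∈ closure B, ∀ φ :
    E3 → F, Continuous φ → ∫⁻ y in B, ∫⁻ p in refTri, ‖φ (triMap a b y p)‖ₑ ≤ C * hsNorm B s φ := by
  obtain ⟨C, hC⟩ := hB.exists_cone_bound (F := F) hne hs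
  refine ⟨C, fun a ha b hb φ hφ => ?_⟩
  have hfin : IsFiniteMeasure (leb refTri : Measure (ℝ × ℝ)) :=
    ⟨by simpa using isCompact_refTri.measure_lt_top⟩
  have hc : Continuous fun q : (ℝ × ℝ) × E3 => ‖φ (triMap a b q.2 q.1)‖ₑ := by
    unfold triMap; fun_prop
  have hc' : Continuous (uncurry fun (y : E3) (p : ℝ × ℝ) => ‖φ (triMap a b y p)‖ₑ) := by
    unfold uncurry triMap; fun_prop
  rw [lintegral_lintegral_swap hc'.aemeasurable]
  refine (lintegral_refTri_le (g := fun p => ∫⁻ y in B, ‖φ (triMap a b y p)‖ₑ)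
    hc.measurable.lintegral_prod_right').trans ?_
  have hc'' : Measurable (uncurry fun t l : ℝ =>
      ∫⁻ y in B, ‖φ (triMap a b y ((1 - t) * l, t))‖ₑ) := by
    refine Measurable.lintegral_prod_right' (f := fun q : (ℝ × ℝ) × E3 =>
      ‖φ (triMap a b q.2 ((1 - q.1.1) * q.1.2, q.1.1))‖ₑ) (Continuous.measurable ?_)
    unfold triMap
    fun_prop
  rw [lintegral_lintegral_swap hc''.aemeasurable]
  calc _ ≤ ∫⁻ l in I₀₁, C * hsNorm B s φ := by
        refine setLIntegral_mono' measurableSet_Ioc fun l hl => ?_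
        have he : a + l • (b - a) ∈ closure B := hB.convex.closure.add_smul_sub_mem ha hb
          ⟨hl.1.le, hl.2⟩
        refine le_trans (le_of_eq ?_) (hC _ he φ hφ)
        refine lintegral_congr fun t => lintegral_congr fun y => ?_
        congr 2
        unfold triMap
        module
    _ = _ := by simp

theorem enorm_le_ofReal_mul {x : F} {y : G} {M : ℝ} (hM : 0 ≤ M) (h : ‖x‖ ≤ M * ‖y‖) :
    ‖x‖ₑ ≤ ofReal M * ‖y‖ₑ := by
  rw [← ofReal_norm, ← ofReal_norm, ← ofReal_mul hM]
  exact ENNReal.ofReal_le_ofReal h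

theorem enorm_edgeMean_le {f : E3 → ℝ} {g : E3 → F} {M : ℝ} (hM : 0 ≤ M)
    (h : ∀ x ∈ segment ℝ a b, ‖f x‖ ≤ M * ‖g x‖) :
    ‖edgeMean a b f‖ₑ ≤ ofReal M * ∫⁻ t in I₀₁, ‖g (a + t • (b - a))‖ₑ := by
  rw [edgeMean, intervalIntegral.integral_of_le zero_le_one]
  refine (enorm_integral_le_lintegral_enorm _).trans ?_
  rw [← lintegral_const_mul' _ _ ofReal_ne_top]
  refine setLIntegral_mono' measurableSet_Ioc fun t ht => enorm_le_ofReal_mul hM (h _ ?_)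
  rw [segment_eq_image']
  exact ⟨t, ⟨ht.1.le, ht.2⟩, rfl⟩

theorem enorm_faceMean_le {f : E3 → ℝ} (hf : Continuous f) {g : E3 → F} {M : ℝ} (hM : 0 ≤ M)
    (h : ∀ x ∈ convexHull ℝ {a, b, c}, ‖f x‖ ≤ M * ‖g x‖) :
    ‖faceMean a b c f‖ₑ ≤ ofReal (2 * M) * ∫⁻ p in refTri, ‖g (triMap a b c p)‖ₑ := by
  rw [faceMean_eq hf, enorm_mul, ofReal_mul zero_le_two, mul_assoc]
  refine mul_le_mul' (by rw [← ofReal_norm]; norm_num)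
    ((enorm_integral_le_lintegral_enorm _).trans ?_)
  rw [← lintegral_const_mul' _ _ ofReal_ne_top]
  exact setLIntegral_mono' isClosed_refTri.measurableSet fun p hp =>
    enorm_le_ofReal_mul hM (h _ (triMap_mem hp))

theorem exists_bound_of_isCompact {X : Type*} [TopologicalSpace X] {S : Set X} (hS : IsCompact S)
    {f : X → ℝ} (hf : Continuous f) : ∃ M : ℝ, 0 ≤ M ∧ ∀ x ∈ S, f x ≤ M := by
  obtain ⟨M, hM⟩ := hS.exists_bound_of_continuousOn hf.continuousOn
  exact ⟨max M 0, le_max_right _ _, fun x hx =>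
    (le_abs_self _).trans ((hM x hx).trans (le_max_left _ _))⟩

theorem continuous_triNormal (a b : E3) : Continuous fun y => triNormal a b y := by
  simp only [triNormal_apply]
  refine (PiLp.continuous_toLp 2 _).comp (continuous_pi fun i => ?_)
  fin_cases i <;> (simp; fun_prop)

theorem continuous_stokesField (a b : E3) (q : Poly) :
    Continuous fun p : E3 × E3 => evalV (stokesField a b p.2 q) p.1 := by
  simp only [evalV_stokesField, dirP]
  have h (v : E3 → E3) (hv : Continuous v) :
      Continuous fun p : E3 × E3 => evalP (∑ i, (v p.2) i • pderiv i q) p.1 := by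
    have : (fun p : E3 × E3 => evalP (∑ i, (v p.2) i • pderiv i q) p.1) =
        fun p => ∑ i, (v p.2) i * evalP (pderiv i q) p.1 := by ext p; simp [evalP]
    rw [this]
    fun_prop
  have h1 := h (fun _ => b - a) continuous_const
  have h2 := h (fun y => y - a) (by fun_prop)
  exact (h1.smul (by fun_prop : Continuous fun p : E3 × E3 => p.2 - a)).sub
    (h2.smul continuous_const)

theorem IsBody.exists_edge_bound (hB : IsBody B D) (hne : B.Nonempty) (hs : 1 / 2 < s)
    (ha : a ∈ closure B) (hb : b ∈ closure B) (q : Poly) : ∃ C : ℝ≥0, ∀ φ :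
    E3 → E3, ContDiff ℝ 1 φ → ‖edgeMean a b (fun x => inner ℝ (φ x) (b - a) * evalP q x)‖ₑ ≤
    C * (hsNorm B s φ + hsNorm B s (curlF φ)) := by
  obtain ⟨C₁, hC₁⟩ := hB.exists_cone_bound (F := E3) hne hs
  obtain ⟨C₂, hC₂⟩ := hB.exists_fan_bound (F := E3) hne hs
  have hVt := hB.measure_lt_top
  have hV0 := hB.measure_pos hne
  have hcomp := hB.isCompact_closure.prod hB.isCompact_closure
  have hcv := hB.convex.closure
  obtain ⟨M₁, hM₁, H₁⟩ := exists_bound_of_isCompact hcomp (f := fun p : E3 × E3 =>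
    ‖triNormal a b p.2‖ * ‖evalP q p.1‖) (by have := continuous_triNormal a b; fun_prop)
  obtain ⟨M₂, hM₂, H₂⟩ := exists_bound_of_isCompact hcomp (f := fun p : E3 × E3 =>
    ‖evalV (stokesField a b p.2 q) p.1‖) (continuous_stokesField a b q).norm
  obtain ⟨M₃, hM₃, H₃⟩ := exists_bound_of_isCompact hcomp (f := fun p : E3 × E3 =>
    ‖p.2 - a‖ * ‖evalP q p.1‖) (by fun_prop)
  obtain ⟨M₄, hM₄, H₄⟩ := exists_bound_of_isCompact hcomp (f := fun p : E3 × E3 =>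
    ‖p.2 - b‖ * ‖evalP q p.1‖) (by fun_prop)
  set A : ℝ≥0∞ := (volume B)⁻¹ * (ofReal (2 * M₁) * C₂ + ofReal (2 * M₂) * C₂ +
    ofReal M₃ * C₁ + ofReal M₄ * C₁) with hA
  have hAt : A ≠ ⊤ := by
    refine mul_ne_top (ENNReal.inv_ne_top.2 hV0) ?_
    simp only [ne_eq, ENNReal.add_eq_top, not_or]
    refine ⟨⟨⟨?_, ?_⟩, ?_⟩, ?_⟩ <;> exact mul_ne_top ofReal_ne_top coe_ne_top
  refine ⟨A.toNNReal, fun φ hφ => ?_⟩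
  rw [coe_toNNReal hAt]
  have hc := hφ.continuous
  have hcc := continuous_curlF hφ
  set E := edgeMean a b (fun x => inner ℝ (φ x) (b - a) * evalP q x)
  have hinner (z : E3) {x w : E3} {M : ℝ} (h : ‖w‖ * ‖evalP q x‖ ≤ M) :
      ‖inner ℝ z w * evalP q x‖ ≤ M * ‖z‖ := by
    rw [norm_mul]
    calc _ ≤ ‖z‖ * ‖w‖ * ‖evalP q x‖ :=
          mul_le_mul_of_nonneg_right (norm_inner_le_norm _ _) (norm_nonneg _)
      _ = (‖w‖ * ‖evalP q x‖) * ‖z‖ := by ring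
      _ ≤ _ := mul_le_mul_of_nonneg_right h (norm_nonneg _)
  have h1 (y : E3) (hy : y ∈ B) : ‖E‖ₑ ≤
      ofReal (2 * M₁) * (∫⁻ p in refTri, ‖curlF φ (triMap a b y p)‖ₑ) +
      ofReal (2 * M₂) * (∫⁻ p in refTri, ‖φ (triMap a b y p)‖ₑ) +
      ofReal M₃ * (∫⁻ t in I₀₁, ‖φ (a + t • (y - a))‖ₑ) +
      ofReal M₄ * (∫⁻ t in I₀₁, ‖φ (b + t • (y - b))‖ₑ) := by
    have hyc := subset_closure hy
    have e := faceMean_curlF hφ a b y q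
    have hsub : convexHull ℝ {a, b, y} ⊆ closure B := convexHull_min (by
      rintro x (rfl | rfl | rfl) <;> assumption) hcv
    have e1 := enorm_faceMean_le (a := a) (b := b) (c := y) (g := curlF φ)
      (f := fun x => inner ℝ (curlF φ x) (triNormal a b y) * evalP q x) (by fun_prop) hM₁
      (fun x hx => hinner _ (H₁ (x, y) ⟨hsub hx, hyc⟩))
    have e2 := enorm_faceMean_le (a := a) (b := b) (c := y) (g := φ)
      (f := fun x => inner ℝ (φ x) (evalV (stokesField a b y q) x)) (by fun_prop) hM₂
      (fun x hx => (norm_inner_le_norm _ _).trans (by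
        rw [mul_comm]
        exact mul_le_mul_of_nonneg_right (H₂ (x, y) ⟨hsub hx, hyc⟩) (norm_nonneg _)))
    have e3 := enorm_edgeMean_le (a := a) (b := y) (g := φ)
      (f := fun x => inner ℝ (φ x) (y - a) * evalP q x) hM₃
      (fun x hx => hinner _ (H₃ (x, y) ⟨hcv.segment_subset ha hyc hx, hyc⟩))
    have e4 := enorm_edgeMean_le (a := b) (b := y) (g := φ)
      (f := fun x => inner ℝ (φ x) (y - b) * evalP q x) hM₄
      (fun x hx => hinner _ (H₄ (x, y) ⟨hcv.segment_subset hb hyc hx, hyc⟩))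
    set X1 := faceMean a b y (fun x => inner ℝ (curlF φ x) (triNormal a b y) * evalP q x)
    set X2 := faceMean a b y (fun x => inner ℝ (φ x) (evalV (stokesField a b y q) x))
    set X3 := edgeMean a y (fun x => inner ℝ (φ x) (y - a) * evalP q x)
    set X4 := edgeMean b y (fun x => inner ℝ (φ x) (y - b) * evalP q x)
    have hE : E = (1 / 2) * X1 + (1 / 2) * X2 + X3 - X4 := by linarith
    have hhalf (X : ℝ) : ‖1 / 2 * X‖ₑ ≤ ‖X‖ₑ := by
      rw [enorm_mul]
      refine mul_le_of_le_one_left zero_le ?_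
      rw [← ofReal_norm]
      exact ENNReal.ofReal_le_one.2 (by norm_num)
    rw [hE]
    refine enorm_sub_le.trans (add_le_add ((enorm_add_le _ _).trans (add_le_add
      ((enorm_add_le _ _).trans (add_le_add ?_ ?_)) e3)) e4)
    · exact (hhalf _).trans e1
    · exact (hhalf _).trans e2
  have hm1 (g : E3 → E3) (hg : Continuous g) (M : ℝ) : Measurable fun y =>
      ofReal M * ∫⁻ p in refTri, ‖g (triMap a b y p)‖ₑ := by
    refine Measurable.const_mul (Measurable.lintegral_prod_right'
      (f := fun q : E3 × (ℝ × ℝ) => ‖g (triMap a b q.1 q.2)‖ₑ) (Continuous.measurable ?_)) _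
    unfold triMap; fun_prop
  have hm2 (e : E3) (M : ℝ) : Measurable fun y =>
      ofReal M * ∫⁻ t in I₀₁, ‖φ (e + t • (y - e))‖ₑ := by
    refine Measurable.const_mul (Measurable.lintegral_prod_right'
      (f := fun q : E3 × ℝ => ‖φ (e + q.2 • (q.1 - e))‖ₑ) (Continuous.measurable ?_)) _
    fun_prop
  have hcone (e : E3) (he : e ∈ closure B) :
      ∫⁻ y in B, ∫⁻ t in I₀₁, ‖φ (e + t • (y - e))‖ₑ ≤ C₁ * hsNorm B s φ := by
    rw [lintegral_lintegral_swap]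
    · exact hC₁ e he _ hc
    · exact Continuous.aemeasurable (by unfold uncurry; fun_prop)
  have h2 : volume B * ‖E‖ₑ ≤ ofReal (2 * M₁) * (C₂ * hsNorm B s (curlF φ)) +
      ofReal (2 * M₂) * (C₂ * hsNorm B s φ) + ofReal M₃ * (C₁ * hsNorm B s φ) +
      ofReal M₄ * (C₁ * hsNorm B s φ) := by
    calc volume B * ‖E‖ₑ = ∫⁻ _ in B, ‖E‖ₑ := by rw [setLIntegral_const, mul_comm]
      _ ≤ _ := setLIntegral_mono' hB.isOpen.measurableSet h1
      _ ≤ _ := by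
        rw [lintegral_add_right _ (hm2 _ _), lintegral_add_right _ (hm2 _ _),
          lintegral_add_right _ (hm1 _ hc _), lintegral_const_mul' _ _ ofReal_ne_top,
          lintegral_const_mul' _ _ ofReal_ne_top, lintegral_const_mul' _ _ ofReal_ne_top,
          lintegral_const_mul' _ _ ofReal_ne_top]
        exact add_le_add (add_le_add (add_le_add (mul_le_mul' le_rfl (hC₂ a ha b hb _ hcc))
          (mul_le_mul' le_rfl (hC₂ a ha b hb _ hc))) (mul_le_mul' le_rfl (hcone a ha)))
          (mul_le_mul' le_rfl (hcone b hb))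
  calc ‖E‖ₑ = (volume B)⁻¹ * (volume B * ‖E‖ₑ) := by
        rw [← mul_assoc, ENNReal.inv_mul_cancel hV0 hVt.ne, one_mul]
    _ ≤ (volume B)⁻¹ * _ := mul_le_mul' le_rfl h2
    _ ≤ _ := by
        rw [hA, mul_assoc]
        simp only [add_mul, ← mul_assoc]
        gcongr
        · exact le_add_self
        all_goals exact le_self_add

theorem nedelec_dof_bound (h : IsTet K a b c d) (hs : 1 / 2 < s) {L : (E3 → E3) → ℝ}
    (hL : L ∈ nedelecDofs r (K : Set E3)) : ∃ C : ℝ≥0, ∀ φ : E3 → E3, ContDiff ℝ 1 φ → ‖L φ‖ₑ ≤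
    C * (hsNorm (tetInt K) s φ + hsNorm (tetInt K) s (curlF φ)) := by
  obtain ⟨D, hB⟩ := h.isBody
  have hmem (x : E3) (hx : x ∈ (K : Set E3)) : x ∈ closure (tetInt K) := by
    rw [h.closure_tetInt]; exact subset_convexHull ℝ _ hx
  rcases hL with ⟨v, hv, w, hw, -, q, -, rfl⟩ | ⟨u, hu, v, hv, w, hw, huv, huw, hvw, q, -, -, rfl⟩
  · exact hB.exists_edge_bound h.interior_nonempty hs (hmem v hv) (hmem w hw) q
  · obtain ⟨x, h'⟩ := h.exists_of_mem₃ hu hv hw huv huw hvw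
    obtain ⟨C, hC⟩ := h'.exists_face_bound (F := E3) hs
    obtain ⟨M, hM, H⟩ := exists_bound_of_isCompact
      (({u, v, w} : Set E3).toFinite.isCompact_convexHull ℝ) (continuous_evalV q).norm
    refine ⟨(ofReal (2 * M)).toNNReal * C, fun φ hφ => ?_⟩
    have hc := hφ.continuous
    refine (enorm_faceMean_le (g := φ) (by fun_prop) hM fun x hx => (norm_inner_le_norm _ _).trans
      ((mul_comm _ _).trans_le (mul_le_mul_of_nonneg_right (H x hx) (norm_nonneg _)))).trans ?_
    rw [ENNReal.coe_mul, coe_toNNReal ofReal_ne_top, mul_assoc]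
    exact mul_le_mul' le_rfl ((hC φ hc).trans (mul_le_mul' le_rfl le_self_add))

theorem flux_dof_bound (h : IsTet K a b c d) (hs : 1 / 2 < s) {L : (E3 → E3) → ℝ}
    (hL : L ∈ fluxDofs r (K : Set E3)) : ∃ C : ℝ≥0, ∀ φ :
    E3 → E3, Continuous φ → ‖L φ‖ₑ ≤ C * hsNorm (tetInt K) s φ := by
  obtain ⟨u, hu, v, hv, w, hw, huv, huw, hvw, q, -, rfl⟩ := hL
  obtain ⟨x, h'⟩ := h.exists_of_mem₃ hu hv hw huv huw hvw
  obtain ⟨C, hC⟩ := h'.exists_face_bound (F := E3) hs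
  obtain ⟨M, hM, H⟩ := exists_bound_of_isCompact
    (({u, v, w} : Set E3).toFinite.isCompact_convexHull ℝ)
    (f := fun x => ‖triNormal u v w‖ * ‖evalP q x‖) (by fun_prop)
  refine ⟨(ofReal (2 * M)).toNNReal * C, fun φ hc => ?_⟩
  rw [enorm_mul]
  refine (mul_le_of_le_one_left zero_le ?_).trans ((enorm_faceMean_le (g := φ) (by fun_prop) hM
    fun x hx => ?_).trans ?_)
  · rw [← ofReal_norm]
    exact ENNReal.ofReal_le_one.2 (by norm_num)
  · rw [norm_mul]
    calc _ ≤ ‖φ x‖ * ‖triNormal u v w‖ * ‖evalP q x‖ :=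
          mul_le_mul_of_nonneg_right (norm_inner_le_norm _ _) (norm_nonneg _)
      _ = (‖triNormal u v w‖ * ‖evalP q x‖) * ‖φ x‖ := by ring
      _ ≤ _ := mul_le_mul_of_nonneg_right (H x hx) (norm_nonneg _)
  · rw [ENNReal.coe_mul, coe_toNNReal ofReal_ne_top, mul_assoc]
    exact mul_le_mul' le_rfl (hC φ hc)

/-- Interior moments are continuous in `L²`. -/
theorem tendsto_interiorV_of_eLpNorm (h : IsTet K a b c d) {Q : Submodule ℝ VPoly}
    {L : (E3 → E3) → ℝ} (hL : L ∈ interiorVDofs Q K) {φ : ℕ → E3 → E3} {u : E3 → E3}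
    (hφ : ∀ n, Continuous (φ n)) (hu : MemLp u 2 (leb (tetInt K)))
    (ht : (fun n => eLpNorm (φ n - u) 2 (leb (tetInt K))) ⇝ 0) :
    (fun n => L (φ n)) ⇝ (L u) := by
  obtain ⟨q, -, rfl⟩ := hL
  obtain ⟨D, hB⟩ := h.isBody
  have hfin : IsFiniteMeasure (leb (tetInt K)) := ⟨by simpa using hB.measure_lt_top⟩
  simp only [← restrict_tetInt]
  obtain ⟨M, hM, H⟩ := exists_bound_of_isCompact hB.isCompact_closure (continuous_evalV q).norm
  have hae : ∀ᵐ x ∂(leb (tetInt K)), ‖evalV q x‖ ≤ M :=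
    (ae_restrict_iff' hB.isOpen.measurableSet).2 (of_forall fun x hx => H x (subset_closure hx))
  have hq : MemLp (evalV q) 2 (leb (tetInt K)) :=
    MemLp.of_bound (continuous_evalV q).aestronglyMeasurable M hae
  have hφ2 (n : ℕ) : MemLp (φ n) 2 (leb (tetInt K)) := by
    obtain ⟨M', hM'⟩ := hB.exists_bound (hφ n)
    exact MemLp.of_bound (hφ n).aestronglyMeasurable M' ((ae_restrict_iff' hB.isOpen.measurableSet).2
      (of_forall fun x hx => hM' x (subset_closure hx)))
  rw [tendsto_iff_edist_tendsto_0]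
  have hV2 : volume (tetInt K) ^ (1 / 2 : ℝ) ≠ ⊤ :=
    ENNReal.rpow_ne_top_of_nonneg (by norm_num) hB.measure_lt_top.ne
  have hz : (fun n => ofReal M * (volume (tetInt K) ^ (1 / 2 : ℝ) *
      eLpNorm (φ n - u) 2 (leb (tetInt K)))) ⇝ 0 := by
    have := ENNReal.Tendsto.const_mul (a := ofReal M) (ENNReal.Tendsto.const_mul
      (a := volume (tetInt K) ^ (1 / 2 : ℝ)) ht (Or.inr hV2)) (Or.inr ofReal_ne_top)
    simpa using this
  refine tendsto_zero_of_le hz fun n => ?_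
  have hi (w : E3 → E3) (hw : MemLp w 2 (leb (tetInt K))) :
      Integrable (fun x => inner ℝ (w x) (evalV q x)) (leb (tetInt K)) :=
    ((hw.integrable one_le_two).norm.const_mul M).mono'
      (hw.aestronglyMeasurable.inner (𝕜 := ℝ) hq.aestronglyMeasurable) (hae.mono fun x hx =>
        (norm_inner_le_norm _ _).trans ((mul_comm _ _).trans_le
          (mul_le_mul_of_nonneg_right hx (norm_nonneg _))))
  change edist _ _ ≤ _
  rw [edist_eq_enorm_sub, ← integral_sub (hi _ (hφ2 n)) (hi _ hu)]
  refine (enorm_integral_le_lintegral_enorm _).trans ?_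
  refine le_trans ?_ (mul_le_mul' le_rfl (lintegral_enorm_le_eLpNorm_two
    ((hφ2 n).sub hu).aestronglyMeasurable))
  rw [← lintegral_const_mul' _ _ ofReal_ne_top]
  refine lintegral_mono_ae (hae.mono fun x hx => enorm_le_ofReal_mul hM ?_)
  rw [← inner_sub_left]
  exact (norm_inner_le_norm _ _).trans ((mul_comm _ _).trans_le
    (mul_le_mul_of_nonneg_right hx (norm_nonneg _)))

/-! ### The weakly singular kernel -/

theorem lintegral_sq_le {α : Type*} [MeasurableSpace α] {μ : Measure α} [IsProbabilityMeasure μ]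
    {f : α → ℝ≥0∞} (hf : AEMeasurable f μ) : (∫⁻ x, f x ∂μ) ^ 2 ≤ ∫⁻ x, f x ^ 2 ∂μ := by
  have h1 := eLpNorm_le_eLpNorm_of_exponent_le (p := 1) (q := 2) one_le_two hf.aestronglyMeasurable
  have h2 := eLpNorm_nnreal_pow_eq_lintegral (f := f) (μ := μ) (p := 2) two_ne_zero
  rw [eLpNorm_one_eq_lintegral_enorm] at h1
  simp only [enorm_eq_self] at h1 h2
  calc _ ≤ eLpNorm f 2 μ ^ 2 := pow_le_pow_left' h1 2
    _ = _ := by simpa using h2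

/-- `|h|^{-1/2-s}`, written so that it vanishes at `0`. -/
def singKer (s : ℝ) (h : E3) : ℝ := ‖h‖ * (‖h‖ ^ (3 / 2 + s))⁻¹

theorem singKer_nonneg (s : ℝ) (h : E3) : 0 ≤ singKer s h := by unfold singKer; positivity

theorem measurable_singKer (s : ℝ) : Measurable (singKer s) := by unfold singKer; fun_prop

theorem lintegral_singKer_lt_top (hs1 : s < 1) (D : ℝ) :
    ∫⁻ h in closedBall (0 : E3) D, ofReal (singKer s h ^ 2) < ⊤ := by
  have h1 : Integrable (fun h : E3 => (Set.Iic D).indicator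
      (fun y : ℝ => (y * (y ^ (3 / 2 + s))⁻¹) ^ 2) ‖h‖) volume := by
    rw [integrable_fun_norm_addHaar volume (f := (Set.Iic D).indicator
      (fun y : ℝ => (y * (y ^ (3 / 2 + s))⁻¹) ^ 2))]
    have h2 : IntegrableOn (fun y : ℝ => y ^ (1 - 2 * s)) (Ioc 0 (max D 0)) := by
      have := intervalIntegral.intervalIntegrable_rpow' (a := 0) (b := max D 0) (r := 1 - 2 * s)
        (by linarith)
      rwa [intervalIntegrable_iff_integrableOn_Ioc_of_le (le_max_right _ _)] at this
    have h3 : IntegrableOn ((Ioc 0 (max D 0)).indicator fun y : ℝ => y ^ (1 - 2 * s))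
        (Set.Ioi 0) := (h2.integrable_indicator measurableSet_Ioc).integrableOn
    refine h3.congr_fun (fun y (hy : 0 < y) => ?_) measurableSet_Ioi
    rw [finrank_euclideanSpace_fin]
    by_cases hD : y ≤ D
    · rw [indicator_of_mem (Set.mem_Ioc.2 ⟨hy, le_max_of_le_left hD⟩), indicator_of_mem (Set.mem_Iic.2 hD),
        smul_eq_mul, mul_pow, inv_pow, ← Real.rpow_natCast (y ^ (3 / 2 + s)), ← Real.rpow_mul hy.le,
        ← mul_assoc, ← pow_add, ← Real.rpow_neg hy.le, ← Real.rpow_natCast, ← Real.rpow_add hy]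
      congr 1
      push_cast; ring
    · rw [indicator_of_notMem (by
        rw [Set.mem_Ioc, not_and, le_max_iff, not_or]; exact fun _ => ⟨hD, hy.not_ge⟩),
        indicator_of_notMem (mt Set.mem_Iic.1 hD), smul_zero]
  have h4 := h1.lintegral_lt_top
  rw [← lintegral_indicator Metric.isClosed_closedBall.measurableSet]
  refine lt_of_le_of_lt (lintegral_mono fun h => ?_) h4
  by_cases hh : ‖h‖ ≤ D
  · rw [indicator_of_mem (by simpa using hh), indicator_of_mem (Set.mem_Iic.2 hh)]; rfl
  · rw [indicator_of_notMem (by simpa using hh)]; exact zero_le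

theorem exists_singKer_bound (hm : MeasurableSet Ω) (hD : ∀ x ∈ Ω, ∀ y ∈ Ω, ‖x - y‖ ≤ D)
    (hs1 : s < 1) : ∃ κ : ℝ≥0, ∀ x ∈ Ω, ∫⁻ y in Ω, ofReal (singKer s (x - y) ^ 2) ≤ κ := by
  refine ⟨(∫⁻ h in closedBall (0 : E3) D, ofReal (singKer s h ^ 2)).toNNReal, fun x hx => ?_⟩
  rw [coe_toNNReal (lintegral_singKer_lt_top hs1 D).ne, ← lintegral_indicator hm,
    ← lintegral_indicator Metric.isClosed_closedBall.measurableSet,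
    ← lintegral_sub_left_eq_self (fun h => Set.indicator (closedBall (0 : E3) D)
      (fun h => ofReal (singKer s h ^ 2)) h) x]
  refine lintegral_mono fun y => ?_
  by_cases hy : y ∈ Ω
  · rw [indicator_of_mem hy, indicator_of_mem (by simpa using hD x hx y hy)]
  · rw [indicator_of_notMem hy]; exact zero_le

/-! ### Multiplication by smooth functions -/

theorem eLpNorm_singKer_le (hΩ : MeasurableSet Ω) (hS : MeasurableSet S) {κ : ℝ≥0}
    (hκ : ∀ x ∈ Ω, ∫⁻ y in Ω, ofReal (singKer s (x - y) ^ 2) ≤ κ) {w : E3 → F}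
    (hw : AEStronglyMeasurable w (leb Ω)) : eLpNorm (fun p : E3 × E3 => singKer s (p.1 - p.2) *
    S.indicator (fun x => ‖w x‖) p.1) 2 (leb (Ω ×ˢ Ω)) ≤ NNReal.sqrt κ * eLpNorm w 2 (leb S) := by
  rw [← ENNReal.pow_le_pow_left_iff two_ne_zero, eLpNorm_two_sq, mul_pow, eLpNorm_two_sq,
    ← ENNReal.coe_pow, NNReal.sq_sqrt, volume_eq_prod, ← prod_restrict]
  have hi : AEStronglyMeasurable (S.indicator fun x => ‖w x‖) (leb Ω) := hw.norm.indicator hS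
  have hsk : Measurable fun p : E3 × E3 => singKer s (p.1 - p.2) :=
    (measurable_singKer s).comp (by fun_prop)
  rw [lintegral_prod (fun p : E3 × E3 => ‖singKer s (p.1 - p.2) * S.indicator (fun x => ‖w x‖) p.1‖ₑ ^ 2)
    ((hsk.aestronglyMeasurable.mul hi.comp_fst).enorm.pow_const 2)]
  have e1 (x y : E3) : ‖singKer s (x - y) * S.indicator (fun x => ‖w x‖) x‖ₑ ^ 2 =
      S.indicator (fun x => ‖w x‖ₑ ^ 2) x * ofReal (singKer s (x - y) ^ 2) := by
    rw [enorm_mul, mul_pow, mul_comm, Real.enorm_of_nonneg (singKer_nonneg _ _),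
      ENNReal.ofReal_pow (singKer_nonneg _ _)]
    congr 1
    by_cases hx : x ∈ S <;> simp [hx]
  simp only [e1]
  rw [← lintegral_indicator hS]
  calc _ ≤ ∫⁻ x in Ω, κ * S.indicator (fun x => ‖w x‖ₑ ^ 2) x := by
        refine setLIntegral_mono' hΩ fun x hx => ?_
        have hmx : Measurable fun y => ofReal (singKer s (x - y) ^ 2) :=
          (((measurable_singKer s).comp (measurable_const.sub measurable_id)).pow_const 2).ennreal_ofReal
        rw [lintegral_const_mul _ hmx, mul_comm]
        exact mul_le_mul' (hκ x hx) le_rfl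
    _ = κ * ∫⁻ x in Ω, S.indicator (fun x => ‖w x‖ₑ ^ 2) x := lintegral_const_mul' _ _ coe_ne_top
    _ ≤ _ := mul_le_mul' le_rfl (setLIntegral_le_lintegral _ _)

theorem exists_eLpNorm_mul_bound {U : Set E3} (hU : MeasurableSet U)
    {A : E3 → F →L[ℝ] G} (hA : Continuous A) (hAc : HasCompactSupport A)
    (hAU : Function.support A ⊆ U) : ∃ C : ℝ≥0, ∀ w :
    E3 → F, eLpNorm (fun x => A x (w x)) 2 (leb Ω) ≤ C * eLpNorm w 2 (leb (U ∩ Ω)) := by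
  obtain ⟨M, hM⟩ := hAc.exists_bound_of_continuous hA
  refine ⟨M.toNNReal, fun w => ?_⟩
  rw [← Measure.restrict_restrict hU, ← eLpNorm_indicator_eq_eLpNorm_restrict hU]
  refine eLpNorm_le_mul_eLpNorm_of_ae_le_mul (g := U.indicator w) (c := M) (of_forall fun x => ?_) 2
  by_cases hx : x ∈ U
  · rw [indicator_of_mem hx]
    exact ((A x).le_opNorm _).trans (mul_le_mul_of_nonneg_right (hM x) (norm_nonneg _))
  · rw [Function.notMem_support.1 fun h => hx (hAU h)]
    simp [hx]

/-- Multiplication by a smooth function supported in `U` is bounded from `H^s(U ∩ Ω)` to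
`H^s(Ω)`. -/
theorem exists_hsNorm_mul_bound {U : Set E3} (hΩ : MeasurableSet Ω)
    (hD : ∀ x ∈ Ω, ∀ y ∈ Ω, ‖x - y‖ ≤ D) (hU : MeasurableSet U) {A : E3 → F →L[ℝ] G}
    (hA : ContDiff ℝ 1 A) (hAc : HasCompactSupport A) (hAU : Function.support A ⊆ U) (hs1 : s < 1) :
    ∃ C : ℝ≥0, ∀ w : E3 → F, AEStronglyMeasurable w (leb Ω) → hsNorm Ω s (fun x => A x (w x)) ≤
    C * hsNorm (U ∩ Ω) s w := by
  obtain ⟨κ, hκ⟩ := exists_singKer_bound hΩ hD hs1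
  obtain ⟨C₀, hC₀⟩ := exists_eLpNorm_mul_bound (F := F) hU hA.continuous hAc hAU
  obtain ⟨M, hM⟩ := hAc.exists_bound_of_continuous hA.continuous
  obtain ⟨Λ, hΛ⟩ := hA.lipschitzWith_of_hasCompactSupport hAc one_ne_zero
  have hM0 : 0 ≤ M := (norm_nonneg _).trans (hM 0)
  refine ⟨C₀ + M.toNNReal + 2 * Λ * NNReal.sqrt κ, fun w hw => ?_⟩
  have hS : MeasurableSet (U ∩ Ω) := hU.inter hΩ
  set S := U ∩ Ω with hSdef
  have hSΩ : S ⊆ Ω := Set.inter_subset_right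
  have hA0 (x : E3) (hx : x ∉ U) : A x = 0 := Function.notMem_support.1 fun h => hx (hAU h)
  set f₁ : E3 × E3 → ℝ := fun p => M * (S ×ˢ S).indicator (fun p => ‖dq s w p‖) p
  set f₂ : E3 × E3 → ℝ := fun p => singKer s (p.1 - p.2) * S.indicator (fun x => ‖w x‖) p.1
  set f₃ : E3 × E3 → ℝ := fun p => singKer s (p.2 - p.1) * S.indicator (fun x => ‖w x‖) p.2
  have hpt : ∀ p ∈ Ω ×ˢ Ω, ‖dq s (fun x => A x (w x)) p‖ ≤ (f₁ + (Λ : ℝ) • (f₂ + f₃)) p := by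
    rintro ⟨x, y⟩ ⟨hx, hy⟩
    have hk : singKer s (y - x) = singKer s (x - y) := by rw [singKer, singKer, norm_sub_rev]
    simp only [Pi.add_apply, Pi.smul_apply, smul_eq_mul, f₁, f₂, f₃, hk]
    have hn (u : E3 → F) : ‖dq s u (x, y)‖ = (‖x - y‖ ^ (3 / 2 + s))⁻¹ * ‖u x - u y‖ := by
      rw [dq, norm_smul, Real.norm_of_nonneg (by positivity)]
    have hn' (u : E3 → G) : ‖dq s u (x, y)‖ = (‖x - y‖ ^ (3 / 2 + s))⁻¹ * ‖u x - u y‖ := by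
      rw [dq, norm_smul, Real.norm_of_nonneg (by positivity)]
    have hL : ‖A x - A y‖ ≤ Λ * ‖x - y‖ := hΛ.norm_sub_le x y
    set g := (‖x - y‖ ^ (3 / 2 + s))⁻¹ with hg
    have hg0 : 0 ≤ g := by positivity
    have hkk : singKer s (x - y) = ‖x - y‖ * g := rfl
    have hterm (z : E3) (hz : z ∈ S) : g * ‖(A x - A y) (w z)‖ ≤
        Λ * (singKer s (x - y) * S.indicator (fun x => ‖w x‖) z) := by
      rw [indicator_of_mem hz, hkk]
      calc _ ≤ g * (Λ * ‖x - y‖ * ‖w z‖) := mul_le_mul_of_nonneg_left (((A x - A y).le_opNorm _).trans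
            (mul_le_mul_of_nonneg_right hL (norm_nonneg _))) hg0
        _ = _ := by ring
    have hnn (z : E3) : 0 ≤ Λ * (singKer s (x - y) * S.indicator (fun x => ‖w x‖) z) :=
      mul_nonneg Λ.2 (mul_nonneg (singKer_nonneg _ _) (Set.indicator_nonneg (fun _ _ => norm_nonneg _) _))
    have hnn1 : 0 ≤ M * (S ×ˢ S).indicator (fun p => ‖dq s w p‖) (x, y) :=
      mul_nonneg hM0 (Set.indicator_nonneg (fun _ _ => norm_nonneg _) _)
    rw [hn', mul_add]
    by_cases hxU : x ∈ U
    · by_cases hyU : y ∈ U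
      · have e : A x (w x) - A y (w y) = A x (w x - w y) + (A x - A y) (w y) := by simp
        rw [e]
        have h1 := hterm y ⟨hyU, hy⟩
        have h2 : g * ‖A x (w x - w y)‖ ≤ M * (S ×ˢ S).indicator (fun p => ‖dq s w p‖) (x, y) := by
          rw [indicator_of_mem (show (x, y) ∈ S ×ˢ S from ⟨⟨hxU, hx⟩, ⟨hyU, hy⟩⟩), hn]
          calc _ ≤ g * (M * ‖w x - w y‖) := mul_le_mul_of_nonneg_left (((A x).le_opNorm _).trans
                (mul_le_mul_of_nonneg_right (hM x) (norm_nonneg _))) hg0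
            _ = _ := by ring
        have h3 := mul_le_mul_of_nonneg_left (norm_add_le (A x (w x - w y)) ((A x - A y) (w y))) hg0
        linarith [hnn x]
      · have e : A x (w x) - A y (w y) = (A x - A y) (w x) := by simp [hA0 y hyU]
        rw [e]
        linarith [hterm x ⟨hxU, hx⟩, hnn y]
    · by_cases hyU : y ∈ U
      · have e : A x (w x) - A y (w y) = (A x - A y) (w y) := by simp [hA0 x hxU]
        rw [e]
        linarith [hterm y ⟨hyU, hy⟩, hnn x]
      · have e : A x (w x) - A y (w y) = 0 := by simp [hA0 x hxU, hA0 y hyU]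
        rw [e, norm_zero, mul_zero]
        linarith [hnn x, hnn y]
  have hSS : MeasurableSet (S ×ˢ S) := hS.prod hS
  have hi : AEStronglyMeasurable (S.indicator fun x => ‖w x‖) (leb Ω) := hw.norm.indicator hS
  have hsk : Measurable fun p : E3 × E3 => singKer s (p.1 - p.2) :=
    (measurable_singKer s).comp (by fun_prop)
  have hsk' : Measurable fun p : E3 × E3 => singKer s (p.2 - p.1) :=
    (measurable_singKer s).comp (by fun_prop)
  have m₁ : AEStronglyMeasurable f₁ (leb (Ω ×ˢ Ω)) :=
    (((aestronglyMeasurable_dq s hw).norm).indicator hSS).const_mul M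
  have m₂ : AEStronglyMeasurable f₂ (leb (Ω ×ˢ Ω)) := by
    rw [volume_eq_prod, ← prod_restrict]
    exact hsk.aestronglyMeasurable.mul hi.comp_fst
  have m₃ : AEStronglyMeasurable f₃ (leb (Ω ×ˢ Ω)) := by
    rw [volume_eq_prod, ← prod_restrict]
    exact hsk'.aestronglyMeasurable.mul hi.comp_snd
  have n₁ : eLpNorm f₁ 2 (leb (Ω ×ˢ Ω)) ≤ M.toNNReal * hsSemi S s w := by
    have : f₁ = M • (S ×ˢ S).indicator (fun p => ‖dq s w p‖) := rfl
    rw [this, eLpNorm_const_smul, eLpNorm_indicator_eq_eLpNorm_restrict hSS,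
      Measure.restrict_restrict hSS, Set.inter_eq_left.2 (Set.prod_mono hSΩ hSΩ), eLpNorm_norm,
      Real.enorm_of_nonneg hM0]
    exact le_rfl
  have n₂ := eLpNorm_singKer_le hΩ hS hκ hw
  have n₃ : eLpNorm f₃ 2 (leb (Ω ×ˢ Ω)) ≤ NNReal.sqrt κ * eLpNorm w 2 (leb S) := by
    have hmp : MeasurePreserving Prod.swap (leb (Ω ×ˢ Ω)) (leb (Ω ×ˢ Ω)) := by
      rw [volume_eq_prod, ← prod_restrict]
      exact Measure.measurePreserving_swap
    have : f₃ = f₂ ∘ Prod.swap := rfl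
    rw [this, eLpNorm_comp_measurePreserving m₂ hmp]
    exact n₂
  have hsemi : hsSemi Ω s (fun x => A x (w x)) ≤ M.toNNReal * hsSemi S s w +
      Λ * (NNReal.sqrt κ * eLpNorm w 2 (leb S) + NNReal.sqrt κ * eLpNorm w 2 (leb S)) := by
    refine (eLpNorm_mono_ae_real ((ae_restrict_iff' (hΩ.prod hΩ)).2 (of_forall hpt))).trans ?_
    refine (eLpNorm_add_le m₁ ((m₂.add m₃).const_smul _) one_le_two).trans (add_le_add n₁ ?_)
    rw [eLpNorm_const_smul, Real.enorm_of_nonneg Λ.coe_nonneg, ENNReal.ofReal_coe_nnreal]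
    exact mul_le_mul' le_rfl ((eLpNorm_add_le m₂ m₃ one_le_two).trans (add_le_add n₂ n₃))
  calc hsNorm Ω s (fun x => A x (w x)) ≤ C₀ * eLpNorm w 2 (leb S) +
        (M.toNNReal * hsSemi S s w + Λ * (NNReal.sqrt κ * eLpNorm w 2 (leb S) +
        NNReal.sqrt κ * eLpNorm w 2 (leb S))) := add_le_add (hC₀ w) hsemi
    _ = C₀ * eLpNorm w 2 (leb S) + M.toNNReal * hsSemi S s w +
        (2 * Λ * NNReal.sqrt κ) * eLpNorm w 2 (leb S) := by ring
    _ ≤ C₀ * hsNorm S s w + M.toNNReal * hsNorm S s w + (2 * Λ * NNReal.sqrt κ) * hsNorm S s w := by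
        refine add_le_add (add_le_add ?_ ?_) ?_ <;> refine mul_le_mul' le_rfl ?_
        · exact le_self_add
        · exact le_add_self
        · exact le_self_add
    _ = _ := by push_cast; ring

/-- On convex sets, the semi-norm of `H^s` is bounded by the `L²` norm of the derivative. -/
theorem IsBody.exists_hsSemi_le_fderiv (hB : IsBody B D) [CompleteSpace F] (hs1 : s < 1) : ∃ C :
    ℝ≥0, ∀ w : E3 → F, ContDiff ℝ 1 w → hsSemi B s w ≤ C * eLpNorm (fderiv ℝ w) 2 (leb B) := by
  have hκ := lintegral_singKer_lt_top hs1 D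
  set κ : ℝ≥0∞ := ∫⁻ h in closedBall (0 : E3) D, ofReal (singKer s h ^ 2) with hκd
  have hBm := hB.isOpen.measurableSet
  refine ⟨NNReal.sqrt κ.toNNReal, fun w hw => ?_⟩
  have hc : Continuous (fderiv ℝ w) := hw.continuous_fderiv one_ne_zero
  set g : E3 → ℝ≥0∞ := B.indicator fun z => ‖fderiv ℝ w z‖ₑ ^ 2 with hg
  have hgm : Measurable g := (hc.enorm.measurable.pow_const 2).indicator hBm
  set kk : E3 → ℝ≥0∞ := (closedBall (0 : E3) D).indicator fun h => ofReal (singKer s h ^ 2) with hkk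
  have hkm : Measurable kk := (((measurable_singKer s).pow_const 2).ennreal_ofReal).indicator
    Metric.isClosed_closedBall.measurableSet
  rw [← ENNReal.pow_le_pow_left_iff two_ne_zero, mul_pow, ← ENNReal.coe_pow, NNReal.sq_sqrt,
    coe_toNNReal hκ.ne, hsSemi, eLpNorm_two_sq, eLpNorm_two_sq, volume_eq_prod,
    ← prod_restrict, lintegral_prod (fun p : E3 × E3 => ‖dq s w p‖ₑ ^ 2) (((measurable_dq_coeff s).aestronglyMeasurable.smul
      (hw.continuous.aestronglyMeasurable.comp_fst.sub
        hw.continuous.aestronglyMeasurable.comp_snd)).enorm.pow_const 2)]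
  have hpt (x : E3) (hx : x ∈ B) (y : E3) (hy : y ∈ B) : ‖dq s w (x, y)‖ₑ ^ 2 ≤
      kk (y - x) * ∫⁻ t in I₀₁, g (x + t • (y - x)) := by
    have h1 : w y - w x = ∫ t in (0 : ℝ)..1, fderiv ℝ w (x + t • (y - x)) (y - x) := by
      rw [intervalIntegral.integral_eq_sub_of_hasDerivAt (f := fun t : ℝ => w (x + t • (y - x)))]
      · simp
      · intro t _
        have h2 : HasDerivAt (fun t : ℝ => x + t • (y - x)) (y - x) t := by
          simpa using ((hasDerivAt_id t).smul_const (y - x)).const_add x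
        exact ((hw.differentiable one_ne_zero _).hasFDerivAt).comp_hasDerivAt t h2
      · exact Continuous.intervalIntegrable (by fun_prop) _ _
    have h2 : ‖w x - w y‖ₑ ≤ ‖y - x‖ₑ * ∫⁻ t in I₀₁, ‖fderiv ℝ w (x + t • (y - x))‖ₑ := by
      rw [← enorm_neg, neg_sub, h1, intervalIntegral.integral_of_le zero_le_one]
      refine (enorm_integral_le_lintegral_enorm _).trans ?_
      rw [← lintegral_const_mul' _ _ enorm_ne_top]
      exact lintegral_mono fun t => by rw [mul_comm]; exact ContinuousLinearMap.le_opENorm _ _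
    have h3 : (∫⁻ t in I₀₁, ‖fderiv ℝ w (x + t • (y - x))‖ₑ) ^ 2 ≤
        ∫⁻ t in I₀₁, g (x + t • (y - x)) := by
      have : IsProbabilityMeasure (leb I₀₁) := ⟨by simp⟩
      refine (lintegral_sq_le (Continuous.aemeasurable (by fun_prop))).trans (le_of_eq ?_)
      refine setLIntegral_congr_fun measurableSet_Ioc fun t ht => ?_
      rw [hg, indicator_of_mem (hB.mem (subset_closure hx) hy ht)]
    have h4 : kk (y - x) = (‖(‖x - y‖ ^ (3 / 2 + s))⁻¹‖ₑ * ‖y - x‖ₑ) ^ 2 := by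
      rw [hkk, indicator_of_mem (by
        simpa using hB.dist_le _ (subset_closure hy) _ (subset_closure hx)), singKer,
        ENNReal.ofReal_pow (by positivity), ofReal_mul (by positivity), ofReal_norm,
        Real.enorm_of_nonneg (by positivity), norm_sub_rev x y, mul_comm]
    calc ‖dq s w (x, y)‖ₑ ^ 2 ≤ (‖(‖x - y‖ ^ (3 / 2 + s))⁻¹‖ₑ * (‖y - x‖ₑ *
          ∫⁻ t in I₀₁, ‖fderiv ℝ w (x + t • (y - x))‖ₑ)) ^ 2 := by
          rw [dq, enorm_smul]
          exact pow_le_pow_left' (mul_le_mul' le_rfl h2) 2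
      _ = kk (y - x) * (∫⁻ t in I₀₁, ‖fderiv ℝ w (x + t • (y - x))‖ₑ) ^ 2 := by
          rw [h4, ← mul_assoc, mul_pow]
      _ ≤ _ := mul_le_mul' le_rfl h3
  have hm1 : Measurable fun p : E3 × E3 => ∫⁻ t in I₀₁, g (p.1 + t • p.2) := by
    refine Measurable.lintegral_prod_right' (f := fun q : (E3 × E3) × ℝ => g (q.1.1 + q.2 • q.1.2)) ?_
    exact hgm.comp (by fun_prop)
  calc _ ≤ ∫⁻ x in B, ∫⁻ y in B, kk (y - x) * ∫⁻ t in I₀₁, g (x + t • (y - x)) :=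
        setLIntegral_mono' hBm fun x hx => setLIntegral_mono' hBm fun y hy => hpt x hx y hy
    _ ≤ ∫⁻ x, ∫⁻ y, kk (y - x) * ∫⁻ t in I₀₁, g (x + t • (y - x)) :=
        (setLIntegral_le_lintegral _ _).trans
          (lintegral_mono fun x => setLIntegral_le_lintegral _ _)
    _ = ∫⁻ x, ∫⁻ h, kk h * ∫⁻ t in I₀₁, g (x + t • h) :=
        lintegral_congr fun x => lintegral_sub_right_eq_self
          (fun h => kk h * ∫⁻ t in I₀₁, g (x + t • h)) x
    _ = ∫⁻ h, ∫⁻ x, kk h * ∫⁻ t in I₀₁, g (x + t • h) :=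
        lintegral_lintegral_swap ((hkm.comp measurable_snd).mul hm1).aemeasurable
    _ = ∫⁻ h, kk h * ∫⁻ z, g z := by
        refine lintegral_congr fun h => ?_
        have hm2 : Measurable fun x => ∫⁻ t in I₀₁, g (x + t • h) :=
          hm1.comp (by fun_prop : Measurable fun x : E3 => (x, h))
        rw [lintegral_const_mul _ hm2, lintegral_lintegral_swap]
        · congr 1
          calc _ = ∫⁻ t in I₀₁, ∫⁻ z, g z :=
                lintegral_congr fun t => lintegral_add_right_eq_self g (t • h)
            _ = _ := by simp
        · exact (hgm.comp (by fun_prop : Measurable fun p : E3 × ℝ => p.1 + p.2 • h)).aemeasurable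
    _ = κ * ∫⁻ z in B, ‖fderiv ℝ w z‖ₑ ^ 2 := by
        rw [lintegral_mul_const _ hkm, hκd, hkk, lintegral_indicator Metric.isClosed_closedBall.measurableSet,
          hg, lintegral_indicator hBm]

/-! ### Smoothing -/

section
variable {V : Type*} [NormedAddCommGroup V] [MeasurableSpace V] [BorelSpace V]
  [SecondCountableTopology V] {μ : Measure V} [μ.IsAddRightInvariant]
  [IsLocallyFiniteMeasure μ] [μ.InnerRegularCompactLTTop]

/-- Translations are continuous in `L²`. -/
theorem tendsto_eLpNorm_translate {ι : E3 → V} (hι : Continuous ι) (hι0 : ι 0 = 0) {W : V → G}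
    (hW : MemLp W 2 μ) :
    Tendsto (fun h : E3 => eLpNorm (fun z => W (z + ι h) - W z) 2 μ) (𝓝 0) (𝓝 0) := by
  have h0 : Fact ((1 : ℝ≥0∞) ≤ 2) := ⟨one_le_two⟩
  set g : E3 → C(V, V) := fun h => ⟨fun z => z + ι h, by fun_prop⟩ with hg
  have hgc : Continuous g := ContinuousMap.continuous_of_continuous_uncurry g (by
      simp only [hg, ContinuousMap.coe_mk, Function.uncurry_def]
      fun_prop)
  have hmp (h : E3) : MeasurePreserving (g h) μ μ := measurePreserving_add_right μ (ι h)
  have h1 := Filter.Tendsto.compMeasurePreservingLp (f := fun _ => hW.toLp W)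
    (tendsto_const_nhds (x := hW.toLp W) (f := 𝓝 (0 : E3))) (hgc.tendsto 0) hmp (hmp 0) (by simp)
  rw [tendsto_iff_edist_tendsto_0] at h1
  refine h1.congr fun h => ?_
  rw [Lp.toLp_compMeasurePreserving, Lp.toLp_compMeasurePreserving, Lp.edist_toLp_toLp]
  congr 1
  ext z
  simp [hg, hι0]

/-- Averages of translates. -/
theorem lintegral_translate_sq_le {ι : E3 → V} (hι : Continuous ι) {W : V → G}
    (hW : StronglyMeasurable W) (P : Measure E3) [IsProbabilityMeasure P] [SFinite μ] {ε : ℝ≥0∞}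
    (hε : ∀ᵐ h ∂P, eLpNorm (fun z => W (z + ι h) - W z) 2 μ ≤ ε) :
    ∫⁻ z, (∫⁻ h, ‖W (z + ι h) - W z‖ₑ ∂P) ^ 2 ∂μ ≤ ε ^ 2 := by
  have hm : Measurable fun p : V × E3 => ‖W (p.1 + ι p.2) - W p.1‖ₑ :=
    ((hW.comp_measurable (by fun_prop : Measurable fun p : V × E3 => p.1 + ι p.2)).sub
      (hW.comp_measurable measurable_fst)).enorm
  calc _ ≤ ∫⁻ z, ∫⁻ h, ‖W (z + ι h) - W z‖ₑ ^ 2 ∂P ∂μ :=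
        lintegral_mono fun z => lintegral_sq_le (hm.comp measurable_prodMk_left).aemeasurable
    _ = ∫⁻ h, ∫⁻ z, ‖W (z + ι h) - W z‖ₑ ^ 2 ∂μ ∂P :=
        lintegral_lintegral_swap (hm.pow_const 2).aemeasurable
    _ = ∫⁻ h, eLpNorm (fun z => W (z + ι h) - W z) 2 μ ^ 2 ∂P := by simp only [eLpNorm_two_sq]
    _ ≤ ∫⁻ h, ε ^ 2 ∂P := lintegral_mono_ae (hε.mono fun h hh => pow_le_pow_left' hh 2)
    _ = ε ^ 2 := by simp

end

/-- A nonnegative smooth kernel of integral `1` that is supported in `S`. -/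
structure IsKernel (k : E3 → ℝ) (S : Set E3) : Prop where
  contDiff : ContDiff ℝ ∞ k
  compact : HasCompactSupport k
  nonneg : ∀ h, 0 ≤ k h
  integral : ∫ h, k h = 1
  support : tsupport k ⊆ S

/-- The probability measure with density `k`. -/
def kerMeasure (k : E3 → ℝ) : Measure E3 := volume.withDensity fun h => ofReal (k h)

/-- The average of `u` near `x` with weight `k`. -/
def smoothing (k : E3 → ℝ) (u : E3 → F) (x : E3) : F := ∫ y, k (y - x) • u y

section

variable {k : E3 → ℝ}

theorem IsKernel.integrable (hk : IsKernel k S) : Integrable k :=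
  hk.contDiff.continuous.integrable_of_hasCompactSupport hk.compact

theorem IsKernel.isProbabilityMeasure (hk : IsKernel k S) : IsProbabilityMeasure (kerMeasure k) := by
  constructor
  rw [kerMeasure, withDensity_apply _ MeasurableSet.univ, Measure.restrict_univ,
    ← ofReal_integral_eq_lintegral_ofReal hk.integrable (of_forall hk.nonneg), hk.integral,
    ENNReal.ofReal_one]

theorem IsKernel.ae_mem (hk : IsKernel k S) : ∀ᵐ h ∂(kerMeasure k), h ∈ S := by
  have hm : Measurable fun h => ofReal (k h) := hk.contDiff.continuous.measurable.ennreal_ofReal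
  rw [kerMeasure, ae_withDensity_iff hm]
  refine of_forall fun h hh => hk.support (subset_tsupport _ ?_)
  rw [Function.mem_support]
  intro h0
  exact hh (by rw [h0, ENNReal.ofReal_zero])

theorem IsKernel.lintegral (hk : IsKernel k S) {f : E3 → ℝ≥0∞} (hf : Measurable f) :
    ∫⁻ h, f h ∂(kerMeasure k) = ∫⁻ h, ofReal (k h) * f h := by
  rw [kerMeasure, lintegral_withDensity_eq_lintegral_mul _
    hk.contDiff.continuous.measurable.ennreal_ofReal hf]
  rfl

theorem smoothing_eq (k : E3 → ℝ) (u : E3 → F) (x : E3) :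
    smoothing k u x = ∫ h, k h • u (x + h) := by
  rw [smoothing, ← integral_add_left_eq_self (fun y => k (y - x) • u y) x]
  simp

theorem IsKernel.integrable_smul (hk : IsKernel k S) {u : E3 → F} (hu : Integrable u) (x : E3) :
    Integrable fun h => k h • u (x + h) := by
  obtain ⟨M, hM⟩ := hk.compact.exists_bound_of_continuous hk.contDiff.continuous
  exact (hu.comp_add_left x).bdd_smul M hk.contDiff.continuous.aestronglyMeasurable (of_forall hM)

theorem IsKernel.enorm_integral_le (hk : IsKernel k S) {f : E3 → F} (hf : StronglyMeasurable f) :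
    ‖∫ h, k h • f h‖ₑ ≤ ∫⁻ h, ‖f h‖ₑ ∂(kerMeasure k) := by
  rw [hk.lintegral hf.enorm]
  refine (enorm_integral_le_lintegral_enorm _).trans (le_of_eq (lintegral_congr fun h => ?_))
  rw [enorm_smul, Real.enorm_of_nonneg (hk.nonneg h)]

theorem IsKernel.integral_smul_const [CompleteSpace F] (hk : IsKernel k S) (v : F) :
    ∫ h, k h • v = v := by rw [_root_.integral_smul_const, hk.integral, one_smul]

theorem IsKernel.enorm_smoothing_sub_le [CompleteSpace F] (hk : IsKernel k S) {u : E3 → F}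
    (hm : StronglyMeasurable u) (hu : Integrable u) (x : E3) :
    ‖smoothing k u x - u x‖ₑ ≤ ∫⁻ h, ‖u (x + h) - u x‖ₑ ∂(kerMeasure k) := by
  rw [smoothing_eq]
  nth_rw 1 [← hk.integral_smul_const (u x)]
  rw [← integral_sub (hk.integrable_smul hu x) (hk.integrable.smul_const _)]
  simp only [← smul_sub]
  exact hk.enorm_integral_le ((hm.comp_measurable (by fun_prop)).sub stronglyMeasurable_const)

theorem IsKernel.enorm_dq_smoothing_sub_le [CompleteSpace F] (hk : IsKernel k S) {u : E3 → F}
    (hm : StronglyMeasurable u) (hu : Integrable u) (s : ℝ) (x y : E3) :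
    ‖dq s (smoothing k u - u) (x, y)‖ₑ ≤
      ∫⁻ h, ‖dq s u (x + h, y + h) - dq s u (x, y)‖ₑ ∂(kerMeasure k) := by
  have hi (z : E3) : Integrable fun h => k h • (u (z + h) - u z) := by
    simp only [smul_sub]
    exact (hk.integrable_smul hu z).sub (hk.integrable.smul_const _)
  have e (z : E3) : (smoothing k u - u) z = ∫ h, k h • (u (z + h) - u z) := by
    rw [Pi.sub_apply, smoothing_eq]
    nth_rw 1 [← hk.integral_smul_const (u z)]
    rw [← integral_sub (hk.integrable_smul hu z) (hk.integrable.smul_const _)]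
    simp only [smul_sub]
  have e2 : dq s (smoothing k u - u) (x, y) =
      ∫ h, k h • (dq s u (x + h, y + h) - dq s u (x, y)) := by
    rw [dq, e, e, ← integral_sub (hi x) (hi y), ← integral_smul]
    refine integral_congr_ae (of_forall fun h => ?_)
    simp only [dq, add_sub_add_right_eq_sub]
    module
  rw [e2]
  refine hk.enorm_integral_le (StronglyMeasurable.sub ?_ stronglyMeasurable_const)
  simp only [dq, add_sub_add_right_eq_sub]
  exact ((hm.comp_measurable (by fun_prop)).sub (hm.comp_measurable (by fun_prop))).const_smul _

theorem tendsto_smoothing_aux {V : Type*} [NormedAddCommGroup V] [MeasurableSpace V] [BorelSpace V]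
    [SecondCountableTopology V] {μ : Measure V} [μ.IsAddRightInvariant] [IsLocallyFiniteMeasure μ]
    [μ.InnerRegularCompactLTTop] [SFinite μ] {ι : E3 → V} (hι : Continuous ι) (hι0 : ι 0 = 0)
    {W : V → G} (hWm : StronglyMeasurable W) (hW : MemLp W 2 μ) {k : ℕ → E3 → ℝ} {ρ : ℕ → ℝ}
    (hk : ∀ n, IsKernel (k n) (closedBall 0 (ρ n))) (hρ : ρ ⇝ 0) {f : ℕ → V → F} {A : Set V}
    (hA : MeasurableSet A) (hf : ∀ n, ∀ z ∈ A, ‖f n z‖ₑ ≤ ∫⁻ h,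
    ‖W (z + ι h) - W z‖ₑ ∂(kerMeasure (k n))) : (fun n => eLpNorm (f n) 2 (μ.restrict A)) ⇝ 0 := by
  rw [ENNReal.tendsto_atTop_zero]
  intro ε hε
  have h1 := (ENNReal.tendsto_nhds_zero.1 (tendsto_eLpNorm_translate hι hι0 hW)) ε hε
  obtain ⟨R, hR, hball⟩ := Metric.eventually_nhds_iff_ball.1 h1
  obtain ⟨N, hN⟩ := eventually_atTop.1 (hρ.eventually (gt_mem_nhds hR))
  refine ⟨N, fun n hn => ?_⟩
  have := (hk n).isProbabilityMeasure
  rw [← ENNReal.pow_le_pow_left_iff two_ne_zero, eLpNorm_two_sq]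
  calc _ ≤ ∫⁻ z in A, (∫⁻ h, ‖W (z + ι h) - W z‖ₑ ∂(kerMeasure (k n))) ^ 2 ∂μ :=
        setLIntegral_mono' hA fun z hz => pow_le_pow_left' (hf n z hz) 2
    _ ≤ ∫⁻ z, (∫⁻ h, ‖W (z + ι h) - W z‖ₑ ∂(kerMeasure (k n))) ^ 2 ∂μ := setLIntegral_le_lintegral _ _
    _ ≤ ε ^ 2 := lintegral_translate_sq_le hι hWm _ ((hk n).ae_mem.mono fun h hh =>
        hball h (Metric.closedBall_subset_ball (hN n hn) hh))

theorem tendsto_smoothing_L2 [CompleteSpace F] {k : ℕ → E3 → ℝ} {ρ : ℕ → ℝ}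
    (hk : ∀ n, IsKernel (k n) (closedBall 0 (ρ n))) (hρ : ρ ⇝ 0) {u : E3 → F}
    (hm : StronglyMeasurable u) (hi : Integrable u) (hu : MemLp u 2) {A : Set E3}
    (hA : MeasurableSet A) :
    (fun n => eLpNorm (smoothing (k n) u - u) 2 (leb A)) ⇝ 0 :=
  tendsto_smoothing_aux continuous_id rfl hm hu hk hρ hA fun n z _ =>
    (hk n).enorm_smoothing_sub_le hm hi z

theorem tendsto_smoothing_hsNorm [CompleteSpace F] {k : ℕ → E3 → ℝ} {ρ : ℕ → ℝ} (hk : ∀ n,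
    IsKernel (k n) (closedBall 0 (ρ n))) (hρ : ρ ⇝ 0) {u : E3 → F} (hm : StronglyMeasurable u)
    (hi : Integrable u) (hu : MemLp u 2) {A : Set E3} (hA : MeasurableSet A) (hΩ : MeasurableSet Ω)
    (hAΩ : A ⊆ Ω) (hs : hsSemi Ω s u < ⊤) (hmem : ∀ n, ∀ x ∈ A, ∀ h ∈ tsupport (k n), x + h ∈ Ω) :
    (fun n => hsNorm A s (smoothing (k n) u - u)) ⇝ 0 := by
  have : (volume : Measure (E3 × E3)).IsAddRightInvariant := by rw [volume_eq_prod]; infer_instance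
  have hdm : StronglyMeasurable (dq s u) := (measurable_dq_coeff s).stronglyMeasurable.smul
      ((hm.comp_measurable measurable_fst).sub (hm.comp_measurable measurable_snd))
  set W : E3 × E3 → F := (Ω ×ˢ Ω).indicator (dq s u) with hW
  have hWm : StronglyMeasurable W := hdm.indicator (hΩ.prod hΩ)
  have hW2 : MemLp W 2 := (memLp_indicator_iff_restrict (hΩ.prod hΩ)).2
    ⟨hdm.aestronglyMeasurable, hs⟩
  have h1 := tendsto_smoothing_L2 hk hρ hm hi hu hA
  have h2 := tendsto_smoothing_aux (F := F) (ι := fun h : E3 => (h, h)) (by fun_prop) rfl hWm hW2 hk hρ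
    (f := fun n => dq s (smoothing (k n) u - u)) (hA.prod hA) (fun n z hz => by
      refine ((hk n).enorm_dq_smoothing_sub_le hm hi s z.1 z.2).trans (le_of_eq ?_)
      refine lintegral_congr_ae ?_
      have hk' : IsKernel (k n) (tsupport (k n)) :=
        ⟨(hk n).contDiff, (hk n).compact, (hk n).nonneg, (hk n).integral, subset_rfl⟩
      filter_upwards [hk'.ae_mem] with h hh
      rw [hW, indicator_of_mem (show z ∈ Ω ×ˢ Ω from ⟨hAΩ hz.1, hAΩ hz.2⟩),
        indicator_of_mem (show z + (h, h) ∈ Ω ×ˢ Ω from ⟨hmem n _ hz.1 _ hh, hmem n _ hz.2 _ hh⟩)]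
      rfl)
  simpa [hsNorm, hsSemi] using h1.add h2

end

section

/-- `T ∘ D` maps `u` to `d` in the sense of distributions on `Ω`. -/
def HasWeakOp (Ω : Set E3) (T : (E3 →L[ℝ] F) →L[ℝ] G) (u : E3 → F) (d : E3 → G) : Prop :=
  ∀ χ : E3 → ℝ, IsTest Ω χ → ∫ x in Ω, T ((fderiv ℝ χ x).smulRight (u x)) = -∫ x in Ω, χ x • d x

theorem smoothing_eq_convolution (k : E3 → ℝ) (u : E3 → F) :
    smoothing k u = convolution u (fun z => k (-z)) (lsmul ℝ ℝ).flip volume := by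
  ext x
  simp [smoothing, convolution]

variable {k : E3 → ℝ}

theorem IsKernel.comp_neg (hk : IsKernel k S) : ContDiff ℝ ∞ (fun z => k (-z)) ∧
    HasCompactSupport fun z => k (-z) :=
  ⟨hk.contDiff.comp contDiff_neg, hk.compact.comp_homeomorph (Homeomorph.neg E3)⟩

theorem IsKernel.contDiff_smoothing (hk : IsKernel k S) {u : E3 → F} (hu : Integrable u) :
    ContDiff ℝ ∞ (smoothing k u) := by
  rw [smoothing_eq_convolution]
  exact hk.comp_neg.2.contDiff_convolution_right _ hu.locallyIntegrable hk.comp_neg.1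

theorem IsKernel.hasFDerivAt_smoothing (hk : IsKernel k S) {u : E3 → F} (hu : Integrable u) (x : E3) :
    Integrable (fun t => (fderiv ℝ k (t - x)).smulRight (u t)) ∧
    HasFDerivAt (smoothing k u) (-∫ t, (fderiv ℝ k (t - x)).smulRight (u t)) x := by
  obtain ⟨h1, h2⟩ := hk.comp_neg
  have h3 := h2.hasFDerivAt_convolution_right (lsmul ℝ ℝ (E := F)).flip
    hu.locallyIntegrable (h1.of_le (by simp)) x
  have h4 : ConvolutionExistsAt u (fderiv ℝ fun z => k (-z)) x
      (ContinuousLinearMap.precompR E3 (lsmul ℝ ℝ (E := F)).flip) volume :=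
    (h2.fderiv ℝ).convolutionExists_right _ hu.locallyIntegrable (h1.continuous_fderiv (by simp)) x
  have e (t : E3) : ContinuousLinearMap.precompR E3 (lsmul ℝ ℝ (E := F)).flip (u t)
      (fderiv ℝ (fun z => k (-z)) (x - t)) = -(fderiv ℝ k (t - x)).smulRight (u t) := by
    have e1 : fderiv ℝ (fun z => k (-z)) (x - t) = (fderiv ℝ k (t - x)).comp (-ContinuousLinearMap.id ℝ E3) := by
      have h5 : HasFDerivAt (fun z : E3 => -z) (-ContinuousLinearMap.id ℝ E3) (x - t) :=
        (hasFDerivAt_id _).neg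
      have h6 := (hk.contDiff.differentiable (by simp) (-(x - t))).hasFDerivAt.comp (x - t) h5
      rw [neg_sub] at h6
      exact h6.fderiv
    rw [e1]
    ext v
    simp [ContinuousLinearMap.precompR_apply]
  rw [ConvolutionExistsAt] at h4
  rw [convolution, ← smoothing_eq_convolution] at h3
  simp only [e] at h3 h4
  rw [integral_neg] at h3
  exact ⟨by simpa using h4.neg, h3⟩

/-- Smoothing commutes with differential operators away from the boundary. -/
theorem IsKernel.op_smoothing [CompleteSpace F] [CompleteSpace G] (hk : IsKernel k S)
    {T : (E3 →L[ℝ] F) →L[ℝ] G} {u : E3 → F} {d : E3 → G} (hu : Integrable u)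
    (hu0 : ∀ x ∉ Ω, u x = 0) (hd0 : ∀ x ∉ Ω, d x = 0) (hw : HasWeakOp Ω T u d) {x : E3}
    (hx : ∀ h ∈ tsupport k, x + h ∈ Ω) : T (fderiv ℝ (smoothing k u) x) = smoothing k d x := by
  obtain ⟨h1, h2⟩ := hk.hasFDerivAt_smoothing hu x
  have hχ : IsTest Ω fun t => k (t - x) := by
    refine ⟨hk.contDiff.comp (contDiff_id.sub contDiff_const),
      hk.compact.comp_homeomorph (Homeomorph.subRight x), ?_⟩
    have : tsupport (fun t => k (t - x)) = (Homeomorph.subRight x) ⁻¹' tsupport k :=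
      tsupport_comp_eq_preimage k (Homeomorph.subRight x)
    rw [this]
    intro t ht
    simpa using hx _ ht
  have h3 := hw _ hχ
  have h4 (t : E3) : fderiv ℝ (fun t => k (t - x)) t = fderiv ℝ k (t - x) := fderiv_comp_sub (f := k) x
  simp only [h4] at h3
  rw [setIntegral_eq_integral_of_forall_compl_eq_zero (fun t ht => by simp [hu0 t ht]),
    setIntegral_eq_integral_of_forall_compl_eq_zero (fun t ht => by simp [hd0 t ht])] at h3
  rw [h2.fderiv, map_neg, ← T.integral_comp_comm h1, h3, neg_neg]
  rfl

theorem hsNorm_sum_le {ι : Type*} (I : Finset ι) {w : ι → E3 → F}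
    (hw : ∀ j, AEStronglyMeasurable (w j) (leb Ω)) :
    hsNorm Ω s (∑ j ∈ I, w j) ≤ ∑ j ∈ I, hsNorm Ω s (w j) := by
  classical
  induction I using Finset.induction_on with
  | empty =>
    have : dq s (0 : E3 → F) = 0 := by ext p; simp [dq]
    simp [hsNorm, hsSemi, this]
  | insert j I hj ih =>
    rw [Finset.sum_insert hj, Finset.sum_insert hj]
    exact (hsNorm_add_le (hw j) (I.aestronglyMeasurable_sum fun i _ => hw i)).trans
      (add_le_add le_rfl ih)

end

/-- A covering of the closure of `Ω` with a partition of unity, such that a neighbourhood of each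
point of `U j ∩ Ω` can be shifted into `Ω`. -/
structure ShiftCover (Ω : Set E3) where
  N : ℕ
  U : Fin N → Set E3
  η : Fin N → E3 → ℝ
  ker : Fin N → ℕ → E3 → ℝ
  ρ : Fin N → ℕ → ℝ
  isOpen : ∀ j, IsOpen (U j)
  contDiff : ∀ j, ContDiff ℝ ∞ (η j)
  compact : ∀ j, HasCompactSupport (η j)
  support : ∀ j, tsupport (η j) ⊆ U j
  sum_eq : ∀ x ∈ Ω, ∑ j, η j x = 1
  kernel : ∀ j n, IsKernel (ker j n) (closedBall 0 (ρ j n))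
  tendsto : ∀ j, (ρ j) ⇝ 0
  shift : ∀ j n, ∀ x ∈ U j ∩ Ω, ∀ h ∈ tsupport (ker j n), x + h ∈ Ω

/-- A representative of a square integrable function on `Ω`, extended by `0`. -/
structure IsRep {F : Type*} [NormedAddCommGroup F] (Ω : Set E3) (u : E3 → F) : Prop where
  stronglyMeasurable : StronglyMeasurable u
  eq_zero : ∀ x ∉ Ω, u x = 0
  integrable : Integrable u
  memLp : MemLp u 2

section

theorem exists_isRep (hΩ : MeasurableSet Ω) (hfin : volume Ω < ⊤) {u : E3 → F}
    (hu : MemLp u 2 (leb Ω)) : ∃ u', IsRep Ω u' ∧ u' =ᵐ[leb Ω] u := by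
  have : IsFiniteMeasure (leb Ω) := ⟨by simpa using hfin⟩
  have h1 : hu.1.mk u =ᵐ[leb Ω] u := hu.1.ae_eq_mk.symm
  have h2 : MemLp (hu.1.mk u) 2 (leb Ω) := hu.ae_eq h1.symm
  refine ⟨Ω.indicator (hu.1.mk u), ⟨hu.1.stronglyMeasurable_mk.indicator hΩ,
    fun x hx => indicator_of_notMem hx _,
    (integrable_indicator_iff hΩ).2 (h2.integrable one_le_two),
    (memLp_indicator_iff_restrict hΩ).2 h2⟩, ?_⟩
  exact (indicator_ae_eq_restrict hΩ).trans h1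

namespace ShiftCover
variable {Ω : Set E3} (c : ShiftCover Ω)

/-- `∑ⱼ Aⱼ Sⱼ u` with the smoothing operators `Sⱼ`. -/
def fam (A : Fin c.N → E3 → F →L[ℝ] G) (n : ℕ) (u : E3 → F) (x : E3) : G :=
  ∑ j, A j x (smoothing (c.ker j n) u x)

theorem aestronglyMeasurable_apply {A : E3 → F →L[ℝ] G} (hA : Continuous A) {w : E3 → F}
    {μ : Measure E3} (hw : AEStronglyMeasurable w μ) :
    AEStronglyMeasurable (fun x => A x (w x)) μ :=
  isBoundedBilinearMap_apply.continuous.comp_aestronglyMeasurable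
    (hA.aestronglyMeasurable.prodMk hw)

theorem fam_sub (A : Fin c.N → E3 → F →L[ℝ] G) (n : ℕ) (u : E3 → F) :
    (c.fam A n u - fun x => ∑ j, A j x (u x)) =
      ∑ j, fun x => A j x ((smoothing (c.ker j n) u - u) x) := by
  ext x
  simp [fam, Finset.sum_apply]

theorem continuous_smoothing {u : E3 → F} (hu : IsRep Ω u) (j n) :
    Continuous (smoothing (c.ker j n) u) := ((c.kernel j n).contDiff_smoothing hu.integrable).continuous

theorem aestronglyMeasurable_smoothing_sub {u : E3 → F} (hu : IsRep Ω u) (j n) {μ : Measure E3} :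
    AEStronglyMeasurable (smoothing (c.ker j n) u - u) μ :=
  (c.continuous_smoothing hu j n).aestronglyMeasurable.sub hu.stronglyMeasurable.aestronglyMeasurable

theorem aestronglyMeasurable_fam_sub {A : Fin c.N → E3 → F →L[ℝ] G} (hA : ∀ j, Continuous (A j))
    {u : E3 → F} (hu : IsRep Ω u) (n : ℕ) {μ : Measure E3} :
    AEStronglyMeasurable (c.fam A n u - fun x => ∑ j, A j x (u x)) μ := by
  rw [fam_sub]
  exact Finset.aestronglyMeasurable_sum _ fun j _ => aestronglyMeasurable_apply (hA j)
    (c.aestronglyMeasurable_smoothing_sub hu j n)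

theorem tendsto_fam_L2 [CompleteSpace F] (hΩ : IsOpen Ω) {A : Fin c.N → E3 → F →L[ℝ] G}
    (hA : ∀ j, Continuous (A j)) (hAc : ∀ j, HasCompactSupport (A j))
    (hAU : ∀ j, Function.support (A j) ⊆ c.U j) {u : E3 → F} (hu : IsRep Ω u) :
    (fun n => eLpNorm (c.fam A n u - fun x => ∑ j, A j x (u x)) 2 (leb Ω)) ⇝ 0 := by
  choose C hC using fun j => exists_eLpNorm_mul_bound (c.isOpen j).measurableSet
    (hA j) (hAc j) (hAU j)
  have h1 (j) := ENNReal.Tendsto.const_mul (a := (C j : ℝ≥0∞)) (tendsto_smoothing_L2 (c.kernel j)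
    (c.tendsto j) hu.stronglyMeasurable hu.integrable hu.memLp
    ((c.isOpen j).measurableSet.inter hΩ.measurableSet)) (Or.inr coe_ne_top)
  have h2 := tendsto_finsetSum Finset.univ fun j _ => h1 j
  simp only [mul_zero, Finset.sum_const_zero] at h2
  refine tendsto_zero_of_le h2 fun n => ?_
  rw [fam_sub]
  exact (eLpNorm_sum_le (fun j _ => aestronglyMeasurable_apply (hA j)
    (c.aestronglyMeasurable_smoothing_sub hu j n)) one_le_two).trans
    (Finset.sum_le_sum fun j _ => hC j _)

theorem tendsto_fam_hs [CompleteSpace F] (hΩ : IsOpen Ω) (hD : ∀ x ∈ Ω, ∀ y ∈ Ω, ‖x - y‖ ≤ D)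
    {A : Fin c.N → E3 → F →L[ℝ] G} (hA : ∀ j, ContDiff ℝ 1 (A j))
    (hAc : ∀ j, HasCompactSupport (A j)) (hAU : ∀ j, Function.support (A j) ⊆ c.U j) {u : E3 → F}
    (hu : IsRep Ω u) (hs1 : s < 1) (hus : hsSemi Ω s u < ⊤) :
    (fun n => hsNorm Ω s (c.fam A n u - fun x => ∑ j, A j x (u x))) ⇝ 0 := by
  choose C hC using fun j => exists_hsNorm_mul_bound hΩ.measurableSet hD (c.isOpen j).measurableSet
    (hA j) (hAc j) (hAU j) hs1
  have h1 (j) := ENNReal.Tendsto.const_mul (a := (C j : ℝ≥0∞)) (tendsto_smoothing_hsNorm (c.kernel j)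
    (c.tendsto j) hu.stronglyMeasurable hu.integrable hu.memLp
    ((c.isOpen j).measurableSet.inter hΩ.measurableSet) hΩ.measurableSet Set.inter_subset_right hus
    (c.shift j)) (Or.inr coe_ne_top)
  have h2 := tendsto_finsetSum Finset.univ fun j _ => h1 j
  simp only [mul_zero, Finset.sum_const_zero] at h2
  refine tendsto_zero_of_le h2 fun n => ?_
  rw [fam_sub]
  exact (hsNorm_sum_le _ (fun j => aestronglyMeasurable_apply (hA j).continuous
    (c.aestronglyMeasurable_smoothing_sub hu j n))).trans
    (Finset.sum_le_sum fun j _ => hC j _ (c.aestronglyMeasurable_smoothing_sub hu j n))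

/-- The cut-off functions as operators. -/
def cut (j : Fin c.N) (x : E3) : F →L[ℝ] F := c.η j x • ContinuousLinearMap.id ℝ F

/-- The smooth approximations of `u`. -/
def approx (n : ℕ) (u : E3 → F) : E3 → F := c.fam c.cut n u

theorem contDiff_cut (j) : ContDiff ℝ ∞ (c.cut (F := F) j) := (c.contDiff j).smul contDiff_const

theorem compact_cut (j) : HasCompactSupport (c.cut (F := F) j) := (c.compact j).smul_right

theorem support_cut (j) : Function.support (c.cut (F := F) j) ⊆ c.U j :=
  (Function.support_smul_subset_left _ _).trans ((subset_tsupport _).trans (c.support j))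

theorem sum_cut {x : E3} (hx : x ∈ Ω) (v : F) : ∑ j, c.cut j x v = v := by
  simp [cut, ← Finset.sum_smul, c.sum_eq x hx]

theorem contDiff_fam {A : Fin c.N → E3 → F →L[ℝ] G} {m : ℕ∞} (hA : ∀ j, ContDiff ℝ m (A j)) {u : E3 → F}
    (hu : IsRep Ω u) (n : ℕ) : ContDiff ℝ m (c.fam A n u) :=
  ContDiff.sum fun j _ => (hA j).clm_apply
    (((c.kernel j n).contDiff_smoothing hu.integrable).of_le (by exact_mod_cast le_top))

theorem contDiff_approx {u : E3 → F} (hu : IsRep Ω u) (n : ℕ) : ContDiff ℝ ∞ (c.approx n u) :=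
  c.contDiff_fam c.contDiff_cut hu n

theorem tendsto_approx_L2 [CompleteSpace F] (hΩ : IsOpen Ω) {u : E3 → F} (hu : IsRep Ω u) :
    (fun n => eLpNorm (c.approx n u - u) 2 (leb Ω)) ⇝ 0 := by
  refine (c.tendsto_fam_L2 hΩ (fun j => (c.contDiff_cut j).continuous) c.compact_cut c.support_cut
    hu).congr fun n => eLpNorm_congr_ae ((ae_restrict_iff' hΩ.measurableSet).2
      (of_forall fun x hx => ?_))
  simp only [Pi.sub_apply, c.sum_cut hx]
  rfl

theorem tendsto_approx_hs [CompleteSpace F] (hΩ : IsOpen Ω) (hD : ∀ x ∈ Ω, ∀ y ∈ Ω, ‖x - y‖ ≤ D)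
    {u : E3 → F} (hu : IsRep Ω u) (hs1 : s < 1) (hus : hsSemi Ω s u < ⊤) :
    (fun n => hsNorm Ω s (c.approx n u - u)) ⇝ 0 := by
  refine (c.tendsto_fam_hs hΩ hD (fun j => (c.contDiff_cut j).of_le (by simp)) c.compact_cut
    c.support_cut hu hs1 hus).congr fun n => hsNorm_congr ((ae_restrict_iff' hΩ.measurableSet).2
      (of_forall fun x hx => ?_))
  simp only [Pi.sub_apply, c.sum_cut hx]
  rfl

/-- The commutators of `T ∘ D` with the cut-off functions. -/
def comm (T : (E3 →L[ℝ] F) →L[ℝ] G) (j : Fin c.N) (x : E3) : F →L[ℝ] G :=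
  T.comp (smulRightL ℝ E3 F (fderiv ℝ (c.η j) x))

theorem comm_apply (T : (E3 →L[ℝ] F) →L[ℝ] G) (j : Fin c.N) (x : E3) (v : F) :
    c.comm T j x v = T ((fderiv ℝ (c.η j) x).smulRight v) := rfl

theorem contDiff_comm (T : (E3 →L[ℝ] F) →L[ℝ] G) (j) : ContDiff ℝ ∞ (c.comm T j) := by
  have h : ContDiff ℝ ∞ fun A : E3 →L[ℝ] ℝ => smulRightL ℝ E3 F A := ContinuousLinearMap.contDiff _
  exact contDiff_const.clm_comp (h.comp ((c.contDiff j).fderiv_right (m := ∞) le_rfl))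

theorem support_comm_subset (T : (E3 →L[ℝ] F) →L[ℝ] G) (j) :
    Function.support (c.comm T j) ⊆ Function.support (fderiv ℝ (c.η j)) := by
  intro x hx h0
  refine hx ?_
  ext v
  rw [comm_apply, h0]
  simp

theorem support_comm (T : (E3 →L[ℝ] F) →L[ℝ] G) (j) : Function.support (c.comm T j) ⊆ c.U j :=
  (c.support_comm_subset T j).trans ((support_fderiv_subset ℝ).trans (c.support j))

theorem compact_comm (T : (E3 →L[ℝ] F) →L[ℝ] G) (j) : HasCompactSupport (c.comm T j) :=
  ((c.compact j).fderiv ℝ).mono (c.support_comm_subset T j)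

theorem sum_comm (hΩ : IsOpen Ω) (T : (E3 →L[ℝ] F) →L[ℝ] G) {x : E3} (hx : x ∈ Ω) :
    ∑ j, c.comm T j x = 0 := by
  have h1 : fderiv ℝ (fun y => ∑ j, c.η j y) x = 0 := by
    have : (fun y => ∑ j, c.η j y) =ᶠ[𝓝 x] fun _ => 1 :=
      Filter.eventuallyEq_of_mem (hΩ.mem_nhds hx) c.sum_eq
    rw [this.fderiv_eq]; simp
  rw [fderiv_fun_sum fun j _ => ((c.contDiff j).differentiable (by simp)).differentiableAt] at h1
  simp only [comm]
  ext v
  rw [sum_apply]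
  simp only [ContinuousLinearMap.comp_apply]
  rw [← map_sum, ← sum_apply, ← map_sum, h1]
  simp

theorem op_approx [CompleteSpace F] [CompleteSpace G] {T : (E3 →L[ℝ] F) →L[ℝ] G}
    {u : E3 → F} {d : E3 → G} (hu : IsRep Ω u) (hd : IsRep Ω d) (hw : HasWeakOp Ω T u d) (n : ℕ) {x : E3}
    (hx : x ∈ Ω) : T (fderiv ℝ (c.approx n u) x) = c.approx n d x + c.fam (c.comm T) n u x := by
  have hS (j) : DifferentiableAt ℝ (smoothing (c.ker j n) u) x :=
    (((c.kernel j n).contDiff_smoothing hu.integrable).differentiable (by simp)).differentiableAt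
  have hη (j) : DifferentiableAt ℝ (c.η j) x := ((c.contDiff j).differentiable (by simp)).differentiableAt
  have e : c.approx n u = fun x => ∑ j, c.η j x • smoothing (c.ker j n) u x := by
    ext x; simp [approx, fam, cut]
  rw [e, fderiv_fun_sum fun j _ => (hη j).fun_smul (hS j), map_sum, approx, fam, fam,
    ← sum_add_distrib]
  refine Finset.sum_congr rfl fun j _ => ?_
  rw [fderiv_fun_smul (hη j) (hS j), map_add, map_smul, comm_apply, cut]
  congr 1
  by_cases hxU : x ∈ c.U j
  · rw [(c.kernel j n).op_smoothing hu.integrable hu.eq_zero hd.eq_zero hw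
      (c.shift j n x ⟨hxU, hx⟩)]
    rfl
  · have : c.η j x = 0 := image_eq_zero_of_notMem_tsupport fun h => hxU (c.support j h)
    simp [this]

theorem tendsto_op_approx_hs [CompleteSpace F] [CompleteSpace G] (hΩ : IsOpen Ω)
    (hD : ∀ x ∈ Ω, ∀ y ∈ Ω, ‖x - y‖ ≤ D) {T : (E3 →L[ℝ] F) →L[ℝ] G} {u : E3 → F} {d : E3 → G}
    (hu : IsRep Ω u) (hd : IsRep Ω d) (hw : HasWeakOp Ω T u d) (hs1 : s < 1)
    (hus : hsSemi Ω s u < ⊤) (hds : hsSemi Ω s d < ⊤) :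
    (fun n => hsNorm Ω s ((fun x => T (fderiv ℝ (c.approx n u) x)) - d)) ⇝ 0 := by
  have h1 := c.tendsto_approx_hs hΩ hD hd hs1 hds
  have h2 := c.tendsto_fam_hs hΩ hD (fun j => (c.contDiff_comm T j).of_le (by simp)) (c.compact_comm T)
    (c.support_comm T) hu hs1 hus
  have h3 := h1.add h2
  rw [add_zero] at h3
  refine tendsto_zero_of_le h3 fun n => ?_
  refine le_trans (le_of_eq (hsNorm_congr ((ae_restrict_iff' hΩ.measurableSet).2
    (of_forall fun x hx => ?_)))) (hsNorm_add_le
      ((c.contDiff_approx hd n).continuous.aestronglyMeasurable.sub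
        hd.stronglyMeasurable.aestronglyMeasurable)
      ((c.contDiff_fam (c.contDiff_comm T) hu n).continuous.aestronglyMeasurable.sub ?_))
  · simp only [Pi.sub_apply, Pi.add_apply, ← sum_apply, c.sum_comm hΩ T hx]
    rw [c.op_approx hu hd hw n hx]
    simp
    abel
  · simp only [← sum_apply]
    exact aestronglyMeasurable_apply (continuous_finsetSum _ fun j _ => (c.contDiff_comm T j).continuous)
      hu.stronglyMeasurable.aestronglyMeasurable

theorem tendsto_op_approx_L2 [CompleteSpace F] [CompleteSpace G] (hΩ : IsOpen Ω)
    {T : (E3 →L[ℝ] F) →L[ℝ] G}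
    {u : E3 → F} {d : E3 → G} (hu : IsRep Ω u) (hd : IsRep Ω d) (hw : HasWeakOp Ω T u d) :
    (fun n => eLpNorm ((fun x => T (fderiv ℝ (c.approx n u) x)) - d) 2 (leb Ω)) ⇝ 0 := by
  have h1 := c.tendsto_approx_L2 hΩ hd
  have h2 := c.tendsto_fam_L2 hΩ (fun j => (c.contDiff_comm T j).continuous) (c.compact_comm T)
    (c.support_comm T) hu
  have h3 := h1.add h2
  rw [add_zero] at h3
  refine tendsto_zero_of_le h3 fun n => ?_
  refine le_trans (le_of_eq (eLpNorm_congr_ae ((ae_restrict_iff' hΩ.measurableSet).2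
    (of_forall fun x hx => ?_)))) (eLpNorm_add_le
      ((c.contDiff_approx hd n).continuous.aestronglyMeasurable.sub
        hd.stronglyMeasurable.aestronglyMeasurable)
      ((c.contDiff_fam (c.contDiff_comm T) hu n).continuous.aestronglyMeasurable.sub ?_) one_le_two)
  · simp only [Pi.sub_apply, Pi.add_apply, ← sum_apply, c.sum_comm hΩ T hx]
    rw [c.op_approx hu hd hw n hx]
    simp
    abel
  · simp only [← sum_apply]
    exact aestronglyMeasurable_apply (continuous_finsetSum _ fun j _ => (c.contDiff_comm T j).continuous)
      hu.stronglyMeasurable.aestronglyMeasurable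

/-- On a convex subset, the commutators tend to `0` in `H^s` if the derivative is square
integrable. -/
theorem tendsto_fam_hs_of_fderiv [CompleteSpace F] [CompleteSpace G] (hΩ : IsOpen Ω)
    (hB : IsBody B D) (hBΩ : B ⊆ Ω) {u : E3 → F} {d : E3 → E3 →L[ℝ] F} (hu : IsRep Ω u)
    (hd : IsRep Ω d) (hw : HasWeakOp Ω (ContinuousLinearMap.id ℝ _) u d) {A : Fin c.N → E3 → F →L[ℝ]
    G} (hA : ∀ j, ContDiff ℝ ∞ (A j)) (hAc : ∀ j, HasCompactSupport (A j))
    (hAU : ∀ j, tsupport (A j) ⊆ c.U j) (hA0 : ∀ x ∈ Ω, ∑ j, A j x = 0) (hs1 : s < 1) :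
    (fun n => hsNorm B s (c.fam A n u)) ⇝ 0 := by
  obtain ⟨C, hC⟩ := hB.exists_hsSemi_le_fderiv (F := G) hs1
  set A₁ : Fin c.N → E3 → F →L[ℝ] E3 →L[ℝ] G := fun j x => (fderiv ℝ (A j) x).flip
  set A₂ : Fin c.N → E3 → (E3 →L[ℝ] F) →L[ℝ] E3 →L[ℝ] G := fun j x =>
    ContinuousLinearMap.compL ℝ E3 F G (A j x)
  have hA1 (j) : Continuous (A₁ j) := (ContinuousLinearMap.flipₗᵢ ℝ E3 F G).continuous.comp
    ((hA j).continuous_fderiv (by simp))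
  have hA2 (j) : Continuous (A₂ j) := (ContinuousLinearMap.compL ℝ E3 F G).continuous.comp
    (hA j).continuous
  have hs1' (j) : Function.support (A₁ j) ⊆ Function.support (fderiv ℝ (A j)) := fun x hx h0 =>
    hx (by simp only [A₁]; rw [h0]; rfl)
  have hs2' (j) : Function.support (A₂ j) ⊆ Function.support (A j) := fun x hx h0 =>
    hx (by simp only [A₂]; rw [h0, map_zero])
  have h0 := c.tendsto_fam_L2 hΩ (fun j => (hA j).continuous) hAc
    (fun j => (subset_tsupport _).trans (hAU j)) hu
  have h1 := c.tendsto_fam_L2 hΩ hA1 (fun j => ((hAc j).fderiv ℝ).mono (hs1' j))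
    (fun j => (hs1' j).trans ((support_fderiv_subset ℝ).trans (hAU j))) hu
  have h2 := c.tendsto_fam_L2 hΩ hA2 (fun j => (hAc j).mono (hs2' j))
    (fun j => (hs2' j).trans ((subset_tsupport _).trans (hAU j))) hd
  have h3 := h0.add (ENNReal.Tendsto.const_mul (a := (C : ℝ≥0∞)) (h1.add h2) (Or.inr coe_ne_top))
  rw [add_zero, mul_zero, add_zero] at h3
  refine tendsto_zero_of_le h3 fun n => ?_
  have hS (j) (x) : DifferentiableAt ℝ (smoothing (c.ker j n) u) x :=
    (((c.kernel j n).contDiff_smoothing hu.integrable).differentiable (by simp)).differentiableAt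
  have hAd (j) (x) : DifferentiableAt ℝ (A j) x := ((hA j).differentiable (by simp)).differentiableAt
  have hsumA1 (x : E3) (hx : x ∈ Ω) (v : F) : ∑ j, A₁ j x v = 0 := by
    have e : fderiv ℝ (fun y => ∑ j, A j y) x = 0 := by
      have : (fun y => ∑ j, A j y) =ᶠ[𝓝 x] fun _ => 0 := Filter.eventuallyEq_of_mem (hΩ.mem_nhds hx) hA0
      rw [this.fderiv_eq]; simp
    rw [fderiv_fun_sum fun j _ => hAd j x] at e
    ext w
    have := congrArg (fun f => f w v) e
    simpa [A₁] using this
  have hsumA2 (x : E3) (hx : x ∈ Ω) (v : E3 →L[ℝ] F) : ∑ j, A₂ j x v = 0 := by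
    simp only [A₂]
    rw [← sum_apply, ← map_sum, hA0 x hx]
    simp
  have hfd (x : E3) (hx : x ∈ Ω) : fderiv ℝ (c.fam A n u) x =
      ((c.fam A₁ n u - fun x => ∑ j, A₁ j x (u x)) + (c.fam A₂ n d - fun x => ∑ j, A₂ j x (d x))) x := by
    simp only [Pi.add_apply, Pi.sub_apply, hsumA1 x hx, hsumA2 x hx, sub_zero]
    have e : c.fam A n u = fun x => ∑ j, A j x (smoothing (c.ker j n) u x) := rfl
    rw [e, fderiv_fun_sum fun j _ => (hAd j x).clm_apply (hS j x), fam, fam, ← sum_add_distrib]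
    refine Finset.sum_congr rfl fun j _ => ?_
    rw [fderiv_clm_apply (hAd j x) (hS j x), add_comm]
    congr 1
    by_cases hxU : x ∈ c.U j
    · have := (c.kernel j n).op_smoothing hu.integrable hu.eq_zero hd.eq_zero hw
        (c.shift j n x ⟨hxU, hx⟩)
      rw [← this]
      rfl
    · have : A j x = 0 := image_eq_zero_of_notMem_tsupport fun h => hxU (hAU j h)
      simp [A₂, this]
  clear_value A₁ A₂
  have hle := eLpNorm_add_le (c.aestronglyMeasurable_fam_sub hA1 hu n (μ := leb Ω))
    (c.aestronglyMeasurable_fam_sub hA2 hd n) (p := 2) one_le_two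
  refine add_le_add ?_ ((hC _ ((c.contDiff_fam hA hu n).of_le (by simp))).trans (mul_le_mul' le_rfl ?_))
  · refine (eLpNorm_mono_measure _ (restrict_mono hBΩ le_rfl)).trans (le_of_eq
      (eLpNorm_congr_ae ((ae_restrict_iff' hΩ.measurableSet).2 (of_forall fun x hx => ?_))))
    simp only [Pi.sub_apply, ← sum_apply, hA0 x hx]
    simp
  · refine (eLpNorm_mono_measure _ (restrict_mono hBΩ le_rfl)).trans ((le_of_eq
      (eLpNorm_congr_ae ((ae_restrict_iff' hΩ.measurableSet).2 (of_forall hfd)))).trans ?_)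
    exact hle

end ShiftCover

end

/-! ### Gradient, curl and divergence as operators -/

/-- The partial derivative `∂ᵢ` of the `j`-th component. -/
def entry (i j : Fin 3) : (E3 →L[ℝ] E3) →L[ℝ] ℝ := (proj j : E3 →L[ℝ] ℝ).comp
    (ContinuousLinearMap.apply ℝ E3 (single i (1 : ℝ)))

theorem entry_apply (i j : Fin 3) (A : E3 →L[ℝ] E3) : entry i j A = A (single i 1) j := rfl

/-- The linear map into `ℝ³` with given components. -/
def toE3 (f : Fin 3 → H →L[ℝ] ℝ) : H →L[ℝ] E3 :=
  ((PiLp.continuousLinearEquiv 2 ℝ fun _ : Fin 3 => ℝ).symm : (Fin 3 → ℝ) →L[ℝ] E3).comp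
    (ContinuousLinearMap.pi f)

def gradT : (E3 →L[ℝ] ℝ) →L[ℝ] E3 := toE3 fun i => ContinuousLinearMap.apply ℝ ℝ (single i (1 : ℝ))

def curlT : (E3 →L[ℝ] E3) →L[ℝ] E3 :=
  toE3 ![entry 1 2 - entry 2 1, entry 2 0 - entry 0 2, entry 0 1 - entry 1 0]

def divT : (E3 →L[ℝ] E3) →L[ℝ] ℝ := ∑ i, entry i i

theorem gradT_fderiv (ψ : E3 → ℝ) (x : E3) : gradT (fderiv ℝ ψ x) = gradF ψ x := by ext i; rfl

theorem partialD_coord {φ : E3 → E3} {x : E3} (hφ : DifferentiableAt ℝ φ x) (i j : Fin 3) :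
    partialD i (fun y => φ y j) x = entry i j (fderiv ℝ φ x) := by
  have : HasFDerivAt (fun y => φ y j) ((proj j : E3 →L[ℝ] ℝ).comp (fderiv ℝ φ x)) x :=
    (proj j : E3 →L[ℝ] ℝ).hasFDerivAt.comp x hφ.hasFDerivAt
  rw [partialD, this.fderiv]
  rfl

theorem curlT_fderiv {φ : E3 → E3} {x : E3} (hφ : DifferentiableAt ℝ φ x) :
    curlT (fderiv ℝ φ x) = curlF φ x := by
  ext i
  simp only [curlF, partialD_coord hφ]
  fin_cases i <;> rfl

theorem divT_fderiv {φ : E3 → E3} {x : E3} (hφ : DifferentiableAt ℝ φ x) :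
    divT (fderiv ℝ φ x) = divF φ x := by
  simp only [divF, partialD_coord hφ]
  simp [divT]

/-! ### Weak derivatives -/

theorem IsTest.integrable_smulRight {χ : E3 → ℝ} (hχ : IsTest Ω χ) {u : E3 → F} (hu : Integrable u) :
    Integrable fun x => (fderiv ℝ χ x).smulRight (u x) := by
  have hc := hχ.1.continuous_fderiv (by simp)
  obtain ⟨M, hM⟩ := (hχ.2.1.fderiv ℝ).exists_bound_of_continuous hc
  have hA : Continuous fun x => smulRightL ℝ E3 F (fderiv ℝ χ x) :=
    (smulRightL ℝ E3 F).continuous.comp hc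
  refine (hu.norm.const_mul M).mono' (ShiftCover.aestronglyMeasurable_apply hA hu.1)
    (of_forall fun x => ?_)
  rw [ContinuousLinearMap.norm_smulRight_apply]
  exact mul_le_mul_of_nonneg_right (hM x) (norm_nonneg _)

theorem IsTest.integrable_smul {χ : E3 → ℝ} (hχ : IsTest Ω χ) {u : E3 → F} (hu : Integrable u) :
    Integrable fun x => χ x • u x := by
  obtain ⟨M, hM⟩ := hχ.2.1.exists_bound_of_continuous hχ.1.continuous
  exact hu.bdd_smul M hχ.1.continuous.aestronglyMeasurable (of_forall hM)

theorem HasWeakOp.comp [CompleteSpace F] [CompleteSpace G] [CompleteSpace H]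
    {T : (E3 →L[ℝ] F) →L[ℝ] G} {u : E3 → F} {d : E3 → G}
    (h : HasWeakOp Ω T u d) (hu : IsRep Ω u) (hd : IsRep Ω d) (J : G →L[ℝ] H) :
    HasWeakOp Ω (J.comp T) u fun x => J (d x) := by
  intro χ hχ
  have h1 := congrArg J (h χ hχ)
  rw [map_neg, ← J.integral_comp_comm (T.integrable_comp (hχ.integrable_smulRight hu.integrable).integrableOn),
    ← J.integral_comp_comm (hχ.integrable_smul hd.integrable).integrableOn] at h1
  simpa using h1

theorem IsRep.comp {u : E3 → F} (hu : IsRep Ω u) (J : F →L[ℝ] G) : IsRep Ω fun x => J (u x) :=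
  ⟨J.continuous.comp_stronglyMeasurable hu.stronglyMeasurable, fun x hx => by rw [hu.eq_zero x hx, map_zero],
    J.integrable_comp hu.integrable, J.comp_memLp' hu.memLp⟩

theorem HasWeakGrad.hasWeakOp {u u' : E3 → ℝ} {g g' : E3 → E3} (h : HasWeakGrad Ω u g)
    (hu : IsRep Ω u') (hg : IsRep Ω g') (eu : u' =ᵐ[leb Ω] u)
    (eg : g' =ᵐ[leb Ω] g) : HasWeakOp Ω gradT u' g' := by
  intro χ hχ
  ext i
  have h1 := h.2.2 χ hχ i
  have e1 : (∫ x in Ω, gradT ((fderiv ℝ χ x).smulRight (u' x))) i =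
      ∫ x in Ω, u x * partialD i χ x := by
    change (proj i : E3 →L[ℝ] ℝ) _ = _
    rw [← integral_comp_comm _
      (gradT.integrable_comp (hχ.integrable_smulRight hu.integrable).integrableOn)]
    refine integral_congr_ae (eu.mono fun x hx => ?_)
    change (fderiv ℝ χ x) _ * u' x = _
    rw [hx, mul_comm]
    rfl
  have e2 : (∫ x in Ω, χ x • g' x) i = ∫ x in Ω, g x i * χ x := by
    change (proj i : E3 →L[ℝ] ℝ) _ = _
    rw [← integral_comp_comm _ (hχ.integrable_smul hg.integrable).integrableOn]
    refine integral_congr_ae (eg.mono fun x hx => ?_)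
    change χ x * g' x i = _
    rw [hx, mul_comm]
  rw [e1, h1, PiLp.neg_apply, e2]

theorem HasWeakDiv.hasWeakOp {u u' : E3 → E3} {d d' : E3 → ℝ} (h : HasWeakDiv Ω u d)
    (eu : u' =ᵐ[leb Ω] u)
    (ed : d' =ᵐ[leb Ω] d) : HasWeakOp Ω divT u' d' := by
  intro χ hχ
  have h1 := h.2.2 χ hχ
  have e1 : (∫ x in Ω, divT ((fderiv ℝ χ x).smulRight (u' x))) =
      ∫ x in Ω, ∑ i, u x i * partialD i χ x := by
    refine integral_congr_ae (eu.mono fun x hx => ?_)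
    simp only [divT, sum_apply, entry_apply, hx, partialD]
    simp [mul_comm]
  have e2 : (∫ x in Ω, χ x • d' x) = ∫ x in Ω, d x * χ x := by
    refine integral_congr_ae (ed.mono fun x hx => ?_)
    simp [hx, mul_comm]
  rw [e1, h1, e2]

theorem curlF_smul_const {χ : E3 → ℝ} {x : E3} (hχ : DifferentiableAt ℝ χ x) (e v : E3) :
    inner ℝ v (curlF (fun y => χ y • e) x) = -inner ℝ e (curlT ((fderiv ℝ χ x).smulRight v)) := by
  have h (i j : Fin 3) : partialD i (fun y => (χ y • e) j) x = partialD i χ x * e j := by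
    simp only [PiLp.smul_apply, smul_eq_mul, partialD]
    rw [fderiv_mul_const hχ]
    simp [mul_comm]
  simp only [curlF, h]
  have h2 (m : Fin 3) : curlT ((fderiv ℝ χ x).smulRight v) m = 
    (![entry 1 2 - entry 2 1, entry 2 0 - entry 0 2, entry 0 1 - entry 1 0] m) ((fderiv ℝ χ x).smulRight v) := rfl
  simp only [inner_E3, h2]
  simp [entry_apply, partialD]
  ring

theorem HasWeakCurl.hasWeakOp {u u' c c' : E3 → E3} (h : HasWeakCurl Ω u c)
    (hu : IsRep Ω u') (hc : IsRep Ω c') (eu : u' =ᵐ[leb Ω] u)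
    (ec : c' =ᵐ[leb Ω] c) : HasWeakOp Ω curlT u' c' := by
  intro χ hχ
  ext i
  set e : E3 := single i 1
  have he (v : E3) : inner ℝ e v = v i := by simp [e, EuclideanSpace.inner_single_left]
  have hφ : IsTest Ω fun y => χ y • e :=
    ⟨hχ.1.smul contDiff_const, hχ.2.1.smul_right, (closure_mono (Function.support_smul_subset_left _ _)).trans
      hχ.2.2⟩
  have h1 := h.2.2 _ hφ
  have e1 : (∫ x in Ω, curlT ((fderiv ℝ χ x).smulRight (u' x))) i =
      -∫ x in Ω, inner ℝ (u x) (curlF (fun y => χ y • e) x) := by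
    change (proj i : E3 →L[ℝ] ℝ) _ = _
    rw [← integral_comp_comm _
      (curlT.integrable_comp (hχ.integrable_smulRight hu.integrable).integrableOn), ← integral_neg]
    refine integral_congr_ae (eu.mono fun x hx => ?_)
    simp only [curlF_smul_const (hχ.1.differentiable (by simp) x), he, neg_neg, hx]
    rfl
  have e2 : (∫ x in Ω, χ x • c' x) i = ∫ x in Ω, inner ℝ (c x) (χ x • e) := by
    change (proj i : E3 →L[ℝ] ℝ) _ = _
    rw [← integral_comp_comm _ (hχ.integrable_smul hc.integrable).integrableOn]
    refine integral_congr_ae (ec.mono fun x hx => ?_)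
    change χ x * c' x i = inner ℝ (c x) (χ x • e)
    rw [inner_smul_right, real_inner_comm, he, hx]
  rw [e1, h1, PiLp.neg_apply, e2]

/-! ### Approximation by smooth functions -/

theorem exists_isRep_hs (hΩ : MeasurableSet Ω) (hfin : volume Ω < ⊤) {u : E3 → F}
    (hu : MemHs Ω s u) : ∃ u', IsRep Ω u' ∧ u' =ᵐ[leb Ω] u ∧ hsSemi Ω s u' < ⊤ := by
  obtain ⟨u', h1, h2⟩ := exists_isRep hΩ hfin hu.1
  refine ⟨u', h1, h2, lt_of_le_of_lt le_add_self ((hsNorm_congr (s := s) h2).trans_lt (memHs_iff.1 hu).2)⟩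

theorem ShiftCover.exists_approx_curl (cov : ShiftCover Ω) (hΩ : IsOpen Ω) (hfin : volume Ω < ⊤)
    (hD : ∀ x ∈ Ω, ∀ y ∈ Ω, ‖x - y‖ ≤ D) (hs1 : s < 1) {u c : E3 → E3} (hu : MemHs Ω s u)
    (hc : MemHs Ω s c) (h : HasWeakCurl Ω u c) : ∃ φ : ℕ → E3 → E3, (∀ n, ContDiff ℝ ∞ (φ n)) ∧
    (fun n => hsNorm Ω s (φ n - u)) ⇝ 0 ∧ (fun n => hsNorm Ω s (curlF (φ n) - c)) ⇝ 0 := by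
  obtain ⟨u', h1, h2, h3⟩ := exists_isRep_hs hΩ.measurableSet hfin hu
  obtain ⟨c', h4, h5, h6⟩ := exists_isRep_hs hΩ.measurableSet hfin hc
  refine ⟨fun n => cov.approx n u', fun n => cov.contDiff_approx h1 n, ?_, ?_⟩
  · refine (cov.tendsto_approx_hs hΩ hD h1 hs1 h3).congr fun n => hsNorm_congr ?_
    exact EventuallyEq.rfl.sub h2
  · refine (cov.tendsto_op_approx_hs hΩ hD h1 h4 (h.hasWeakOp h1 h4 h2 h5) hs1 h3 h6).congr
      fun n => hsNorm_congr (EventuallyEq.sub (of_forall fun x => ?_) h5)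
    exact curlT_fderiv ((cov.contDiff_approx h1 n).differentiable (by simp) x)

theorem ShiftCover.exists_approx_div (cov : ShiftCover Ω) (hΩ : IsOpen Ω) (hfin : volume Ω < ⊤)
    (hD : ∀ x ∈ Ω, ∀ y ∈ Ω, ‖x - y‖ ≤ D) (hs1 : s < 1) {u : E3 → E3} {d : E3 → ℝ} (hu : MemHs Ω s u)
    (hd : MemLp d 2 (leb Ω)) (h : HasWeakDiv Ω u d) : ∃ φ : ℕ → E3 → E3, (∀ n, ContDiff ℝ ∞ (φ n)) ∧
    (fun n => hsNorm Ω s (φ n - u)) ⇝ 0 ∧ (fun n => eLpNorm (divF (φ n) - d) 2 (leb Ω)) ⇝ 0 := by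
  obtain ⟨u', h1, h2, h3⟩ := exists_isRep_hs hΩ.measurableSet hfin hu
  obtain ⟨d', h4, h5⟩ := exists_isRep hΩ.measurableSet hfin hd
  refine ⟨fun n => cov.approx n u', fun n => cov.contDiff_approx h1 n, ?_, ?_⟩
  · refine (cov.tendsto_approx_hs hΩ hD h1 hs1 h3).congr fun n => hsNorm_congr ?_
    exact EventuallyEq.rfl.sub h2
  · refine (cov.tendsto_op_approx_L2 hΩ h1 h4 (h.hasWeakOp h2 h5)).congr
      fun n => eLpNorm_congr_ae (EventuallyEq.sub (of_forall fun x => ?_) h5)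
    exact divT_fderiv ((cov.contDiff_approx h1 n).differentiable (by simp) x)

theorem ShiftCover.exists_approx_grad (cov : ShiftCover Ω) (hΩ : IsOpen Ω) (hfin : volume Ω < ⊤)
    (hD : ∀ x ∈ Ω, ∀ y ∈ Ω, ‖x - y‖ ≤ D) (hs1 : s < 1) {u : E3 → ℝ} {g : E3 → E3}
    (hu : MemLp u 2 (leb Ω)) (hg : MemHs Ω s g) (h : HasWeakGrad Ω u g) : ∃ ψ :
    ℕ → E3 → ℝ, (∀ n, ContDiff ℝ ∞ (ψ n)) ∧ (fun n => eLpNorm (ψ n - u) 2 (leb Ω)) ⇝ 0 ∧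
    ∀ B D, IsBody B D → B ⊆ Ω → (fun n => hsNorm B s (gradF (ψ n) - g)) ⇝ 0 := by
  obtain ⟨u', h1, h2⟩ := exists_isRep hΩ.measurableSet hfin hu
  obtain ⟨g', h4, h5, h6⟩ := exists_isRep_hs hΩ.measurableSet hfin hg
  have hw := h.hasWeakOp h1 h4 h2 h5
  refine ⟨fun n => cov.approx n u', fun n => cov.contDiff_approx h1 n, ?_, fun B D' hB hBΩ => ?_⟩
  · exact (cov.tendsto_approx_L2 hΩ h1).congr fun n => eLpNorm_congr_ae (EventuallyEq.rfl.sub h2)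
  · have hJ : HasWeakOp Ω (ContinuousLinearMap.id ℝ _) u' fun x => innerSL ℝ (g' x) := by
      have e : (innerSL ℝ : E3 →L[ℝ] E3 →L[ℝ] ℝ).comp gradT = ContinuousLinearMap.id ℝ _ := by
        ext A v
        have hv : v = ∑ i, v i • single i (1 : ℝ) := by
          ext j; simp [Finset.sum_apply, Pi.single_apply]
        conv_rhs => rw [hv]
        simp only [ContinuousLinearMap.comp_apply, innerSL_apply_apply,
          map_sum, map_smul, PiLp.inner_apply]
        rfl
      rw [← e]
      exact hw.comp h1 h4 (innerSL ℝ : E3 →L[ℝ] E3 →L[ℝ] ℝ)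
    have t1 := cov.tendsto_fam_hs_of_fderiv hΩ hB hBΩ h1
      (h4.comp (innerSL ℝ : E3 →L[ℝ] E3 →L[ℝ] ℝ)) hJ (cov.contDiff_comm gradT) (cov.compact_comm gradT)
      (fun j => (closure_mono (cov.support_comm_subset gradT j)).trans
        ((tsupport_fderiv_subset ℝ).trans (cov.support j))) (fun x hx => cov.sum_comm hΩ gradT hx) hs1
    have t2 := (cov.tendsto_approx_hs hΩ hD h4 hs1 h6).add t1
    rw [add_zero] at t2
    refine tendsto_zero_of_le t2 fun n => ?_
    have c1 := (cov.contDiff_approx h4 n).continuous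
    have c2 := (cov.contDiff_fam (cov.contDiff_comm gradT) h1 n).continuous
    have e : (gradF (cov.approx n u') - g) =ᵐ[leb B]
        (cov.approx n g' - g') + cov.fam (cov.comm gradT) n u' := by
      filter_upwards [ae_restrict_of_ae_restrict_of_subset hBΩ h5,
        ae_restrict_mem hB.isOpen.measurableSet] with x hx hxB
      rw [Pi.sub_apply, ← gradT_fderiv, cov.op_approx h1 h4 hw n (hBΩ hxB), Pi.add_apply, Pi.sub_apply,
        hx]
      abel
    rw [hsNorm_congr e]
    refine (hsNorm_add_le (c1.aestronglyMeasurable.sub h4.stronglyMeasurable.aestronglyMeasurable)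
      c2.aestronglyMeasurable).trans (add_le_add (hsNorm_mono hBΩ s _) le_rfl)

/-! ### Lipschitz domains -/

theorem IsLipschitzDomain.exists_shift (hΩ : IsLipschitzDomain Ω) {x : E3} (hx : x ∈ closure Ω) :
    ∃ (R : ℝ) (e : E3) (c ε₀ : ℝ), 0 < R ∧ 0 < c ∧ 0 < ε₀ ∧
    ∀ y ∈ Metric.ball x R ∩ Ω, ∀ ε, 0 < ε → ε < ε₀ → ∀ h, ‖h - ε • e‖ ≤ c * ε → y + h ∈ Ω := by
  by_cases hxΩ : x ∈ Ω
  · obtain ⟨R, hR, hball⟩ := Metric.isOpen_iff.1 hΩ.1 x hxΩ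
    refine ⟨R / 2, 0, 1, R / 2, by positivity, one_pos, by positivity, ?_⟩
    rintro y ⟨hy, -⟩ ε - hε' h hh
    refine hball ?_
    rw [Metric.mem_ball, dist_eq_norm] at hy ⊢
    have e : y + h - x = (y - x) + h := by abel
    rw [e]
    simp only [smul_zero, sub_zero, one_mul] at hh
    linarith [norm_add_le (y - x) h]
  · obtain ⟨A, L, g, hg, hA⟩ := hΩ.2 x (by rw [frontier, hΩ.1.interior_eq]; exact ⟨hx, hxΩ⟩)
    obtain ⟨R, hR, hball⟩ := Metric.eventually_nhds_iff_ball.1 hA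
    have hL : (0 : ℝ) < 1 + L := by positivity
    refine ⟨R / 2, A.symm (single 2 1), (1 + L : ℝ)⁻¹, R / 4, by positivity,
      by positivity, by positivity, ?_⟩
    rintro y ⟨hy, hyΩ⟩ ε hε hε' h hh
    set e : E3 := A.symm (single 2 1) with he
    have hen : ‖e‖ = 1 := by rw [he, LinearIsometryEquiv.norm_map]; simp
    have hc1 : (1 + L : ℝ)⁻¹ * ε ≤ ε :=
      mul_le_of_le_one_left hε.le (inv_le_one_of_one_le₀ (by linarith [L.coe_nonneg]))
    have hhn : ‖h‖ ≤ 2 * ε := by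
      have : h = (h - ε • e) + ε • e := by abel
      rw [this]
      refine (norm_add_le _ _).trans ?_
      rw [norm_smul, hen, Real.norm_of_nonneg hε.le]
      linarith
    rw [Metric.mem_ball, dist_eq_norm] at hy
    have hyb : y ∈ Metric.ball x R := by rw [Metric.mem_ball, dist_eq_norm]; linarith
    have hyh : y + h ∈ Metric.ball x R := by
      rw [Metric.mem_ball, dist_eq_norm]
      have e' : y + h - x = (y - x) + h := by abel
      rw [e']
      linarith [norm_add_le (y - x) h]
    rw [hball _ hyh]
    have h0 := (hball _ hyb).1 hyΩ
    set w := h - ε • e with hw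
    have hAh : A (y + h) = A y + ε • single 2 1 + A w := by
      have : y + h = y + ε • e + w := by rw [hw]; abel
      rw [this, map_add, map_add, map_smul, he, LinearIsometryEquiv.apply_symm_apply]
    have hw2 : |A w 2| ≤ ‖w‖ := by
      rw [← A.norm_map w, ← Real.norm_eq_abs]
      exact PiLp.norm_apply_le _ _
    have hg' : g !₂[A (y + h) 0, A (y + h) 1] ≤ g !₂[A y 0, A y 1] + L * ‖w‖ := by
      have h1 := hg.dist_le_mul !₂[A (y + h) 0, A (y + h) 1] !₂[A y 0, A y 1]
      have h2 : dist (!₂[A (y + h) 0, A (y + h) 1] : EuclideanSpace ℝ (Fin 2)) !₂[A y 0, A y 1] ≤ ‖w‖ := by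
        rw [← A.norm_map w, EuclideanSpace.dist_eq, EuclideanSpace.norm_eq, hAh]
        refine Real.sqrt_le_sqrt ?_
        simp [Fin.sum_univ_two, Fin.sum_univ_three, Real.dist_eq]
        positivity
      rw [Real.dist_eq] at h1
      have := (le_abs_self _).trans h1
      have h3 := mul_le_mul_of_nonneg_left h2 L.coe_nonneg
      linarith
    have h2 : A (y + h) 2 = A y 2 + ε + A w 2 := by rw [hAh]; simp
    have h3 : (1 + L : ℝ) * ‖w‖ ≤ ε := by
      have := mul_le_mul_of_nonneg_left hh hL.le
      rwa [← mul_assoc, mul_inv_cancel₀ hL.ne', one_mul] at this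
    have h4 := abs_le.1 hw2
    rw [h2]
    linarith [h4.1]

theorem IsLipschitzDomain.interior_closure (hΩ : IsLipschitzDomain Ω) :
    interior (closure Ω) ⊆ Ω := by
  intro x hx
  by_contra hxΩ
  obtain ⟨A, L, g, hg, hA⟩ := hΩ.2 x
    (by rw [frontier, hΩ.1.interior_eq]; exact ⟨interior_subset hx, hxΩ⟩)
  set e : E3 := A.symm (single 2 1) with he
  have hx0 : A x 2 ≤ g !₂[A x 0, A x 1] := not_lt.1 fun h => hxΩ (hA.self_of_nhds.2 h)
  have ht : Tendsto (fun ε : ℝ => x - ε • e) (𝓝[>] 0) (𝓝 x) := by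
    have : Continuous fun ε : ℝ => x - ε • e := by fun_prop
    have h1 := this.tendsto 0
    rw [zero_smul, sub_zero] at h1
    exact h1.mono_left nhdsWithin_le_nhds
  have h2 : ∀ᶠ ε in 𝓝[>] (0 : ℝ), x - ε • e ∈ closure Ω :=
    ht.eventually ((mem_interior_iff_mem_nhds.1 hx))
  obtain ⟨ε, ⟨hε1, hε2⟩, hε⟩ := ((h2.and (ht.eventually hA.eventually_nhds)).and
    self_mem_nhdsWithin).exists
  set y := x - ε • e
  have hAy : A y = A x - ε • single 2 1 := by
    simp only [y]
    rw [map_sub, map_smul, he, LinearIsometryEquiv.apply_symm_apply]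
  have hlt : A y 2 < g !₂[A y 0, A y 1] := by
    rw [hAy]
    simp
    linarith
  have hc : ∀ᶠ z in 𝓝 y, A z 2 < g !₂[A z 0, A z 1] := by
    have c1 : Continuous fun z => A z 2 := (proj 2 : E3 →L[ℝ] ℝ).continuous.comp A.continuous
    have c2 : Continuous fun z => (!₂[A z 0, A z 1] : EuclideanSpace ℝ (Fin 2)) := by
      refine (PiLp.continuous_toLp 2 _).comp (continuous_pi fun i => ?_)
      fin_cases i
      · exact (proj 0 : E3 →L[ℝ] ℝ).continuous.comp A.continuous
      · exact (proj 1 : E3 →L[ℝ] ℝ).continuous.comp A.continuous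
    exact (c1.tendsto y).eventually_lt ((hg.continuous.comp c2).tendsto y) hlt
  have hno : ∀ᶠ z in 𝓝 y, z ∉ Ω := by
    filter_upwards [hc, hε2] with z h1 h2 h3
    exact absurd (h2.1 h3) h1.not_gt
  obtain ⟨z, hz1, hz2⟩ := (mem_closure_iff_frequently.1 hε1).and_eventually hno |>.exists
  exact hz2 hz1

/-- The kernels `k` with support in `closedBall (ε e) (c ε)`. -/
theorem exists_shift_kernel (e : E3) {c ε : ℝ} (hc : 0 < c) (hε : 0 < ε) :
    ∃ k : E3 → ℝ, IsKernel k (closedBall 0 (ε * (‖e‖ + c))) ∧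
      ∀ h ∈ tsupport k, ‖h - ε • e‖ ≤ c * ε := by
  set f : ContDiffBump (ε • e) := ⟨c * ε / 2, c * ε, by positivity, by linarith [mul_pos hc hε]⟩
  have hs : tsupport (f.normed volume) = closedBall (ε • e) (c * ε) := f.tsupport_normed_eq
  refine ⟨f.normed volume, ⟨f.contDiff_normed, f.hasCompactSupport_normed, f.nonneg_normed,
    f.integral_normed, ?_⟩, ?_⟩
  · rw [hs]
    intro h hh
    rw [Metric.mem_closedBall, dist_eq_norm] at hh ⊢
    have e' : h - 0 = (h - ε • e) + ε • e := by abel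
    rw [e']
    refine (norm_add_le _ _).trans ?_
    rw [norm_smul, Real.norm_of_nonneg hε.le]
    linarith
  · intro h hh
    rwa [hs, Metric.mem_closedBall, dist_eq_norm] at hh

open scoped Manifold in
theorem IsLipschitzDomain.exists_shiftCover (hΩ : IsLipschitzDomain Ω)
    (hcomp : IsCompact (closure Ω)) : Nonempty (ShiftCover Ω) := by
  choose! R e c ε₀ hR hc hε₀ H using fun x (hx : x ∈ closure Ω) => hΩ.exists_shift hx
  obtain ⟨t, ht, hcov⟩ := hcomp.elim_nhds_subcover (fun x => Metric.ball x (R x))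
    fun x hx => Metric.ball_mem_nhds x (hR x hx)
  set p : Fin t.card → E3 := fun j => (t.equivFin.symm j : E3) with hp
  have hpm (j) : p j ∈ closure Ω := ht _ (t.equivFin.symm j).2
  have hcov' : closure Ω ⊆ ⋃ j, Metric.ball (p j) (R (p j)) := by
    intro x hx
    obtain ⟨y, hy, hxy⟩ := Set.mem_iUnion₂.1 (hcov hx)
    refine Set.mem_iUnion.2 ⟨t.equivFin ⟨y, hy⟩, ?_⟩
    simpa [hp] using hxy
  obtain ⟨f, hf⟩ := SmoothPartitionOfUnity.exists_isSubordinate 𝓘(ℝ, E3) isClosed_closure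
    (fun j => Metric.ball (p j) (R (p j))) (fun j => Metric.isOpen_ball) hcov'
  have hε (j : Fin t.card) (n : ℕ) : 0 < ε₀ (p j) / (n + 2) := div_pos (hε₀ _ (hpm j)) (by positivity)
  choose k hk hks using fun (j : Fin t.card) (n : ℕ) => exists_shift_kernel (e (p j)) (hc _ (hpm j)) (hε j n)
  exact ⟨{
    N := t.card
    U := fun j => Metric.ball (p j) (R (p j))
    η := fun j => f j
    ker := k
    ρ := fun j n => ε₀ (p j) / (n + 2) * (‖e (p j)‖ + c (p j))
    isOpen := fun j => Metric.isOpen_ball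
    contDiff := fun j => (f j).contMDiff.contDiff
    compact := fun j => Metric.isCompact_of_isClosed_isBounded (isClosed_tsupport _)
      (Metric.isBounded_ball.subset (hf j))
    support := hf
    sum_eq := fun x hx => by
      rw [← finsum_eq_sum_of_fintype]
      exact f.sum_eq_one (subset_closure hx)
    kernel := hk
    tendsto := fun j => by
      have h1 : (fun n : ℕ => ε₀ (p j) / ((n : ℝ) + 2)) ⇝ 0 :=
        tendsto_const_nhds.div_atTop (tendsto_atTop_add_const_right _ _ tendsto_natCast_atTop_atTop)
      simpa using h1.mul_const (‖e (p j)‖ + c (p j))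
    shift := fun j n x hx h hh => H (p j) (hpm j) x hx _ (hε j n)
      (div_lt_self (hε₀ _ (hpm j)) (by have : (0 : ℝ) ≤ n := n.cast_nonneg; linarith)) h (hks j n h hh) }⟩

/-! ### Degrees of freedom as functionals -/

theorem map_sub_of_linear {L : (E3 → F) → ℝ} (hL : ∃ ℓ : C(E3, F) →ₗ[ℝ] ℝ, ∀ u : C(E3, F),
    ℓ u = L u) {f g : E3 → F} (hf : Continuous f) (hg : Continuous g) : L (f - g) = L f - L g := by
  obtain ⟨ℓ, h⟩ := hL
  exact (h (⟨f, hf⟩ - ⟨g, hg⟩)).symm.trans ((map_sub ℓ _ _).trans (congrArg₂ _ (h _) (h _)))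

theorem IsTet.exists_linear (h : IsTet K a b c d) {Q : Submodule ℝ Poly} {L : (E3 → ℝ) → ℝ}
    (hL : L ∈ lagrangeDofs m (K : Set E3) ∪ interiorDofs Q K) : ∃ ℓ : C(E3, ℝ) →ₗ[ℝ] ℝ, ∀ u :
    C(E3, ℝ), ℓ u = L u := by
  rcases hL with hL | ⟨q, -, rfl⟩
  · obtain ⟨ℓ, -, H⟩ := exists_mem_lagrangeW h L hL
    exact ⟨ℓ, H⟩
  · exact ⟨cellL K q, fun u => rfl⟩

theorem exists_linear_interiorV {Q : Submodule ℝ VPoly} {L : (E3 → E3) → ℝ}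
    (hL : L ∈ interiorVDofs Q K) : ∃ ℓ : C(E3, E3) →ₗ[ℝ] ℝ, ∀ u : C(E3, E3), ℓ u = L u := by
  obtain ⟨q, -, rfl⟩ := hL
  exact ⟨cellV K q, fun u => rfl⟩

theorem IsTet.exists_linear_nedelec (h : IsTet K a b c d) {L : (E3 → E3) → ℝ}
    (hL : L ∈ nedelecDofs r (K : Set E3)) : ∃ ℓ : C(E3, E3) →ₗ[ℝ] ℝ, ∀ u :
    C(E3, E3), ℓ u = L u := by
  obtain ⟨ℓ, -, H⟩ := exists_mem_nedelecW h L hL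
  exact ⟨ℓ, H⟩

theorem IsTet.exists_linear_flux (h : IsTet K a b c d) {L : (E3 → E3) → ℝ}
    (hL : L ∈ fluxDofs r (K : Set E3)) : ∃ ℓ : C(E3, E3) →ₗ[ℝ] ℝ, ∀ u : C(E3, E3), ℓ u = L u := by
  obtain ⟨ℓ, -, H⟩ := exists_mem_fluxW h L hL
  exact ⟨ℓ, H⟩

theorem evalP_sub_eq (p q : Poly) : evalP (p - q) = evalP p - evalP q := by ext x; simp [evalP]

theorem evalV_sub_eq (p q : VPoly) : evalV (p - q) = evalV p - evalV q := by
  ext x i; simp [evalV, evalP]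

theorem IsTet.dof_congr (h : IsTet K a b c d) {Q : Submodule ℝ Poly} {L : (E3 → ℝ) → ℝ}
    (hL : L ∈ lagrangeDofs m (K : Set E3) ∪ interiorDofs Q K) {f g : E3 → ℝ}
    (H : ∀ x ∈ hull K, f x = g x) : L f = L g := by
  rcases hL with hL | ⟨q, -, rfl⟩
  · refine lagrangeDofs_congr h (fun x y z w h' v hv => H v (convexHull_mono ?_ hv)) L hL
    rw [h'.eq]
    intro t; simp; tauto
  · refine setAverage_congr_fun h.isCompact.measurableSet (of_forall fun w hw => ?_)
    rw [H w hw]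

/-- Vertex, edge and face moments are continuous with respect to uniform convergence. -/
theorem lagrange_dof_bound {L : (E3 → ℝ) → ℝ} (hL : L ∈ lagrangeDofs m (K : Set E3)) : ∃ C :
    ℝ≥0, ∀ f : E3 → ℝ, Continuous f → ∀ ε : ℝ≥0∞, (∀ x ∈ hull K, ‖f x‖ₑ ≤ ε) → ‖L f‖ₑ ≤ C * ε := by
  have hcpt := K.finite_toSet.isCompact_convexHull ℝ
  rcases hL with (⟨v, hv, rfl⟩ | ⟨x, hx, y, hy, -, q, -, rfl⟩) |
    ⟨x, hx, y, hy, z, hz, -, -, -, q, -, rfl⟩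
  · exact ⟨1, fun f _ ε h => by simpa using h v (subset_convexHull ℝ _ hv)⟩
  · obtain ⟨M, hM, H⟩ := exists_bound_of_isCompact hcpt (continuous_evalP q).norm
    have hs : segment ℝ x y ⊆ hull K :=
      (convex_convexHull ℝ _).segment_subset (subset_convexHull ℝ _ hx) (subset_convexHull ℝ _ hy)
    refine ⟨M.toNNReal, fun f hf ε h => (enorm_edgeMean_le (g := f) hM fun w hw => ?_).trans
      (mul_le_mul' le_rfl ?_)⟩
    · rw [norm_mul, mul_comm]
      exact mul_le_mul_of_nonneg_right (H w (hs hw)) (norm_nonneg _)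
    · refine (setLIntegral_mono' measurableSet_Ioc fun t ht => h _ (hs ?_)).trans
        (b := ∫⁻ t in I₀₁, ε) (by simp)
      rw [segment_eq_image']
      exact ⟨t, ⟨ht.1.le, ht.2⟩, rfl⟩
  · obtain ⟨M, hM, H⟩ := exists_bound_of_isCompact hcpt (continuous_evalP q).norm
    have hs : convexHull ℝ {x, y, z} ⊆ hull K :=
      convexHull_mono (by rintro _ (rfl | rfl | rfl) <;> assumption)
    refine ⟨(2 * M).toNNReal * (volume refTri).toNNReal, fun f hf ε h =>
      (enorm_faceMean_le (by fun_prop) (g := f) hM fun w hw => ?_).trans ?_⟩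
    · rw [norm_mul, mul_comm]
      exact mul_le_mul_of_nonneg_right (H w (hs hw)) (norm_nonneg _)
    · rw [ENNReal.coe_mul, mul_assoc, coe_toNNReal isCompact_refTri.measure_lt_top.ne]
      refine mul_le_mul' le_rfl ((setLIntegral_mono' isClosed_refTri.measurableSet
        fun p hp => h _ (hs (triMap_mem hp))).trans ?_)
      rw [setLIntegral_const, mul_comm]

theorem tendsto_of_enorm_sub_le {x : ℕ → ℝ} {t : ℝ} {C : ℝ≥0} {ε : ℕ → ℝ≥0∞}
    (h : ∀ n, ‖x n - t‖ₑ ≤ C * ε n) (hε : ε ⇝ 0) : x ⇝ t := by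
  rw [tendsto_iff_edist_tendsto_0]
  have := ENNReal.Tendsto.const_mul (a := C) hε (Or.inr coe_ne_top)
  rw [mul_zero] at this
  exact tendsto_zero_of_le this fun n => (edist_eq_enorm_sub _ _).trans_le (h n)

/-- Interior moments are continuous in `L²`. -/
theorem tendsto_interior_of_eLpNorm (h : IsTet K a b c d) {Q : Submodule ℝ Poly}
    {L : (E3 → ℝ) → ℝ} (hL : L ∈ interiorDofs Q K) {φ : ℕ → E3 → ℝ} {u : E3 → ℝ}
    (hφ : ∀ n, Continuous (φ n)) (hu : MemLp u 2 (leb (tetInt K)))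
    (ht : (fun n => eLpNorm (φ n - u) 2 (leb (tetInt K))) ⇝ 0) :
    (fun n => L (φ n)) ⇝ (L u) := by
  obtain ⟨q, -, rfl⟩ := hL
  let e : ℝ →L[ℝ] E3 := ContinuousLinearMap.toSpanSingleton ℝ (single 0 1)
  have he (t : ℝ) : e t = t • single 0 1 := rfl
  have hn (t : ℝ) : ‖e t‖ = ‖t‖ := by rw [he, norm_smul]; simp
  have h1 := tendsto_interiorV_of_eLpNorm h (Q := ⊤) (u := fun x => e (u x))
    (φ := fun n x => e (φ n x)) ⟨![q, 0, 0], trivial, rfl⟩ (fun n => e.continuous.comp (hφ n))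
    (e.comp_memLp' hu) (ht.congr fun n => eLpNorm_congr_norm_ae (of_forall fun x => by
      simp only [Pi.sub_apply, ← map_sub, hn]))
  have h2 (f : E3 → ℝ) (x : E3) : inner ℝ (e (f x)) (evalV ![q, 0, 0] x) = f x * evalP q x := by
    rw [he, real_inner_smul_left, EuclideanSpace.inner_single_left]
    simp [evalV]
  simp only [h2] at h1
  exact h.tendsto_average_iff.2 h1

/-! ### Uniqueness of weak derivatives and of continuous representatives -/

theorem LocallyIntegrableOn.integrableOn_mul_test {f χ : E3 → ℝ}
    (hf : LocallyIntegrableOn f Ω) (hχ : IsTest Ω χ) : IntegrableOn (fun x => f x * χ x) Ω := by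
  have h1 : IntegrableOn (fun x => f x * χ x) (tsupport χ) :=
    (hf.integrableOn_compact_subset hχ.2.2 hχ.2.1).mul_continuousOn hχ.1.continuous.continuousOn
      hχ.2.1
  refine ((integrableOn_iff_integrable_of_support_subset fun x hx => subset_tsupport χ ?_).1
    h1).integrableOn
  exact fun h => hx (by simp [h])

theorem ae_eq_of_forall_test {f g : E3 → ℝ} (hΩ : IsOpen Ω) (hf : LocallyIntegrableOn f Ω)
    (hg : LocallyIntegrableOn g Ω)
    (h : ∀ χ, IsTest Ω χ → ∫ x in Ω, f x * χ x = ∫ x in Ω, g x * χ x) :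
    f =ᵐ[leb Ω] g := by
  have h1 := hΩ.ae_eq_zero_of_integral_contDiff_smul_eq_zero (hf.sub hg) fun χ h1 h2 h3 => by
    have hχ : IsTest Ω χ := ⟨h1, h2, h3⟩
    rw [← setIntegral_eq_integral_of_forall_compl_eq_zero (s := Ω) fun x hx => by
      rw [image_eq_zero_of_notMem_tsupport fun hx' => hx (h3 hx'), zero_smul]]
    have h4 : ∀ x, χ x • (f - g) x = f x * χ x - g x * χ x := fun x => by
      simp only [Pi.sub_apply, smul_eq_mul]; ring
    simp only [h4]
    rw [integral_sub (LocallyIntegrableOn.integrableOn_mul_test hf hχ)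
      (LocallyIntegrableOn.integrableOn_mul_test hg hχ), h χ hχ, sub_self]
  refine (ae_restrict_iff' hΩ.measurableSet).2 (h1.mono fun x hx hxΩ => ?_)
  exact sub_eq_zero.1 (hx hxΩ)

theorem LocallyIntegrableOn.coord {f : E3 → E3} (hf : LocallyIntegrableOn f Ω) (i : Fin 3) :
    LocallyIntegrableOn (fun x => f x i) Ω := fun x hx => by
  obtain ⟨s, hs, hi⟩ := hf x hx
  exact ⟨s, hs, (proj i : E3 →L[ℝ] ℝ).integrable_comp hi⟩

theorem ae_eq_of_forall_coord {f g : E3 → E3} (h : ∀ i, (fun x => f x i) =ᵐ[leb Ω] fun x => g x i) :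
    f =ᵐ[leb Ω] g := by
  filter_upwards [ae_all_iff.2 h] with x hx
  ext i
  exact hx i

theorem HasWeakGrad.ae_eq (hΩ : IsOpen Ω) {u : E3 → ℝ} {g g' : E3 → E3} (h : HasWeakGrad Ω u g)
    (h' : HasWeakGrad Ω u g') : g =ᵐ[leb Ω] g' :=
  ae_eq_of_forall_coord fun i => ae_eq_of_forall_test hΩ (LocallyIntegrableOn.coord h.2.1 i)
    (LocallyIntegrableOn.coord h'.2.1 i) fun χ hχ =>
    neg_injective ((h.2.2 χ hχ i).symm.trans (h'.2.2 χ hχ i))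

theorem HasWeakDiv.ae_eq (hΩ : IsOpen Ω) {u : E3 → E3} {d d' : E3 → ℝ} (h : HasWeakDiv Ω u d)
    (h' : HasWeakDiv Ω u d') : d =ᵐ[leb Ω] d' :=
  ae_eq_of_forall_test hΩ h.2.1 h'.2.1 fun χ hχ =>
    neg_injective ((h.2.2 χ hχ).symm.trans (h'.2.2 χ hχ))

theorem HasWeakCurl.ae_eq (hΩ : IsOpen Ω) {u c c' : E3 → E3} (h : HasWeakCurl Ω u c)
    (h' : HasWeakCurl Ω u c') : c =ᵐ[leb Ω] c' := by
  refine ae_eq_of_forall_coord fun i => ae_eq_of_forall_test hΩ (LocallyIntegrableOn.coord h.2.1 i)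
    (LocallyIntegrableOn.coord h'.2.1 i) fun χ hχ => ?_
  have hv : IsTest Ω fun x => χ x • (single i (1 : ℝ) : E3) :=
    ⟨hχ.1.smul contDiff_const, hχ.2.1.smul_right, (tsupport_smul_subset_left _ _).trans hχ.2.2⟩
  have h1 := (h.2.2 _ hv).symm.trans (h'.2.2 _ hv)
  simpa [real_inner_smul_right, EuclideanSpace.inner_single_right, mul_comm] using h1

theorem IsContRep.eqOn (hΩ : IsOpen Ω) {u v v' : E3 → ℝ} (h : IsContRep Ω u v)
    (h' : IsContRep Ω u v') : Set.EqOn v v' (closure Ω) := by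
  refine Set.EqOn.of_subset_closure (Measure.eqOn_open_of_ae_eq (h.2.trans h'.2.symm) hΩ
    (h.1.mono subset_closure) (h'.1.mono subset_closure)) h.1 h'.1 subset_closure subset_rfl

/-! ### The complex property in the weak sense -/

theorem IsTest.partialD {χ : E3 → ℝ} (hχ : IsTest Ω χ) (i : Fin 3) :
    IsTest Ω (GradDivFE.partialD i χ) :=
  ⟨(hχ.1.fderiv_right (m := ∞) (by simp)).clm_apply contDiff_const,
    (hχ.2.1.fderiv ℝ).comp_left (g := fun A : E3 →L[ℝ] ℝ => A (single i 1)) rfl,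
    (closure_mono (Function.support_comp_subset
      (g := fun A : E3 →L[ℝ] ℝ => A (single i 1)) rfl _)).trans
      ((tsupport_fderiv_subset ℝ).trans hχ.2.2)⟩

theorem partialD_partialD_comm {χ : E3 → ℝ} (hχ : ContDiff ℝ ∞ χ) (i j : Fin 3) (x : E3) :
    partialD i (partialD j χ) x = partialD j (partialD i χ) x := by
  have h1 : DifferentiableAt ℝ (fderiv ℝ χ) x :=
    (hχ.fderiv_right (m := ∞) (by simp)).differentiable (by simp) x
  have h2 (i j : Fin 3) : partialD i (partialD j χ) x =
      fderiv ℝ (fderiv ℝ χ) x (single i 1) (single j 1) := by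
    change fderiv ℝ (fun y => fderiv ℝ χ y (single j 1)) x _ = _
    rw [fderiv_clm_apply h1 (differentiableAt_const _)]
    simp
  rw [h2, h2]
  exact (hχ.contDiffAt.isSymmSndFDerivAt (by simpa using (mod_cast le_top : ((2 : ℕ∞) : WithTop ℕ∞) ≤ ((⊤ : ℕ∞) : WithTop ℕ∞)))) _ _

theorem curlF_gradF {χ : E3 → ℝ} (hχ : ContDiff ℝ ∞ χ) : curlF (gradF χ) = fun _ => 0 := by
  ext x i
  fin_cases i <;> exact sub_eq_zero.2 (partialD_partialD_comm hχ _ _ x)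

theorem HasWeakCurl.hasWeakDiv_zero {u c : E3 → E3} (h : HasWeakCurl Ω u c) :
    HasWeakDiv Ω c fun _ => 0 := by
  refine ⟨h.2.1, locallyIntegrableOn_const 0, fun χ hχ => ?_⟩
  have hv : IsTest Ω (gradF χ) := by
    have h1 : gradF χ = fun x => ∑ i, GradDivFE.partialD i χ x • single i (1 : ℝ) := by
      ext x i
      simp [gradF, Pi.single_apply]
    have h2 : Function.support (gradF χ) ⊆ Function.support (fderiv ℝ χ) := fun x hx hx' => hx (by
      ext i
      simp [gradF, GradDivFE.partialD, hx'])
    refine ⟨?_, (hχ.2.1.fderiv ℝ).mono h2,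
      (closure_mono h2).trans ((tsupport_fderiv_subset ℝ).trans hχ.2.2)⟩
    rw [h1]
    exact ContDiff.sum fun i _ => (hχ.partialD i).1.smul contDiff_const
  have h1 := h.2.2 _ hv
  simp only [curlF_gradF hχ.1, inner_zero_right, integral_zero] at h1
  have h3 (x : E3) : ∑ i, c x i * GradDivFE.partialD i χ x = inner ℝ (c x) (gradF χ x) := by
    simp [gradF, PiLp.inner_apply, mul_comm]
  simp only [h3, ← h1, zero_mul, integral_zero, neg_zero]

theorem HasWeakGrad.hasWeakCurl_zero {u : E3 → ℝ} {g : E3 → E3}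
    (h : HasWeakGrad Ω u g) : HasWeakCurl Ω g fun _ => 0 := by
  refine ⟨h.2.1, locallyIntegrableOn_const 0, fun φ hφ => ?_⟩
  have hc (j : Fin 3) : IsTest Ω fun x => φ x j :=
    ⟨by have := hφ.1; fun_prop, hφ.2.1.comp_left (g := fun v : E3 => v j) rfl,
      (closure_mono (Function.support_comp_subset (g := fun v : E3 => v j) rfl _)).trans hφ.2.2⟩
  have key (i j l : Fin 3) : IntegrableOn (fun x => g x i * partialD j (fun y => φ y l) x -
        g x j * partialD i (fun y => φ y l) x) Ω ∧
      ∫ x in Ω, (g x i * partialD j (fun y => φ y l) x -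
        g x j * partialD i (fun y => φ y l) x) = 0 := by
    have hi (i j : Fin 3) := LocallyIntegrableOn.integrableOn_mul_test
      (LocallyIntegrableOn.coord h.2.1 i) ((hc l).partialD j)
    refine ⟨(hi i j).sub (hi j i), ?_⟩
    rw [integral_sub (hi i j) (hi j i), sub_eq_zero]
    refine neg_injective ?_
    rw [← h.2.2 _ ((hc l).partialD j) i, ← h.2.2 _ ((hc l).partialD i) j]
    simp only [partialD_partialD_comm (hc l).1 i j]
  have e (x : E3) : inner ℝ (g x) (curlF φ x) =
      ((g x 0 * partialD 1 (fun y => φ y 2) x - g x 1 * partialD 0 (fun y => φ y 2) x) +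
      (g x 1 * partialD 2 (fun y => φ y 0) x - g x 2 * partialD 1 (fun y => φ y 0) x)) +
      (g x 2 * partialD 0 (fun y => φ y 1) x - g x 0 * partialD 2 (fun y => φ y 1) x) := by
    simp [PiLp.inner_apply, Fin.sum_univ_three, curlF]
    ring
  simp only [e, inner_zero_left, integral_zero]
  have k1 := key 0 1 2
  have k2 := key 1 2 0
  have k3 := key 2 0 1
  exact ((integral_add (k1.1.add k2.1) k3.1).trans (congrArg₂ (· + ·)
    ((integral_add k1.1 k2.1).trans (congrArg₂ (· + ·) k1.2 k2.2)) k3.2)).trans (by norm_num)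

/-! ### Limits along approximating sequences -/

theorem exists_limit_of_bound {X : Type*} {A : X → Prop} {L : X → ℝ} {E : X → ℝ≥0∞} {C : ℝ≥0}
    (h : ∀ φ, A φ → ∀ φ', A φ' → ‖L φ - L φ'‖ₑ ≤ C * (E φ + E φ')) {φ₀ : ℕ → X} (hA : ∀ n, A (φ₀ n))
    (hE : (fun n => E (φ₀ n)) ⇝ 0) :
    ∃ t, ∀ φ, A φ → ‖L φ - t‖ₑ ≤ C * E φ := by
  have h0 {φ} : (fun n => C * (E φ + E (φ₀ n))) ⇝ (C * E φ) := by
    have := ENNReal.Tendsto.const_mul (a := C) (hE.const_add (E φ)) (Or.inr coe_ne_top)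
    rwa [add_zero] at this
  have hc : CauchySeq fun n => L (φ₀ n) := by
    refine EMetric.cauchySeq_iff.2 fun ε hε => ?_
    have h1 := ENNReal.Tendsto.const_mul (a := C) (hE) (Or.inr coe_ne_top)
    rw [mul_zero] at h1
    obtain ⟨N, hN⟩ := eventually_atTop.1 (h1.eventually (gt_mem_nhds (ENNReal.half_pos hε.ne')))
    refine ⟨N, fun m hm n hn => ?_⟩
    calc edist (L (φ₀ m)) (L (φ₀ n)) ≤ C * (E (φ₀ m) + E (φ₀ n)) :=
          (edist_eq_enorm_sub _ _).trans_le (h _ (hA m) _ (hA n))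
      _ = C * E (φ₀ m) + C * E (φ₀ n) := mul_add _ _ _
      _ < ε / 2 + ε / 2 := ENNReal.add_lt_add (hN m hm) (hN n hn)
      _ = ε := ENNReal.add_halves ε
  obtain ⟨t, ht⟩ := cauchySeq_tendsto_of_complete hc
  refine ⟨t, fun φ hφ => le_of_tendsto_of_tendsto ((tendsto_const_nhds.sub ht).enorm) h0
    (of_forall fun n => h φ hφ _ (hA n))⟩

theorem hsNorm_sub_le {u v w : E3 → F} (hu : AEStronglyMeasurable u (leb B))
    (hv : AEStronglyMeasurable v (leb B)) (hw : AEStronglyMeasurable w (leb B)) :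
    hsNorm B s (u - v) ≤ hsNorm B s (u - w) + hsNorm B s (v - w) := by
  rw [hsNorm_sub_comm B s v w, ← sub_add_sub_cancel u w v]
  exact hsNorm_add_le (hu.sub hw) (hw.sub hv)

theorem gradF_sub {ψ ψ' : E3 → ℝ} (hψ : ContDiff ℝ 1 ψ) (hψ' : ContDiff ℝ 1 ψ') :
    gradF (ψ - ψ') = gradF ψ - gradF ψ' := by
  ext x
  rw [Pi.sub_apply, ← gradT_fderiv, ← gradT_fderiv, ← gradT_fderiv, fderiv_sub
    (hψ.differentiable (by simp) x) (hψ'.differentiable (by simp) x), map_sub]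

theorem curlF_sub {φ φ' : E3 → E3} (hφ : ContDiff ℝ 1 φ) (hφ' : ContDiff ℝ 1 φ') :
    curlF (φ - φ') = curlF φ - curlF φ' := by
  ext x
  have h1 := hφ.differentiable (by simp) x
  have h2 := hφ'.differentiable (by simp) x
  rw [Pi.sub_apply, ← curlT_fderiv h1, ← curlT_fderiv h2, ← curlT_fderiv (h1.sub h2),
    fderiv_sub h1 h2, map_sub]

theorem nedelec_tendsto (h : IsTet K a b c d) (hs : 1 / 2 < s) {L : (E3 → E3) → ℝ}
    (hL : L ∈ nedelecDofs r (K : Set E3)) {u w : E3 → E3}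
    (hu : AEStronglyMeasurable u (leb (tetInt K))) (hw : AEStronglyMeasurable w (leb (tetInt K))) :
    ∃ t, ∀ φ : ℕ → E3 → E3, (∀ n, ContDiff ℝ 1 (φ n)) → (fun n => hsNorm (tetInt K) s (φ n - u)) ⇝
    0 → (fun n => hsNorm (tetInt K) s (curlF (φ n) - w)) ⇝ 0 → (fun n => L (φ n)) ⇝ t := by
  by_cases! hex : ∃ φ : ℕ → E3 → E3, (∀ n, ContDiff ℝ 1 (φ n)) ∧
      (fun n => hsNorm (tetInt K) s (φ n - u)) ⇝ 0 ∧
      (fun n => hsNorm (tetInt K) s (curlF (φ n) - w)) ⇝ 0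
  swap
  · exact ⟨0, fun φ h1 h2 h3 => (hex φ h1 h2 h3).elim⟩
  obtain ⟨φ₀, h1, h2, h3⟩ := hex
  obtain ⟨C, hC⟩ := nedelec_dof_bound h hs hL
  obtain ⟨t, ht⟩ := exists_limit_of_bound (A := ContDiff ℝ 1) (L := L) (C := C)
    (E := fun φ => hsNorm (tetInt K) s (φ - u) + hsNorm (tetInt K) s (curlF φ - w))
    (fun φ hφ φ' hφ' => by
      rw [← map_sub_of_linear (h.exists_linear_nedelec hL) hφ.continuous hφ'.continuous]
      refine (hC (φ - φ') (hφ.sub hφ')).trans (mul_le_mul' le_rfl ?_)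
      rw [curlF_sub hφ hφ', add_add_add_comm]
      exact add_le_add (hsNorm_sub_le hφ.continuous.aestronglyMeasurable
        hφ'.continuous.aestronglyMeasurable hu) (hsNorm_sub_le
        (continuous_curlF hφ).aestronglyMeasurable (continuous_curlF hφ').aestronglyMeasurable hw))
    h1 (by simpa using h2.add h3)
  exact ⟨t, fun φ h4 h5 h6 => tendsto_of_enorm_sub_le (fun n => ht (φ n) (h4 n))
    (by simpa using h5.add h6)⟩

theorem flux_tendsto (h : IsTet K a b c d) (hs : 1 / 2 < s) {L : (E3 → E3) → ℝ} (hL : L ∈ fluxDofs r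
    (K : Set E3)) {u : E3 → E3} (hu : AEStronglyMeasurable u (leb (tetInt K))) : ∃ t, ∀ φ :
    ℕ → E3 → E3, (∀ n, Continuous (φ n)) → (fun n => hsNorm (tetInt K) s (φ n - u)) ⇝ 0 →
    (fun n => L (φ n)) ⇝ t := by
  by_cases! hex : ∃ φ : ℕ → E3 → E3, (∀ n, Continuous (φ n)) ∧
      (fun n => hsNorm (tetInt K) s (φ n - u)) ⇝ 0
  swap
  · exact ⟨0, fun φ h1 h2 => (hex φ h1 h2).elim⟩
  obtain ⟨φ₀, h1, h2⟩ := hex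
  obtain ⟨C, hC⟩ := flux_dof_bound h hs hL
  obtain ⟨t, ht⟩ := exists_limit_of_bound (A := Continuous) (L := L) (C := C)
    (E := fun φ => hsNorm (tetInt K) s (φ - u))
    (fun φ hφ φ' hφ' => by
      rw [← map_sub_of_linear (h.exists_linear_flux hL) hφ hφ']
      exact (hC (φ - φ') (hφ.sub hφ')).trans (mul_le_mul' le_rfl (hsNorm_sub_le
        hφ.aestronglyMeasurable hφ'.aestronglyMeasurable hu))) h1 h2
  exact ⟨t, fun φ h4 h5 => tendsto_of_enorm_sub_le (fun n => ht (φ n) (h4 n)) h5⟩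

/-! ### The mesh and the domain -/

/-- The properties of the domain and of its partition that are used in the construction. -/
structure IsRegularMesh (T : Geometry.SimplicialComplex ℝ E3) (Ω : Set E3) : Prop where
  isOpen : IsOpen Ω
  finite : Finite (Elem T)
  tet : ∀ K : Elem T, ∃ a b c d, IsTet K.1 a b c d
  closure_eq : closure Ω = ⋃ K : Elem T, convexHull ℝ (K.1 : Set E3)
  subset : ∀ K : Elem T, tetInt K.1 ⊆ Ω
  lt_top : volume Ω < ⊤
  bounded : ∃ D, ∀ x ∈ Ω, ∀ y ∈ Ω, ‖x - y‖ ≤ D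
  cover : Nonempty (ShiftCover Ω)

section

variable {T : Geometry.SimplicialComplex ℝ E3}

theorem IsTetMesh.isRegularMesh (hT : IsTetMesh T Ω) (hΩ : IsLipschitzDomain Ω) :
    IsRegularMesh T Ω := by
  have hfin : Finite (Elem T) :=
    (hT.finite.subset (t := {K | K ∈ T.faces ∧ K.card = 4}) fun K h => h.1).to_subtype
  have hcl : closure Ω = ⋃ K : Elem T, convexHull ℝ (K.1 : Set E3) := by
    rw [← hT.cover]
    ext x
    rw [Geometry.SimplicialComplex.mem_space_iff, Set.mem_iUnion]
    constructor
    · rintro ⟨σ, hσ, hx⟩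
      obtain ⟨K, hK, hσK, hc⟩ := hT.pure σ hσ
      exact ⟨⟨K, hK, hc⟩, convexHull_mono (Finset.coe_subset.2 hσK) hx⟩
    · rintro ⟨K, hx⟩
      exact ⟨K.1, K.2.1, hx⟩
  have hcomp : IsCompact (closure Ω) := by
    rw [hcl]
    exact isCompact_iUnion fun K => K.1.finite_toSet.isCompact_convexHull ℝ
  refine ⟨hΩ.1, hfin, fun K => exists_isTet K.2.2 (T.indep K.2.1), hcl, fun K =>
    (interior_mono ?_).trans hΩ.interior_closure, (measure_mono subset_closure).trans_lt
    hcomp.measure_lt_top, ?_, hΩ.exists_shiftCover hcomp⟩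
  · rw [hcl]
    exact Set.subset_iUnion (fun K : Elem T => convexHull ℝ (K.1 : Set E3)) K
  · obtain ⟨D, hD⟩ := Metric.isBounded_iff.1 (hcomp.isBounded.subset subset_closure)
    exact ⟨D, fun x hx y hy => (dist_eq_norm x y).symm.trans_le (hD hx hy)⟩

/-- Functions in `H^{1+s}`, `s > 1/2`, have a continuous representative. -/
theorem IsRegularMesh.exists_isContRep (hM : IsRegularMesh T Ω) (hs : 1 / 2 < s) (hs1 : s < 1)
    {u : E3 → ℝ} {g : E3 → E3} (hu : MemLp u 2 (leb Ω)) (hg : MemHs Ω s g) (h : HasWeakGrad Ω u g) :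
    ∃ (v : E3 → ℝ) (ψ : ℕ → E3 → ℝ), IsContRep Ω u v ∧ (∀ n, ContDiff ℝ ∞ (ψ n)) ∧
    (fun n => eLpNorm (ψ n - u) 2 (leb Ω)) ⇝ 0 ∧
    (∀ K : Elem T, (fun n => hsNorm (tetInt K.1) s (gradF (ψ n) - g)) ⇝ 0) ∧ ∀ K :
    Elem T, ∀ m, ∀ L ∈ lagrangeDofs m (K.1 : Set E3), (fun n => L (ψ n)) ⇝ (L v) := by
  obtain ⟨D, hD⟩ := hM.bounded
  obtain ⟨cov⟩ := hM.cover
  obtain ⟨ψ, hψ, h1, h2⟩ := cov.exists_approx_grad hM.isOpen hM.lt_top hD hs1 hu hg h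
  have hψ1 (n : ℕ) : ContDiff ℝ 1 (ψ n) := (hψ n).of_le (by simp)
  have h3 (K : Elem T) : (fun n => hsNorm (tetInt K.1) s (gradF (ψ n) - g)) ⇝ 0 := by
    obtain ⟨a, b, c, d, hK⟩ := hM.tet K
    obtain ⟨D', hB⟩ := hK.isBody
    exact h2 _ _ hB (hM.subset K)
  have hsub (K : Elem T) : leb (tetInt K.1) ≤ leb Ω := restrict_mono (hM.subset K) le_rfl
  have hsup (K : Elem T) : ∃ C : ℝ≥0, ∀ x ∈ convexHull ℝ (K.1 : Set E3), ∀ ψ : E3 → ℝ,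
      ContDiff ℝ 1 ψ → ‖ψ x‖ₑ ≤ C * (eLpNorm ψ 2 (leb (tetInt K.1)) +
        hsNorm (tetInt K.1) s (gradF ψ)) := by
    obtain ⟨a, b, c, d, hK⟩ := hM.tet K
    obtain ⟨D', hB⟩ := hK.isBody
    rw [← hK.closure_tetInt]
    exact hB.exists_sup_bound hK.interior_nonempty hs
  choose C hC using hsup
  have := hM.finite
  have := Fintype.ofFinite (Elem T)
  set E : Elem T → (E3 → ℝ) → ℝ≥0∞ := fun K ψ => eLpNorm (ψ - u) 2 (leb (tetInt K.1)) +
    hsNorm (tetInt K.1) s (gradF ψ - g) with hE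
  have hE0 (K : Elem T) : (fun n => E K (ψ n)) ⇝ 0 := by
    have := (tendsto_zero_of_le h1
      fun n => eLpNorm_mono_measure (ψ n - u) (hsub K)).add (h3 K)
    simpa using this
  have hlim (x : E3) : ∃ t, ∀ K : Elem T, x ∈ convexHull ℝ (K.1 : Set E3) →
      ∀ φ : E3 → ℝ, ContDiff ℝ 1 φ → ‖φ x - t‖ₑ ≤ C K * E K φ := by
    have key (K : Elem T) (hx : x ∈ convexHull ℝ (K.1 : Set E3)) :
        ∃ t, ∀ φ : E3 → ℝ, ContDiff ℝ 1 φ → ‖φ x - t‖ₑ ≤ C K * E K φ := by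
      refine exists_limit_of_bound (A := ContDiff ℝ 1) (fun φ hφ φ' hφ' => ?_) hψ1 (hE0 K)
      refine (hC K x hx (φ - φ') (hφ.sub hφ')).trans (mul_le_mul' le_rfl ?_)
      have hφm := hφ.continuous.aestronglyMeasurable (μ := leb (tetInt K.1))
      have hφm' := hφ'.continuous.aestronglyMeasurable (μ := leb (tetInt K.1))
      simp only [hE]
      rw [gradF_sub hφ hφ', add_add_add_comm]
      refine add_le_add ?_ (hsNorm_sub_le (continuous_gradF hφ).aestronglyMeasurable
        (continuous_gradF hφ').aestronglyMeasurable (hg.1.1.mono_measure (hsub K)))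
      rw [eLpNorm_sub_comm φ' u, ← sub_add_sub_cancel φ u φ']
      have hum := hu.1.mono_measure (hsub K)
      exact eLpNorm_add_le (hφm.sub hum) (hum.sub hφm') one_le_two
    by_cases hx : ∃ K : Elem T, x ∈ convexHull ℝ (K.1 : Set E3)
    · obtain ⟨K, hK⟩ := hx
      obtain ⟨t, ht⟩ := key K hK
      refine ⟨t, fun K' hK' => ?_⟩
      obtain ⟨t', ht'⟩ := key K' hK'
      rwa [tendsto_nhds_unique (tendsto_of_enorm_sub_le (fun n => ht _ (hψ1 n)) (hE0 K))
        (tendsto_of_enorm_sub_le (fun n => ht' _ (hψ1 n)) (hE0 K'))]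
    · exact ⟨0, fun K hK => (hx ⟨K, hK⟩).elim⟩
  choose v₀ hv₀ using hlim
  set W : ℕ → ℝ≥0∞ := fun n => ∑ K, C K * E K (ψ n) with hW
  have hW0 : W ⇝ 0 := by
    have := tendsto_finsetSum Finset.univ fun K _ =>
      ENNReal.Tendsto.const_mul (a := C K) (hE0 K) (Or.inr coe_ne_top)
    simpa using this
  have hunif (n : ℕ) (x : E3) (hx : x ∈ closure Ω) : ‖ψ n x - v₀ x‖ₑ ≤ W n := by
    rw [hM.closure_eq] at hx
    obtain ⟨K, hK⟩ := Set.mem_iUnion.1 hx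
    exact (hv₀ x K hK _ (hψ1 n)).trans (Finset.single_le_sum
      (f := fun K => C K * E K (ψ n)) (fun _ _ => zero_le) (Finset.mem_univ K))
  have hv₀c : ContinuousOn v₀ (closure Ω) := by
    refine TendstoUniformlyOn.continuousOn (F := ψ) (p := atTop) (EMetric.tendstoUniformlyOn_iff.2
      fun ε hε => ?_) (of_forall fun n => (hψ n).continuous.continuousOn).frequently
    refine (hW0.eventually (gt_mem_nhds hε)).mono fun n hn x hx => ?_
    rw [edist_comm, edist_eq_enorm_sub]
    exact (hunif n x hx).trans_lt hn
  obtain ⟨v, hv⟩ := ContinuousMap.exists_restrict_eq isClosed_closure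
    (⟨_, hv₀c.domRestrict⟩ : C(closure Ω, ℝ))
  have hvv (x : E3) (hx : x ∈ closure Ω) : v x = v₀ x := DFunLike.congr_fun hv ⟨x, hx⟩
  refine ⟨v, ψ, ⟨v.continuous.continuousOn, ?_⟩, hψ, h1, h3, fun K m L hL => ?_⟩
  · have hb : (fun n => volume Ω ^ (1 / 2 : ℝ) * W n + eLpNorm (ψ n - u) 2 (leb Ω)) ⇝ 0 := by
      have := (ENNReal.Tendsto.const_mul hW0 (Or.inr (ENNReal.rpow_ne_top_of_nonneg
        (by norm_num) hM.lt_top.ne)) (a := volume Ω ^ (1 / 2 : ℝ))).add h1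
      simpa using this
    have h0 : eLpNorm (⇑v - u) 2 (leb Ω) = 0 := by
      refine le_antisymm (ge_of_tendsto' hb fun n => ?_) zero_le
      have hψm := (hψ n).continuous.aestronglyMeasurable (μ := leb Ω)
      rw [← sub_add_sub_cancel _ (ψ n) u]
      refine (eLpNorm_add_le (v.continuous.aestronglyMeasurable.sub hψm) (hψm.sub hu.1)
        one_le_two).trans (add_le_add ?_ le_rfl)
      refine (eLpNorm_le_of_ae_enorm_bound (C := W n) ?_).trans (by simp [mul_comm])
      refine (ae_restrict_iff' hM.isOpen.measurableSet).2 (of_forall fun x hx => ?_)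
      rw [Pi.sub_apply, hvv x (subset_closure hx), ← enorm_neg, neg_sub]
      exact hunif n x (subset_closure hx)
    rw [eLpNorm_eq_zero_iff (v.continuous.aestronglyMeasurable.sub hu.1) (by simp)] at h0
    exact h0.mono fun x hx => sub_eq_zero.1 hx
  · obtain ⟨C', hC'⟩ := lagrange_dof_bound hL
    obtain ⟨a, b, c, d, hK⟩ := hM.tet K
    refine tendsto_of_enorm_sub_le (C := C') (fun n => ?_) hW0
    rw [← map_sub_of_linear (hK.exists_linear (Q := ⊥) (Or.inl hL)) (hψ n).continuous v.continuous]
    refine hC' _ ((hψ n).continuous.sub v.continuous) _ fun x hx => ?_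
    have hx' : x ∈ closure Ω := by
      rw [hM.closure_eq]
      exact Set.mem_iUnion.2 ⟨K, hx⟩
    rw [Pi.sub_apply, hvv x hx']
    exact hunif n x hx'

end

/-! ### The interpolants -/

theorem lagrangeDofs_mono {σ τ : Set E3} (h : σ ⊆ τ) : lagrangeDofs m σ ⊆ lagrangeDofs m τ := by
  rintro L ((⟨v, hv, e⟩ | ⟨x, hx, y, hy, e⟩) | ⟨x, hx, y, hy, z, hz, e⟩)
  · exact Or.inl (Or.inl ⟨v, h hv, e⟩)
  · exact Or.inl (Or.inr ⟨x, h hx, y, h hy, e⟩)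
  · exact Or.inr ⟨x, h hx, y, h hy, z, h hz, e⟩

theorem nedelecDofs_mono {σ τ : Set E3} (h : σ ⊆ τ) : nedelecDofs r σ ⊆ nedelecDofs r τ := by
  rintro L (⟨x, hx, y, hy, e⟩ | ⟨x, hx, y, hy, z, hz, e⟩)
  · exact Or.inl ⟨x, h hx, y, h hy, e⟩
  · exact Or.inr ⟨x, h hx, y, h hy, z, h hz, e⟩

theorem fluxDofs_mono {σ τ : Set E3} (h : σ ⊆ τ) : fluxDofs r σ ⊆ fluxDofs r τ := by
  rintro L ⟨x, hx, y, hy, z, hz, e⟩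
  exact ⟨x, h hx, y, h hy, z, h hz, e⟩

theorem IsExtendedValue.unique {A : (ℕ → E3 → E3) → Prop} {L : (E3 → E3) → ℝ} {t t' : ℝ}
    (h : IsExtendedValue A L t) (h' : IsExtendedValue A L t') : t = t' := by
  obtain ⟨φ, hφ⟩ := h.1
  exact tendsto_nhds_unique (h.2 φ hφ) (h'.2 φ hφ)

theorem contDiff_curlF {φ : E3 → E3} (hφ : ContDiff ℝ ∞ φ) : ContDiff ℝ ∞ (curlF φ) := by
  have e : curlF φ = fun x => curlT (fderiv ℝ φ x) :=
    funext fun x => (curlT_fderiv (hφ.differentiable (by simp) x)).symm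
  rw [e]
  exact curlT.contDiff.comp (hφ.fderiv_right (m := ∞) (by simp))

theorem contDiff_gradF {ψ : E3 → ℝ} (hψ : ContDiff ℝ ∞ ψ) : ContDiff ℝ ∞ (gradF ψ) := by
  have e : gradF ψ = fun x => gradT (fderiv ℝ ψ x) := funext fun x => (gradT_fderiv ψ x).symm
  rw [e]
  exact gradT.contDiff.comp (hψ.fderiv_right (m := ∞) (by simp))

theorem tendsto_hsNorm_mono (h : B ⊆ Ω) {f : ℕ → E3 → E3} (hf : (fun n => hsNorm Ω s (f n)) ⇝ 0) :
    (fun n => hsNorm B s (f n)) ⇝ 0 :=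
  tendsto_zero_of_le hf fun _ => hsNorm_mono h s _

theorem hsNorm_sub_self (Ω : Set E3) (s : ℝ) (u : E3 → E3) : hsNorm Ω s (u - u) = 0 := by
  rw [hsNorm, hsSemi, dq_sub, sub_self, sub_self, eLpNorm_zero, eLpNorm_zero, add_zero]

section

variable {T : Geometry.SimplicialComplex ℝ E3}

theorem MemHs.congr {u v : E3 → E3} (hu : MemHs Ω s u) (h : u =ᵐ[leb Ω] v) : MemHs Ω s v := by
  rw [memHs_iff] at hu ⊢
  exact ⟨hu.1.congr h, (hsNorm_congr h).symm.trans_lt hu.2⟩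

theorem memHs_zero : MemHs Ω s (fun _ => (0 : E3)) := ⟨MemLp.zero, by simp [gagliardoSq]⟩

theorem IsRegularMesh.exists_approxV (hM : IsRegularMesh T Ω) {δ : ℝ} (hδ' : δ < 1 / 2)
    {u c : E3 → E3} (hu : MemHs Ω (1 / 2 + δ) u) (hc : MemHs Ω (1 / 2 + δ) c)
    (h : HasWeakCurl Ω u c) : ∃ φ, ApproxV Ω δ u φ := by
  obtain ⟨D, hD⟩ := hM.bounded
  obtain ⟨cov⟩ := hM.cover
  obtain ⟨φ, h1, h2, h3⟩ := cov.exists_approx_curl hM.isOpen hM.lt_top hD (by linarith) hu hc h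
  exact ⟨φ, ⟨h1, (tendstoHs_iff (fun n => (h1 n).continuous.aestronglyMeasurable) hu.1.1).2 h2⟩, c, h,
    (tendstoHs_iff (fun n => (contDiff_curlF (h1 n)).continuous.aestronglyMeasurable) hc.1.1).2 h3⟩

theorem ApproxHs.tendsto {δ : ℝ} {u : E3 → E3} {φ : ℕ → E3 → E3} (h : ApproxHs Ω δ u φ)
    (hu : MemHs Ω (1 / 2 + δ) u) :
    (fun n => hsNorm Ω (1 / 2 + δ) (φ n - u)) ⇝ 0 :=
  (tendstoHs_iff (fun n => (h.1 n).continuous.aestronglyMeasurable) hu.1.1).1 h.2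

theorem ApproxV.tendsto {δ : ℝ} {u c : E3 → E3} {φ : ℕ → E3 → E3} (h : ApproxV Ω δ u φ)
    (hΩ : IsOpen Ω) (hw : HasWeakCurl Ω u c) (hc : MemHs Ω (1 / 2 + δ) c) :
    ApproxHs Ω δ c fun n => curlF (φ n) := by
  obtain ⟨⟨h1, h2⟩, c', hc', h3⟩ := h
  have e := hc'.ae_eq hΩ hw
  have hφ (n) := (contDiff_curlF (h1 n)).continuous.aestronglyMeasurable (μ := leb Ω)
  rw [tendstoHs_iff hφ (hc.1.1.congr e.symm)] at h3
  refine ⟨fun n => contDiff_curlF (h1 n), (tendstoHs_iff hφ hc.1.1).2 (h3.congr fun n =>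
    hsNorm_congr (EventuallyEq.rfl.sub e))⟩

variable {K : Elem T} {L : (E3 → E3) → ℝ}

theorem IsRegularMesh.exists_nedelec_value (hM : IsRegularMesh T Ω) {δ : ℝ} (hδ : 0 < δ)
    (hδ' : δ < 1 / 2) {u c : E3 → E3} (hu : MemHs Ω (1 / 2 + δ) u) (hc : MemHs Ω (1 / 2 + δ) c)
    (h : HasWeakCurl Ω u c) (hL : L ∈ nedelecDofs r (K.1 : Set E3)) :
    ∃ t, IsExtendedValue (ApproxV Ω δ u) L t ∧ ∀ φ : ℕ → E3 → E3, (∀ n, ContDiff ℝ 1 (φ n)) →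
    (fun n => hsNorm (tetInt K.1) (1 / 2 + δ) (φ n - u)) ⇝ 0 →
    (fun n => hsNorm (tetInt K.1) (1 / 2 + δ) (curlF (φ n) - c)) ⇝ 0 → (fun n => L (φ n)) ⇝ t := by
  obtain ⟨a, b, c', d, hK⟩ := hM.tet K
  have hsub := restrict_mono (μ := (volume : Measure E3)) (hM.subset K) le_rfl
  obtain ⟨t, ht⟩ := nedelec_tendsto hK (by linarith : 1 / 2 < 1 / 2 + δ) hL
    (hu.1.1.mono_measure hsub) (hc.1.1.mono_measure hsub)
  exact ⟨t, ⟨hM.exists_approxV hδ' hu hc h, fun φ hφ => ht φ (fun n => (hφ.1.1 n).of_le (by simp))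
    (tendsto_hsNorm_mono (hM.subset K) (hφ.1.tendsto hu))
    (tendsto_hsNorm_mono (hM.subset K) ((hφ.tendsto hM.isOpen h hc).tendsto hc))⟩, ht⟩

theorem IsRegularMesh.exists_flux_value (hM : IsRegularMesh T Ω) {δ : ℝ} (hδ : 0 < δ) {u : E3 → E3}
    (hu : MemHs Ω (1 / 2 + δ) u) (hA : ∃ φ, ApproxHs Ω δ u φ) (hL : L ∈ fluxDofs r (K.1 : Set E3)) :
    ∃ t, IsExtendedValue (ApproxHs Ω δ u) L t := by
  obtain ⟨a, b, c', d, hK⟩ := hM.tet K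
  have hsub := restrict_mono (μ := (volume : Measure E3)) (hM.subset K) le_rfl
  obtain ⟨t, ht⟩ := flux_tendsto hK (by linarith : 1 / 2 < 1 / 2 + δ) hL (hu.1.1.mono_measure hsub)
  exact ⟨t, hA, fun φ hφ => ht φ (fun n => (hφ.1 n).continuous)
    (tendsto_hsNorm_mono (hM.subset K) (hφ.tendsto hu))⟩

theorem IsRegularMesh.tendsto_interiorV (hM : IsRegularMesh T Ω) {Q : Submodule ℝ VPoly}
    (hL : L ∈ interiorVDofs Q K.1) {u : E3 → E3} (hu : MemHs Ω s u) {φ : ℕ → E3 → E3}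
    (hφ : ∀ n, Continuous (φ n)) (h : (fun n => hsNorm (tetInt K.1) s (φ n - u)) ⇝ 0) :
    (fun n => L (φ n)) ⇝ (L u) := by
  obtain ⟨a, b, c', d, hK⟩ := hM.tet K
  exact tendsto_interiorV_of_eLpNorm hK hL hφ
    (hu.1.mono_measure (restrict_mono (hM.subset K) le_rfl))
    (tendsto_zero_of_le h fun _ => le_self_add)

theorem IsRegularMesh.tendsto_interior (hM : IsRegularMesh T Ω) {Q : Submodule ℝ Poly}
    {L : (E3 → ℝ) → ℝ} (hL : L ∈ interiorDofs Q K.1) {u v : E3 → ℝ}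
    (hu : MemLp u 2 (leb Ω)) (hv : IsContRep Ω u v) {φ : ℕ → E3 → ℝ}
    (hφ : ∀ n, Continuous (φ n))
    (h : (fun n => eLpNorm (φ n - u) 2 (leb Ω)) ⇝ 0) :
    (fun n => L (φ n)) ⇝ (L v) := by
  obtain ⟨a, b, c', d, hK⟩ := hM.tet K
  have hsub := restrict_mono (μ := (volume : Measure E3)) (hM.subset K) le_rfl
  refine tendsto_interior_of_eLpNorm hK hL hφ ((hu.ae_eq hv.2.symm).mono_measure hsub)
    (tendsto_zero_of_le h fun n => ?_)
  exact (eLpNorm_mono_measure _ hsub).trans_eq (eLpNorm_congr_ae (EventuallyEq.rfl.sub hv.2))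

/-! ### Existence -/

theorem IsRegularMesh.exists_grad_pair (hM : IsRegularMesh T Ω) {δ : ℝ} (hδ : 0 < δ)
    (hδ' : δ < 1 / 2) (hr : 1 ≤ r) {u : E3 → ℝ} {g : E3 → E3} (hu : MemLp u 2 (leb Ω))
    (hg : MemHs Ω (1 / 2 + δ) g) (h : HasWeakGrad Ω u g) : ∃ w z, IsLagrangeInterp T Ω r u w ∧
    IsNedelecInterp T Ω δ r g z ∧ ∀ K, gradP (w K) = z K := by
  obtain ⟨v, ψ, hv, hψ, h1, h2, h3⟩ :=
    hM.exists_isContRep (by linarith : 1 / 2 < 1 / 2 + δ) (by linarith) hu hg h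
  have hψ1 (n : ℕ) : ContDiff ℝ 1 (ψ n) := (hψ n).of_le (by simp)
  have h4 (K : Elem T) (L) (hL : L ∈ lagrangeDofs r (K.1 : Set E3) ∪
      interiorDofs (polyLE ((r : ℤ) - 4)) K.1) : (fun n => L (ψ n)) ⇝ (L v) := by
    rcases hL with hL | hL
    · exact h3 K _ L hL
    · exact hM.tendsto_interior hL hu hv (fun n => (hψ n).continuous) h1
  have hex (K : Elem T) : ∃ p ∈ polyLE r, ∀ L ∈ lagrangeDofs r (K.1 : Set E3) ∪
      interiorDofs (polyLE ((r : ℤ) - 4)) K.1, (fun n => L (ψ n)) ⇝ (L (evalP p)) := by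
    obtain ⟨a, b, c', d, hK⟩ := hM.tet K
    exact exists_lagrange_limit hK hr ψ (fun n => (hψ n).continuous) fun L hL => ⟨_, h4 K L hL⟩
  choose w hw hlim using hex
  have hLw (K : Elem T) (L) (hL : L ∈ lagrangeDofs r (K.1 : Set E3) ∪
      interiorDofs (polyLE ((r : ℤ) - 4)) K.1) : L v = L (evalP (w K)) :=
    tendsto_nhds_unique (h4 K L hL) (hlim K L hL)
  have hz (K : Elem T) (L) (hL : L ∈ nedelecDofs r (K.1 : Set E3)) :
      IsExtendedValue (ApproxV Ω δ g) L (L (evalV (gradP (w K)))) := by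
    obtain ⟨a, b, c', d, hK⟩ := hM.tet K
    obtain ⟨t, ht, H⟩ := hM.exists_nedelec_value hδ hδ' hg memHs_zero h.hasWeakCurl_zero hL
    have h5 := tendsto_nedelecDofs_gradF hK hψ1 ((contDiff_evalP (w K)).of_le (by simp))
      (fun L hL => hlim K L (Or.inl hL)) L hL
    rw [gradF_evalP] at h5
    rwa [← tendsto_nhds_unique (H _ (fun n => (contDiff_gradF (hψ n)).of_le (by simp)) (h2 K) (by
      simp only [curlF_gradF (hψ _)]
      simp only [hsNorm_sub_self, tendsto_const_nhds])) h5]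
  refine ⟨w, fun K => gradP (w K), ⟨⟨hw, fun K K' L hL => ?_⟩, v, hv, hLw⟩,
    ⟨⟨fun K => gradP_mem_nedelecSpace (hw K), fun K K' L hL => ?_⟩, fun K => ⟨hz K, fun L hL => ?_⟩⟩,
    fun K => rfl⟩
  · exact (hLw K L (Or.inl (lagrangeDofs_mono Set.inter_subset_left hL))).symm.trans
      (hLw K' L (Or.inl (lagrangeDofs_mono Set.inter_subset_right hL)))
  · exact (hz K L (nedelecDofs_mono Set.inter_subset_left hL)).unique
      (hz K' L (nedelecDofs_mono Set.inter_subset_right hL))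
  · obtain ⟨a, b, c', d, hK⟩ := hM.tet K
    have h5 := tendsto_interior_gradF hK hψ1 ((contDiff_evalP (w K)).of_le (by simp)) (hlim K) L hL
    rw [gradF_evalP] at h5
    exact tendsto_nhds_unique
      (hM.tendsto_interiorV hL hg (fun n => continuous_gradF (hψ1 n)) (h2 K)) h5

theorem IsRegularMesh.exists_curl_pair (hM : IsRegularMesh T Ω) {δ : ℝ} (hδ : 0 < δ)
    (hδ' : δ < 1 / 2) {k : ℕ} (hr : 1 ≤ r) (hk : k ≤ r + 1) {C : Elem T → Submodule ℝ VPoly}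
    (hC : ∀ K, IsGradComplement r (C K)) {u c : E3 → E3} (hu : MemHs Ω (1 / 2 + δ) u)
    (hc : MemHs Ω (1 / 2 + δ) c) (h : HasWeakCurl Ω u c) : ∃ z y, IsNedelecInterp T Ω δ r u z ∧
    IsGradDivInterp T Ω δ r k C c y ∧ ∀ K, curlP (z K) = y K := by
  obtain ⟨φ, hφ⟩ := hM.exists_approxV hδ' hu hc h
  have hφc := hφ.tendsto hM.isOpen h hc
  have hφ1 (n : ℕ) : ContDiff ℝ 1 (φ n) := (hφ.1.1 n).of_le (by simp)
  have t1 (K : Elem T) := tendsto_hsNorm_mono (hM.subset K) (hφ.1.tendsto hu)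
  have t2 (K : Elem T) := tendsto_hsNorm_mono (hM.subset K) (hφc.tendsto hc)
  have hI (K : Elem T) (L) (hL : L ∈ interiorVDofs (vpolyLE ((r : ℤ) - 3)) K.1) :=
    hM.tendsto_interiorV hL hu (fun n => (hφ1 n).continuous) (t1 K)
  have hex (K : Elem T) : ∃ z ∈ nedelecSpace r, ∀ L ∈ nedelecDofs r (K.1 : Set E3) ∪
      interiorVDofs (vpolyLE ((r : ℤ) - 3)) K.1,
      (fun n => L (φ n)) ⇝ (L (evalV z)) := by
    obtain ⟨a, b, c', d, hK⟩ := hM.tet K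
    refine exists_nedelec_limit hK hr φ (fun n => (hφ1 n).continuous) fun L hL => ?_
    rcases hL with hL | hL
    · obtain ⟨t, ht, -⟩ := hM.exists_nedelec_value hδ hδ' hu hc h hL
      exact ⟨t, ht.2 φ hφ⟩
    · exact ⟨_, hI K L hL⟩
  choose z hz hlim using hex
  have hE (K : Elem T) (L) (hL : L ∈ nedelecDofs r (K.1 : Set E3)) :
      IsExtendedValue (ApproxV Ω δ u) L (L (evalV (z K))) := by
    obtain ⟨t, ht, -⟩ := hM.exists_nedelec_value hδ hδ' hu hc h hL
    rwa [← tendsto_nhds_unique (ht.2 φ hφ) (hlim K L (Or.inl hL))]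
  have hF (K : Elem T) (L) (hL : L ∈ fluxDofs r (K.1 : Set E3)) :
      IsExtendedValue (ApproxHs Ω δ c) L (L (evalV (curlP (z K)))) := by
    obtain ⟨t, ht⟩ := hM.exists_flux_value hδ hc ⟨_, hφc⟩ hL
    rw [evalV_curlP]
    rwa [← tendsto_nhds_unique (ht.2 _ hφc) (tendsto_fluxDofs_curlF hφ1
      ((contDiff_evalV (z K)).of_le (by simp)) (fun L hL => hlim K L (Or.inl hL)) L hL)]
  have e0 : evalP 0 = fun _ => 0 := by ext x; simp [evalP]
  refine ⟨z, fun K => curlP (z K), ⟨⟨hz, fun K K' L hL => ?_⟩, fun K => ⟨hE K, fun L hL => ?_⟩⟩,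
    ⟨⟨fun K => ?_, fun K K' => ⟨fun L _ => by rw [divP_curlP, divP_curlP], fun L hL => ?_⟩⟩,
      fun _ => 0, fun _ => 0, h.hasWeakDiv_zero, ⟨continuousOn_const, EventuallyEq.rfl⟩, fun K =>
      ⟨fun L _ => by rw [divP_curlP, e0], hF K, fun L hL => ?_⟩⟩, fun K => rfl⟩
  · exact (hE K L (nedelecDofs_mono Set.inter_subset_left hL)).unique
      (hE K' L (nedelecDofs_mono Set.inter_subset_right hL))
  · exact tendsto_nhds_unique (hI K L hL) (hlim K L (Or.inr hL))
  · obtain ⟨a, b, c', d, hK⟩ := hM.tet K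
    refine (mem_gradDivSub hK).1 (mem_sup_left ?_)
    rw [divFreeSub_eq]
    exact ⟨z K, mem_nedelecSub.2 (hz K), rfl⟩
  · exact (hF K L (fluxDofs_mono Set.inter_subset_left hL)).unique
      (hF K' L (fluxDofs_mono Set.inter_subset_right hL))
  · obtain ⟨a, b, c', d, hK⟩ := hM.tet K
    rw [evalV_curlP]
    exact tendsto_nhds_unique
      (hM.tendsto_interiorV hL hc (fun n => continuous_curlF (hφ1 n)) (t2 K))
      (tendsto_interior_curlF hK hφ1 ((contDiff_evalV (z K)).of_le (by simp)) (hlim K) L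
        (interiorVDofs_mono (gradDivTests_le (by omega) (hC K)) hL))

theorem IsRegularMesh.exists_div_pair (hM : IsRegularMesh T Ω) {δ : ℝ} (hδ : 0 < δ)
    (hδ' : δ < 1 / 2) {k : ℕ} (hr : 1 ≤ r) (hk2 : 2 ≤ k) (hk : k ≤ r + 1)
    {C : Elem T → Submodule ℝ VPoly} (hC : ∀ K, IsGradComplement r (C K)) {u : E3 → E3} {d : E3 → ℝ}
    (hu : MemHs Ω (1 / 2 + δ) u) (hd : MemH1s Ω (1 / 2 + δ) d) (h : HasWeakDiv Ω u d) : ∃ y w,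
    IsGradDivInterp T Ω δ r k C u y ∧ IsLagrangePlusInterp T Ω k d w ∧ ∀ K, divP (y K) = w K := by
  obtain ⟨hd, g, hgw, hg⟩ := hd
  obtain ⟨v, ψ, hv, hψ, h1, h2, h3⟩ :=
    hM.exists_isContRep (by linarith : 1 / 2 < 1 / 2 + δ) (by linarith) hd hg hgw
  obtain ⟨D, hD⟩ := hM.bounded
  obtain ⟨cov⟩ := hM.cover
  obtain ⟨φ, hφ, h4, h5⟩ := cov.exists_approx_div hM.isOpen hM.lt_top hD (by linarith) hu hd h
  have hφ1 (n : ℕ) : ContDiff ℝ 1 (φ n) := (hφ n).of_le (by simp)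
  have hA : ApproxHs Ω δ u φ :=
    ⟨hφ, (tendstoHs_iff (fun n => (hφ n).continuous.aestronglyMeasurable) hu.1.1).2 h4⟩
  have hI (K : Elem T) (L) (hL : L ∈ interiorVDofs (gradDivTests k (C K)) K.1) :=
    hM.tendsto_interiorV hL hu (fun n => (hφ1 n).continuous) (tendsto_hsNorm_mono (hM.subset K) h4)
  have hex (K : Elem T) : ∃ y ∈ gradDivSpace r k K.1,
      (∀ L ∈ lagrangeDofs ((k : ℤ) - 1) (K.1 : Set E3), (fun n => L (ψ n)) ⇝ (L (evalP (divP y)))) ∧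
      ∀ L ∈ fluxDofs r (K.1 : Set E3) ∪ interiorVDofs (gradDivTests k (C K)) K.1,
        (fun n => L (φ n)) ⇝ (L (evalV y)) := by
    obtain ⟨a, b, c', d', hK⟩ := hM.tet K
    refine exists_gradDiv_limit hK hr hk2 hk (hC K) ψ (fun n => (hψ n).continuous) φ
      (fun n => (hφ n).continuous) (fun L hL => ⟨_, h3 K _ L hL⟩) fun L hL => ?_
    rcases hL with hL | hL
    · obtain ⟨t, ht⟩ := hM.exists_flux_value hδ hu ⟨_, hA⟩ hL
      exact ⟨t, ht.2 φ hA⟩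
    · exact ⟨_, hI K L hL⟩
  choose y hy hlim1 hlim2 using hex
  have hLy (K : Elem T) (L) (hL : L ∈ lagrangeDofs ((k : ℤ) - 1) (K.1 : Set E3)) :
      L v = L (evalP (divP (y K))) := tendsto_nhds_unique (h3 K _ L hL) (hlim1 K L hL)
  have hF (K : Elem T) (L) (hL : L ∈ fluxDofs r (K.1 : Set E3)) :
      IsExtendedValue (ApproxHs Ω δ u) L (L (evalV (y K))) := by
    obtain ⟨t, ht⟩ := hM.exists_flux_value hδ hu ⟨_, hA⟩ hL
    rwa [← tendsto_nhds_unique (ht.2 _ hA) (hlim2 K L (Or.inl hL))]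
  have hglue (K K' : Elem T) (L) (hL : L ∈ lagrangeDofs ((k : ℤ) - 1) ((K.1 : Set E3) ∩ K'.1)) :
      L (evalP (divP (y K))) = L (evalP (divP (y K'))) :=
    (hLy K L (lagrangeDofs_mono Set.inter_subset_left hL)).symm.trans
      (hLy K' L (lagrangeDofs_mono Set.inter_subset_right hL))
  refine ⟨y, fun K => divP (y K), ⟨⟨hy, fun K K' => ⟨hglue K K', fun L hL => ?_⟩⟩, d, v, h, hv,
    fun K => ⟨hLy K, hF K, fun L hL => tendsto_nhds_unique (hI K L hL) (hlim2 K L (Or.inr hL))⟩⟩,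
    ⟨⟨fun K => ?_, hglue⟩, v, hv, fun K L hL => ?_⟩, fun K => rfl⟩
  · exact (hF K L (fluxDofs_mono Set.inter_subset_left hL)).unique
      (hF K' L (fluxDofs_mono Set.inter_subset_right hL))
  · obtain ⟨a, b, c', d', hK⟩ := hM.tet K
    exact (mem_sigmaPlusSub hK).1 (divP_mem_sigmaPlusSub ((mem_gradDivSub hK).2 (hy K)))
  · rcases hL with hL | hL
    · exact hLy K L hL
    · obtain ⟨a, b, c', d', hK⟩ := hM.tet K
      have h6 := tendsto_interior_divF hK hr hk hφ1 ((contDiff_evalV (y K)).of_le (by simp))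
        (hlim2 K) L hL
      rw [divF_evalV] at h6
      exact tendsto_nhds_unique (hM.tendsto_interior hL hd hv (fun n => continuous_divF (hφ1 n)) h5) h6

/-! ### Uniqueness -/

theorem IsRegularMesh.contRep_dof_eq (hM : IsRegularMesh T Ω) {Q : Submodule ℝ Poly}
    {L : (E3 → ℝ) → ℝ} (hL : L ∈ lagrangeDofs m (K.1 : Set E3) ∪ interiorDofs Q K.1)
    {u v v' : E3 → ℝ} (hv : IsContRep Ω u v) (hv' : IsContRep Ω u v') : L v = L v' := by
  obtain ⟨a, b, c', d, hK⟩ := hM.tet K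
  refine hK.dof_congr hL fun x hx => hv.eqOn hM.isOpen hv' ?_
  rw [hM.closure_eq]
  exact Set.mem_iUnion.2 ⟨K, hx⟩

theorem IsRegularMesh.lagrangeInterp_unique (hM : IsRegularMesh T Ω) {u : E3 → ℝ} {w w' : Elem T →
    Poly} (h : IsLagrangeInterp T Ω r u w) (h' : IsLagrangeInterp T Ω r u w') : w = w' := by
  obtain ⟨hw, v, hv, H⟩ := h
  obtain ⟨hw', v', hv', H'⟩ := h'
  funext K
  obtain ⟨a, b, c', d, hK⟩ := hM.tet K
  refine sub_eq_zero.1 (lagrange_inj hK (sub_mem (hw.1 K) (hw'.1 K)) fun L hL => ?_)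
  rw [evalP_sub_eq, map_sub_of_linear (hK.exists_linear hL) (continuous_evalP _)
    (continuous_evalP _), ← H K L hL, ← H' K L hL, sub_eq_zero]
  exact hM.contRep_dof_eq hL hv hv'

theorem IsRegularMesh.lagrangePlusInterp_unique (hM : IsRegularMesh T Ω) {k : ℕ} {u : E3 → ℝ}
    {w w' : Elem T → Poly} (h : IsLagrangePlusInterp T Ω k u w)
    (h' : IsLagrangePlusInterp T Ω k u w') : w = w' := by
  obtain ⟨hw, v, hv, H⟩ := h
  obtain ⟨hw', v', hv', H'⟩ := h'
  funext K
  obtain ⟨a, b, c', d, hK⟩ := hM.tet K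
  refine sub_eq_zero.1 (lagrangePlus_inj hK (sub_mem ((mem_sigmaPlusSub hK).2 (hw.1 K))
    ((mem_sigmaPlusSub hK).2 (hw'.1 K))) fun L hL => ?_)
  rw [evalP_sub_eq, map_sub_of_linear (hK.exists_linear hL) (continuous_evalP _)
    (continuous_evalP _), ← H K L hL, ← H' K L hL, sub_eq_zero]
  exact hM.contRep_dof_eq hL hv hv'

theorem IsRegularMesh.nedelecInterp_unique (hM : IsRegularMesh T Ω) {δ : ℝ} (hr : 1 ≤ r)
    {u : E3 → E3} {z z' : Elem T → VPoly} (h : IsNedelecInterp T Ω δ r u z)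
    (h' : IsNedelecInterp T Ω δ r u z') : z = z' := by
  funext K
  obtain ⟨a, b, c', d, hK⟩ := hM.tet K
  refine sub_eq_zero.1 (nedelec_inj hK hr (mem_nedelecSub.1 (sub_mem (mem_nedelecSub.2 (h.1.1 K))
    (mem_nedelecSub.2 (h'.1.1 K)))) fun L hL => ?_)
  rw [evalV_sub_eq]
  rcases hL with hL | hL
  · rw [map_sub_of_linear (hK.exists_linear_nedelec hL) (continuous_evalV _) (continuous_evalV _),
      sub_eq_zero]
    exact ((h.2 K).1 L hL).unique ((h'.2 K).1 L hL)
  · rw [map_sub_of_linear (exists_linear_interiorV hL) (continuous_evalV _) (continuous_evalV _),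
      ← (h.2 K).2 L hL, ← (h'.2 K).2 L hL, sub_self]

theorem IsRegularMesh.gradDivInterp_unique (hM : IsRegularMesh T Ω) {δ : ℝ} {k : ℕ} (hr : 1 ≤ r)
    (hk : k ≤ r + 1) {C : Elem T → Submodule ℝ VPoly} (hC : ∀ K, IsGradComplement r (C K))
    {u : E3 → E3} {y y' : Elem T → VPoly} (h : IsGradDivInterp T Ω δ r k C u y)
    (h' : IsGradDivInterp T Ω δ r k C u y') : y = y' := by
  obtain ⟨hy, d, v, hd, hv, H⟩ := h
  obtain ⟨hy', d', v', hd', hv', H'⟩ := h'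
  funext K
  obtain ⟨a, b, c', e, hK⟩ := hM.tet K
  refine sub_eq_zero.1 (gradDiv_inj hK hr hk (hC K) (sub_mem ((mem_gradDivSub hK).2 (hy.1 K))
    ((mem_gradDivSub hK).2 (hy'.1 K))) (fun L hL => ?_) fun L hL => ?_)
  · have hL' := Or.inl (b := L ∈ interiorDofs ⊥ K.1) hL
    rw [← divL_apply, map_sub, divL_apply, divL_apply, evalP_sub_eq,
      map_sub_of_linear (hK.exists_linear hL') (continuous_evalP _) (continuous_evalP _),
      ← (H K).1 L hL, ← (H' K).1 L hL, sub_eq_zero]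
    exact hM.contRep_dof_eq hL' hv ⟨hv'.1, hv'.2.trans (hd'.ae_eq hM.isOpen hd)⟩
  · rw [evalV_sub_eq]
    rcases hL with hL | hL
    · rw [map_sub_of_linear (hK.exists_linear_flux hL) (continuous_evalV _) (continuous_evalV _),
        sub_eq_zero]
      exact ((H K).2.1 L hL).unique ((H' K).2.1 L hL)
    · rw [map_sub_of_linear (exists_linear_interiorV hL) (continuous_evalV _) (continuous_evalV _),
        ← (H K).2.2 L hL, ← (H' K).2.2 L hL, sub_self]

theorem existsUnique_and_of_pair {A B : Type*} {P : A → Prop} {Q : B → Prop} {R : A → B → Prop}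
    (hP : ∀ x x', P x → P x' → x = x') (hQ : ∀ y y', Q y → Q y' → y = y')
    (h : ∃ x y, P x ∧ Q y ∧ R x y) :
    (∃! x, P x) ∧ (∃! y, Q y) ∧ ∀ x y, P x → Q y → R x y := by
  obtain ⟨x, y, hx, hy, hR⟩ := h
  refine ⟨⟨x, hx, fun x' h => hP _ _ h hx⟩, ⟨y, hy, fun y' h => hQ _ _ h hy⟩, fun x' y' hx' hy' => ?_⟩
  rwa [hP _ _ hx' hx, hQ _ _ hy' hy]

end

end GradDivFE
end

theorem mainTheorem8 (Ω : Set GradDivFE.E3) (hΩ : GradDivFE.IsLipschitzDomain Ω)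
    (hcontr : ContractibleSpace Ω)
    (T : Geometry.SimplicialComplex ℝ GradDivFE.E3) (hT : GradDivFE.IsTetMesh T Ω)
    (r k : ℕ) (hk : 2 ≤ k) (hr : r + 1 = k ∨ r = k ∨ r = k + 1)
    (C : GradDivFE.Elem T → Submodule ℝ GradDivFE.VPoly)
    (hC : ∀ K, GradDivFE.IsGradComplement r (C K))
    (δ : ℝ) (hδ : 0 < δ) (hδ' : δ < 1 / 2) :
    (∀ u g, GradDivFE.MemSigma Ω δ u → GradDivFE.HasWeakGrad Ω u g →
      (∃! w, GradDivFE.IsLagrangeInterp T Ω r u w) ∧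
      (∃! z, GradDivFE.IsNedelecInterp T Ω δ r g z) ∧
      ∀ w z, GradDivFE.IsLagrangeInterp T Ω r u w → GradDivFE.IsNedelecInterp T Ω δ r g z →
        ∀ K, GradDivFE.gradP (w K) = z K) ∧
    (∀ u c, GradDivFE.MemV Ω δ u → GradDivFE.HasWeakCurl Ω u c →
      (∃! z, GradDivFE.IsNedelecInterp T Ω δ r u z) ∧
      (∃! y, GradDivFE.IsGradDivInterp T Ω δ r k C c y) ∧
      ∀ z y, GradDivFE.IsNedelecInterp T Ω δ r u z →
        GradDivFE.IsGradDivInterp T Ω δ r k C c y → ∀ K, GradDivFE.curlP (z K) = y K) ∧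
    (∀ u d, GradDivFE.MemW Ω δ u → GradDivFE.HasWeakDiv Ω u d →
      (∃! y, GradDivFE.IsGradDivInterp T Ω δ r k C u y) ∧
      (∃! w, GradDivFE.IsLagrangePlusInterp T Ω k d w) ∧
      ∀ y w, GradDivFE.IsGradDivInterp T Ω δ r k C u y →
        GradDivFE.IsLagrangePlusInterp T Ω k d w → ∀ K, GradDivFE.divP (y K) = w K) := by
  have hr1 : 1 ≤ r := by omega
  have hkr : k ≤ r + 1 := by omega
  have hM := hT.isRegularMesh hΩ
  refine ⟨fun u g hu hg => ?_, fun u c hu hc => ?_, fun u d hu hd => ?_⟩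
  · obtain ⟨hu, g', hg', hgs⟩ := hu
    exact GradDivFE.existsUnique_and_of_pair (fun _ _ => hM.lagrangeInterp_unique)
      (fun _ _ => hM.nedelecInterp_unique hr1)
      (hM.exists_grad_pair hδ hδ' hr1 hu (hgs.congr (hg'.ae_eq hM.isOpen hg)) hg)
  · obtain ⟨hu, c', hc', hcs⟩ := hu
    exact GradDivFE.existsUnique_and_of_pair (fun _ _ => hM.nedelecInterp_unique hr1)
      (fun _ _ => hM.gradDivInterp_unique hr1 hkr hC)
      (hM.exists_curl_pair hδ hδ' hr1 hkr hC hu (hcs.congr (hc'.ae_eq hM.isOpen hc)) hc)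
  · obtain ⟨hu, d', hd', hds⟩ := hu
    obtain ⟨y, w, hy, ⟨hw, v, hv, H⟩, hR⟩ := hM.exists_div_pair hδ hδ' hr1 hk hkr hC hu hds hd'
    exact GradDivFE.existsUnique_and_of_pair (fun _ _ => hM.gradDivInterp_unique hr1 hkr hC)
      (fun _ _ => hM.lagrangePlusInterp_unique)
      ⟨y, w, hy, ⟨hw, v, ⟨hv.1, hv.2.trans (hd'.ae_eq hM.isOpen hd)⟩, H⟩, hR⟩
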